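/- Let $\mathfrak g=\mathfrak g_{\bar 0}\oplus\mathfrak g_{\bar 1}$ be a basic Lie superalgebra over $\mathbb C$: finite-dimensional, simple, with $\mathfrak g_{\bar 0}$ reductive and with a non-degenerate, invariant, supersymmetric, even bilinear form. Fix a Cartan subalgebra $\mathfrak h$ of $\mathfrak g_{\bar 0}$ and a positive system of roots, given by a total order on the real span of the roots that is compatible with the vector space structure, and let $\mathfrak g=\mathfrak n^-\oplus\mathfrak h\oplus\mathfrak n^+$, $\mathfrak b=\mathfrak h\oplus\mathfrak n^+$. For $\mu\in\mathfrak h^*$ let $M(\mu)=U(\mathfrak g)\otimes_{U(\mathfrak b)}\mathbb C_\mu$ be the Verma module; $\mu$ is dominant integral if the simple quotient of $M(\mu)$ is finite-dimensional, and $K(\mu)$ is the maximal finite-dimensional quotient of $M(\mu)$, with even highest weight vector $v_\mu$. Let $\lambda\in\mathfrak h^*$ be such that $k\lambda$ is dominant integral for all $k\ge 0$. Let $R(\lambda)=\bigoplus_{k\ge 0}K(k\lambda)^*$ be the commutative superalgebra in which the product of $\varphi\in K(m\lambda)^*$ and $\psi\in K(n\lambda)^*$ is the composition of the $\mathfrak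 g$-map $K((m+n)\lambda)\to K(n\lambda)\otimes K(m\lambda)$, $v_{(m+n)\lambda}\mapsto v_{n\lambda}\otimes v_{m\lambda}$, with $r\otimes s\mapsto\psi(r)\varphi(s)$; let $R^+(\lambda)=\mathbb C\oplus\bigoplus_{k\ge1}K(k\lambda)^*\subseteq R(\lambda)$. Let $f_1,\dots,f_N$ be a homogeneous basis of $\mathfrak n^-$ and $<$ a total order on $\mathbb N^N$ that is compatible with addition. Call $e\in\mathbb N^N$ admissible if $e_i\le1$ whenever $f_i$ is odd, and put $f^e=f_N^{e_N}\cdots f_1^{e_1}\in U(\mathfrak g)$. Let $\mathrm{es}(k\lambda)$ be the set of the admissible $e$ with $f^ev_{k\lambda}\notin\mathrm{span}\{f^{e'}v_{k\lambda}: e'\text{ admissible},\ e'<e\}$. Assume that $K(\lambda)$ is favourable: for every $k\ge 1$, each element of $\mathrm{es}(k\lambda)$ is a sum of $k$ elements of $\mathrm{es}(\lambda)$. Let $\eta_{e,k}\in K(k\lambda)^*$ $(e\in\mathrm{es}(k\lambda))$ be given by $\eta_{e,k}(f^{e'}v_{k\lambda})=\delta_{e,e'}\prod_ie_i!$ for $e'\in\mathrm{es}(k\lambda)$.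 Let $\mathcal S$ be the free supercommutative superalgebra on variables $X_e$ $(e\in\mathrm{es}(\lambda))$ of the parity of $f^e$, and $\mathrm{ev}:\mathcal S\to R(\lambda)$ the map with $X_e\mapsto\eta_{e,1}$. A product $X_{e^{(1)}}\cdots X_{e^{(h)}}$ has degree $(\sum_i e^{(i)},h)$. Let $R_h^{>\alpha}=\mathrm{span}\{\eta_{e,h}:e\in\mathrm{es}(h\lambda),\,e>\alpha\}$ and let $\mathcal K\subseteq\mathcal S$ be the ideal spanned by the elements $s$ that are homogeneous of some degree $(\alpha,h)$ with $\mathrm{ev}(s)\in R_h^{>\alpha}$ (the kernel of $\mathcal S\to\mathrm{gr}\,R(\lambda)$). Then the following choices can be made: finitely many generators $\bar g_1,\dots,\bar g_m$ of $\mathcal K$, each of the form $M\pm M'$ or $M$ with products of variables $M,M'$ of the same degree $(J_k,h_k)$ and with $\mathrm{ev}(\bar g_k)\in R_{h_k}^{>J_k}$; elements $g_{k,1},\dots,g_{k,r_k}\in\mathcal S$, homogeneous of degrees $(U_{k,j},h_k)$ with $U_{k,j}\in\mathrm{es}(h_k\lambda)$ and $U_{k,j}>J_k$, such that $\mathrm{ev}(\bar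 g_k+\sum_jg_{k,j})=0$; and $w\in\mathbb Z^N$ with $w\cdot U_{k,j}>w\cdot J_k$ for all $k,j$. For every such choice let $\mathcal R=\mathcal S[t]/\mathcal I$, where $\mathcal I$ is generated by the elements $\bar g_k+\sum_jt^{\,w\cdot U_{k,j}-w\cdot J_k}g_{k,j}$ and, for all $h\ge0$, by all binomials $M\pm M'\in\mathcal K$ with products of variables $M,M'$ of degree $(\max\mathrm{es}(h\lambda),h)$. Let $\kappa:\mathrm{Spec}\,\mathcal R\to\mathbb A^{1|0}=\mathrm{Spec}\,\mathbb C[t]$ be the morphism of superschemes given by $t\mapsto t$. Then $\kappa$ is flat. For $a\in\mathbb C\setminus\{0\}$ its fibre over $a$ is isomorphic to $\mathrm{Spec}\,R^+(\lambda)$, and also to $\mathrm{Spec}\,R(\lambda)$ if the condition of favourability holds for $k=0$ too, that is, if $\mathrm{es}(0)\subseteq\{0\}$ (then $R^+(\lambda)=R(\lambda)$). Its fibre over $0$ is isomorphic to the spectrum of the monomial superalgebra $\mathbb C[\xi^Ix^{\mathbf m}v\mid(I,\mathbf m)\in\mathrm{es}(\lambda)]$, the subalgebra of the free supercommutative superalgebra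 with one variable for each $f_i$, of the parity of $f_i$ ($x$ for even, $\xi$ for odd $f_i$), and an even variable $v$, that is generated by these monomials. -/

import Mathlib

noncomputable section

open scoped TensorProduct
open CategoryTheory TopologicalSpace Opposite

/-- The sign `(-1)^{ij}` of the Koszul rule. -/
def ksign (i j : ZMod 2) : ℂ := if i = 1 ∧ j = 1 then -1 else 1

theorem zmod2_cases (i : ZMod 2) : i = 0 ∨ i = 1 := by
  revert i; decide

/-- A commutative superalgebra over `ℂ`.  The `ℤ/2`-grading is recorded by the parity
automorphism `a₀ + a₁ ↦ a₀ - a₁`; its eigenspaces are the homogeneous parts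
(`SuperAlg.gr`, `SuperAlg.isInternal_gr`). -/
structure SuperAlg where
  carrier : Type
  [ring : Ring carrier]
  [alg : Algebra ℂ carrier]
  par : carrier →ₐ[ℂ] carrier
  par_par : ∀ a, par (par a) = a
  comm : ∀ (i j : ZMod 2) (a b : carrier), par a = ksign 1 i • a → par b = ksign 1 j • b →
    a * b = ksign i j • (b * a)

namespace SuperAlg

instance : CoeSort SuperAlg Type := ⟨SuperAlg.carrier⟩
instance (A : SuperAlg) : Ring A := A.ring
instance (A : SuperAlg) : Algebra ℂ A := A.alg

/-- The homogeneous part of parity `i`. -/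
def gr (A : SuperAlg) (i : ZMod 2) : Submodule ℂ A where
  carrier := {a | A.par a = ksign 1 i • a}
  add_mem' {a b} ha hb := by
    simp only [Set.mem_ofPred_eq] at *
    rw [map_add, ha, hb, smul_add]
  zero_mem' := by simp
  smul_mem' c a ha := by
    simp only [Set.mem_ofPred_eq] at *
    rw [map_smul, ha, smul_comm]

theorem mem_gr {A : SuperAlg} {i : ZMod 2} {a : A} : a ∈ A.gr i ↔ A.par a = ksign 1 i • a := Iff.rfl

theorem mem_gr_zero {A : SuperAlg} {a : A} : a ∈ A.gr 0 ↔ A.par a = a := by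
  simp [mem_gr, ksign]

theorem mem_gr_one {A : SuperAlg} {a : A} : a ∈ A.gr 1 ↔ A.par a = -a := by
  simp [mem_gr, ksign]

/-- The homogeneous parts are a `ℤ/2`-grading. -/
theorem isInternal_gr (A : SuperAlg) : DirectSum.IsInternal A.gr := by
  rw [DirectSum.isInternal_submodule_iff_isCompl A.gr (i := 0) (j := 1) (by decide)
    (by ext i; rcases zmod2_cases i with h | h <;> simp [h])]
  refine ⟨?_, ?_⟩
  · rw [Submodule.disjoint_def]
    intro a h0 h1
    rw [mem_gr_zero] at h0
    rw [mem_gr_one, h0] at h1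
    have h2 : (2 : ℂ) • a = 0 := by rw [two_smul]; nth_rw 2 [h1]; exact add_neg_cancel a
    exact (smul_eq_zero.mp h2).resolve_left two_ne_zero
  · rw [codisjoint_iff, Submodule.eq_top_iff']
    intro a
    rw [Submodule.mem_sup]
    refine ⟨(1 / 2 : ℂ) • (a + A.par a), ?_, (1 / 2 : ℂ) • (a - A.par a), ?_, ?_⟩
    · rw [mem_gr_zero, map_smul, map_add, A.par_par, add_comm]
    · rw [mem_gr_one, map_smul, map_sub, A.par_par, ← smul_neg, neg_sub]
    · rw [← smul_add, add_add_sub_cancel, ← two_smul ℂ a, smul_smul]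
      norm_num

theorem mul_mem_gr {A : SuperAlg} {i j : ZMod 2} {a b : A} (ha : a ∈ A.gr i) (hb : b ∈ A.gr j) :
    a * b ∈ A.gr (i + j) := by
  rw [mem_gr] at *
  rw [map_mul, ha, hb, smul_mul_smul_comm]
  congr 1
  rcases zmod2_cases i with rfl | rfl <;> rcases zmod2_cases j with rfl | rfl <;>
    simp [ksign, show (1 + 1 : ZMod 2) = 0 from rfl]

theorem comm_even {A : SuperAlg} (a b : A) : (a + A.par a) * b = b * (a + A.par a) := by
  have h0 : A.par (a + A.par a) = ksign 1 0 • (a + A.par a) := by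
    simp [ksign, A.par_par, add_comm]
  have e : b = (1 / 2 : ℂ) • (b + A.par b) + (1 / 2 : ℂ) • (b - A.par b) := by
    rw [← smul_add, add_add_sub_cancel, ← two_smul ℂ b, smul_smul]
    norm_num
  have h1 := A.comm 0 0 _ (b + A.par b) h0 (by simp [ksign, A.par_par, add_comm])
  have h2 := A.comm 0 1 _ (b - A.par b) h0 (by simp [ksign, A.par_par])
  simp only [ksign, zero_ne_one, false_and, and_false, if_false, one_smul] at h1 h2
  generalize a + A.par a = c at h1 h2 ⊢
  conv_lhs => rw [e, mul_add, mul_smul_comm, mul_smul_comm, h1, h2]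
  conv_rhs => rw [e, add_mul, smul_mul_assoc, smul_mul_assoc]

theorem comm_odd {A : SuperAlg} (a b : A) :
    (a - A.par a) * (b - A.par b) = -((b - A.par b) * (a - A.par a)) := by
  have := A.comm 1 1 (a - A.par a) (b - A.par b) (by simp [ksign, A.par_par])
    (by simp [ksign, A.par_par])
  simpa [ksign] using this

/-- Construct a commutative superalgebra from an involution; commutativity is to be checked for
the elements `a + par a`, which are even, and `a - par a`, which are odd. -/
def ofPar (A : Type) [Ring A] [Algebra ℂ A] (par : A →ₐ[ℂ] A) (par_par : ∀ a, par (par a) = a)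
    (h0 : ∀ a b, (a + par a) * b = b * (a + par a))
    (h1 : ∀ a b, (a - par a) * (b - par b) = -((b - par b) * (a - par a))) : SuperAlg where
  carrier := A
  par := par
  par_par := par_par
  comm i j a b ha hb := by
    have key : ∀ a b : A, par a = a → a * b = b * a := fun a b ha => by
      have := h0 a b
      rw [ha, ← two_smul ℂ a, smul_mul_assoc, mul_smul_comm] at this
      exact smul_right_injective _ (two_ne_zero (α := ℂ)) this
    rcases zmod2_cases i with rfl | rfl
    · simp only [ksign, zero_ne_one, and_false, if_false, one_smul, false_and] at *
      exact key a b ha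
    · rcases zmod2_cases j with rfl | rfl
      · simp only [ksign, zero_ne_one, and_false, if_false, one_smul, false_and] at *
        exact (key b a hb).symm
      · simp only [ksign, and_self, if_true, neg_smul, one_smul] at *
        have := h1 a b
        rw [ha, hb, sub_neg_eq_add, sub_neg_eq_add, ← two_smul ℂ a, ← two_smul ℂ b,
          smul_mul_smul_comm, smul_mul_smul_comm, ← smul_neg] at this
        exact smul_right_injective _ (by norm_num) this

/-- A morphism of commutative superalgebras: an algebra map of degree `0`. -/
@[ext]
structure Hom (A B : SuperAlg) where
  hom : A →ₐ[ℂ] B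
  map_par : ∀ a, hom (A.par a) = B.par (hom a)

instance : Category SuperAlg where
  Hom := Hom
  id A := ⟨AlgHom.id ℂ A, fun _ => rfl⟩
  comp f g := ⟨g.hom.comp f.hom, fun a => by simp [f.map_par, g.map_par]⟩

/-- The even part `A₀`, a commutative ring. -/
def Even (A : SuperAlg) : Type := AlgHom.equalizer A.par (AlgHom.id ℂ A)

instance (A : SuperAlg) : Ring A.Even :=
  inferInstanceAs (Ring (AlgHom.equalizer A.par (AlgHom.id ℂ A)))

instance (A : SuperAlg) : Algebra ℂ A.Even :=
  inferInstanceAs (Algebra ℂ (AlgHom.equalizer A.par (AlgHom.id ℂ A)))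

/-- The inclusion `A₀ → A`. -/
def Even.val (A : SuperAlg) : A.Even →ₐ[ℂ] A :=
  (AlgHom.equalizer A.par (AlgHom.id ℂ A)).val

/-- An even element of `A`, as an element of `A₀`. -/
def Even.mk {A : SuperAlg} (a : A) (ha : A.par a = a) : A.Even :=
  (⟨a, ha⟩ : AlgHom.equalizer A.par (AlgHom.id ℂ A))

theorem Even.val_mk {A : SuperAlg} (a : A) (ha : A.par a = a) : Even.val A (Even.mk a ha) = a := rfl

theorem Even.val_injective (A : SuperAlg) : Function.Injective (Even.val A) := Subtype.val_injective

theorem par_val {A : SuperAlg} (e : A.Even) : A.par (Even.val A e) = Even.val A e :=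
  (AlgHom.mem_equalizer A.par (AlgHom.id ℂ A) _).mp e.2

theorem Even.val_comm {A : SuperAlg} (e : A.Even) (b : A) :
    Even.val A e * b = b * Even.val A e := by
  have ha := par_val e
  have h0 : ∀ c : A, A.par c = c → Even.val A e * c = c * Even.val A e := fun c hc => by
    have := A.comm 0 0 _ c (by simpa [ksign] using ha) (by simpa [ksign] using hc)
    simpa [ksign] using this
  have h1 : ∀ c : A, A.par c = -c → Even.val A e * c = c * Even.val A e := fun c hc => by
    have := A.comm 0 1 _ c (by simpa [ksign] using ha) (by simpa [ksign] using hc)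
    simpa [ksign] using this
  have hb : b = (1 / 2 : ℂ) • (b + A.par b) + (1 / 2 : ℂ) • (b - A.par b) := by
    rw [← smul_add, add_add_sub_cancel, ← two_smul ℂ b, smul_smul]
    norm_num
  rw [hb, mul_add, add_mul,
    h0 _ (by rw [map_smul, map_add, A.par_par, add_comm]),
    h1 _ (by rw [map_smul, map_sub, A.par_par, ← smul_neg, neg_sub])]

instance (A : SuperAlg) : CommRing A.Even :=
  { (inferInstance : Ring A.Even) with
    mul_comm := fun a b => Even.val_injective A (by
      rw [map_mul, map_mul]; exact Even.val_comm a _) }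

instance (A : SuperAlg) : Algebra A.Even A :=
  RingHom.toAlgebra' (Even.val A : A.Even →+* A) fun a b => Even.val_comm a b

theorem Even.smul_def {A : SuperAlg} (e : A.Even) (a : A) : e • a = Even.val A e * a := rfl

/-- The parity automorphism is `A₀`-linear. -/
def parLin (A : SuperAlg) : A →ₗ[A.Even] A where
  toFun := A.par
  map_add' := map_add _
  map_smul' e a := by
    rw [Even.smul_def, map_mul, par_val, RingHom.id_apply, Even.smul_def]

/-- The map on even parts. -/
def Hom.even {A B : SuperAlg} (f : A ⟶ B) : A.Even →+* B.Even where
  toFun a := Even.mk (f.hom (Even.val A a)) (by rw [← f.map_par, par_val])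
  map_one' := Even.val_injective B (by simp [Even.val_mk])
  map_zero' := Even.val_injective B (by simp [Even.val_mk])
  map_mul' a b := Even.val_injective B (by simp [Even.val_mk])
  map_add' a b := Even.val_injective B (by simp [Even.val_mk])

/-- A morphism of superalgebras, as a map that is semilinear over the even parts. -/
def Hom.semi {A B : SuperAlg} (f : A ⟶ B) : A →ₛₗ[Hom.even f] B where
  toFun := f.hom
  map_add' := map_add _
  map_smul' e a := by
    rw [Even.smul_def, map_mul, Even.smul_def]
    rfl

/-! ### Affine superschemes -/

/-- The stalk `A_𝔭` of the structure sheaf at a prime `𝔭` of `A₀`. -/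
abbrev Stalk (A : SuperAlg) (x : PrimeSpectrum A.Even) : Type :=
  LocalizedModule x.asIdeal.primeCompl A

/-- The parity automorphism of a stalk. -/
def stalkPar (A : SuperAlg) (x : PrimeSpectrum A.Even) : A.Stalk x →ₗ[A.Even] A.Stalk x :=
  IsLocalizedModule.map x.asIdeal.primeCompl
    (LocalizedModule.mkLinearMap x.asIdeal.primeCompl A)
    (LocalizedModule.mkLinearMap x.asIdeal.primeCompl A) A.parLin

theorem stalkPar_mk {A : SuperAlg} {x : PrimeSpectrum A.Even} (a : A)
    (s : x.asIdeal.primeCompl) :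
    A.stalkPar x (LocalizedModule.mk a s) = LocalizedModule.mk (A.par a) s := by
  have := IsLocalizedModule.map_mk' (S := x.asIdeal.primeCompl)
    (LocalizedModule.mkLinearMap x.asIdeal.primeCompl A)
    (LocalizedModule.mkLinearMap x.asIdeal.primeCompl A) A.parLin a s
  rw [← IsLocalizedModule.mk_eq_mk', ← IsLocalizedModule.mk_eq_mk'] at this
  exact this

theorem stalkPar_par {A : SuperAlg} {x : PrimeSpectrum A.Even} (a : A.Stalk x) :
    A.stalkPar x (A.stalkPar x a) = a := by
  induction a using LocalizedModule.induction_on with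
  | _ a s => rw [stalkPar_mk, stalkPar_mk, A.par_par]

theorem stalkPar_mul {A : SuperAlg} {x : PrimeSpectrum A.Even} (a b : A.Stalk x) :
    A.stalkPar x (a * b) = A.stalkPar x a * A.stalkPar x b := by
  induction a using LocalizedModule.induction_on with
  | _ a s =>
    induction b using LocalizedModule.induction_on with
    | _ b t => rw [LocalizedModule.mk_mul_mk, stalkPar_mk, stalkPar_mk, stalkPar_mk,
        LocalizedModule.mk_mul_mk, map_mul]

theorem stalkPar_one {A : SuperAlg} {x : PrimeSpectrum A.Even} :
    A.stalkPar x (1 : A.Stalk x) = 1 := by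
  have : (1 : A.Stalk x) = LocalizedModule.mk 1 1 := OreLocalization.one_def
  rw [this, stalkPar_mk, map_one]

/-- The sections over `U`: functions with values in the stalks that are locally fractions
`a / s` with `a ∈ A` and `s ∈ A₀`. -/
def sections (A : SuperAlg) (U : Opens (PrimeSpectrum A.Even)) :
    Subalgebra A.Even (∀ x : U, A.Stalk x.1) where
  carrier := {f | ∀ x : U, ∃ V : Opens (PrimeSpectrum A.Even), x.1 ∈ V ∧ ∃ (a : A) (s : A.Even),
    ∀ y : U, y.1 ∈ V → ∃ hs : s ∉ y.1.asIdeal, f y = LocalizedModule.mk a ⟨s, hs⟩}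
  mul_mem' {f g} hf hg x := by
    obtain ⟨V, hV, a, s, h⟩ := hf x
    obtain ⟨W, hW, b, t, h'⟩ := hg x
    refine ⟨V ⊓ W, ⟨hV, hW⟩, a * b, s * t, fun y hy => ?_⟩
    obtain ⟨hs, e⟩ := h y hy.1
    obtain ⟨ht, e'⟩ := h' y hy.2
    refine ⟨y.1.asIdeal.primeCompl.mul_mem hs ht, ?_⟩
    rw [Pi.mul_apply, e, e', LocalizedModule.mk_mul_mk]
    rfl
  add_mem' {f g} hf hg x := by
    obtain ⟨V, hV, a, s, h⟩ := hf x
    obtain ⟨W, hW, b, t, h'⟩ := hg x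
    refine ⟨V ⊓ W, ⟨hV, hW⟩, t • a + s • b, s * t, fun y hy => ?_⟩
    obtain ⟨hs, e⟩ := h y hy.1
    obtain ⟨ht, e'⟩ := h' y hy.2
    refine ⟨y.1.asIdeal.primeCompl.mul_mem hs ht, ?_⟩
    rw [Pi.add_apply, e, e', LocalizedModule.mk_add_mk]
    rfl
  algebraMap_mem' r x := ⟨⊤, trivial, algebraMap A.Even A r, 1, fun y _ =>
    ⟨y.1.asIdeal.primeCompl.one_mem, rfl⟩⟩

theorem stalk_comm_even {A : SuperAlg} {x : PrimeSpectrum A.Even} (a b : A.Stalk x) :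
    (a + A.stalkPar x a) * b = b * (a + A.stalkPar x a) := by
  induction a using LocalizedModule.induction_on with
  | _ a s =>
    induction b using LocalizedModule.induction_on with
    | _ b t =>
      rw [stalkPar_mk, LocalizedModule.mk_add_mk, ← smul_add, LocalizedModule.mk_cancel_common_left,
        LocalizedModule.mk_mul_mk, LocalizedModule.mk_mul_mk, comm_even, mul_comm s t]

theorem stalk_comm_odd {A : SuperAlg} {x : PrimeSpectrum A.Even} (a b : A.Stalk x) :
    (a - A.stalkPar x a) * (b - A.stalkPar x b) =
      -((b - A.stalkPar x b) * (a - A.stalkPar x a)) := by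
  have key : ∀ (a : A) (s : x.asIdeal.primeCompl), (LocalizedModule.mk a s : A.Stalk x) -
      A.stalkPar x (LocalizedModule.mk a s) = LocalizedModule.mk (a - A.par a) s := fun a s => by
    rw [stalkPar_mk, sub_eq_add_neg, ← LocalizedModule.mk_neg, LocalizedModule.mk_add_mk,
      ← smul_add, LocalizedModule.mk_cancel_common_left, sub_eq_add_neg]
  induction a using LocalizedModule.induction_on with
  | _ a s =>
    induction b using LocalizedModule.induction_on with
    | _ b t =>
      rw [key, key, LocalizedModule.mk_mul_mk, LocalizedModule.mk_mul_mk, comm_odd, mul_comm s t,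
        LocalizedModule.mk_neg]

instance (A : SuperAlg) (U : Opens (PrimeSpectrum A.Even)) : Algebra ℂ (A.sections U) :=
  Algebra.compHom _ (algebraMap ℂ A.Even)

theorem algebraMap_sections {A : SuperAlg} {U : Opens (PrimeSpectrum A.Even)} (c : ℂ) :
    algebraMap ℂ (A.sections U) c = algebraMap A.Even (A.sections U) (algebraMap ℂ A.Even c) := rfl

/-- The parity automorphism of the sections over `U`. -/
def sectionsPar (A : SuperAlg) (U : Opens (PrimeSpectrum A.Even)) :
    A.sections U →ₐ[ℂ] A.sections U where
  toFun f := ⟨fun x => A.stalkPar x.1 (f.1 x), fun x => by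
    obtain ⟨V, hV, a, s, h⟩ := f.2 x
    refine ⟨V, hV, A.par a, s, fun y hy => ?_⟩
    obtain ⟨hs, e⟩ := h y hy
    exact ⟨hs, (congrArg (A.stalkPar y.1) e).trans (stalkPar_mk a ⟨s, hs⟩)⟩⟩
  map_one' := Subtype.ext (funext fun _ => stalkPar_one)
  map_zero' := Subtype.ext (funext fun _ => map_zero _)
  map_mul' f g := Subtype.ext (funext fun x => stalkPar_mul (f.1 x) (g.1 x))
  map_add' f g := Subtype.ext (funext fun x => map_add (A.stalkPar x.1) (f.1 x) (g.1 x))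
  commutes' c := by
    refine Subtype.ext (funext fun x => ?_)
    rw [algebraMap_sections]
    have : ∀ e : A.Even, (algebraMap A.Even (A.sections U) e).1 x = e • (1 : A.Stalk x.1) :=
      fun e => Algebra.algebraMap_eq_smul_one (A := A.Stalk x.1) e
    change A.stalkPar x.1 ((algebraMap A.Even (A.sections U) _).1 x) = _
    rw [this, map_smul, stalkPar_one]

/-- The superalgebra `𝒪_A(U)` of sections over `U`. -/
def sectionsAlg (A : SuperAlg) (U : Opens (PrimeSpectrum A.Even)) : SuperAlg :=
  ofPar (A.sections U) (A.sectionsPar U)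
    (fun _ => Subtype.ext (funext fun _ => stalkPar_par _))
    (fun f g => Subtype.ext (funext fun x => stalk_comm_even (f.1 x) (g.1 x)))
    (fun f g => Subtype.ext (funext fun x => stalk_comm_odd (f.1 x) (g.1 x)))

/-- Restriction of sections. -/
def res (A : SuperAlg) {U V : Opens (PrimeSpectrum A.Even)} (h : V ≤ U) :
    A.sectionsAlg U ⟶ A.sectionsAlg V where
  hom :=
    { toFun := fun (f : A.sections U) => (⟨fun x => f.1 ⟨x.1, h x.2⟩, fun x => by
        obtain ⟨W, hW, a, s, h'⟩ := f.2 ⟨x.1, h x.2⟩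
        exact ⟨W, hW, a, s, fun y hy => h' ⟨y.1, h y.2⟩ hy⟩⟩ : A.sections V)
      map_one' := rfl
      map_zero' := rfl
      map_mul' := fun _ _ => rfl
      map_add' := fun _ _ => rfl
      commutes' := fun _ => rfl }
  map_par _ := rfl

/-- The affine superscheme `Spec A`: the topological space `|Spec A₀|` with the sheaf `𝒪_A` of
commutative superalgebras. -/
def Spec (A : SuperAlg) : AlgebraicGeometry.PresheafedSpace SuperAlg where
  carrier := TopCat.of (PrimeSpectrum A.Even)
  presheaf :=
    { obj := fun U => A.sectionsAlg U.unop
      map := fun i => A.res i.unop.le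
      map_id := fun _ => rfl
      map_comp := fun _ _ => rfl }

/-- The map on stalks `B_{φ⁻¹𝔭} → A_𝔭`, `b / s ↦ φ(b) / φ(s)`, given by `φ : B → A`. -/
def Hom.stalkFun {B A : SuperAlg} (φ : B ⟶ A) (x : PrimeSpectrum A.Even)
    (b : B.Stalk (PrimeSpectrum.comap (Hom.even φ) x)) : A.Stalk x :=
  b.liftOn (fun p => LocalizedModule.mk (φ.hom p.1) ⟨Hom.even φ p.2.1, p.2.2⟩) (by
    rintro ⟨m, s⟩ ⟨m', s'⟩ ⟨u, h⟩
    refine LocalizedModule.mk_eq.mpr ⟨⟨Hom.even φ u.1, u.2⟩, ?_⟩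
    have := congrArg (Hom.semi φ) h
    simp only [Submonoid.smul_def, LinearMap.map_smulₛₗ] at this
    exact this)

theorem Hom.stalkFun_mk {B A : SuperAlg} (φ : B ⟶ A) (x : PrimeSpectrum A.Even) (b : B)
    (s : (PrimeSpectrum.comap (Hom.even φ) x).asIdeal.primeCompl) :
    Hom.stalkFun φ x (LocalizedModule.mk b s) =
      LocalizedModule.mk (φ.hom b) ⟨Hom.even φ s.1, s.2⟩ :=
  LocalizedModule.liftOn_mk _ _ _

/-- The map on stalks `B_{φ⁻¹𝔭} → A_𝔭`. -/
def Hom.stalkMap {B A : SuperAlg} (φ : B ⟶ A) (x : PrimeSpectrum A.Even) :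
    B.Stalk (PrimeSpectrum.comap (Hom.even φ) x) →ₛₗ[Hom.even φ] A.Stalk x where
  toFun := Hom.stalkFun φ x
  map_add' a b := by
    induction a using LocalizedModule.induction_on with
    | _ a s =>
      induction b using LocalizedModule.induction_on with
      | _ b t =>
        rw [LocalizedModule.mk_add_mk, Hom.stalkFun_mk, Hom.stalkFun_mk, Hom.stalkFun_mk,
          LocalizedModule.mk_add_mk]
        congr 1
        · have e1 := (Hom.semi φ).map_smulₛₗ t.1 a
          have e2 := (Hom.semi φ).map_smulₛₗ s.1 b
          exact (map_add (Hom.semi φ) _ _).trans (congrArg₂ (· + ·) e1 e2)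
        · exact Subtype.ext (map_mul (Hom.even φ) _ _)
  map_smul' r a := by
    induction a using LocalizedModule.induction_on with
    | _ a s =>
      rw [LocalizedModule.smul'_mk, Hom.stalkFun_mk, Hom.stalkFun_mk, LocalizedModule.smul'_mk]
      congr 1
      exact (Hom.semi φ).map_smulₛₗ r a

theorem Hom.stalkMap_mk {B A : SuperAlg} (φ : B ⟶ A) (x : PrimeSpectrum A.Even) (b : B)
    (s : (PrimeSpectrum.comap (Hom.even φ) x).asIdeal.primeCompl) :
    Hom.stalkMap φ x (LocalizedModule.mk b s) =
      LocalizedModule.mk (φ.hom b) ⟨Hom.even φ s.1, s.2⟩ :=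
  Hom.stalkFun_mk φ x b s

theorem Hom.stalkMap_mul {B A : SuperAlg} (φ : B ⟶ A) (x : PrimeSpectrum A.Even)
    (a b : B.Stalk (PrimeSpectrum.comap (Hom.even φ) x)) :
    Hom.stalkMap φ x (a * b) = Hom.stalkMap φ x a * Hom.stalkMap φ x b := by
  induction a using LocalizedModule.induction_on with
  | _ a s =>
    induction b using LocalizedModule.induction_on with
    | _ b t =>
      rw [LocalizedModule.mk_mul_mk, Hom.stalkMap_mk, Hom.stalkMap_mk, Hom.stalkMap_mk,
        LocalizedModule.mk_mul_mk, map_mul]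
      congr 1
      exact Subtype.ext (map_mul (Hom.even φ) _ _)

theorem Hom.stalkMap_one {B A : SuperAlg} (φ : B ⟶ A) (x : PrimeSpectrum A.Even) :
    Hom.stalkMap φ x 1 = 1 := by
  have e : (1 : B.Stalk (PrimeSpectrum.comap (Hom.even φ) x)) = LocalizedModule.mk 1 1 :=
    OreLocalization.one_def
  have e' : (1 : A.Stalk x) = LocalizedModule.mk 1 1 := OreLocalization.one_def
  rw [e, e', Hom.stalkMap_mk, map_one]
  congr 1
  exact Subtype.ext (map_one (Hom.even φ))

theorem Hom.stalkMap_par {B A : SuperAlg} (φ : B ⟶ A) (x : PrimeSpectrum A.Even)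
    (b : B.Stalk (PrimeSpectrum.comap (Hom.even φ) x)) :
    Hom.stalkMap φ x (B.stalkPar _ b) = A.stalkPar x (Hom.stalkMap φ x b) := by
  induction b using LocalizedModule.induction_on with
  | _ b s => rw [stalkPar_mk, Hom.stalkMap_mk, Hom.stalkMap_mk, stalkPar_mk, φ.map_par]

/-- The continuous map `|Spec A₀| → |Spec B₀|`. -/
def Spec.base {B A : SuperAlg} (φ : B ⟶ A) : C(PrimeSpectrum A.Even, PrimeSpectrum B.Even) :=
  ⟨PrimeSpectrum.comap (Hom.even φ), PrimeSpectrum.continuous_comap _⟩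

theorem algebraMap_sections_apply {A : SuperAlg} {U : Opens (PrimeSpectrum A.Even)} (c : ℂ)
    (x : U) : (algebraMap ℂ (A.sections U) c).1 x = algebraMap ℂ A.Even c • (1 : A.Stalk x.1) :=
  Algebra.algebraMap_eq_smul_one (A := A.Stalk x.1) (algebraMap ℂ A.Even c)

theorem Hom.even_algebraMap {B A : SuperAlg} (φ : B ⟶ A) (c : ℂ) :
    Hom.even φ (algebraMap ℂ B.Even c) = algebraMap ℂ A.Even c := by
  apply Even.val_injective A
  rw [AlgHom.commutes]
  exact (congrArg φ.hom ((Even.val B).commutes c)).trans (φ.hom.commutes c)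

/-- Pullback of sections along `φ : B → A`, as a function. -/
def Spec.pullFun {B A : SuperAlg} (φ : B ⟶ A) (U : Opens (PrimeSpectrum B.Even))
    (f : B.sections U) : A.sections (U.comap (Spec.base φ)) :=
  ⟨fun x => Hom.stalkMap φ x.1 (f.1 ⟨PrimeSpectrum.comap (Hom.even φ) x.1, x.2⟩), fun x => by
    obtain ⟨W, hW, a, s, h'⟩ := f.2 ⟨PrimeSpectrum.comap (Hom.even φ) x.1, x.2⟩
    refine ⟨W.comap (Spec.base φ), hW, φ.hom a, Hom.even φ s, fun y hy => ?_⟩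
    obtain ⟨hs, e⟩ := h' ⟨PrimeSpectrum.comap (Hom.even φ) y.1, y.2⟩ hy
    exact ⟨hs, (congrArg (Hom.stalkMap φ y.1) e).trans (Hom.stalkMap_mk φ y.1 a ⟨s, hs⟩)⟩⟩

/-- Pullback of sections along `φ : B → A`, as a map of algebras. -/
def Spec.pullHom {B A : SuperAlg} (φ : B ⟶ A) (U : Opens (PrimeSpectrum B.Even)) :
    B.sections U →ₐ[ℂ] A.sections (U.comap (Spec.base φ)) where
  toFun := Spec.pullFun φ U
  map_one' := Subtype.ext (funext fun x => Hom.stalkMap_one φ x.1)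
  map_zero' := Subtype.ext (funext fun x => map_zero (Hom.stalkMap φ x.1))
  map_mul' f g := Subtype.ext (funext fun x => Hom.stalkMap_mul φ x.1 _ _)
  map_add' f g := Subtype.ext (funext fun x => map_add (Hom.stalkMap φ x.1) _ _)
  commutes' c := by
    refine Subtype.ext (funext fun x => ?_)
    have e : Hom.stalkMap φ x.1 ((algebraMap ℂ (B.sections U) c).1
        ⟨PrimeSpectrum.comap (Hom.even φ) x.1, x.2⟩) =
          algebraMap ℂ A.Even c • (1 : A.Stalk x.1) := by
      rw [algebraMap_sections_apply, LinearMap.map_smulₛₗ, Hom.stalkMap_one, Hom.even_algebraMap]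
    exact e.trans (algebraMap_sections_apply c x).symm

/-- Pullback of sections along `φ : B → A`. -/
def Spec.pull {B A : SuperAlg} (φ : B ⟶ A) (U : Opens (PrimeSpectrum B.Even)) :
    B.sectionsAlg U ⟶ A.sectionsAlg (U.comap (Spec.base φ)) where
  hom := Spec.pullHom φ U
  map_par (f : B.sections U) := Subtype.ext (funext fun x =>
    Hom.stalkMap_par φ x.1 (f.1 ⟨PrimeSpectrum.comap (Hom.even φ) x.1, x.2⟩))

/-- The morphism of superschemes `Spec A → Spec B` given by `φ : B → A`. -/
def Spec.map {B A : SuperAlg} (φ : B ⟶ A) : Spec A ⟶ Spec B where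
  base := TopCat.ofHom (Spec.base φ)
  c :=
    { app := fun U => Spec.pull φ U.unop
      naturality := fun _ _ _ => rfl }

end SuperAlg

namespace SuperAlg

/-- The two-sided homogeneous ideal generated by (the homogeneous
components of the elements of) `s`. -/
def ideal (A : SuperAlg) (s : Set A) : TwoSidedIdeal A := TwoSidedIdeal.span (s ∪ A.par '' s)

theorem par_mem_ideal {A : SuperAlg} {s : Set A} {a : A} (ha : a ∈ A.ideal s) :
    A.par a ∈ A.ideal s := by
  have h : A.ideal s ≤ TwoSidedIdeal.comap A.par (A.ideal s) := by
    refine TwoSidedIdeal.span_le.mpr ?_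
    rintro x (hx | ⟨y, hy, rfl⟩)
    · exact (TwoSidedIdeal.mem_comap A.par).mpr (TwoSidedIdeal.subset_span (Or.inr ⟨x, hx, rfl⟩))
    · refine (TwoSidedIdeal.mem_comap A.par).mpr ?_
      rw [A.par_par]
      exact TwoSidedIdeal.subset_span (Or.inl hy)
  exact (TwoSidedIdeal.mem_comap A.par).mp (h ha)

/-- The quotient map, to the underlying ring of the quotient superalgebra. -/
def quotMk (A : SuperAlg) (s : Set A) : A →ₐ[ℂ] (A.ideal s).ringCon.Quotient :=
  RingCon.mkₐ ℂ (A.ideal s).ringCon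

/-- The parity automorphism of a quotient. -/
def quotPar (A : SuperAlg) (s : Set A) :
    (A.ideal s).ringCon.Quotient →ₐ[ℂ] (A.ideal s).ringCon.Quotient :=
  RingCon.liftₐ (A.ideal s).ringCon ((A.quotMk s).comp A.par) (by
    intro x y h
    refine (RingCon.eq _).mpr ?_
    have := par_mem_ideal ((TwoSidedIdeal.rel_iff _ _ _).mp h)
    rw [map_sub] at this
    exact (TwoSidedIdeal.rel_iff _ _ _).mpr this)

theorem quotPar_mk (A : SuperAlg) (s : Set A) (a : A) :
    A.quotPar s (A.quotMk s a) = A.quotMk s (A.par a) := rfl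

/-- The quotient superalgebra of `A` by the homogeneous ideal generated by `s`. -/
def quot (A : SuperAlg) (s : Set A) : SuperAlg :=
  ofPar (A.ideal s).ringCon.Quotient (A.quotPar s)
    (fun a => by
      obtain ⟨a, rfl⟩ := RingCon.mkₐ_surjective (α := ℂ) (A.ideal s).ringCon a
      change A.quotPar s (A.quotPar s (A.quotMk s a)) = A.quotMk s a
      rw [quotPar_mk, quotPar_mk, A.par_par])
    (fun a b => by
      obtain ⟨a, rfl⟩ := RingCon.mkₐ_surjective (α := ℂ) (A.ideal s).ringCon a
      obtain ⟨b, rfl⟩ := RingCon.mkₐ_surjective (α := ℂ) (A.ideal s).ringCon b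
      change (A.quotMk s a + A.quotPar s (A.quotMk s a)) * A.quotMk s b =
        A.quotMk s b * (A.quotMk s a + A.quotPar s (A.quotMk s a))
      rw [quotPar_mk, ← map_add, ← map_mul, ← map_mul, comm_even])
    (fun a b => by
      obtain ⟨a, rfl⟩ := RingCon.mkₐ_surjective (α := ℂ) (A.ideal s).ringCon a
      obtain ⟨b, rfl⟩ := RingCon.mkₐ_surjective (α := ℂ) (A.ideal s).ringCon b
      change (A.quotMk s a - A.quotPar s (A.quotMk s a)) *
          (A.quotMk s b - A.quotPar s (A.quotMk s b)) =
        -((A.quotMk s b - A.quotPar s (A.quotMk s b)) *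
          (A.quotMk s a - A.quotPar s (A.quotMk s a)))
      rw [quotPar_mk, quotPar_mk, ← map_sub, ← map_sub, ← map_mul, ← map_mul, comm_odd, map_neg])

/-- The quotient map `A → A / ⟨s⟩`. -/
def toQuot (A : SuperAlg) (s : Set A) : A ⟶ A.quot s where
  hom := A.quotMk s
  map_par _ := rfl

theorem par_mem_adjoin {A : SuperAlg} {s : Set A} {a : A}
    (ha : a ∈ Algebra.adjoin ℂ (s ∪ A.par '' s)) :
    A.par a ∈ Algebra.adjoin ℂ (s ∪ A.par '' s) := by
  have h : Algebra.adjoin ℂ (s ∪ A.par '' s) ≤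
      (Algebra.adjoin ℂ (s ∪ A.par '' s)).comap A.par := by
    refine Algebra.adjoin_le ?_
    rintro x (hx | ⟨y, hy, rfl⟩)
    · exact Algebra.subset_adjoin (Or.inr ⟨x, hx, rfl⟩)
    · refine Algebra.subset_adjoin (Or.inl ?_)
      rwa [show (A.par : A →+* A) (A.par y) = y from A.par_par y]
  exact h ha

/-- The sub-superalgebra of `A` generated by (the homogeneous components of the elements of)
`s`. -/
def adjoin (A : SuperAlg) (s : Set A) : SuperAlg :=
  ofPar (Algebra.adjoin ℂ (s ∪ A.par '' s))
    ((A.par.comp (Algebra.adjoin ℂ (s ∪ A.par '' s)).val).codRestrict _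
      fun a => par_mem_adjoin a.2)
    (fun a => Subtype.ext (A.par_par a.1))
    (fun a b => Subtype.ext (comm_even a.1 b.1))
    (fun a b => Subtype.ext (comm_odd a.1 b.1))

end SuperAlg

/-! ### Free supercommutative superalgebras -/

/-- The relations `X_i X_j = (-1)^{|i||j|} X_j X_i`. -/
inductive FreeSuperRel {ι : Type} (p : ι → ZMod 2) : FreeAlgebra ℂ ι → FreeAlgebra ℂ ι → Prop
  | swap (i j : ι) : FreeSuperRel p (FreeAlgebra.ι ℂ i * FreeAlgebra.ι ℂ j)
      (ksign (p i) (p j) • (FreeAlgebra.ι ℂ j * FreeAlgebra.ι ℂ i))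

/-- The underlying algebra of the free supercommutative superalgebra. -/
def FreeSuperRing {ι : Type} (p : ι → ZMod 2) : Type := RingQuot (FreeSuperRel p)

namespace FreeSuperRing

variable {ι : Type} (p : ι → ZMod 2)

instance : Semiring (FreeSuperRing p) := inferInstanceAs (Semiring (RingQuot (FreeSuperRel p)))
instance : Algebra ℂ (FreeSuperRing p) := inferInstanceAs (Algebra ℂ (RingQuot (FreeSuperRel p)))
instance : Ring (FreeSuperRing p) := Algebra.semiringToRing ℂ

/-- The quotient map from the free algebra. -/
def mk : FreeAlgebra ℂ ι →ₐ[ℂ] FreeSuperRing p := RingQuot.mkAlgHom ℂ (FreeSuperRel p)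

/-- The generator `X_i`. -/
def X (i : ι) : FreeSuperRing p := mk p (FreeAlgebra.ι ℂ i)

theorem X_mul_X (i j : ι) : X p i * X p j = ksign (p i) (p j) • (X p j * X p i) := by
  have : mk p _ = mk p _ := RingQuot.mkAlgHom_rel ℂ (FreeSuperRel.swap (p := p) i j)
  rwa [map_mul, map_smul, map_mul] at this

/-- The universal property: a map on generators that respects the commutation relations extends
to a morphism of algebras. -/
def lift {A : Type*} [Ring A] [Algebra ℂ A] (f : ι → A)
    (hf : ∀ i j, f i * f j = ksign (p i) (p j) • (f j * f i)) : FreeSuperRing p →ₐ[ℂ] A :=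
  RingQuot.liftAlgHom ℂ ⟨FreeAlgebra.lift ℂ f, by
    rintro _ _ ⟨i, j⟩
    simpa using hf i j⟩

theorem lift_X {A : Type*} [Ring A] [Algebra ℂ A] (f : ι → A)
    (hf : ∀ i j, f i * f j = ksign (p i) (p j) • (f j * f i)) (i : ι) :
    lift p f hf (X p i) = f i := by
  have h : lift p f hf (mk p (FreeAlgebra.ι ℂ i)) = FreeAlgebra.lift ℂ f (FreeAlgebra.ι ℂ i) :=
    RingQuot.liftAlgHom_mkAlgHom_apply ..
  rw [X, h, FreeAlgebra.lift_ι_apply]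

theorem hom_ext {A : Type*} [Ring A] [Algebra ℂ A] {f g : FreeSuperRing p →ₐ[ℂ] A}
    (h : ∀ i, f (X p i) = g (X p i)) : f = g :=
  RingQuot.ringQuot_ext' _ _ _ (FreeAlgebra.hom_ext (funext h))

theorem adjoin_X : Algebra.adjoin ℂ (Set.range (X p)) = ⊤ := by
  have : Set.range (X p) = mk p '' Set.range (FreeAlgebra.ι ℂ) := by
    rw [← Set.range_comp]; rfl
  rw [this, ← AlgHom.map_adjoin, FreeAlgebra.adjoin_range_ι, Algebra.map_top, AlgHom.range_eq_top]
  exact RingQuot.mkAlgHom_surjective ℂ _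

/-- The parity automorphism. -/
def par : FreeSuperRing p →ₐ[ℂ] FreeSuperRing p :=
  lift p (fun i => ksign 1 (p i) • X p i) fun i j => by
    rw [smul_mul_smul_comm, smul_mul_smul_comm, X_mul_X, smul_comm, mul_comm (ksign 1 (p i))]

theorem par_X (i : ι) : par p (X p i) = ksign 1 (p i) • X p i := lift_X ..

theorem par_par (a : FreeSuperRing p) : par p (par p a) = a := by
  have : (par p).comp (par p) = AlgHom.id ℂ _ := hom_ext p fun i => by
    rcases zmod2_cases (p i) with h | h <;> simp [par_X, ksign, h]
  exact congrArg (fun f : FreeSuperRing p →ₐ[ℂ] FreeSuperRing p => f a) this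

theorem X_even {i : ι} (hi : p i = 0) (b : FreeSuperRing p) : X p i * b = b * X p i := by
  have hb : b ∈ Algebra.adjoin ℂ (Set.range (X p)) := by rw [adjoin_X]; trivial
  induction hb using Algebra.adjoin_induction with
  | mem x hx =>
    obtain ⟨j, rfl⟩ := hx
    rw [X_mul_X, hi]
    simp [ksign]
  | algebraMap r => exact (Algebra.commutes r _).symm
  | add x y _ _ hx hy => rw [mul_add, add_mul, hx, hy]
  | mul x y _ _ hx hy => rw [← mul_assoc, hx, mul_assoc, hy, mul_assoc]

theorem X_odd {i : ι} (hi : p i = 1) (b : FreeSuperRing p) : X p i * b = par p b * X p i := by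
  have hb : b ∈ Algebra.adjoin ℂ (Set.range (X p)) := by rw [adjoin_X]; trivial
  induction hb using Algebra.adjoin_induction with
  | mem x hx =>
    obtain ⟨j, rfl⟩ := hx
    rw [X_mul_X, hi, par_X, smul_mul_assoc]
  | algebraMap r => rw [AlgHom.commutes]; exact (Algebra.commutes r _).symm
  | add x y _ _ hx hy => rw [mul_add, map_add, add_mul, hx, hy]
  | mul x y _ _ hx hy => rw [← mul_assoc, hx, mul_assoc, hy, map_mul, mul_assoc]

theorem decomp (a : FreeSuperRing p) : ∃ a₀ a₁ : FreeSuperRing p, a = a₀ + a₁ ∧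
    par p a₀ = a₀ ∧ par p a₁ = -a₁ ∧ (∀ b, a₀ * b = b * a₀) ∧ ∀ b, a₁ * b = par p b * a₁ := by
  have ha : a ∈ Algebra.adjoin ℂ (Set.range (X p)) := by rw [adjoin_X]; trivial
  induction ha using Algebra.adjoin_induction with
  | mem x hx =>
    obtain ⟨i, rfl⟩ := hx
    rcases zmod2_cases (p i) with h | h
    · exact ⟨X p i, 0, by simp, by simp [par_X, ksign, h], by simp, X_even p h, by simp⟩
    · exact ⟨0, X p i, by simp, by simp, by simp [par_X, ksign, h], by simp, X_odd p h⟩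
  | algebraMap r =>
    exact ⟨algebraMap ℂ _ r, 0, by simp, AlgHom.commutes _ _, by simp, Algebra.commutes r, by simp⟩
  | add x y _ _ hx hy =>
    obtain ⟨x₀, x₁, rfl, h0, h1, h2, h3⟩ := hx
    obtain ⟨y₀, y₁, rfl, k0, k1, k2, k3⟩ := hy
    refine ⟨x₀ + y₀, x₁ + y₁, by abel, by rw [map_add, h0, k0], by rw [map_add, h1, k1]; abel,
      fun b => by rw [add_mul, mul_add, h2, k2], fun b => by rw [add_mul, mul_add, h3, k3]⟩
  | mul x y _ _ hx hy =>
    obtain ⟨x₀, x₁, rfl, h0, h1, h2, h3⟩ := hx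
    obtain ⟨y₀, y₁, rfl, k0, k1, k2, k3⟩ := hy
    refine ⟨x₀ * y₀ + x₁ * y₁, x₀ * y₁ + x₁ * y₀, by noncomm_ring,
      by simp [h0, h1, k0, k1], by simp [h0, h1, k0, k1]; abel, fun b => ?_, fun b => ?_⟩
    · rw [add_mul, mul_add, mul_assoc, k2, ← mul_assoc, h2, mul_assoc, mul_assoc x₁, k3,
        ← mul_assoc x₁, h3, par_par, mul_assoc]
    · rw [add_mul, mul_add, mul_assoc, k3, ← mul_assoc, h2, mul_assoc, mul_assoc x₁, k2,
        ← mul_assoc x₁, h3, mul_assoc]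

end FreeSuperRing

/-- The free supercommutative superalgebra `ℂ[X_i | i ∈ ι]` on generators of parity `p i`. -/
def FreeSuper {ι : Type} (p : ι → ZMod 2) : SuperAlg :=
  SuperAlg.ofPar (FreeSuperRing p) (FreeSuperRing.par p) (FreeSuperRing.par_par p)
    (fun a b => by
      obtain ⟨a₀, a₁, rfl, h0, h1, h2, h3⟩ := FreeSuperRing.decomp p a
      have : a₀ + a₁ + FreeSuperRing.par p (a₀ + a₁) = a₀ + a₀ := by
        rw [map_add, h0, h1]; abel
      rw [this, add_mul, mul_add, h2])
    (fun a b => by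
      obtain ⟨a₀, a₁, rfl, h0, h1, h2, h3⟩ := FreeSuperRing.decomp p a
      have : a₀ + a₁ - FreeSuperRing.par p (a₀ + a₁) = a₁ + a₁ := by
        rw [map_add, h0, h1]; abel
      rw [this, add_mul, mul_add, h3, map_sub, FreeSuperRing.par_par]
      noncomm_ring)

/-! ### The affine line, flatness and fibres -/

/-- The superalgebra `ℂ[t]` of functions on `𝔸^{1|0}`, which is purely even. -/
def lineAlg : SuperAlg :=
  SuperAlg.ofPar (Polynomial ℂ) (AlgHom.id ℂ _) (fun _ => rfl) (fun a b => mul_comm _ _)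
    (fun a b => by simp)

/-- The coordinate `t` of the affine line. -/
def lineT : lineAlg := (Polynomial.X : Polynomial ℂ)

/-- The affine line `𝔸^{1|0}`. -/
def affineLine : AlgebraicGeometry.PresheafedSpace SuperAlg := lineAlg.Spec

namespace SuperAlg

/-- The action of the local ring of `Spec B₀` at the image of a point `x` of `Spec A` on the stalk
at `x`. -/
abbrev stalkModule {B A : SuperAlg} (φ : B ⟶ A) (x : PrimeSpectrum A.Even) :
    Module (Localization.AtPrime (x.asIdeal.comap (Hom.even φ))) (A.Stalk x) :=
  Module.compHom (A.Stalk x)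
    (Localization.localRingHom (x.asIdeal.comap (Hom.even φ)) x.asIdeal (Hom.even φ) rfl)

/-- A morphism from an affine superscheme to the affine line is flat if all its stalk maps are
flat. -/
def IsFlatOverLine {A : SuperAlg} (f : A.Spec ⟶ affineLine) : Prop :=
  ∃ φ : lineAlg ⟶ A, f = Spec.map φ ∧ ∀ x : PrimeSpectrum A.Even,
    @Module.Flat (Localization.AtPrime (x.asIdeal.comap (Hom.even φ))) (A.Stalk x) _ _
      (stalkModule φ x)

/-- The superscheme `F` is (isomorphic to) the fibre `Spec A ×_{𝔸^{1|0}} {a}` of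
`f : Spec A → 𝔸^{1|0}` over the closed point `a`, that is, to `Spec A / (f^#(t) - a)`. -/
def IsFibreOver {A : SuperAlg} (f : A.Spec ⟶ affineLine) (a : ℂ)
    (F : AlgebraicGeometry.PresheafedSpace SuperAlg) : Prop :=
  ∃ φ : lineAlg ⟶ A, f = Spec.map φ ∧
    Nonempty (F ≅ (A.quot {φ.hom lineT - algebraMap ℂ A a}).Spec)

end SuperAlg

/-! ### Lie superalgebras -/

/-- A Lie superalgebra over `ℂ`. -/
class LieSuperalgebra (g : Type) [AddCommGroup g] [Module ℂ g] where
  gr : ZMod 2 → Submodule ℂ g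
  isInternal : DirectSum.IsInternal gr
  br : g →ₗ[ℂ] g →ₗ[ℂ] g
  br_mem : ∀ {i j : ZMod 2} {x y : g}, x ∈ gr i → y ∈ gr j → br x y ∈ gr (i + j)
  skew : ∀ {i j : ZMod 2} {x y : g}, x ∈ gr i → y ∈ gr j → br x y = -(ksign i j • br y x)
  jacobi : ∀ {i j k : ZMod 2} {x y z : g}, x ∈ gr i → y ∈ gr j → z ∈ gr k →
    br x (br y z) = br (br x y) z + ksign i j • br y (br x z)

namespace LieSuperalgebra

section basics

variable (g : Type) [AddCommGroup g] [Module ℂ g] [LieSuperalgebra g]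

theorem isCompl_gr : IsCompl (gr (g := g) 0) (gr 1) :=
  (DirectSum.isInternal_submodule_iff_isCompl (gr (g := g)) (i := 0) (j := 1) (by decide)
    (by ext i; rcases zmod2_cases i with h | h <;> simp [h])).mp isInternal

/-- The even component of an element. -/
def even : g →ₗ[ℂ] g := (gr (g := g) 0).projection (gr 1) (isCompl_gr g)

/-- The odd component of an element. -/
def odd : g →ₗ[ℂ] g := (gr (g := g) 1).projection (gr 0) (isCompl_gr g).symm

/-- The map `x₀ + x₁ ↦ x₀ - x₁`. -/
def par : g →ₗ[ℂ] g := even g - odd g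

variable {g}

theorem even_add_odd (x : g) : even g x + odd g x = x :=
  Submodule.projection_add_projection_eq_self (isCompl_gr g) x

theorem even_mem (x : g) : even g x ∈ gr (g := g) 0 := Submodule.projection_apply_mem _ _
theorem odd_mem (x : g) : odd g x ∈ gr (g := g) 1 := Submodule.projection_apply_mem _ _

theorem even_of_even {x : g} (hx : x ∈ gr (g := g) 0) : even g x = x :=
  Submodule.projection_apply_of_mem_left _ hx
theorem odd_of_odd {x : g} (hx : x ∈ gr (g := g) 1) : odd g x = x :=
  Submodule.projection_apply_of_mem_left _ hx
theorem even_of_odd {x : g} (hx : x ∈ gr (g := g) 1) : even g x = 0 :=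
  (Submodule.projection_apply_eq_zero_iff _).mpr hx
theorem odd_of_even {x : g} (hx : x ∈ gr (g := g) 0) : odd g x = 0 :=
  (Submodule.projection_apply_eq_zero_iff _).mpr hx

theorem par_of_mem {i : ZMod 2} {x : g} (hx : x ∈ gr (g := g) i) : par g x = ksign 1 i • x := by
  rcases zmod2_cases i with rfl | rfl
  · simp [par, even_of_even hx, odd_of_even hx, ksign]
  · simp [par, even_of_odd hx, odd_of_odd hx, ksign]

/-- To check a linear property, it suffices to check it on homogeneous elements. -/
theorem homogeneous_induction {P : g → Prop} (h : ∀ i, ∀ x ∈ gr (g := g) i, P x)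
    (hadd : ∀ x y, P x → P y → P (x + y)) (x : g) : P x := by
  rw [← even_add_odd x]
  exact hadd _ _ (h 0 _ (even_mem x)) (h 1 _ (odd_mem x))

variable (g)

/-- The even part `g₀`. -/
abbrev EvenPart : Type := gr (g := g) 0

instance : LieRing (EvenPart g) where
  bracket x y := ⟨br x.1 y.1, by simpa using br_mem x.2 y.2⟩
  add_lie x y z := Subtype.ext (by
    change br (x.1 + y.1) z.1 = br x.1 z.1 + br y.1 z.1
    rw [map_add, LinearMap.add_apply])
  lie_add x y z := Subtype.ext (map_add (br x.1) y.1 z.1)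
  lie_self x := Subtype.ext (by
    change br x.1 x.1 = 0
    have h := skew x.2 x.2
    simp only [ksign, zero_ne_one, false_and, if_false, one_smul] at h
    have h2 : (2 : ℂ) • br x.1 x.1 = 0 := by
      rw [two_smul]; nth_rw 1 [h]; exact neg_add_cancel _
    exact (smul_eq_zero.mp h2).resolve_left two_ne_zero)
  leibniz_lie x y z := Subtype.ext (by
    change br x.1 (br y.1 z.1) = br (br x.1 y.1) z.1 + br y.1 (br x.1 z.1)
    have h := jacobi x.2 y.2 z.2
    simpa only [ksign, zero_ne_one, false_and, if_false, one_smul] using h)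

instance : LieAlgebra ℂ (EvenPart g) where
  lie_smul c x y := Subtype.ext (map_smul (br x.1) c y.1)

/-- `g` is simple: it is not abelian and has no non-trivial graded ideals. -/
structure IsSimple : Prop where
  not_abelian : ∃ x y : g, br x y ≠ 0
  eq_bot_or_top : ∀ I : Submodule ℂ g, (∀ x ∈ I, even g x ∈ I) → (∀ x, ∀ y ∈ I, br x y ∈ I) →
    I = ⊥ ∨ I = ⊤

/-- `g` is a basic Lie superalgebra: it is simple, `g₀` is reductive (its radical is its centre),
and there is a non-degenerate invariant even supersymmetric bilinear form. -/
structure IsBasic : Prop where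
  simple : IsSimple g
  reductive : LieAlgebra.HasCentralRadical ℂ (EvenPart g)
  form : ∃ B : g →ₗ[ℂ] g →ₗ[ℂ] ℂ, B.Nondegenerate ∧
    (∀ x y z, B (br x y) z = B x (br y z)) ∧
    (∀ i j, ∀ x ∈ gr (g := g) i, ∀ y ∈ gr (g := g) j, B x y = ksign i j • B y x) ∧
    (∀ x ∈ gr (g := g) 0, ∀ y ∈ gr (g := g) 1, B x y = 0)

end basics

section roots

variable {g : Type} [AddCommGroup g] [Module ℂ g] [LieSuperalgebra g] (H : Submodule ℂ g)

/-- The simultaneous eigenspace `g_α`. -/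
def rootSpace (α : Module.Dual ℂ H) : Submodule ℂ g where
  carrier := {x | ∀ h : H, br h.1 x = α h • x}
  add_mem' hx hy h := by rw [map_add, hx h, hy h, smul_add]
  zero_mem' h := by simp
  smul_mem' c x hx h := by rw [map_smul, hx h, smul_comm]

/-- `H` is a Cartan subalgebra of `g`, that is, of the reductive Lie algebra `g₀`: an abelian
subalgebra of `g₀` that consists of `ad`-diagonalizable elements and is its own centralizer
in `g₀`. -/
structure IsCartan : Prop where
  le_even : H ≤ gr 0
  abelian : ∀ x ∈ H, ∀ y ∈ H, br x y = 0
  diagonalizable : ∀ h ∈ H, ⨆ c : ℂ, Module.End.eigenspace (br h) c = ⊤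
  centralizer : ∀ x ∈ gr (g := g) 0, (∀ h ∈ H, br h x = 0) → x ∈ H

/-- The set of roots. -/
def roots : Set (Module.Dual ℂ H) := {α | α ≠ 0 ∧ rootSpace H α ≠ ⊥}

/-- The real vector space spanned by the roots. -/
abbrev RootSpan : Type := Submodule.span ℝ (roots H)

end roots

/-- A Borel subalgebra of `g`: it is given by a Cartan subalgebra `𝔥` and by a total order on the
real span `E` of the roots that is compatible with the structure of a real vector space; the order
determines the positive system. -/
structure Borel (g : Type) [AddCommGroup g] [Module ℂ g] [LieSuperalgebra g] where
  H : Submodule ℂ g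
  isCartan : IsCartan H
  lt : RootSpan H → RootSpan H → Prop
  total : IsStrictTotalOrder (RootSpan H) lt
  add_lt : ∀ x y z, lt x y → lt (x + z) (y + z)
  smul_lt : ∀ (c : ℝ) (x y), 0 < c → lt x y → lt (c • x) (c • y)

namespace Borel

variable {g : Type} [AddCommGroup g] [Module ℂ g] [LieSuperalgebra g] (b : Borel g)

/-- The positive roots. -/
def pos : Set (Module.Dual ℂ b.H) :=
  {α | ∃ h : α ∈ roots b.H, b.lt 0 ⟨α, Submodule.subset_span h⟩}

/-- The negative roots. -/
def neg : Set (Module.Dual ℂ b.H) :=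
  {α | ∃ h : α ∈ roots b.H, b.lt ⟨α, Submodule.subset_span h⟩ 0}

/-- `𝔫⁺`, so that the Borel subalgebra is `𝔟 = 𝔥 ⊕ 𝔫⁺`. -/
def nPos : Submodule ℂ g := ⨆ α ∈ b.pos, rootSpace b.H α

/-- `𝔫⁻`. -/
def nNeg : Submodule ℂ g := ⨆ α ∈ b.neg, rootSpace b.H α

theorem par_mem_nPos {x : g} (hx : x ∈ b.nPos) : par g x ∈ b.nPos := by
  have key : ∀ h ∈ gr (g := g) 0, ∀ y : g, br h (par g y) = par g (br h y) := fun h hh y => by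
    refine homogeneous_induction (P := fun y => br h (par g y) = par g (br h y)) ?_ ?_ y
    · intro i y hy
      have := br_mem hh hy
      rw [zero_add] at this
      rw [par_of_mem hy, par_of_mem this, map_smul]
    · intro y z hy hz
      rw [map_add, map_add, map_add, map_add, hy, hz]
  have h : b.nPos ≤ b.nPos.comap (par g) := by
    refine iSup₂_le fun α hα y hy => ?_
    refine le_iSup₂ (f := fun α (_ : α ∈ b.pos) => rootSpace b.H α) α hα ?_
    intro k
    rw [key _ (b.isCartan.le_even k.2), hy k, map_smul]
  exact h hx

theorem even_mem_nPos {x : g} (hx : x ∈ b.nPos) : even g x ∈ b.nPos := by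
  have : even g x = (1 / 2 : ℂ) • (x + par g x) := by
    conv_rhs => rw [← even_add_odd x]
    rw [map_add, par_of_mem (even_mem x), par_of_mem (odd_mem x)]
    simp only [ksign, true_and, zero_ne_one, and_false, if_false, if_true]
    module
  rw [this]
  exact b.nPos.smul_mem _ (b.nPos.add_mem hx (b.par_mem_nPos hx))

theorem odd_mem_nPos {x : g} (hx : x ∈ b.nPos) : odd g x ∈ b.nPos := by
  have : odd g x = x - even g x := eq_sub_of_add_eq' (even_add_odd x)
  rw [this]
  exact b.nPos.sub_mem hx (b.even_mem_nPos hx)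

end Borel

end LieSuperalgebra

/-! ### The universal enveloping superalgebra -/

open LieSuperalgebra

section envelope

variable (g : Type) [AddCommGroup g] [Module ℂ g] [LieSuperalgebra g]

/-- The relations `x y - (-1)^{|x||y|} y x = [x, y]`. -/
inductive EnvRel : TensorAlgebra ℂ g → TensorAlgebra ℂ g → Prop
  | swap {i j : ZMod 2} {x y : g} (hx : x ∈ gr (g := g) i) (hy : y ∈ gr (g := g) j) :
      EnvRel (TensorAlgebra.ι ℂ x * TensorAlgebra.ι ℂ y)
        (ksign i j • (TensorAlgebra.ι ℂ y * TensorAlgebra.ι ℂ x) + TensorAlgebra.ι ℂ (br x y))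

/-- The universal enveloping superalgebra `U(g)`. -/
def Env : Type := RingQuot (EnvRel g)

namespace Env

instance : Semiring (Env g) := inferInstanceAs (Semiring (RingQuot (EnvRel g)))
instance : Algebra ℂ (Env g) := inferInstanceAs (Algebra ℂ (RingQuot (EnvRel g)))
instance : Ring (Env g) := Algebra.semiringToRing ℂ

/-- The quotient map from the tensor algebra. -/
def mk : TensorAlgebra ℂ g →ₐ[ℂ] Env g := RingQuot.mkAlgHom ℂ (EnvRel g)

/-- The canonical map `g → U(g)`. -/
def ι : g →ₗ[ℂ] Env g := (mk g).toLinearMap ∘ₗ TensorAlgebra.ι ℂ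

variable {g}

theorem ι_mul_ι {i j : ZMod 2} {x y : g} (hx : x ∈ gr (g := g) i) (hy : y ∈ gr (g := g) j) :
    ι g x * ι g y = ksign i j • (ι g y * ι g x) + ι g (br x y) := by
  have : mk g _ = mk g _ := RingQuot.mkAlgHom_rel ℂ (EnvRel.swap hx hy)
  rwa [map_mul, map_add, map_smul, map_mul] at this

/-- The universal property of `U(g)`. -/
def lift {A : Type*} [Ring A] [Algebra ℂ A] (f : g →ₗ[ℂ] A)
    (hf : ∀ i j, ∀ x ∈ gr (g := g) i, ∀ y ∈ gr (g := g) j,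
      f x * f y = ksign i j • (f y * f x) + f (br x y)) : Env g →ₐ[ℂ] A :=
  RingQuot.liftAlgHom ℂ ⟨TensorAlgebra.lift ℂ f, by
    rintro _ _ ⟨hx, hy⟩
    simpa using hf _ _ _ hx _ hy⟩

theorem lift_ι {A : Type*} [Ring A] [Algebra ℂ A] (f : g →ₗ[ℂ] A)
    (hf : ∀ i j, ∀ x ∈ gr (g := g) i, ∀ y ∈ gr (g := g) j,
      f x * f y = ksign i j • (f y * f x) + f (br x y)) (x : g) :
    lift f hf (ι g x) = f x := by
  have h : lift f hf (mk g (TensorAlgebra.ι ℂ x)) = TensorAlgebra.lift ℂ f (TensorAlgebra.ι ℂ x) :=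
    RingQuot.liftAlgHom_mkAlgHom_apply ..
  exact h.trans (TensorAlgebra.lift_ι_apply f x)

theorem adjoin_ι : Algebra.adjoin ℂ (Set.range (ι g)) = ⊤ := by
  have : Set.range (ι g) = mk g '' Set.range (TensorAlgebra.ι ℂ) := by
    rw [← Set.range_comp]; rfl
  rw [this, ← AlgHom.map_adjoin, TensorAlgebra.adjoin_range_ι, Algebra.map_top, AlgHom.range_eq_top]
  exact RingQuot.mkAlgHom_surjective ℂ _

theorem induction {P : Env g → Prop} (hι : ∀ i, ∀ x ∈ gr (g := g) i, P (ι g x))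
    (hc : ∀ c : ℂ, P (algebraMap ℂ _ c))
    (hadd : ∀ u v, P u → P v → P (u + v)) (hmul : ∀ u v, P u → P v → P (u * v)) (u : Env g) :
    P u := by
  have hu : u ∈ Algebra.adjoin ℂ (Set.range (ι g)) := by rw [adjoin_ι]; trivial
  induction hu using Algebra.adjoin_induction with
  | mem u hu =>
    obtain ⟨x, rfl⟩ := hu
    exact homogeneous_induction (P := fun x => P (ι g x)) hι
      (fun x y hx hy => by rw [map_add]; exact hadd _ _ hx hy) x
  | algebraMap r => exact hc r
  | add x y _ _ hx hy => exact hadd _ _ hx hy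
  | mul x y _ _ hx hy => exact hmul _ _ hx hy

variable (g)

/-- The parity automorphism of `U(g)`. -/
def par : Env g →ₐ[ℂ] Env g :=
  lift (ι g ∘ₗ LieSuperalgebra.par g) fun i j x hx y hy => by
    simp only [LinearMap.comp_apply, par_of_mem hx, par_of_mem hy, par_of_mem (br_mem hx hy),
      map_smul, smul_mul_smul_comm, ι_mul_ι hx hy, smul_add]
    congr 1
    · rw [smul_comm, mul_comm]
    · congr 1
      rcases zmod2_cases i with rfl | rfl <;> rcases zmod2_cases j with rfl | rfl <;>
        simp [ksign, show (1 + 1 : ZMod 2) = 0 from rfl]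

variable {g}

theorem par_ι {i : ZMod 2} {x : g} (hx : x ∈ gr (g := g) i) : par g (ι g x) = ksign 1 i • ι g x := by
  rw [par, lift_ι, LinearMap.comp_apply, par_of_mem hx, map_smul]

theorem par_ι' (x : g) : par g (ι g x) = ι g (LieSuperalgebra.par g x) := by
  rw [par, lift_ι, LinearMap.comp_apply]

theorem ksign_sq (i : ZMod 2) : ksign 1 i * ksign 1 i = 1 := by
  rcases zmod2_cases i with rfl | rfl <;> simp [ksign]

theorem par_par (u : Env g) : par g (par g u) = u := by
  induction u using Env.induction with
  | hι i x hx => rw [par_ι hx, map_smul, par_ι hx, smul_smul, ksign_sq, one_smul]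
  | hc c => rw [AlgHom.commutes, AlgHom.commutes]
  | hadd u v hu hv => rw [map_add, map_add, hu, hv]
  | hmul u v hu hv => rw [map_mul, map_mul, hu, hv]

end Env

end envelope

/-! ### Supermodules and their tensor products -/

/-- The power `σ^i` of an involution. -/
def parPow {V : Type} [AddCommGroup V] [Module ℂ V] (σ : Module.End ℂ V) (i : ZMod 2) :
    Module.End ℂ V := if i = 0 then 1 else σ

/-- A `ℤ/2`-graded representation of `g`, where the grading of `V` is recorded by
`σ (v₀ + v₁) = v₀ - v₁`. -/
structure SuperRep (g : Type) [AddCommGroup g] [Module ℂ g] [LieSuperalgebra g]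
    (V : Type) [AddCommGroup V] [Module ℂ V] where
  ρ : Env g →ₐ[ℂ] Module.End ℂ V
  σ : Module.End ℂ V
  σ_σ : σ * σ = 1
  σ_ρ : ∀ u, σ * ρ u = ρ (Env.par g u) * σ

namespace SuperRep

variable {g : Type} [AddCommGroup g] [Module ℂ g] [LieSuperalgebra g]
variable {V W X V' W' : Type} [AddCommGroup V] [Module ℂ V] [AddCommGroup W] [Module ℂ W]
  [AddCommGroup X] [Module ℂ X] [AddCommGroup V'] [Module ℂ V'] [AddCommGroup W'] [Module ℂ W']

/-- The action of an element of `g`. -/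
def act (R : SuperRep g V) : g →ₗ[ℂ] Module.End ℂ V := R.ρ.toLinearMap ∘ₗ Env.ι g

theorem act_apply (R : SuperRep g V) (x : g) : R.act x = R.ρ (Env.ι g x) := rfl

theorem act_mul_act (R : SuperRep g V) {i j : ZMod 2} {x y : g} (hx : x ∈ gr (g := g) i)
    (hy : y ∈ gr (g := g) j) :
    R.act x * R.act y = ksign i j • (R.act y * R.act x) + R.act (br x y) := by
  simp only [act_apply, ← map_mul, Env.ι_mul_ι hx hy, map_add, map_smul]

theorem σ_act (R : SuperRep g V) (j : ZMod 2) {i : ZMod 2} {x : g} (hx : x ∈ gr (g := g) i) :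
    parPow R.σ j * R.act x = ksign i j • (R.act x * parPow R.σ j) := by
  rcases zmod2_cases j with rfl | rfl
  · simp [parPow, ksign]
  · rw [parPow, if_neg one_ne_zero, act_apply, R.σ_ρ, Env.par_ι hx, map_smul, smul_mul_assoc]
    congr 1
    simp [ksign, and_comm]

theorem parPow_mul (R : SuperRep g V) (i j : ZMod 2) :
    parPow R.σ i * parPow R.σ j = parPow R.σ (i + j) := by
  rcases zmod2_cases i with rfl | rfl <;> rcases zmod2_cases j with rfl | rfl <;>
    simp [parPow, R.σ_σ, show (1 + 1 : ZMod 2) = 0 from rfl]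

/-- The action of `g` on a tensor product: `x (v ⊗ w) = x v ⊗ w + (-1)^{|x||v|} v ⊗ x w`. -/
def tensAct (R : SuperRep g V) (S : SuperRep g W) : g →ₗ[ℂ] Module.End ℂ (V ⊗[ℂ] W) :=
  (TensorProduct.mapBilinear (.id ℂ) V W V W).flip 1 ∘ₗ R.act +
  (TensorProduct.mapBilinear (.id ℂ) V W V W 1 ∘ₗ S.act) ∘ₗ even g +
  (TensorProduct.mapBilinear (.id ℂ) V W V W R.σ ∘ₗ S.act) ∘ₗ odd g

theorem tensAct_apply (R : SuperRep g V) (S : SuperRep g W) {i : ZMod 2} {x : g}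
    (hx : x ∈ gr (g := g) i) : tensAct R S x =
      TensorProduct.map (R.act x) 1 + TensorProduct.map (parPow R.σ i) (S.act x) := by
  rcases zmod2_cases i with rfl | rfl
  · simp [tensAct, even_of_even hx, odd_of_even hx, parPow]
  · simp [tensAct, even_of_odd hx, odd_of_odd hx, parPow]

theorem tensAct_mul (R : SuperRep g V) (S : SuperRep g W) {i j : ZMod 2} {x y : g}
    (hx : x ∈ gr (g := g) i) (hy : y ∈ gr (g := g) j) :
    tensAct R S x * tensAct R S y =
      ksign i j • (tensAct R S y * tensAct R S x) + tensAct R S (br x y) := by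
  rw [tensAct_apply R S hx, tensAct_apply R S hy, tensAct_apply R S (br_mem hx hy)]
  simp only [add_mul, mul_add, ← TensorProduct.map_mul, mul_one, one_mul, R.act_mul_act hx hy,
    S.act_mul_act hx hy, R.parPow_mul, R.σ_act _ hx, R.σ_act _ hy, TensorProduct.map_add_left,
    TensorProduct.map_add_right, TensorProduct.map_smul_left, TensorProduct.map_smul_right,
    smul_add, smul_smul]
  have h : ksign i j * ksign i j = 1 := by
    rcases zmod2_cases i with rfl | rfl <;> rcases zmod2_cases j with rfl | rfl <;> simp [ksign]
  have h' : ksign j i = ksign i j := by simp [ksign, and_comm]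
  rw [h, h', one_smul, add_comm j i]
  abel

/-- The tensor product of two graded representations. -/
def tens (R : SuperRep g V) (S : SuperRep g W) : SuperRep g (V ⊗[ℂ] W) where
  ρ := Env.lift (tensAct R S) fun _ _ _ hx _ hy => tensAct_mul R S hx hy
  σ := TensorProduct.map R.σ S.σ
  σ_σ := by rw [← TensorProduct.map_mul, R.σ_σ, S.σ_σ, TensorProduct.map_one]
  σ_ρ u := by
    induction u using Env.induction with
    | hι i x hx =>
      rw [Env.par_ι hx, map_smul, Env.lift_ι, tensAct_apply R S hx, mul_add, smul_mul_assoc,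
        add_mul, ← TensorProduct.map_mul, ← TensorProduct.map_mul, ← TensorProduct.map_mul,
        ← TensorProduct.map_mul]
      have h1 := R.σ_act 1 hx
      have h2 := S.σ_act 1 hx
      have h3 : R.σ * parPow R.σ i = parPow R.σ i * R.σ := by
        rcases zmod2_cases i with rfl | rfl <;> simp [parPow]
      have h4 : ksign 1 i = ksign i 1 := by simp [ksign, and_comm]
      simp only [parPow, one_ne_zero, if_false] at h1 h2
      rw [h1, h2, h3, h4, mul_one, one_mul, TensorProduct.map_smul_left,
        TensorProduct.map_smul_right, smul_add]
    | hc c =>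
      rw [AlgHom.commutes, AlgHom.commutes, AlgHom.commutes]
      exact (Algebra.commutes c _).symm
    | hadd u v hu hv => rw [map_add, map_add, map_add, mul_add, add_mul, hu, hv]
    | hmul u v hu hv => rw [map_mul, map_mul, map_mul, ← mul_assoc, hu, mul_assoc, hv, mul_assoc]

theorem tens_act (R : SuperRep g V) (S : SuperRep g W) (x : g) :
    (R.tens S).act x = tensAct R S x :=
  Env.lift_ι (tensAct R S) (fun _ _ _ hx _ hy => tensAct_mul R S hx hy) x

/-- A linear map that commutes with the action of `g` commutes with that of `U(g)`. -/
theorem equivariant {R : SuperRep g V} {S : SuperRep g W} {f : V →ₗ[ℂ] W}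
    (h : ∀ i, ∀ x ∈ gr (g := g) i, f ∘ₗ R.act x = S.act x ∘ₗ f) (u : Env g) :
    f ∘ₗ R.ρ u = S.ρ u ∘ₗ f := by
  induction u using Env.induction with
  | hι i x hx => exact h i x hx
  | hc c =>
    rw [AlgHom.commutes, AlgHom.commutes]
    ext v
    simp
  | hadd u v hu hv => rw [map_add, map_add, LinearMap.comp_add, LinearMap.add_comp, hu, hv]
  | hmul u v hu hv =>
    rw [map_mul, map_mul, Module.End.mul_eq_comp, Module.End.mul_eq_comp, ← LinearMap.comp_assoc,
      hu, LinearMap.comp_assoc, hv, LinearMap.comp_assoc]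

/-- The map `u ↦ u v`. -/
def orbit (R : SuperRep g V) (v : V) : Env g →ₗ[ℂ] V := R.ρ.toLinearMap.flip v

theorem orbit_apply (R : SuperRep g V) (v : V) (u : Env g) : R.orbit v u = R.ρ u v := rfl

theorem comp_orbit {R : SuperRep g V} {S : SuperRep g W} {f : V →ₗ[ℂ] W}
    (h : ∀ i, ∀ x ∈ gr (g := g) i, f ∘ₗ R.act x = S.act x ∘ₗ f) (v : V) :
    f ∘ₗ R.orbit v = S.orbit (f v) := by
  ext u
  exact congrArg (fun k : V →ₗ[ℂ] W => k v) (equivariant h u)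

/-- Maps that respect the actions and, on the left factor, the parity, induce an equivariant map
of tensor products. -/
theorem map_equivariant {R : SuperRep g V} {S : SuperRep g W} {R' : SuperRep g V'}
    {S' : SuperRep g W'} {f : V →ₗ[ℂ] V'} {k : W →ₗ[ℂ] W'}
    (hf : ∀ i, ∀ x ∈ gr (g := g) i, f ∘ₗ R.act x = R'.act x ∘ₗ f) (hσ : f ∘ₗ R.σ = R'.σ ∘ₗ f)
    (hk : ∀ i, ∀ x ∈ gr (g := g) i, k ∘ₗ S.act x = S'.act x ∘ₗ k) :
    ∀ i, ∀ x ∈ gr (g := g) i, TensorProduct.map f k ∘ₗ (R.tens S).act x =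
      (R'.tens S').act x ∘ₗ TensorProduct.map f k := by
  intro i x hx
  have hp : f ∘ₗ parPow R.σ i = parPow R'.σ i ∘ₗ f := by
    rcases zmod2_cases i with rfl | rfl
    · simp [parPow, Module.End.one_eq_id]
    · simpa [parPow] using hσ
  rw [tens_act, tens_act, tensAct_apply R S hx, tensAct_apply R' S' hx, LinearMap.comp_add,
    LinearMap.add_comp, ← TensorProduct.map_comp, ← TensorProduct.map_comp,
    ← TensorProduct.map_comp, ← TensorProduct.map_comp, hf i x hx, hk i x hx, hp]
  rfl

variable (g) in
/-- The regular representation of `g` on `U(g)`. -/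
def reg : SuperRep g (Env g) where
  ρ := Algebra.lmul ℂ (Env g)
  σ := (Env.par g).toLinearMap
  σ_σ := LinearMap.ext fun u => Env.par_par u
  σ_ρ u := LinearMap.ext fun v => map_mul (Env.par g) u v

variable (g) in
/-- The trivial representation. -/
def triv : SuperRep g ℂ where
  ρ := Env.lift 0 (by simp)
  σ := 1
  σ_σ := one_mul 1
  σ_ρ u := by
    induction u using Env.induction with
    | hι i x hx => rw [Env.par_ι hx, map_smul, Env.lift_ι]; simp
    | hc c => rw [AlgHom.commutes (Env.par g), one_mul, mul_one]
    | hadd u v hu hv => rw [map_add, map_add, map_add, mul_add, add_mul, hu, hv]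
    | hmul u v hu hv => rw [map_mul, map_mul, map_mul, ← mul_assoc, hu, mul_assoc, hv, mul_assoc]

theorem triv_act (x : g) : (triv g).act x = 0 := Env.lift_ι 0 (by simp) x

variable (g) in
/-- The coproduct of `U(g)`, `Δ(u) = u (1 ⊗ 1)`. -/
def comul : Env g →ₗ[ℂ] Env g ⊗[ℂ] Env g := ((reg g).tens (reg g)).orbit (1 ⊗ₜ 1)

variable (g) in
/-- The counit of `U(g)`. -/
def counit : Env g →ₗ[ℂ] ℂ := (triv g).orbit 1

theorem orbit_equivariant (R : SuperRep g V) (v : V) (x : g) :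
    R.orbit v ∘ₗ (reg g).act x = R.act x ∘ₗ R.orbit v := by
  ext u
  exact congrArg (fun k : Module.End ℂ V => k v) (map_mul R.ρ (Env.ι g x) u)

theorem orbit_σ (R : SuperRep g V) {v : V} (hv : R.σ v = v) :
    R.orbit v ∘ₗ (reg g).σ = R.σ ∘ₗ R.orbit v := by
  ext u
  have := congrArg (fun k : Module.End ℂ V => k v) (R.σ_ρ u)
  simp only [Module.End.mul_apply, hv] at this
  exact this.symm

theorem reg_orbit (u : Env g) : (reg g).orbit u = (Algebra.lmul ℂ (Env g)).toLinearMap.flip u := rfl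

/-- The orbit map of `v ⊗ w` in a tensor product factors through the coproduct. -/
theorem orbit_tens (R : SuperRep g V) (S : SuperRep g W) {v : V} (hv : R.σ v = v) (w : W) :
    (R.tens S).orbit (v ⊗ₜ w) = TensorProduct.map (R.orbit v) (S.orbit w) ∘ₗ comul g := by
  rw [comul, comp_orbit (map_equivariant (fun _ x _ => R.orbit_equivariant v x) (R.orbit_σ hv)
    (fun _ x _ => S.orbit_equivariant w x))]
  simp [orbit_apply]

theorem tens_σ_one : ((reg g).tens (reg g)).σ ((1 : Env g) ⊗ₜ (1 : Env g)) = 1 ⊗ₜ 1 := by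
  change ((Env.par g) 1) ⊗ₜ ((Env.par g) 1) = _
  rw [map_one]

theorem assoc_equivariant (R : SuperRep g V) (S : SuperRep g W) (T : SuperRep g X) :
    ∀ i, ∀ x ∈ gr (g := g) i,
      (TensorProduct.assoc ℂ V W X).toLinearMap ∘ₗ ((R.tens S).tens T).act x =
      (R.tens (S.tens T)).act x ∘ₗ (TensorProduct.assoc ℂ V W X).toLinearMap := by
  intro i x hx
  have hp : parPow (R.tens S).σ i = TensorProduct.map (parPow R.σ i) (parPow S.σ i) := by
    rcases zmod2_cases i with rfl | rfl
    · simp [parPow]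
    · simp [parPow, tens]
  rw [tens_act, tens_act, tensAct_apply _ _ hx, tensAct_apply _ _ hx, tens_act, tens_act,
    tensAct_apply _ _ hx, tensAct_apply _ _ hx, hp]
  ext v w y
  simp [add_assoc, TensorProduct.add_tmul, TensorProduct.tmul_add]

theorem coassoc : (TensorProduct.assoc ℂ (Env g) (Env g) (Env g)).toLinearMap ∘ₗ
    TensorProduct.map (comul g) .id ∘ₗ comul g = TensorProduct.map .id (comul g) ∘ₗ comul g := by
  have h1 := orbit_tens ((reg g).tens (reg g)) (reg g) tens_σ_one 1
  have h2 := orbit_tens (reg g) ((reg g).tens (reg g)) (map_one (Env.par g)) (1 ⊗ₜ 1)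
  have h3 : (reg g).orbit 1 = .id := by ext u; exact mul_one u
  rw [h3] at h1 h2
  change _ = TensorProduct.map .id (comul g) ∘ₗ comul g at h2
  change _ = TensorProduct.map (comul g) .id ∘ₗ comul g at h1
  rw [← h1, ← h2, comp_orbit (assoc_equivariant _ _ _)]
  simp

theorem counit_left : (TensorProduct.lid ℂ (Env g)).toLinearMap ∘ₗ
    TensorProduct.map (counit g) .id ∘ₗ comul g = .id := by
  have h3 : (reg g).orbit 1 = .id := by ext u; exact mul_one u
  have h1 := orbit_tens (triv g) (reg g) (v := 1) rfl 1
  rw [h3] at h1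
  change _ = TensorProduct.map (counit g) .id ∘ₗ comul g at h1
  rw [← h1, comp_orbit (S := reg g)]
  · simpa using h3
  · intro i x hx
    rw [tens_act, tensAct_apply _ _ hx, triv_act]
    have hp : parPow (triv g).σ i = 1 := by
      rcases zmod2_cases i with rfl | rfl <;> simp [parPow, triv]
    rw [hp]
    ext u
    simp

theorem counit_right : (TensorProduct.rid ℂ (Env g)).toLinearMap ∘ₗ
    TensorProduct.map .id (counit g) ∘ₗ comul g = .id := by
  have h3 : (reg g).orbit 1 = .id := by ext u; exact mul_one u
  have h1 := orbit_tens (reg g) (triv g) (map_one (Env.par g)) (1 : ℂ)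
  rw [h3] at h1
  change _ = TensorProduct.map .id (counit g) ∘ₗ comul g at h1
  rw [← h1, comp_orbit (S := reg g)]
  · simpa using h3
  · intro i x hx
    rw [tens_act, tensAct_apply _ _ hx, triv_act]
    ext u
    simp

/-- The braiding `v ⊗ w ↦ (-1)^{|v||w|} w ⊗ v`. -/
def braid (R : SuperRep g V) (S : SuperRep g W) : V ⊗[ℂ] W →ₗ[ℂ] W ⊗[ℂ] V :=
  (1 / 2 : ℂ) • ((TensorProduct.comm ℂ V W).toLinearMap ∘ₗ
    (1 + TensorProduct.map R.σ 1 + TensorProduct.map 1 S.σ - TensorProduct.map R.σ S.σ))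

theorem σ_σ_apply (R : SuperRep g V) (v : V) : R.σ (R.σ v) = v :=
  congrArg (fun k : Module.End ℂ V => k v) R.σ_σ

theorem braid_equivariant (R : SuperRep g V) (S : SuperRep g W) :
    ∀ i, ∀ x ∈ gr (g := g) i,
      braid R S ∘ₗ (R.tens S).act x = (S.tens R).act x ∘ₗ braid R S := by
  intro i x hx
  rw [tens_act, tens_act, tensAct_apply _ _ hx, tensAct_apply _ _ hx]
  have h1 := R.σ_act 1 hx
  have h2 := S.σ_act 1 hx
  simp only [parPow, one_ne_zero, if_false] at h1 h2
  have k1 : ∀ v, R.σ (R.act x v) = ksign i 1 • R.act x (R.σ v) := fun v =>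
    congrArg (fun k : Module.End ℂ V => k v) h1
  have k2 : ∀ v, S.σ (S.act x v) = ksign i 1 • S.act x (S.σ v) := fun v =>
    congrArg (fun k : Module.End ℂ W => k v) h2
  ext v w
  rcases zmod2_cases i with rfl | rfl
  · simp [braid, parPow, k1, k2, ksign, TensorProduct.add_tmul, TensorProduct.tmul_add]
    module
  · simp [braid, parPow, k1, k2, ksign, TensorProduct.add_tmul, TensorProduct.tmul_add,
      σ_σ_apply, TensorProduct.neg_tmul, TensorProduct.tmul_neg]
    module

theorem braid_comul : braid (reg g) (reg g) ∘ₗ comul g = comul g := by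
  rw [comul, comp_orbit (braid_equivariant _ _)]
  congr 1
  have : (reg g).σ 1 = 1 := map_one (Env.par g)
  simp [braid, this]
  module

end SuperRep

/-! ### Highest weight modules -/

section parity

variable {g : Type} [AddCommGroup g] [Module ℂ g] [LieSuperalgebra g]
variable {V : Type} [AddCommGroup V] [Module ℂ V] [Module (Env g) V] [IsScalarTower ℂ (Env g) V]

variable (g V) in
/-- A parity on a `U(g)`-module, that is, a `ℤ/2`-grading compatible with the action. -/
structure Parity where
  σ : V →ₗ[ℂ] V
  σ_σ : ∀ v, σ (σ v) = v
  σ_smul : ∀ (u : Env g) (v : V), σ (u • v) = Env.par g u • σ v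

namespace Parity

/-- The graded representation defined by a `U(g)`-module with a parity. -/
def rep (p : Parity g V) : SuperRep g V where
  ρ := Algebra.lsmul ℂ ℂ V
  σ := p.σ
  σ_σ := LinearMap.ext p.σ_σ
  σ_ρ u := LinearMap.ext (p.σ_smul u)

theorem rep_ρ (p : Parity g V) (u : Env g) (v : V) : p.rep.ρ u v = u • v := rfl

theorem rep_act (p : Parity g V) (x : g) (v : V) : p.rep.act x v = Env.ι g x • v := rfl

/-- The parity of a quotient by a graded submodule. -/
def quot (p : Parity g V) (N : Submodule (Env g) V) (hN : ∀ v ∈ N, p.σ v ∈ N) :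
    Parity g (V ⧸ N) where
  σ :=
    { toFun := Quotient.map' p.σ fun v w h => by
        rw [Submodule.quotientRel_def] at h ⊢
        rw [← map_sub]
        exact hN _ h
      map_add' := by
        rintro ⟨v⟩ ⟨w⟩
        exact congrArg (Submodule.Quotient.mk (p := N)) (map_add p.σ v w)
      map_smul' := by
        rintro c ⟨v⟩
        exact congrArg (Submodule.Quotient.mk (p := N)) (map_smul p.σ c v) }
  σ_σ := by
    rintro ⟨v⟩
    exact congrArg (Submodule.Quotient.mk (p := N)) (p.σ_σ v)
  σ_smul := by
    rintro u ⟨v⟩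
    exact congrArg (Submodule.Quotient.mk (p := N)) (p.σ_smul u v)

theorem quot_mk (p : Parity g V) (N : Submodule (Env g) V) (hN : ∀ v ∈ N, p.σ v ∈ N) (v : V) :
    (p.quot N hN).σ (Submodule.Quotient.mk v) = Submodule.Quotient.mk (p.σ v) := rfl

variable (g) in
/-- The parity of `U(g)`. -/
def env : Parity g (Env g) where
  σ := (Env.par g).toLinearMap
  σ_σ := Env.par_par
  σ_smul u v := map_mul (Env.par g) u v

/-- The preimage of a submodule under the parity map. -/
def preimage (p : Parity g V) (N : Submodule (Env g) V) : Submodule (Env g) V where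
  carrier := {v | p.σ v ∈ N}
  add_mem' hv hw := by
    simp only [Set.mem_ofPred_eq] at *
    rw [map_add]; exact N.add_mem hv hw
  zero_mem' := by simp
  smul_mem' u v hv := by
    simp only [Set.mem_ofPred_eq] at *
    rw [p.σ_smul]; exact N.smul_mem _ hv

end Parity

/-- A submodule is cofinite if it contains the kernel of a map to a finite-dimensional space. -/
theorem cofinite_of {W : Type} [AddCommGroup W] [Module ℂ W] [FiniteDimensional ℂ W]
    (N : Submodule (Env g) V) (f : V →ₗ[ℂ] W) (h : ∀ v, f v = 0 → v ∈ N) :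
    FiniteDimensional ℂ (V ⧸ N) := by
  have h1 : FiniteDimensional ℂ (V ⧸ LinearMap.ker f) :=
    Module.Finite.equiv f.quotKerEquivRange.symm
  let k : (V ⧸ LinearMap.ker f) →ₗ[ℂ] (V ⧸ N) :=
    (LinearMap.ker f).liftQ (N.mkQ.restrictScalars ℂ) fun v hv =>
      (Submodule.Quotient.mk_eq_zero N).mpr (h v hv)
  refine Module.Finite.of_surjective k ?_
  rintro ⟨v⟩
  exact ⟨Submodule.Quotient.mk v, rfl⟩

theorem cofinite_inf {N N' : Submodule (Env g) V} (h : FiniteDimensional ℂ (V ⧸ N))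
    (h' : FiniteDimensional ℂ (V ⧸ N')) : FiniteDimensional ℂ (V ⧸ (N ⊓ N')) :=
  cofinite_of _ ((N.mkQ.restrictScalars ℂ).prod (N'.mkQ.restrictScalars ℂ)) fun v hv => by
    have h1 := congrArg Prod.fst hv
    have h2 := congrArg Prod.snd hv
    exact ⟨(Submodule.Quotient.mk_eq_zero N).mp h1, (Submodule.Quotient.mk_eq_zero N').mp h2⟩

theorem cofinite_preimage (p : Parity g V) {N : Submodule (Env g) V}
    (h : FiniteDimensional ℂ (V ⧸ N)) : FiniteDimensional ℂ (V ⧸ p.preimage N) :=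
  cofinite_of _ ((N.mkQ.restrictScalars ℂ) ∘ₗ p.σ) fun _ hv =>
    (Submodule.Quotient.mk_eq_zero N).mp hv

end parity

section highest

variable {g : Type} [AddCommGroup g] [Module ℂ g] [LieSuperalgebra g]

/-- The left ideal of `U(g)` generated by `𝔫⁺` and by `h - μ(h)` for `h ∈ 𝔥`. -/
def vermaIdeal (b : Borel g) (μ : Module.Dual ℂ b.H) : Submodule (Env g) (Env g) :=
  Submodule.span (Env g) ({u | ∃ x ∈ b.nPos, u = Env.ι g x} ∪
    {u | ∃ h : b.H, u = Env.ι g h.1 - algebraMap ℂ (Env g) (μ h)})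

/-- The Verma module `M_𝔟(μ) = U(g) ⊗_{U(𝔟)} ℂ_μ`, as the quotient of `U(g)` by the left ideal
generated by `𝔫⁺` and by `h - μ(h)` for `h ∈ 𝔥`. -/
abbrev Verma (b : Borel g) (μ : Module.Dual ℂ b.H) : Type := Env g ⧸ vermaIdeal b μ

/-- The simple quotient `L_𝔟(μ)` of the Verma module. -/
abbrev SimpleQuot (b : Borel g) (μ : Module.Dual ℂ b.H) : Type :=
  Verma b μ ⧸ sSup {N : Submodule (Env g) (Verma b μ) | N ≠ ⊤}

/-- `μ` is dominant integral if `L_𝔟(μ)` is finite-dimensional. -/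
def IsDominantIntegral (b : Borel g) (μ : Module.Dual ℂ b.H) : Prop :=
  FiniteDimensional ℂ (SimpleQuot b μ)

/-- The intersection of all submodules of finite codimension of the Verma module. -/
def kIdeal (b : Borel g) (μ : Module.Dual ℂ b.H) : Submodule (Env g) (Verma b μ) :=
  sInf {N : Submodule (Env g) (Verma b μ) | FiniteDimensional ℂ (Verma b μ ⧸ N)}

/-- The maximal finite-dimensional quotient `K_𝔟(μ)` of the Verma module. -/
abbrev KMod (b : Borel g) (μ : Module.Dual ℂ b.H) : Type := Verma b μ ⧸ kIdeal b μ

/-- The highest weight vector `v_μ` of `K_𝔟(μ)`. -/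
def KMod.v (b : Borel g) (μ : Module.Dual ℂ b.H) : KMod b μ :=
  Submodule.Quotient.mk (Submodule.Quotient.mk 1)

variable (b : Borel g) (μ : Module.Dual ℂ b.H)

theorem par_mem_vermaIdeal (u : Env g) (hu : u ∈ vermaIdeal b μ) :
    (Parity.env g).σ u ∈ vermaIdeal b μ := by
  have h : vermaIdeal b μ ≤ (Parity.env g).preimage (vermaIdeal b μ) := by
    refine Submodule.span_le.mpr ?_
    rintro _ (⟨x, hx, rfl⟩ | ⟨h, rfl⟩)
    · refine Submodule.subset_span (Or.inl ⟨par g x, b.par_mem_nPos hx, ?_⟩)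
      exact Env.par_ι' x
    · refine Submodule.subset_span (Or.inr ⟨h, ?_⟩)
      change Env.par g _ = _
      rw [map_sub, AlgHom.commutes, Env.par_ι (b.isCartan.le_even h.2)]
      simp [ksign]
  exact h hu

/-- The parity of the Verma module; the highest weight vector is even. -/
def vermaParity : Parity g (Verma b μ) := (Parity.env g).quot _ (par_mem_vermaIdeal b μ)

theorem par_mem_kIdeal (m : Verma b μ) (hm : m ∈ kIdeal b μ) :
    (vermaParity b μ).σ m ∈ kIdeal b μ := by
  rw [kIdeal, Submodule.mem_sInf] at *
  intro N hN
  exact hm _ (cofinite_preimage (vermaParity b μ) hN)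

/-- The parity of `K_𝔟(μ)`. -/
def kParity : Parity g (KMod b μ) := (vermaParity b μ).quot _ (par_mem_kIdeal b μ)

/-- `K_𝔟(μ)` as a graded representation. -/
def kRep : SuperRep g (KMod b μ) := (kParity b μ).rep

/-- `v` is an even highest weight vector of weight `μ`. -/
structure IsHighest {V : Type} [AddCommGroup V] [Module ℂ V] (R : SuperRep g V) (v : V) : Prop where
  even : R.σ v = v
  nPos : ∀ x ∈ b.nPos, R.act x v = 0
  weight : ∀ h : b.H, R.act h.1 v = μ h • v

/-- `V` with the structure of a `U(g)`-module defined by a representation. -/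
def SuperRep.Space {V : Type} [AddCommGroup V] [Module ℂ V] (_ : SuperRep g V) : Type := V

instance {V : Type} [AddCommGroup V] [Module ℂ V] (R : SuperRep g V) : AddCommGroup R.Space :=
  inferInstanceAs (AddCommGroup V)
instance {V : Type} [AddCommGroup V] [Module ℂ V] (R : SuperRep g V) : Module ℂ R.Space :=
  inferInstanceAs (Module ℂ V)
instance {V : Type} [AddCommGroup V] [Module ℂ V] (R : SuperRep g V) : Module (Env g) R.Space :=
  Module.compHom V R.ρ.toRingHom
instance {V : Type} [AddCommGroup V] [Module ℂ V] (R : SuperRep g V) :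
    IsScalarTower ℂ (Env g) R.Space where
  smul_assoc c u (v : V) := by
    change R.ρ (c • u) v = c • R.ρ u v
    rw [map_smul, LinearMap.smul_apply]

variable {b μ}

/-- The map from the Verma module defined by a highest weight vector. -/
def vermaLift {V : Type} [AddCommGroup V] [Module ℂ V] {R : SuperRep g V} {v : V}
    (hv : IsHighest b μ R v) : Verma b μ →ₗ[Env g] R.Space :=
  (vermaIdeal b μ).liftQ (LinearMap.toSpanSingleton (Env g) R.Space v) (by
    refine Submodule.span_le.mpr ?_
    rintro _ (⟨x, hx, rfl⟩ | ⟨h, rfl⟩)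
    · exact hv.nPos x hx
    · change R.ρ (_ - _) v = 0
      rw [map_sub, LinearMap.sub_apply, sub_eq_zero, AlgHom.commutes]
      exact hv.weight h)

theorem vermaLift_mk {V : Type} [AddCommGroup V] [Module ℂ V] {R : SuperRep g V} {v : V}
    (hv : IsHighest b μ R v) (u : Env g) :
    vermaLift hv (Submodule.Quotient.mk u) = R.orbit v u := rfl

theorem IsHighest.tens {ν : Module.Dual ℂ b.H} {V W : Type} [AddCommGroup V] [Module ℂ V]
    [AddCommGroup W] [Module ℂ W] {R : SuperRep g V} {S : SuperRep g W} {v : V} {w : W}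
    (hv : IsHighest b μ R v) (hw : IsHighest b ν S w) :
    IsHighest b (μ + ν) (R.tens S) (v ⊗ₜ w) where
  even := by
    change TensorProduct.map R.σ S.σ (v ⊗ₜ w) = _
    rw [TensorProduct.map_tmul, hv.even, hw.even]
  nPos x hx := by
    rw [SuperRep.tens_act]
    simp [SuperRep.tensAct, hv.nPos x hx, hw.nPos _ (b.even_mem_nPos hx),
      hw.nPos _ (b.odd_mem_nPos hx)]
  weight h := by
    rw [SuperRep.tens_act, SuperRep.tensAct_apply R S (b.isCartan.le_even h.2)]
    simp [hv.weight, hw.weight, parPow, add_smul, TensorProduct.smul_tmul]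

/-- The image of the highest weight vector in a graded quotient of the Verma module. -/
theorem isHighest_quot (N : Submodule (Env g) (Verma b μ))
    (hN : ∀ m ∈ N, (vermaParity b μ).σ m ∈ N) :
    IsHighest b μ ((vermaParity b μ).quot N hN).rep
      (Submodule.Quotient.mk (Submodule.Quotient.mk 1)) where
  even := congrArg (fun u : Env g => (Submodule.Quotient.mk (Submodule.Quotient.mk u :
    Verma b μ) : Verma b μ ⧸ N)) (map_one (Env.par g))
  nPos x hx := by
    have h : (Submodule.Quotient.mk (Env.ι g x * 1) : Verma b μ) = 0 := by
      rw [Submodule.Quotient.mk_eq_zero, mul_one]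
      exact Submodule.subset_span (Or.inl ⟨x, hx, rfl⟩)
    exact (congrArg (Submodule.Quotient.mk (p := N)) h).trans (Submodule.Quotient.mk_zero N)
  weight h := by
    have h : (Submodule.Quotient.mk (Env.ι g h.1 * 1) : Verma b μ) =
        Submodule.Quotient.mk (μ h • 1) := by
      rw [Submodule.Quotient.eq, mul_one, ← Algebra.algebraMap_eq_smul_one]
      exact Submodule.subset_span (Or.inr ⟨h, rfl⟩)
    exact congrArg (Submodule.Quotient.mk (p := N)) h

theorem isHighest_v : IsHighest b μ (kRep b μ) (KMod.v b μ) :=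
  isHighest_quot (kIdeal b μ) (par_mem_kIdeal b μ)

end highest

section cartan

variable {g : Type} [AddCommGroup g] [Module ℂ g] [LieSuperalgebra g] {b : Borel g}
  {μ ν : Module.Dual ℂ b.H}

/-- The projection from `K_𝔟(μ)` to a smaller quotient of the Verma module. -/
def kFactor (N : Submodule (Env g) (Verma b μ)) (h : kIdeal b μ ≤ N) :
    KMod b μ →ₗ[ℂ] Verma b μ ⧸ N :=
  ((kIdeal b μ).mapQ N LinearMap.id h).restrictScalars ℂ

theorem kFactor_mk (N : Submodule (Env g) (Verma b μ)) (h : kIdeal b μ ≤ N) (m : Verma b μ) :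
    kFactor N h (Submodule.Quotient.mk m) = Submodule.Quotient.mk m := rfl

theorem kIdeal_le {N : Submodule (Env g) (Verma b μ)} (h : FiniteDimensional ℂ (Verma b μ ⧸ N)) :
    kIdeal b μ ≤ N := sInf_le h

/-- A finite-dimensional subspace of `K_𝔟(μ)` embeds into a graded finite-dimensional quotient of
the Verma module. -/
theorem exists_kFactor (V' : Submodule ℂ (KMod b μ)) [FiniteDimensional ℂ V'] :
    ∃ (N : Submodule (Env g) (Verma b μ)) (_ : ∀ m ∈ N, (vermaParity b μ).σ m ∈ N)
      (h : FiniteDimensional ℂ (Verma b μ ⧸ N)),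
      ∀ v ∈ V', kFactor N (kIdeal_le h) v = 0 → v = 0 := by
  let S : Set (Submodule ℂ V') := {A | ∃ (N : Submodule (Env g) (Verma b μ))
    (_ : ∀ m ∈ N, (vermaParity b μ).σ m ∈ N) (h : FiniteDimensional ℂ (Verma b μ ⧸ N)),
    A = (LinearMap.ker (kFactor N (kIdeal_le h))).comap V'.subtype}
  have hS : S.Nonempty := ⟨_, ⊤, fun _ _ => trivial, inferInstance, rfl⟩
  obtain ⟨A, ⟨N, hN, hfin, rfl⟩, hmin⟩ := IsArtinian.set_has_minimal S hS
  refine ⟨N, hN, hfin, fun v hv h0 => ?_⟩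
  by_contra hne
  obtain ⟨m, rfl⟩ := Submodule.Quotient.mk_surjective _ v
  rw [Submodule.Quotient.mk_eq_zero, kIdeal, Submodule.mem_sInf] at hne
  push Not at hne
  obtain ⟨N', hN', hm⟩ := hne
  let N'' := N ⊓ (N' ⊓ (vermaParity b μ).preimage N')
  have hfin'' : FiniteDimensional ℂ (Verma b μ ⧸ N'') :=
    cofinite_inf hfin (cofinite_inf hN' (cofinite_preimage _ hN'))
  have hgr : ∀ m ∈ N'', (vermaParity b μ).σ m ∈ N'' := fun m hm =>
    ⟨hN m hm.1, hm.2.2, show (vermaParity b μ).σ _ ∈ N' by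
      rw [(vermaParity b μ).σ_σ]; exact hm.2.1⟩
  refine hmin _ ⟨N'', hgr, hfin'', rfl⟩ (lt_of_le_not_ge ?_ ?_)
  · rintro ⟨x, hx⟩ hk
    obtain ⟨x, rfl⟩ := Submodule.Quotient.mk_surjective _ x
    have hk' : (Submodule.Quotient.mk x : Verma b μ ⧸ N'') = 0 := hk
    rw [Submodule.Quotient.mk_eq_zero] at hk'
    exact (Submodule.Quotient.mk_eq_zero N).mpr hk'.1
  · intro hle
    have hk : (Submodule.Quotient.mk m : Verma b μ ⧸ N'') = 0 :=
      hle (x := ⟨Submodule.Quotient.mk m, hv⟩) h0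
    rw [Submodule.Quotient.mk_eq_zero] at hk
    exact hm hk.2.1

theorem exists_injOn {V W : Type} [AddCommGroup V] [Module ℂ V] [AddCommGroup W] [Module ℂ W]
    (z : V ⊗[ℂ] W) : ∃ (V' : Submodule ℂ V) (W' : Submodule ℂ W) (_ : FiniteDimensional ℂ V')
      (_ : FiniteDimensional ℂ W'), ∀ (X Y : Type) [AddCommGroup X] [Module ℂ X] [AddCommGroup Y]
      [Module ℂ Y] (f : V →ₗ[ℂ] X) (k : W →ₗ[ℂ] Y), (∀ v ∈ V', f v = 0 → v = 0) →
      (∀ w ∈ W', k w = 0 → w = 0) → TensorProduct.map f k z = 0 → z = 0 := by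
  obtain ⟨V', W', h1, h2, h3⟩ := TensorProduct.exists_finite_submodule_of_setFinite {z}
    (Set.finite_singleton z)
  obtain ⟨z', rfl⟩ := h3 rfl
  refine ⟨V', W', h1, h2, ?_⟩
  intro X Y _ _ _ _ f k hf hk h0
  have hf' : Function.Injective (f ∘ₗ V'.subtype) := by
    rw [injective_iff_map_eq_zero]
    exact fun v hv => Subtype.ext (hf v.1 v.2 hv)
  have hk' : Function.Injective (k ∘ₗ W'.subtype) := by
    rw [injective_iff_map_eq_zero]
    exact fun v hv => Subtype.ext (hk v.1 v.2 hv)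
  have := TensorProduct.map_injective_of_flat_flat _ _ hf' hk'
  rw [injective_iff_map_eq_zero] at this
  have hz : z' = 0 := this z' (by rw [TensorProduct.map_comp]; exact h0)
  rw [hz, map_zero]

theorem kFactor_act (N : Submodule (Env g) (Verma b μ)) (h : kIdeal b μ ≤ N)
    (hN : ∀ m ∈ N, (vermaParity b μ).σ m ∈ N) (x : g) :
    kFactor N h ∘ₗ (kRep b μ).act x = ((vermaParity b μ).quot N hN).rep.act x ∘ₗ kFactor N h :=
  LinearMap.ext fun v => map_smul ((kIdeal b μ).mapQ N LinearMap.id h) (Env.ι g x) v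

theorem kFactor_σ (N : Submodule (Env g) (Verma b μ)) (h : kIdeal b μ ≤ N)
    (hN : ∀ m ∈ N, (vermaParity b μ).σ m ∈ N) :
    kFactor N h ∘ₗ (kRep b μ).σ = ((vermaParity b μ).quot N hN).rep.σ ∘ₗ kFactor N h :=
  LinearMap.ext fun v => by
    obtain ⟨v, rfl⟩ := Submodule.Quotient.mk_surjective _ v
    rfl

theorem kIdeal_le_ker : kIdeal b (μ + ν) ≤
    LinearMap.ker (vermaLift ((isHighest_v (b := b) (μ := μ)).tens (isHighest_v (μ := ν)))) := by
  intro m hm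
  obtain ⟨V', W', _, _, hz⟩ := exists_injOn
    (show KMod b μ ⊗[ℂ] KMod b ν from
      vermaLift ((isHighest_v (b := b) (μ := μ)).tens (isHighest_v (μ := ν))) m)
  obtain ⟨N, hN, hfin, hinj⟩ := exists_kFactor V'
  obtain ⟨N', hN', hfin', hinj'⟩ := exists_kFactor W'
  refine hz _ _ (kFactor N (kIdeal_le hfin)) (kFactor N' (kIdeal_le hfin')) hinj hinj' ?_
  have hq := (isHighest_quot N hN).tens (isHighest_quot N' hN')
  have hk : kIdeal b (μ + ν) ≤ LinearMap.ker (vermaLift hq) :=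
    kIdeal_le (cofinite_of (W := (Verma b μ ⧸ N) ⊗[ℂ] (Verma b ν ⧸ N')) _
      ((vermaLift hq).restrictScalars ℂ) fun _ h => h)
  have h0 := hk hm
  obtain ⟨u, rfl⟩ := Submodule.Quotient.mk_surjective _ m
  have key := SuperRep.comp_orbit (SuperRep.map_equivariant
    (R := kRep b μ) (S := kRep b ν) (R' := ((vermaParity b μ).quot N hN).rep)
    (S' := ((vermaParity b ν).quot N' hN').rep) (f := kFactor N (kIdeal_le hfin))
    (k := kFactor N' (kIdeal_le hfin'))
    (fun _ x _ => kFactor_act _ _ hN x) (kFactor_σ _ _ hN) (fun _ x _ => kFactor_act _ _ hN' x))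
    (KMod.v b μ ⊗ₜ KMod.v b ν)
  exact (congrArg (fun k : Env g →ₗ[ℂ] _ => k u) key).trans h0

/-- The Cartan map `K_𝔟(μ + ν) → K_𝔟(μ) ⊗ K_𝔟(ν)`: the map of `U(g)`-modules with
`v_{μ+ν} ↦ v_μ ⊗ v_ν`. -/
def cartanHom (b : Borel g) (μ ν : Module.Dual ℂ b.H) :
    KMod b (μ + ν) →ₗ[Env g] ((kRep b μ).tens (kRep b ν)).Space :=
  (kIdeal b (μ + ν)).liftQ (vermaLift (isHighest_v.tens isHighest_v)) kIdeal_le_ker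

/-- The Cartan map as a linear map; the equation `κ = μ + ν` is an argument so that it applies to
multiples of one weight. -/
def cartan (b : Borel g) (κ μ ν : Module.Dual ℂ b.H) (h : κ = μ + ν) :
    KMod b κ →ₗ[ℂ] KMod b μ ⊗[ℂ] KMod b ν :=
  h ▸ ((cartanHom b μ ν).restrictScalars ℂ : KMod b (μ + ν) →ₗ[ℂ] KMod b μ ⊗[ℂ] KMod b ν)

/-- The map `U(g) → K_𝔟(μ)`, `u ↦ u v_μ`. -/
def kOrbit (b : Borel g) (μ : Module.Dual ℂ b.H) : Env g →ₗ[ℂ] KMod b μ :=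
  (kRep b μ).orbit (KMod.v b μ)

theorem kOrbit_apply (u : Env g) : kOrbit b μ u = u • KMod.v b μ := rfl

theorem kOrbit_eq (u : Env g) :
    kOrbit b μ u = Submodule.Quotient.mk (Submodule.Quotient.mk u) :=
  congrArg (fun u : Env g => (Submodule.Quotient.mk (Submodule.Quotient.mk u :
    Verma b μ) : KMod b μ)) (mul_one u)

theorem kOrbit_surjective : Function.Surjective (kOrbit b μ) := by
  intro v
  obtain ⟨m, rfl⟩ := Submodule.Quotient.mk_surjective _ v
  obtain ⟨u, rfl⟩ := Submodule.Quotient.mk_surjective _ m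
  exact ⟨u, kOrbit_eq u⟩

theorem cartan_kOrbit (κ : Module.Dual ℂ b.H) (h : κ = μ + ν) :
    cartan b κ μ ν h ∘ₗ kOrbit b κ =
      TensorProduct.map (kOrbit b μ) (kOrbit b ν) ∘ₗ SuperRep.comul g := by
  subst h
  change _ = TensorProduct.map ((kRep b μ).orbit (KMod.v b μ))
    ((kRep b ν).orbit (KMod.v b ν)) ∘ₗ _
  rw [← SuperRep.orbit_tens _ _ isHighest_v.even]
  ext u
  change cartan b _ μ ν rfl (kOrbit b (μ + ν) u) = _
  rw [kOrbit_eq]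
  rfl

end cartan

/-! ### The superalgebra `R(λ)` -/

section conv

variable {g : Type} [AddCommGroup g] [Module ℂ g] [LieSuperalgebra g]

/-- The product of functionals on `U(g)` that is dual to the coproduct, in the order
`(φ ψ)(u) = ∑ ψ(u₁) φ(u₂)`. -/
def conv (φ ψ : Env g →ₗ[ℂ] ℂ) : Env g →ₗ[ℂ] ℂ :=
  LinearMap.mul' ℂ ℂ ∘ₗ TensorProduct.map ψ φ ∘ₗ SuperRep.comul g

theorem conv_assoc (φ ψ χ : Env g →ₗ[ℂ] ℂ) : conv (conv φ ψ) χ = conv φ (conv ψ χ) := by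
  have e1 : TensorProduct.map χ (conv φ ψ) =
      TensorProduct.map χ (LinearMap.mul' ℂ ℂ ∘ₗ TensorProduct.map ψ φ) ∘ₗ
        TensorProduct.map .id (SuperRep.comul g) := by
    rw [← TensorProduct.map_comp]; rfl
  have e2 : TensorProduct.map (conv ψ χ) φ =
      TensorProduct.map (LinearMap.mul' ℂ ℂ ∘ₗ TensorProduct.map χ ψ) φ ∘ₗ
        TensorProduct.map (SuperRep.comul g) .id := by
    rw [← TensorProduct.map_comp]; rfl
  have e3 : LinearMap.mul' ℂ ℂ ∘ₗ
      TensorProduct.map χ (LinearMap.mul' ℂ ℂ ∘ₗ TensorProduct.map ψ φ) ∘ₗ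
        (TensorProduct.assoc ℂ (Env g) (Env g) (Env g)).toLinearMap =
      LinearMap.mul' ℂ ℂ ∘ₗ
        TensorProduct.map (LinearMap.mul' ℂ ℂ ∘ₗ TensorProduct.map χ ψ) φ := by
    ext u v w
    simp [mul_assoc]
  have e4 := congrArg (fun k => LinearMap.mul' ℂ ℂ ∘ₗ
    TensorProduct.map χ (LinearMap.mul' ℂ ℂ ∘ₗ TensorProduct.map ψ φ) ∘ₗ k)
    (SuperRep.coassoc (g := g))
  have e5 := congrArg (fun k => k ∘ₗ TensorProduct.map (SuperRep.comul g) .id ∘ₗ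
    SuperRep.comul g) e3
  simp only [LinearMap.comp_assoc] at e4 e5
  rw [conv, e1, conv, e2]
  simp only [LinearMap.comp_assoc]
  rw [← e4, ← e5]

theorem conv_counit (φ : Env g →ₗ[ℂ] ℂ) : conv φ (SuperRep.counit g) = φ := by
  have e : LinearMap.mul' ℂ ℂ ∘ₗ TensorProduct.map (SuperRep.counit g) φ =
      φ ∘ₗ (TensorProduct.lid ℂ (Env g)).toLinearMap ∘ₗ
        TensorProduct.map (SuperRep.counit g) .id := by
    ext u v
    simp
  rw [conv, ← LinearMap.comp_assoc, e, LinearMap.comp_assoc, LinearMap.comp_assoc,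
    SuperRep.counit_left, LinearMap.comp_id]

theorem counit_conv (φ : Env g →ₗ[ℂ] ℂ) : conv (SuperRep.counit g) φ = φ := by
  have e : LinearMap.mul' ℂ ℂ ∘ₗ TensorProduct.map φ (SuperRep.counit g) =
      φ ∘ₗ (TensorProduct.rid ℂ (Env g)).toLinearMap ∘ₗ
        TensorProduct.map .id (SuperRep.counit g) := by
    ext u v
    simp [mul_comm]
  rw [conv, ← LinearMap.comp_assoc, e, LinearMap.comp_assoc, LinearMap.comp_assoc,
    SuperRep.counit_right, LinearMap.comp_id]

theorem conv_par (φ ψ : Env g →ₗ[ℂ] ℂ) :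
    conv (φ ∘ₗ (Env.par g).toLinearMap) (ψ ∘ₗ (Env.par g).toLinearMap) =
      conv φ ψ ∘ₗ (Env.par g).toLinearMap := by
  have h : SuperRep.comul g ∘ₗ (Env.par g).toLinearMap =
      TensorProduct.map (Env.par g).toLinearMap (Env.par g).toLinearMap ∘ₗ SuperRep.comul g :=
    SuperRep.orbit_σ _ SuperRep.tens_σ_one
  rw [conv, conv, TensorProduct.map_comp, LinearMap.comp_assoc, LinearMap.comp_assoc,
    LinearMap.comp_assoc, h]

theorem conv_comm_even (φ ψ : Env g →ₗ[ℂ] ℂ) (h : φ ∘ₗ (Env.par g).toLinearMap = φ) :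
    conv φ ψ = conv ψ φ := by
  have h' : ∀ u, φ (Env.par g u) = φ u := fun u => congrArg (fun k : Env g →ₗ[ℂ] ℂ => k u) h
  have e : LinearMap.mul' ℂ ℂ ∘ₗ TensorProduct.map ψ φ ∘ₗ
      SuperRep.braid (SuperRep.reg g) (SuperRep.reg g) =
      LinearMap.mul' ℂ ℂ ∘ₗ TensorProduct.map φ ψ := by
    ext u v
    simp [SuperRep.braid, SuperRep.reg, h']
    ring
  rw [conv, ← SuperRep.braid_comul, conv, ← LinearMap.comp_assoc (SuperRep.comul g),
    ← LinearMap.comp_assoc (SuperRep.comul g), e, LinearMap.comp_assoc]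

theorem conv_comm_odd (φ ψ : Env g →ₗ[ℂ] ℂ) (h : φ ∘ₗ (Env.par g).toLinearMap = -φ)
    (k : ψ ∘ₗ (Env.par g).toLinearMap = -ψ) :
    conv φ ψ = -conv ψ φ := by
  have h' : ∀ u, φ (Env.par g u) = -φ u := fun u => congrArg (fun k : Env g →ₗ[ℂ] ℂ => k u) h
  have k' : ∀ u, ψ (Env.par g u) = -ψ u := fun u => congrArg (fun k : Env g →ₗ[ℂ] ℂ => k u) k
  have e : LinearMap.mul' ℂ ℂ ∘ₗ TensorProduct.map ψ φ ∘ₗ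
      SuperRep.braid (SuperRep.reg g) (SuperRep.reg g) =
      -(LinearMap.mul' ℂ ℂ ∘ₗ TensorProduct.map φ ψ) := by
    ext u v
    simp [SuperRep.braid, SuperRep.reg, h', k']
    ring
  rw [conv, ← SuperRep.braid_comul, conv, ← LinearMap.comp_assoc (SuperRep.comul g),
    ← LinearMap.comp_assoc (SuperRep.comul g), e, LinearMap.neg_comp, LinearMap.comp_assoc]

end conv

section ralg

variable {g : Type} [AddCommGroup g] [Module ℂ g] [LieSuperalgebra g]

/-- The component `K_𝔟(kλ)^*` of `R(λ)`. -/
def RPiece (b : Borel g) (l : Module.Dual ℂ b.H) (k : ℕ) : Type :=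
  Module.Dual ℂ (KMod b (k • l))

variable {b : Borel g} {l : Module.Dual ℂ b.H}

instance (k : ℕ) : AddCommGroup (RPiece b l k) :=
  inferInstanceAs (AddCommGroup (Module.Dual ℂ (KMod b (k • l))))
instance (k : ℕ) : Module ℂ (RPiece b l k) :=
  inferInstanceAs (Module ℂ (Module.Dual ℂ (KMod b (k • l))))

theorem dualDistrib_comp {V W V' W' : Type} [AddCommGroup V] [Module ℂ V] [AddCommGroup W]
    [Module ℂ W] [AddCommGroup V'] [Module ℂ V'] [AddCommGroup W'] [Module ℂ W']
    (ψ : Module.Dual ℂ V) (φ : Module.Dual ℂ W) (f : V' →ₗ[ℂ] V) (k : W' →ₗ[ℂ] W) :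
    TensorProduct.dualDistrib ℂ V W (ψ ⊗ₜ φ) ∘ₗ TensorProduct.map f k =
      LinearMap.mul' ℂ ℂ ∘ₗ TensorProduct.map (ψ ∘ₗ f) (φ ∘ₗ k) := by
  ext r s
  simp

namespace RPiece

/-- An element of `K_𝔟(kλ)^*` as a functional. -/
def toDual {k : ℕ} (φ : RPiece b l k) : Module.Dual ℂ (KMod b (k • l)) := φ

/-- A functional on `K_𝔟(kλ)` as an element of the component of degree `k`. -/
def ofDual {k : ℕ} (φ : Module.Dual ℂ (KMod b (k • l))) : RPiece b l k := φ

/-- The functional `u ↦ φ(u v_{kλ})` on `U(g)`. -/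
def pull {k : ℕ} : RPiece b l k →ₗ[ℂ] (Env g →ₗ[ℂ] ℂ) :=
  LinearMap.lcomp ℂ ℂ (kOrbit b (k • l))

theorem pull_apply {k : ℕ} (φ : RPiece b l k) : pull φ = φ.toDual ∘ₗ kOrbit b (k • l) := rfl

theorem toDual_ofDual {k : ℕ} (φ : Module.Dual ℂ (KMod b (k • l))) :
    (ofDual φ).toDual = φ := rfl

theorem pull_injective {k : ℕ} : Function.Injective (pull (b := b) (l := l) (k := k)) :=
  fun φ ψ h => LinearMap.ext fun v => by
    obtain ⟨u, rfl⟩ := kOrbit_surjective v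
    exact congrArg (fun k : Env g →ₗ[ℂ] ℂ => k u) h

theorem gext {i j : ℕ} (h : i = j) {φ : RPiece b l i} {ψ : RPiece b l j}
    (h' : pull φ = pull ψ) : GradedMonoid.mk i φ = GradedMonoid.mk j ψ := by
  subst h
  rw [pull_injective h']

/-- The product `K_𝔟(mλ)^* ⊗ K_𝔟(nλ)^* → (K_𝔟(nλ) ⊗ K_𝔟(mλ))^* → K_𝔟((m+n)λ)^*`, where the first map
is `φ ⊗ ψ ↦ (r ⊗ s ↦ ψ(r) φ(s))` and the second is dual to the Cartan map. -/
def mul {m n : ℕ} (φ : RPiece b l m) (ψ : RPiece b l n) : RPiece b l (m + n) :=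
  ofDual (TensorProduct.dualDistrib ℂ (KMod b (n • l)) (KMod b (m • l))
      (ψ.toDual ⊗ₜ φ.toDual) ∘ₗ
    cartan b ((m + n) • l) (n • l) (m • l) (by rw [add_comm, add_smul]))

theorem pull_mul {m n : ℕ} (φ : RPiece b l m) (ψ : RPiece b l n) :
    pull (mul φ ψ) = conv (pull φ) (pull ψ) := by
  rw [mul, pull_apply, toDual_ofDual, LinearMap.comp_assoc, cartan_kOrbit, ← LinearMap.comp_assoc,
    dualDistrib_comp]
  rfl

theorem isHighest_triv : IsHighest b (0 • l) (SuperRep.triv g) (1 : ℂ) where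
  even := rfl
  nPos x _ := by rw [SuperRep.triv_act]; rfl
  weight h := by rw [SuperRep.triv_act]; simp

/-- The unit: the functional `u v_0 ↦ ε(u)` on `K_𝔟(0)`. -/
def one : RPiece b l 0 :=
  ofDual <| ((kIdeal b (0 • l)).liftQ (vermaLift isHighest_triv)
    (kIdeal_le (cofinite_of (W := ℂ) _
      ((vermaLift (isHighest_triv (b := b) (l := l))).restrictScalars ℂ)
      fun _ h => h))).restrictScalars ℂ

theorem pull_one : pull (one (b := b) (l := l)) = SuperRep.counit g :=
  LinearMap.ext fun u => by
    change one.toDual (kOrbit b (0 • l) u) = _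
    rw [kOrbit_eq]
    rfl

/-- The parity on `K_𝔟(kλ)^*`. -/
def par {k : ℕ} : RPiece b l k →ₗ[ℂ] RPiece b l k :=
  LinearMap.lcomp ℂ ℂ (kRep b (k • l)).σ

theorem toDual_par {k : ℕ} (φ : RPiece b l k) :
    (par φ).toDual = φ.toDual ∘ₗ (kRep b (k • l)).σ := rfl

theorem pull_par {k : ℕ} (φ : RPiece b l k) :
    pull (par φ) = pull φ ∘ₗ (Env.par g).toLinearMap := by
  rw [pull_apply, pull_apply, toDual_par, LinearMap.comp_assoc, LinearMap.comp_assoc]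
  congr 1
  exact (SuperRep.orbit_σ (kRep b (k • l)) isHighest_v.even).symm

end RPiece

instance : GradedMonoid.GMul (RPiece b l) := ⟨RPiece.mul⟩
instance : GradedMonoid.GOne (RPiece b l) := ⟨RPiece.one⟩

theorem RPiece.pull_gmul {m n : ℕ} (φ : RPiece b l m) (ψ : RPiece b l n) :
    pull (GradedMonoid.GMul.mul φ ψ) = conv (pull φ) (pull ψ) := pull_mul φ ψ

theorem conv_add (φ ψ χ : Env g →ₗ[ℂ] ℂ) : conv φ (ψ + χ) = conv φ ψ + conv φ χ := by
  rw [conv, TensorProduct.map_add_left, LinearMap.add_comp, LinearMap.comp_add]; rfl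

theorem add_conv (φ ψ χ : Env g →ₗ[ℂ] ℂ) : conv (φ + ψ) χ = conv φ χ + conv ψ χ := by
  rw [conv, TensorProduct.map_add_right, LinearMap.add_comp, LinearMap.comp_add]; rfl

theorem smul_conv (c : ℂ) (φ ψ : Env g →ₗ[ℂ] ℂ) : conv (c • φ) ψ = c • conv φ ψ := by
  rw [conv, TensorProduct.map_smul_right, LinearMap.smul_comp, LinearMap.comp_smul]; rfl

theorem conv_smul (c : ℂ) (φ ψ : Env g →ₗ[ℂ] ℂ) : conv φ (c • ψ) = c • conv φ ψ := by
  rw [conv, TensorProduct.map_smul_left, LinearMap.smul_comp, LinearMap.comp_smul]; rfl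

theorem conv_zero (φ : Env g →ₗ[ℂ] ℂ) : conv φ 0 = 0 := by
  simpa using conv_smul 0 φ 0

theorem zero_conv (φ : Env g →ₗ[ℂ] ℂ) : conv 0 φ = 0 := by
  simpa using smul_conv 0 0 φ

open RPiece in
instance : DirectSum.GRing (RPiece b l) where
  mul_zero φ := pull_injective (by rw [pull_gmul, map_zero, map_zero, conv_zero])
  zero_mul φ := pull_injective (by rw [pull_gmul, map_zero, map_zero, zero_conv])
  mul_add φ ψ χ := pull_injective (by
    rw [pull_gmul, map_add, map_add, pull_gmul, pull_gmul, conv_add])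
  add_mul φ ψ χ := pull_injective (by
    rw [pull_gmul, map_add, map_add, pull_gmul, pull_gmul, add_conv])
  one_mul := fun ⟨_, φ⟩ => gext (zero_add _) (by
    change pull (RPiece.mul RPiece.one φ) = pull φ
    rw [pull_mul, pull_one, counit_conv])
  mul_one := fun ⟨_, φ⟩ => gext (add_zero _) (by
    change pull (RPiece.mul φ RPiece.one) = pull φ
    rw [pull_mul, pull_one, conv_counit])
  mul_assoc := fun ⟨_, φ⟩ ⟨_, ψ⟩ ⟨_, χ⟩ => gext (add_assoc _ _ _) (by
    change pull (RPiece.mul (RPiece.mul φ ψ) χ) = pull (RPiece.mul φ (RPiece.mul ψ χ))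
    rw [pull_mul, pull_mul, pull_mul, pull_mul, conv_assoc])
  natCast n := (n : ℂ) • RPiece.one
  natCast_zero := by simp
  natCast_succ n := by
    rw [Nat.cast_succ, add_smul, one_smul]; rfl
  intCast n := (n : ℂ) • RPiece.one
  intCast_ofNat n := by simp
  intCast_negSucc_ofNat n := by
    rw [← neg_smul]; simp

open RPiece in
instance : DirectSum.GAlgebra ℂ (RPiece b l) where
  toFun := (LinearMap.toSpanSingleton ℂ (RPiece b l 0) RPiece.one).toAddMonoidHom
  map_one := one_smul ℂ _
  map_mul r s := gext rfl (by
    change pull ((r * s) • RPiece.one) = pull (RPiece.mul (r • RPiece.one) (s • RPiece.one))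
    rw [pull_mul, map_smul, map_smul, map_smul, smul_conv, conv_smul, pull_one, conv_counit,
      smul_smul])
  commutes := fun r ⟨_, φ⟩ => gext (add_comm _ _) (by
    change pull (RPiece.mul (r • RPiece.one) φ) = pull (RPiece.mul φ (r • RPiece.one))
    rw [pull_mul, pull_mul, map_smul, smul_conv, conv_smul, pull_one, conv_counit, counit_conv])
  smul_def := fun r ⟨_, φ⟩ => gext (zero_add _).symm (by
    change pull (r • φ) = pull (RPiece.mul (r • RPiece.one) φ)
    rw [pull_mul, map_smul, map_smul, smul_conv, pull_one, counit_conv])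

variable (b l)

/-- The underlying algebra of `R(λ)`. -/
abbrev RRing : Type := DirectSum ℕ (RPiece b l)

variable {b l} in
theorem RPiece.par_mul {m n : ℕ} (φ : RPiece b l m) (ψ : RPiece b l n) :
    RPiece.par (RPiece.mul φ ψ) = RPiece.mul (RPiece.par φ) (RPiece.par ψ) :=
  RPiece.pull_injective (by
    rw [RPiece.pull_par, RPiece.pull_mul, RPiece.pull_mul, RPiece.pull_par, RPiece.pull_par,
      conv_par])

variable {b l} in
theorem RPiece.par_par {k : ℕ} (φ : RPiece b l k) : RPiece.par (RPiece.par φ) = φ :=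
  RPiece.pull_injective (by
    rw [RPiece.pull_par, RPiece.pull_par]
    exact LinearMap.ext fun u => congrArg (RPiece.pull φ) (Env.par_par u))

variable {b l} in
theorem RPiece.par_one : RPiece.par (RPiece.one : RPiece b l 0) = RPiece.one :=
  RPiece.pull_injective (by
    rw [RPiece.pull_par, RPiece.pull_one]
    exact SuperRep.orbit_σ (SuperRep.triv g) (v := 1) rfl)

/-- The parity automorphism of `R(λ)`. -/
def RRing.par : RRing b l →ₐ[ℂ] RRing b l :=
  DirectSum.toAlgebra ℂ (RPiece b l)
    (fun k => DirectSum.lof ℂ ℕ (RPiece b l) k ∘ₗ RPiece.par)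
    (congrArg (DirectSum.of (RPiece b l) 0) RPiece.par_one)
    (fun {i j} φ ψ => by
      change DirectSum.of (RPiece b l) (i + j) (RPiece.par (RPiece.mul φ ψ)) =
        DirectSum.of (RPiece b l) i (RPiece.par φ) * DirectSum.of (RPiece b l) j (RPiece.par ψ)
      rw [RPiece.par_mul, DirectSum.of_mul_of]
      rfl)

theorem RRing.par_of {k : ℕ} (φ : RPiece b l k) :
    RRing.par b l (DirectSum.of (RPiece b l) k φ) = DirectSum.of (RPiece b l) k (RPiece.par φ) :=
  DirectSum.toAddMonoid_of (fun k => (DirectSum.lof ℂ ℕ (RPiece b l) k ∘ₗ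
    RPiece.par).toAddMonoidHom) k φ

theorem RRing.of_mul_of {i j : ℕ} (φ : RPiece b l i) (ψ : RPiece b l j) :
    DirectSum.of (RPiece b l) i φ * DirectSum.of (RPiece b l) j ψ =
      DirectSum.of (RPiece b l) (i + j) (RPiece.mul φ ψ) :=
  DirectSum.of_mul_of φ ψ

theorem RRing.of_eq_of {i j : ℕ} (h : i = j) {φ : RPiece b l i} {ψ : RPiece b l j}
    (h' : RPiece.pull φ = RPiece.pull ψ) :
    DirectSum.of (RPiece b l) i φ = DirectSum.of (RPiece b l) j ψ :=
  DirectSum.of_eq_of_gradedMonoid_eq (RPiece.gext h h')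

theorem RRing.comm_even (x y : RRing b l) :
    (x + RRing.par b l x) * y = y * (x + RRing.par b l x) := by
  induction x using DirectSum.induction_on with
  | zero => simp
  | add x x' hx hx' =>
    have e : x + x' + RRing.par b l (x + x') = (x + RRing.par b l x) + (x' + RRing.par b l x') := by
      rw [map_add]; abel
    rw [e, add_mul, mul_add, hx, hx']
  | of i φ =>
    induction y using DirectSum.induction_on with
    | zero => simp
    | add y y' hy hy' => rw [mul_add, hy, hy', add_mul y y']
    | of j ψ =>
      rw [RRing.par_of, ← map_add, RRing.of_mul_of, RRing.of_mul_of]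
      refine RRing.of_eq_of b l (add_comm i j) ?_
      rw [RPiece.pull_mul, RPiece.pull_mul]
      refine conv_comm_even _ _ ?_
      rw [← RPiece.pull_par, map_add, RPiece.par_par, add_comm]

theorem RRing.comm_odd (x y : RRing b l) :
    (x - RRing.par b l x) * (y - RRing.par b l y) =
      -((y - RRing.par b l y) * (x - RRing.par b l x)) := by
  induction x using DirectSum.induction_on with
  | zero => simp
  | add x x' hx hx' =>
    have e : x + x' - RRing.par b l (x + x') = (x - RRing.par b l x) + (x' - RRing.par b l x') := by
      rw [map_add]; abel
    rw [e, add_mul, mul_add, hx, hx', neg_add]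
  | of i φ =>
    induction y using DirectSum.induction_on with
    | zero => simp
    | add y y' hy hy' =>
      have e : y + y' - RRing.par b l (y + y') =
          (y - RRing.par b l y) + (y' - RRing.par b l y') := by
        rw [map_add]; abel
      rw [e, add_mul, mul_add, hy, hy', neg_add]
    | of j ψ =>
      rw [RRing.par_of, RRing.par_of, ← map_sub, ← map_sub, RRing.of_mul_of, RRing.of_mul_of,
        ← map_neg]
      refine RRing.of_eq_of b l (add_comm i j) ?_
      rw [map_neg, RPiece.pull_mul, RPiece.pull_mul]
      refine conv_comm_odd _ _ ?_ ?_
      · rw [← RPiece.pull_par, map_sub, RPiece.par_par, ← map_neg, neg_sub]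
      · rw [← RPiece.pull_par, map_sub, RPiece.par_par, ← map_neg, neg_sub]

/-- The commutative superalgebra `R(λ) = ⨁_{k ≥ 0} K_𝔟(kλ)^*`. -/
def RAlg : SuperAlg :=
  SuperAlg.ofPar (RRing b l) (RRing.par b l)
    (fun x => by
      induction x using DirectSum.induction_on with
      | zero => simp
      | add x y hx hy => rw [map_add, map_add, hx, hy]
      | of i φ => rw [RRing.par_of, RRing.par_of, RPiece.par_par])
    (RRing.comm_even b l) (RRing.comm_odd b l)

/-- A functional on `K_𝔟(kλ)`, as an element of `R(λ)`. -/
def RAlg.of (k : ℕ) (φ : Module.Dual ℂ (KMod b (k • l))) : RAlg b l :=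
  (DirectSum.of (RPiece b l) k (RPiece.ofDual φ) : RRing b l)

/-- The sub-superalgebra `ℂ ⊕ ⨁_{k ≥ 1} K_𝔟(kλ)^*` of `R(λ)` generated by the components of positive
degree. -/
def RPosAlg : SuperAlg :=
  (RAlg b l).adjoin {r | ∃ (k : ℕ) (φ : Module.Dual ℂ (KMod b (k • l))), 1 ≤ k ∧ r = RAlg.of b l k φ}

end ralg

/-! ### Essential monomials -/

/-- The data that are fixed throughout: a Borel subalgebra, a weight `λ`, an ordered homogeneous
basis of `𝔫⁻` and a total order on exponent vectors that is compatible with addition. -/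
structure Setting (g : Type) [AddCommGroup g] [Module ℂ g] [LieSuperalgebra g] where
  b : Borel g
  wt : Module.Dual ℂ b.H
  N : ℕ
  f : Fin N → g
  p : Fin N → ZMod 2
  f_mem : ∀ i, f i ∈ gr (g := g) (p i)
  f_indep : LinearIndependent ℂ f
  f_span : Submodule.span ℂ (Set.range f) = b.nNeg
  lt : (Fin N → ℕ) → (Fin N → ℕ) → Prop
  lt_total : IsStrictTotalOrder (Fin N → ℕ) lt
  lt_add : ∀ d e c, lt d e → lt (d + c) (e + c)

namespace Setting

variable {g : Type} [AddCommGroup g] [Module ℂ g] [LieSuperalgebra g] (S : Setting g)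

/-- Exponent vectors, indexed by the basis of `𝔫⁻`. -/
abbrev Exp : Type := Fin S.N → ℕ

/-- The exponent vectors in `ℕ^n × {0,1}^q`: the exponents of odd basis vectors are at most `1`. -/
def Admissible (e : S.Exp) : Prop := ∀ i, S.p i = 1 → e i ≤ 1

/-- The ordered monomial `f^e = f_N^{e_N} ⋯ f_1^{e_1}` in `U(g)`. -/
def mono (e : S.Exp) : Env g := (List.ofFn fun i => Env.ι g (S.f i) ^ e i).reverse.prod

/-- The vector `f^e v_{kλ}` of `K_𝔟(kλ)`. -/
def vec (k : ℕ) (e : S.Exp) : KMod S.b (k • S.wt) := S.mono e • KMod.v S.b (k • S.wt)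

/-- The set `es(K_𝔟(kλ), <)` of essential exponents. -/
def es (k : ℕ) : Set S.Exp :=
  {e | S.Admissible e ∧
    S.vec k e ∉ Submodule.span ℂ {x | ∃ e', S.Admissible e' ∧ S.lt e' e ∧ x = S.vec k e'}}

/-- Every essential exponent of `K_𝔟(kλ)` is a sum of `k` essential exponents of `K_𝔟(λ)`. -/
def FavourableAt (k : ℕ) : Prop :=
  ∀ e ∈ S.es k, ∃ c : Fin k → S.Exp, (∀ i, c i ∈ S.es 1) ∧ ∑ i, c i = e

/-- The parity `|I|` of the monomial with exponent `e = (I, 𝐦)`. -/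
def parity (e : S.Exp) : ZMod 2 := ∑ i, (e i : ZMod 2) * S.p i

/-- The scalar product `w(e)` with an integral vector. -/
def weight (w : Fin S.N → ℤ) (e : S.Exp) : ℤ := ∑ i, w i * (e i : ℤ)

/-! ### The monomial superalgebra -/

/-- The free supercommutative superalgebra `ℂ[v, x_1, …, x_n, ξ_1, …, ξ_q]`; the variable of the
index `none` is `v`, and the variable of the index `i` has the parity of `f_i`. -/
def polyAlg : SuperAlg := FreeSuper fun i : Option (Fin S.N) => i.elim 0 S.p

/-- The variables of `ℂ[v, x_1, …, x_n, ξ_1, …, ξ_q]`. -/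
def polyX (i : Option (Fin S.N)) : S.polyAlg :=
  FreeSuperRing.X (fun i : Option (Fin S.N) => i.elim 0 S.p) i

/-- The monomial `ξ^I x^𝐦 v`, with the factors in descending order of the indices. -/
def polyMono (e : S.Exp) : S.polyAlg :=
  (List.ofFn fun i => S.polyX (some i) ^ e i).reverse.prod * S.polyX none

/-- The monomial superalgebra `ℂ[ξ^I x^𝐦 v | (I, 𝐦) ∈ es(K_𝔟(λ), <)]`. -/
def monomialAlg : SuperAlg := S.polyAlg.adjoin {y | ∃ e ∈ S.es 1, y = S.polyMono e}

/-! ### The free superalgebra on the essential exponents -/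

/-- The free supercommutative superalgebra `𝒮` with one variable for each essential exponent of
`K_𝔟(λ)`, of the corresponding parity. -/
def freeAlg : SuperAlg := FreeSuper fun e : S.es 1 => S.parity e

/-- The variables of `𝒮`. -/
def freeX (e : S.es 1) : S.freeAlg := FreeSuperRing.X (fun e : S.es 1 => S.parity e) e

/-- The product of the variables in a list. -/
def freeMono (L : List (S.es 1)) : S.freeAlg := (L.map S.freeX).prod

/-- The list `L` of essential exponents has `h` members, with sum `e`. -/
def HasDegree (L : List (S.es 1)) (e : S.Exp) (h : ℕ) : Prop :=
  L.length = h ∧ (L.map Subtype.val).sum = e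

/-- The component of `𝒮` of multidegree `e` and total degree `h`. -/
def component (e : S.Exp) (h : ℕ) : Submodule ℂ S.freeAlg :=
  Submodule.span ℂ {s | ∃ L, S.HasDegree L e h ∧ s = S.freeMono L}

/-- The binomials `M ± M'`, where `M` and `M'` are products of variables of multidegree `e` and
total degree `h`. -/
def IsBinomial (e : S.Exp) (h : ℕ) (s : S.freeAlg) : Prop :=
  ∃ (L L' : List (S.es 1)) (σ : ℕ), S.HasDegree L e h ∧ S.HasDegree L' e h ∧
    s = S.freeMono L + (-1 : ℂ) ^ σ • S.freeMono L'

/-- The monomials of multidegree `e` and total degree `h`. -/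
def IsMonomial (e : S.Exp) (h : ℕ) (s : S.freeAlg) : Prop :=
  ∃ L : List (S.es 1), S.HasDegree L e h ∧ s = S.freeMono L

/-- The superalgebra `𝒮[t]`; the variable of the index `none` is `t`. -/
def freeAlgT : SuperAlg := FreeSuper fun e : Option (S.es 1) => e.elim 0 fun e => S.parity e

/-- The variables of `𝒮[t]`. -/
def freeXT (e : Option (S.es 1)) : S.freeAlgT :=
  FreeSuperRing.X (fun e : Option (S.es 1) => e.elim 0 fun e => S.parity e) e

/-- The inclusion `𝒮 → 𝒮[t]`. -/
def inclT : S.freeAlg →ₐ[ℂ] S.freeAlgT :=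
  FreeSuperRing.lift (fun e : S.es 1 => S.parity e)
    (fun e => FreeSuperRing.X (fun e : Option (S.es 1) => e.elim 0 fun e => S.parity e) (some e))
    fun e e' => FreeSuperRing.X_mul_X _ (some e) (some e')

end Setting

/-! ### The degeneration -/

/-- The subspace `R_n(λ)^{> e}` of `R(λ)`, spanned by the vectors `η_{e',n}` with `e' > e`. -/
def Setting.above {g : Type} [AddCommGroup g] [Module ℂ g] [LieSuperalgebra g] (S : Setting g)
    (η : ∀ k : ℕ, S.es k → Module.Dual ℂ (KMod S.b (k • S.wt))) (e : S.Exp) (n : ℕ) :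
    Submodule ℂ (RAlg S.b S.wt) :=
  Submodule.span ℂ {r | ∃ e' : S.es n, S.lt e e' ∧ r = RAlg.of S.b S.wt n (η n e')}

/-- The choices that enter the construction of the family. -/
structure Degeneration {g : Type} [AddCommGroup g] [Module ℂ g] [LieSuperalgebra g]
    (S : Setting g) where
  /-- The (normalized) dual basis `η_{e,k}` of `K_𝔟(kλ)^*`. -/
  η : ∀ (k : ℕ), S.es k → Module.Dual ℂ (KMod S.b (k • S.wt))
  η_vec : ∀ k (e e' : S.es k), η k e (S.vec k e') =
    if e = e' then ((∏ i, (e.1 i).factorial : ℕ) : ℂ) else 0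
  /-- The map `𝒮 → R(λ)` that sends the variable of `e` to `η_{e,1}`. -/
  ev : S.freeAlg ⟶ RAlg S.b S.wt
  ev_X : ∀ e : S.es 1, ev.hom (S.freeX e) = RAlg.of S.b S.wt 1 (η 1 e)
  /-- The number of generators `ḡ_1, …, ḡ_m` of the kernel of `𝒮 → gr R(λ)`. -/
  m : ℕ
  gbar : Fin m → S.freeAlg
  /-- The degrees `(J_k, h_k)` of the generators. -/
  J : Fin m → S.Exp
  h : Fin m → ℕ
  gbar_form : ∀ k, S.IsBinomial (J k) (h k) (gbar k) ∨ S.IsMonomial (J k) (h k) (gbar k)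
  /-- The generators are in the kernel: `ḡ_k(η) ∈ R_{h_k}^{> J_k}`. -/
  gbar_ker : ∀ k, ev.hom (gbar k) ∈ S.above η (J k) (h k)
  /-- The generators generate the kernel, which is spanned by the homogeneous elements `s`, of some
  degree `(e, n)`, with `s(η) ∈ R_n^{> e}`. -/
  gbar_gen : ∀ (e : S.Exp) (n : ℕ), ∀ s ∈ S.component e n, ev.hom s ∈ S.above η e n →
    s ∈ S.freeAlg.ideal (Set.range gbar)
  /-- The correction terms `g_{k,j}`, of degree `(U_{k,j}, h_k)` with `U_{k,j} > J_k`. -/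
  r : Fin m → ℕ
  corr : ∀ k, Fin (r k) → S.freeAlg
  U : ∀ k, Fin (r k) → S.Exp
  corr_mem : ∀ k j, corr k j ∈ S.component (U k j) (h k)
  U_mem : ∀ k j, U k j ∈ S.es (h k)
  U_lt : ∀ k j, S.lt (J k) (U k j)
  /-- `g_k = ḡ_k + ∑_j g_{k,j}` vanishes in `R(λ)`. -/
  ev_lift : ∀ k, ev.hom (gbar k + ∑ j, corr k j) = 0
  /-- The weight vector. -/
  w : Fin S.N → ℤ
  w_lt : ∀ k j, S.weight w (J k) < S.weight w (U k j)

namespace Degeneration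

variable {g : Type} [AddCommGroup g] [Module ℂ g] [LieSuperalgebra g] {S : Setting g}
  (D : Degeneration S)

/-- The relations `ḡ_k + ∑_j t^{w(U_{k,j}) - w(J_k)} g_{k,j}`. -/
def relation (k : Fin D.m) : S.freeAlgT :=
  S.inclT (D.gbar k) + ∑ j, S.freeXT none ^ (S.weight D.w (D.U k j) - S.weight D.w (D.J k)).toNat *
    S.inclT (D.corr k j)

/-- The set of all binomials in the kernel of `𝒮 → gr R(λ)` whose multidegree is the maximal
essential exponent of `K_𝔟(nλ)`. -/
def maxRelations (n : ℕ) : Set S.freeAlg :=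
  {s | ∃ e ∈ S.es n, (∀ e' ∈ S.es n, e' ≠ e → S.lt e' e) ∧ S.IsBinomial e n s ∧
    D.ev.hom s ∈ S.above D.η e n}

/-- The superalgebra `𝓡 = 𝒮[t] / 𝓘`. -/
def family : SuperAlg :=
  S.freeAlgT.quot (Set.range D.relation ∪ ⋃ n, S.inclT '' D.maxRelations n)

/-- The image of `t` in `𝓡`. -/
def familyT : D.family := (S.freeAlgT.toQuot _).hom (S.freeXT none)

theorem par_familyT : D.family.par D.familyT = D.familyT := by
  have h : S.freeAlgT.par (S.freeXT none) = S.freeXT none := by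
    refine (FreeSuperRing.par_X (fun e : Option (S.es 1) => e.elim 0 fun e => S.parity e) none).trans ?_
    have h1 : ksign 1 0 = 1 := by simp [ksign]
    exact (congrArg (fun c : ℂ => c • S.freeXT none) h1).trans (one_smul ℂ _)
  exact ((S.freeAlgT.toQuot _).map_par (S.freeXT none)).symm.trans
    (congrArg (S.freeAlgT.toQuot _).hom h)

/-- The structure map `ℂ[t] → 𝓡`. -/
def familyHom : lineAlg ⟶ D.family where
  hom := (Polynomial.aeval D.familyT : Polynomial ℂ →ₐ[ℂ] D.family)
  map_par := by
    have h : D.family.par.comp (Polynomial.aeval D.familyT) = Polynomial.aeval D.familyT :=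
      Polynomial.algHom_ext (by simp [D.par_familyT])
    exact fun a => (congrArg (fun k : Polynomial ℂ →ₐ[ℂ] D.family => k a) h).symm

/-- The morphism `κ : Spec 𝓡 → 𝔸^{1|0}`. -/
def κ : D.family.Spec ⟶ affineLine := SuperAlg.Spec.map D.familyHom

end Degeneration

end

/-! The proof rests on one computation with leading coefficients. The vectors `f^e v_{kλ}` with `e ∈
es(kλ)` form a basis of `K(kλ)`. In the coproduct of `f^{e'+e}` the term `f^{e'} ⊗ f^e` occurs with
a product of binomial coefficients and a sign, and every other splitting `d₁ + d₂ = e' + e` has `d₁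
< e'` or `d₂ < e`, because the order is total and compatible with addition. So if two functionals
vanish below `e` and below `e'`, their product vanishes below `e + e'`, and the values at these
exponents, divided by `∏ e_i!`, multiply exactly as the monomials `ξ^I x^m v^k` do, with the same
sign (`Setting.coeff_mul`, `Setting.polyAsc_mul`). Hence, degree by degree, the kernel of `𝒮 → gr
R(λ)` is the kernel of the map `Setting.lead` to the polynomial superalgebra, which sends `X_e` to a
monomial (`DualBasis.ev_mem_above_iff`).

Choose one product of variables in each degree `(e, h)` that occurs and has `e` admissible. These
products form a basis of the family over `ℂ[t]`. They generate it: modulo a multiple of the chosen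
product, a homogeneous element lies in the kernel, hence is a combination of the `ḡ_k`, and the
relations replace `ḡ_k` by terms of the same `h` and larger multidegree. For fixed `h` there are
finitely many multidegrees, so this ends (`Degeneration.combination_surjective`). They are
independent after every specialization `t = a`. If `a ≠ 0`, then `t ↦ a`, `X_e ↦ a^{-w(e)} η_{e,1}`
respects all relations and maps the family to `R(λ)`. If `a = 0`, then `t ↦ 0` together with `lead`
maps it to the polynomial superalgebra. In both cases the chosen products have distinct leading
monomials. A binomial of maximal multidegree is harmless: nothing lies above it, so it already
vanishes in `R(λ)`.

It follows that an element in the kernel of a specialization has coefficients divisible by `t - a`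
(`map_eq_zero_iff`), so the fibre over `a` is the image of the specialization; and that there is no
torsion (`eq_zero_of_aeval_mul`), which is flatness, because the base is locally a principal ideal
domain (`flat_stalk`). Favourability identifies the image for `a ≠ 0` with `R^+(λ)`: each `η_{e,k}`
is, up to larger terms, the value of a product of `k` variables.

The choices exist for three reasons. `𝒮` is Noetherian, and its kernel is spanned by binomials and
monomials. Favourability supplies the correction terms. Finally, the differences `U - J` with `J <
U` form a semigroup without `0`, so finitely many of them lie in an open half space
(`exists_rat_dotProduct_pos`).

All this needs `K(μ)` to be finite-dimensional and spanned by ordered monomials in `𝔫⁻`. Spanning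
comes from the triangular decomposition, which requires that a basic Lie superalgebra has no odd
vectors of weight zero (`eq_zero_of_odd_zero`). Finiteness comes from `𝔰𝔩₂`-theory: even root
vectors act on the highest weight vector nilpotently, with an exponent that depends only on the
weight. -/

noncomputable section
open scoped TensorProduct
open CategoryTheory TopologicalSpace Opposite
open LieSuperalgebra

/-! ### Linear algebra -/

section linear

variable {V : Type} [AddCommGroup V] [Module ℂ V]

/-- Joint eigenvectors with distinct systems of eigenvalues are linearly independent. -/
theorem linearIndependent_of_weights {H ι : Type} (T : H → Module.End ℂ V) (χ : ι → H → ℂ)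
    (hχ : Function.Injective χ) (u : ι → V) (hu : ∀ i, u i ≠ 0)
    (h : ∀ i x, T x (u i) = χ i x • u i) : LinearIndependent ℂ u := by
  classical
  rw [linearIndependent_iff']
  intro s
  induction s using Finset.induction_on with
  | empty => simp
  | insert a s ha ih =>
    intro c hc
    have key : ∀ j ∈ s, c j = 0 := by
      intro j hj
      have hne : χ j ≠ χ a := fun h' => ha (hχ h' ▸ hj)
      obtain ⟨x, hx⟩ := Function.ne_iff.mp hne
      -- Applying `T x - χ a x` to the relation removes the term of `a` and leaves a relation over
      -- `s`.
      have h0 : ∑ i ∈ s, (c i * (χ i x - χ a x)) • u i = 0 := by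
        have h1 := congrArg (T x) hc
        have h2 := congrArg (χ a x • ·) hc
        simp only [map_sum, map_smul, h, map_zero, smul_zero, Finset.smul_sum] at h1 h2
        rw [Finset.sum_insert ha] at h1 h2
        have h3 : ∑ i ∈ s, (c i * (χ i x - χ a x)) • u i =
            (∑ i ∈ s, c i • χ i x • u i) - ∑ i ∈ s, χ a x • c i • u i := by
          rw [← Finset.sum_sub_distrib]
          refine Finset.sum_congr rfl fun i _ => ?_
          module
        rw [h3, eq_neg_of_add_eq_zero_right h1, eq_neg_of_add_eq_zero_right h2]
        module
      exact (mul_eq_zero.mp (ih _ h0 j hj)).resolve_right (sub_ne_zero.mpr hx)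
    intro i hi
    rcases Finset.mem_insert.mp hi with rfl | hi
    · rw [Finset.sum_insert ha, Finset.sum_eq_zero fun j hj => by rw [key j hj, zero_smul],
        add_zero] at hc
      exact (smul_eq_zero.mp hc).resolve_right (hu i)
    · exact key i hi

/-- The eigenvalues `w - n c` are pairwise distinct because `c ≠ 0`. If no `u n` vanished, there
would be infinitely many independent vectors. -/
theorem exists_eq_zero_of_eigen [FiniteDimensional ℂ V] (T : Module.End ℂ V) (u : ℕ → V)
    (w c : ℂ) (hc : c ≠ 0) (h : ∀ n, T (u n) = (w - n * c) • u n) : ∃ n, u n = 0 := by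
  by_contra! hne
  have h1 := T.eigenvectors_linearIndependent' (fun n : ℕ => w - n * c) (fun m n hmn => by
    have : (m : ℂ) * c = n * c := by simpa using hmn
    exact_mod_cast mul_right_cancel₀ hc this) u
    fun n => ⟨Module.End.mem_eigenspace_iff.mpr (h n), hne n⟩
  have := h1.finite_of_isNoetherian
  exact not_finite ℕ

/-- The weight of a highest weight vector of a finite-dimensional representation of `𝔰𝔩₂`. -/
theorem sl2_highest [FiniteDimensional ℂ V] {E F T : Module.End ℂ V} {c : ℂ} (hc : c ≠ 0)
    (hEF : E * F - F * E = T) (hTF : T * F - F * T = -(c • F)) {u : V} {w : ℂ} (hu : u ≠ 0)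
    (hE : E u = 0) (hT : T u = w • u) : ∃ n : ℕ, 2 * w = c * n ∧ (F ^ (n + 1)) u = 0 := by
  have aTF : ∀ x, T (F x) = F (T x) - c • F x := fun x => by
    have := congrArg (fun k : Module.End ℂ V => k x) hTF
    simp only [LinearMap.sub_apply, Module.End.mul_apply, LinearMap.neg_apply,
      LinearMap.smul_apply] at this
    rw [sub_eq_iff_eq_add] at this
    rw [this]; abel
  have aEF : ∀ x, E (F x) = F (E x) + T x := fun x => by
    rw [← hEF]; simp
  have hTn : ∀ n : ℕ, T ((F ^ n) u) = (w - n * c) • (F ^ n) u := by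
    intro n
    induction n with
    | zero => simp [hT]
    | succ n ih =>
      rw [pow_succ', Module.End.mul_apply, aTF, ih, map_smul]
      push_cast
      module
  -- The usual `𝔰𝔩₂`-formula, with `c` in place of the normalization `2`. At the last nonzero power
  -- of `F` the left side vanishes, which forces `w = n c / 2`.
  have hEn : ∀ n : ℕ, E ((F ^ (n + 1)) u) = ((n + 1) * (w - n * c / 2)) • (F ^ n) u := by
    intro n
    induction n with
    | zero => simp [aEF, hE, hT]
    | succ n ih =>
      rw [pow_succ', Module.End.mul_apply, aEF, ih, map_smul, hTn, ← Module.End.mul_apply,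
        ← pow_succ', ← add_smul]
      push_cast
      congr 1
      ring
  have hex : ∃ n, (F ^ n) u = 0 := exists_eq_zero_of_eigen T _ w c hc hTn
  classical
  obtain ⟨n, hn⟩ : ∃ n, Nat.find hex = n + 1 := by
    refine Nat.exists_eq_succ_of_ne_zero fun h0 => hu ?_
    have := Nat.find_spec hex
    rw [h0] at this
    simpa using this
  have h1 : (F ^ (n + 1)) u = 0 := hn ▸ Nat.find_spec hex
  have h2 : (F ^ n) u ≠ 0 := Nat.find_min hex (by omega)
  refine ⟨n, ?_, h1⟩
  have h3 := hEn n
  rw [h1, map_zero, eq_comm, smul_eq_zero] at h3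
  have h4 := h3.resolve_right h2
  have h5 : (n : ℂ) + 1 ≠ 0 := by exact_mod_cast n.succ_ne_zero
  have h6 := (mul_eq_zero.mp h4).resolve_left h5
  linear_combination 2 * h6

/-- If `z = [x, y]` is diagonalizable and commutes with `x` and `y`, then `z = 0`. -/
theorem eq_zero_of_heisenberg [FiniteDimensional ℂ V] {x y z : Module.End ℂ V}
    (h : x * y - y * x = z) (hx : Commute z x) (hy : Commute z y)
    (hz : ⨆ c : ℂ, Module.End.eigenspace z c = ⊤) : z = 0 := by
  have key : ∀ c : ℂ, c ≠ 0 → Module.End.eigenspace z c = ⊥ := by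
    intro c hc
    have mx : ∀ u ∈ Module.End.eigenspace z c, x u ∈ Module.End.eigenspace z c := fun u hu => by
      rw [Module.End.mem_eigenspace_iff] at *
      have := congrArg (fun k : Module.End ℂ V => k u) hx.eq
      simp only [Module.End.mul_apply] at this
      rw [this, hu, map_smul]
    have my : ∀ u ∈ Module.End.eigenspace z c, y u ∈ Module.End.eigenspace z c := fun u hu => by
      rw [Module.End.mem_eigenspace_iff] at *
      have := congrArg (fun k : Module.End ℂ V => k u) hy.eq
      simp only [Module.End.mul_apply] at this
      rw [this, hu, map_smul]
    -- On an eigenspace of `z` the scalar `c` is a commutator, so its trace `c · dim` is zero.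
    have e : x.restrict mx * y.restrict my - y.restrict my * x.restrict mx =
        c • (1 : Module.End ℂ (Module.End.eigenspace z c)) := by
      refine LinearMap.ext fun u => Subtype.ext ?_
      have h1 := congrArg (fun k : Module.End ℂ V => k u.1) h
      have h2 := Module.End.mem_eigenspace_iff.mp u.2
      simp only [LinearMap.sub_apply, Module.End.mul_apply] at h1
      simpa using h1.trans h2
    have t := congrArg (LinearMap.trace ℂ _) e
    rw [map_sub, LinearMap.trace_mul_comm, sub_self, map_smul, LinearMap.trace_one, smul_eq_mul,
      eq_comm, mul_eq_zero] at t
    have := t.resolve_left hc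
    exact Submodule.finrank_eq_zero.mp (by exact_mod_cast this)
  have h0 : Module.End.eigenspace z 0 = ⊤ := by
    rw [eq_top_iff, ← hz]
    refine iSup_le fun c => ?_
    by_cases hc : c = 0
    · rw [hc]
    · rw [key c hc]; exact bot_le
  refine LinearMap.ext fun u => ?_
  have : u ∈ Module.End.eigenspace z 0 := h0 ▸ trivial
  simpa [Module.End.mem_eigenspace_iff] using this

end linear

/-! ### The structure of basic Lie superalgebras -/

namespace LieSuperalgebra

variable {g : Type} [AddCommGroup g] [Module ℂ g] [LieSuperalgebra g]

/-- If the first entry is even, the Koszul sign is `1`, so the identity is trilinear without signs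
and extends from homogeneous elements. -/
theorem jacobi_even {x : g} (hx : x ∈ gr (g := g) 0) (y z : g) :
    br x (br y z) = br (br x y) z + br y (br x z) := by
  refine homogeneous_induction
    (P := fun y => br x (br y z) = br (br x y) z + br y (br x z)) ?_ ?_ y
  · intro j y hy
    refine homogeneous_induction
      (P := fun z => br x (br y z) = br (br x y) z + br y (br x z)) ?_ ?_ z
    · intro k z hz
      simpa [ksign] using jacobi hx hy hz
    · intro z z' h h'
      simp only [map_add, h, h']
      abel
  · intro y y' h h'
    simp only [map_add, LinearMap.add_apply, h, h']
    abel

theorem skew_even {x : g} (hx : x ∈ gr (g := g) 0) (y : g) : br x y = -br y x := by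
  refine homogeneous_induction (P := fun y => br x y = -br y x) ?_ ?_ y
  · intro j y hy
    simpa [ksign] using skew hx hy
  · intro y y' h h'
    simp only [map_add, LinearMap.add_apply, h, h']
    abel

theorem even_br {x : g} (hx : x ∈ gr (g := g) 0) (y : g) : even g (br x y) = br x (even g y) := by
  conv_lhs => rw [← even_add_odd y, map_add, map_add]
  have h0 : br x (even g y) ∈ gr (g := g) 0 := by simpa using br_mem hx (even_mem y)
  have h1 : br x (odd g y) ∈ gr (g := g) 1 := by simpa using br_mem hx (odd_mem y)
  rw [even_of_even h0, even_of_odd h1, add_zero]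

theorem odd_br {x : g} (hx : x ∈ gr (g := g) 0) (y : g) : odd g (br x y) = br x (odd g y) := by
  conv_lhs => rw [← even_add_odd y, map_add, map_add]
  have h0 : br x (even g y) ∈ gr (g := g) 0 := by simpa using br_mem hx (even_mem y)
  have h1 : br x (odd g y) ∈ gr (g := g) 1 := by simpa using br_mem hx (odd_mem y)
  rw [odd_of_even h0, odd_of_odd h1, zero_add]

theorem commutator_br {x : g} (hx : x ∈ gr (g := g) 0) (y : g) :
    (br x : Module.End ℂ g) * br y - br y * br x = br (br x y) := by
  refine LinearMap.ext fun z => ?_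
  simp only [LinearMap.sub_apply, Module.End.mul_apply]
  rw [jacobi_even hx]
  abel

section cartan

variable {H : Submodule ℂ g} (hH : IsCartan H)

include hH in
theorem even_mem_rootSpace {α : Module.Dual ℂ H} {x : g} (hx : x ∈ rootSpace H α) :
    even g x ∈ rootSpace H α := fun h => by
  rw [← even_br (hH.le_even h.2), hx h, map_smul]

include hH in
theorem odd_mem_rootSpace {α : Module.Dual ℂ H} {x : g} (hx : x ∈ rootSpace H α) :
    odd g x ∈ rootSpace H α := fun h => by
  rw [← odd_br (hH.le_even h.2), hx h, map_smul]

include hH in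
theorem br_mem_rootSpace {α β : Module.Dual ℂ H} {x y : g} (hx : x ∈ rootSpace H α)
    (hy : y ∈ rootSpace H β) : br x y ∈ rootSpace H (α + β) := fun h => by
  rw [jacobi_even (hH.le_even h.2), hx h, hy h, map_smul, map_smul, LinearMap.smul_apply,
    LinearMap.add_apply, add_smul]

include hH in
theorem mem_of_mem_rootSpace_zero {x : g} (h0 : x ∈ gr (g := g) 0) (hx : x ∈ rootSpace H 0) :
    x ∈ H := hH.centralizer x h0 fun h hh => by simpa using hx ⟨h, hh⟩

include hH in
theorem mem_rootSpace_zero {x : g} (hx : x ∈ H) : x ∈ rootSpace H 0 := fun h => by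
  simpa using hH.abelian _ h.2 _ hx

-- The operators `ad h` commute and are diagonalizable, so `g` is the sum of their joint
-- eigenspaces. A nonzero joint eigenvector makes its system of eigenvalues linear in `h`, hence a
-- weight.
include hH in
theorem iSup_rootSpace [FiniteDimensional ℂ g] : ⨆ α, rootSpace H α = ⊤ := by
  -- The generalized eigenspaces are independent and contain the eigenspaces, which already span; so
  -- the two coincide.
  have hmax : ∀ (h : H) (c : ℂ), Module.End.maxGenEigenspace (br h.1 : Module.End ℂ g) c =
      Module.End.eigenspace (br h.1) c := fun h c => by
    have hle : Module.End.eigenspace (br h.1 : Module.End ℂ g) ≤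
        Module.End.maxGenEigenspace (br h.1 : Module.End ℂ g) := fun c =>
      Module.End.genEigenspace_le_maximal _ _ 1
    have := (iSupIndep.le_iff_eq_of_iSup_eq_top
      (Module.End.independent_maxGenEigenspace (br h.1 : Module.End ℂ g))
      (hH.diagonalizable h.1 h.2)).mp hle
    exact (congrFun this c).symm
  have := Module.End.iSup_iInf_maxGenEigenspace_eq_top_of_iSup_maxGenEigenspace_eq_top_of_commute
    (fun h : H => (br h.1 : Module.End ℂ g)) (fun h h' _ => by
      have := commutator_br (hH.le_even h.2) h'.1
      rw [hH.abelian _ h.2 _ h'.2, map_zero] at this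
      exact sub_eq_zero.mp this) (fun h => by
      simp only [hmax]; exact hH.diagonalizable h.1 h.2)
  rw [eq_top_iff, ← this]
  refine iSup_le fun χ x hx => ?_
  simp only [hmax, Submodule.mem_iInf, Module.End.mem_eigenspace_iff] at hx
  by_cases h0 : x = 0
  · rw [h0]; exact zero_mem _
  · have hadd : ∀ h h' : H, χ (h + h') = χ h + χ h' := fun h h' => by
      refine smul_left_injective ℂ h0 ?_
      simp only [add_smul, ← hx]
      simp
    have hsmul : ∀ (c : ℂ) (h : H), χ (c • h) = c • χ h := fun c h => by
      refine smul_left_injective ℂ h0 ?_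
      simp only [smul_assoc, ← hx]
      simp
    exact Submodule.mem_iSup_of_mem (⟨⟨χ, hadd⟩, hsmul⟩ : Module.Dual ℂ H) hx

include hH in
/-- A root vector of weight `-α` that is annihilated by `e ∈ g_α` is zero. -/
theorem eq_zero_of_triple [FiniteDimensional ℂ g] {α : Module.Dual ℂ H} {e f : g}
    (hf : f ∈ rootSpace H (-α)) (he0 : e ∈ gr (g := g) 0) {t : H} (ht : br e f = t.1)
    (hαt : α t ≠ 0) {u : g} (hu : u ∈ rootSpace H (-α)) (heu : br e u = 0) : u = 0 := by
  by_contra hne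
  have h1 : (br e : Module.End ℂ g) * br f - br f * br e = br t.1 := by
    rw [commutator_br he0, ht]
  have h2 : (br t.1 : Module.End ℂ g) * br f - br f * br t.1 = -(α t • br f) := by
    rw [commutator_br (hH.le_even t.2), hf t]
    simp
  -- The vector `u` would be a highest weight vector of weight `-α(t)`, whence `-2 α(t) = α(t) n`
  -- with `n ≥ 0`.
  obtain ⟨n, hn, -⟩ := sl2_highest hαt h1 h2 hne heu (hu t)
  have h3 : α t * ((n : ℂ) + 2) = 0 := by
    rw [LinearMap.neg_apply] at hn
    linear_combination -hn
  have h4 : (n : ℂ) + 2 ≠ 0 := by exact_mod_cast (Nat.succ_ne_zero (n + 1))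
  exact (mul_ne_zero hαt h4) h3

end cartan

/-- The centre of a simple Lie superalgebra is trivial. -/
theorem IsSimple.eq_zero_of_central (hs : IsSimple g) {i : ZMod 2} {x : g}
    (hx : x ∈ gr (g := g) i) (h : ∀ y, br y x = 0) : x = 0 := by
  rcases hs.eq_bot_or_top (Submodule.span ℂ {x}) (fun y hy => by
    obtain ⟨c, rfl⟩ := Submodule.mem_span_singleton.mp hy
    rw [map_smul]
    refine Submodule.smul_mem _ _ ?_
    rcases zmod2_cases i with rfl | rfl
    · rw [even_of_even hx]; exact Submodule.mem_span_singleton_self x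
    · rw [even_of_odd hx]; exact zero_mem _) (fun y z hz => by
    obtain ⟨c, rfl⟩ := Submodule.mem_span_singleton.mp hz
    rw [map_smul, h, smul_zero]; exact zero_mem _) with h1 | h1
  · exact Submodule.span_singleton_eq_bot.mp h1
  · obtain ⟨y, z, hyz⟩ := hs.not_abelian
    have hz : z ∈ Submodule.span ℂ {x} := h1 ▸ trivial
    obtain ⟨c, rfl⟩ := Submodule.mem_span_singleton.mp hz
    rw [map_smul, h, smul_zero] at hyz
    exact absurd rfl hyz

/-- A non-degenerate invariant even supersymmetric form. -/
structure IsInvariantForm (B : g →ₗ[ℂ] g →ₗ[ℂ] ℂ) : Prop where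
  nondeg : B.Nondegenerate
  inv : ∀ x y z, B (br x y) z = B x (br y z)
  symm : ∀ i j, ∀ x ∈ gr (g := g) i, ∀ y ∈ gr (g := g) j, B x y = ksign i j • B y x
  even : ∀ x ∈ gr (g := g) 0, ∀ y ∈ gr (g := g) 1, B x y = 0

namespace IsInvariantForm

variable {B : g →ₗ[ℂ] g →ₗ[ℂ] ℂ} (hB : IsInvariantForm B) {H : Submodule ℂ g} (hH : IsCartan H)
include hB

theorem eq_zero_of_ne {i j : ZMod 2} (hij : i ≠ j) {x y : g} (hx : x ∈ gr (g := g) i)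
    (hy : y ∈ gr (g := g) j) : B x y = 0 := by
  rcases zmod2_cases i with rfl | rfl <;> rcases zmod2_cases j with rfl | rfl
  · exact absurd rfl hij
  · exact hB.even x hx y hy
  · rw [hB.symm 1 0 x hx y hy, hB.even y hy x hx, smul_zero]
  · exact absurd rfl hij

include hH

/-- Invariance under `h` gives `(α + β)(h) B(x, y) = 0`. -/
theorem eq_zero_of_roots {α β : Module.Dual ℂ H} (hαβ : α + β ≠ 0) {x y : g}
    (hx : x ∈ rootSpace H α) (hy : y ∈ rootSpace H β) : B x y = 0 := by
  obtain ⟨h, hh⟩ := DFunLike.ne_iff.mp hαβ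
  have h1 := hB.inv x h.1 y
  have h2 := skew_even (hH.le_even h.2) x
  rw [← neg_eq_iff_eq_neg] at h2
  rw [← h2, hx h, hy h, map_neg, map_smul, map_smul, LinearMap.neg_apply, LinearMap.smul_apply]
    at h1
  simp only [smul_eq_mul] at h1
  have h3 : (α + β) h * B x y = 0 := by
    rw [LinearMap.add_apply]; linear_combination -h1
  exact (mul_eq_zero.mp h3).resolve_left hh

/-- The form pairs `(g_α)_i` with `(g_{-α})_i`. -/
theorem eq_zero_of_orthogonal [FiniteDimensional ℂ g] {i : ZMod 2} {β : Module.Dual ℂ H} {z : g}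
    (hz : z ∈ rootSpace H β) (hi : z ∈ gr (g := g) i)
    (h : ∀ e ∈ rootSpace H (-β), e ∈ gr (g := g) i → B e z = 0) : z = 0 := by
  refine hB.nondeg.2 z fun x => ?_
  have hx : x ∈ ⨆ α, rootSpace H α := iSup_rootSpace hH ▸ trivial
  induction hx using Submodule.iSup_induction' with
  | mem α x hx =>
    by_cases hα : α + β = 0
    · rw [eq_neg_of_add_eq_zero_left hα] at hx
      rw [← even_add_odd x, map_add, LinearMap.add_apply]
      rcases zmod2_cases i with rfl | rfl
      · rw [h _ (even_mem_rootSpace hH hx) (even_mem x),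
          hB.eq_zero_of_ne one_ne_zero (odd_mem x) hi, add_zero]
      · rw [h _ (odd_mem_rootSpace hH hx) (odd_mem x),
          hB.eq_zero_of_ne zero_ne_one (even_mem x) hi, add_zero]
    · exact hB.eq_zero_of_roots hH hα hx hz
  | zero => simp
  | add x y _ _ hx hy => rw [map_add, LinearMap.add_apply, hx, hy, add_zero]

theorem eq_zero_of_mem_cartan [FiniteDimensional ℂ g] {z : g} (hz : z ∈ H)
    (h : ∀ x ∈ H, B x z = 0) : z = 0 :=
  hB.eq_zero_of_orthogonal hH (mem_rootSpace_zero hH hz) (hH.le_even hz) fun e he h0 =>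
    h e (mem_of_mem_rootSpace_zero hH h0 (by simpa using he))

/-- By invariance `B([e, f], h) = B(e, [f, h])`. So when `[e, f]` lies in `H`, it represents `B(e,
f) α` under the form. -/
theorem apply_br {α : Module.Dual ℂ H} {e f : g} (hf : f ∈ rootSpace H (-α)) (h : H) :
    B (br e f) h = α h * B e f := by
  have := skew_even (hH.le_even h.2) f
  rw [hf h, eq_comm, neg_eq_iff_eq_neg] at this
  rw [hB.inv, this]
  simp

/-- An even root vector `f` belongs to an `𝔰𝔩₂`-triple, up to scaling. -/
theorem exists_triple [FiniteDimensional ℂ g] (hs : IsSimple g) {α : Module.Dual ℂ H}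
    (hα : α ≠ 0) {f : g} (hf : f ∈ rootSpace H (-α)) (hf0 : f ∈ gr (g := g) 0) (hne : f ≠ 0) :
    ∃ e ∈ rootSpace H α, e ∈ gr (g := g) 0 ∧ B e f ≠ 0 ∧
      ∃ t : H, br e f = t.1 ∧ α t ≠ 0 := by
  obtain ⟨e, he, he0, hef⟩ : ∃ e ∈ rootSpace H α, e ∈ gr (g := g) 0 ∧ B e f ≠ 0 := by
    by_contra! h
    exact hne (hB.eq_zero_of_orthogonal hH hf hf0 fun e he => h e (by simpa using he))
  have h0 : br e f ∈ gr (g := g) 0 := by simpa using br_mem he0 hf0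
  have hz : br e f ∈ rootSpace H 0 := by simpa using br_mem_rootSpace hH he hf
  refine ⟨e, he, he0, hef, ⟨br e f, mem_of_mem_rootSpace_zero hH h0 hz⟩, rfl, fun ht => ?_⟩
  set t : H := ⟨br e f, mem_of_mem_rootSpace_zero hH h0 hz⟩
  -- Assume `α(t) = 0`. Then `ad t = [ad e, ad f]` commutes with `ad e` and `ad f` and is
  -- diagonalizable, hence zero; so `t` is central and `t = 0`. By `apply_br` this contradicts `α ≠
  -- 0` and `B(e, f) ≠ 0`.
  have hcomm : ∀ x : g, br t.1 x = 0 → Commute (br t.1 : Module.End ℂ g) (br x) := fun x hx => by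
    have := commutator_br h0 x
    rw [show br (br e f) x = 0 from hx, map_zero] at this
    exact sub_eq_zero.mp this
  have had : (br t.1 : Module.End ℂ g) = 0 :=
    eq_zero_of_heisenberg (commutator_br he0 f) (hcomm e (by rw [he t, ht, zero_smul]))
      (hcomm f (by rw [hf t, LinearMap.neg_apply, ht, neg_zero, zero_smul]))
      (hH.diagonalizable _ t.2)
  have ht0 : t.1 = 0 := hs.eq_zero_of_central h0 fun y => by
    have := skew_even h0 y
    rw [show br (br e f) = 0 from had] at this
    simpa using this.symm
  refine hα (LinearMap.ext fun h => ?_)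
  have := hB.apply_br hH (e := e) hf h
  rw [show br e f = 0 from ht0, map_zero] at this
  exact (mul_eq_zero.mp this.symm).resolve_right hef

/-- The bracket lies in `H`, and `apply_br` with `α = 0` makes it orthogonal to `H`, on which the
form is non-degenerate. -/
theorem br_eq_zero_of_odd_zero [FiniteDimensional ℂ g] {x y : g} (hx : x ∈ rootSpace H 0)
    (hx1 : x ∈ gr (g := g) 1) (hy : y ∈ rootSpace H 0) (hy1 : y ∈ gr (g := g) 1) :
    br x y = 0 := by
  have h0 : br x y ∈ gr (g := g) 0 := by
    simpa [show (1 + 1 : ZMod 2) = 0 from rfl] using br_mem hx1 hy1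
  have hz : br x y ∈ rootSpace H 0 := by simpa using br_mem_rootSpace hH hx hy
  refine hB.eq_zero_of_mem_cartan hH (mem_of_mem_rootSpace_zero hH h0 hz) fun h hh => ?_
  rw [hB.symm 0 0 h (hH.le_even hh) _ h0]
  have := hB.apply_br hH (α := 0) (e := x) (f := y) (by simpa using hy) ⟨h, hh⟩
  simp [this]

/-- There are no odd vectors of weight zero. -/
theorem eq_zero_of_odd_zero [FiniteDimensional ℂ g] (hs : IsSimple g) {y : g}
    (hy : y ∈ rootSpace H 0) (hy1 : y ∈ gr (g := g) 1) : y = 0 := by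
  have anti : ∀ x ∈ rootSpace H 0, x ∈ gr (g := g) 1 → ∀ y ∈ rootSpace H 0, y ∈ gr (g := g) 1 →
      ∀ z, br x (br y z) = -br y (br x z) := by
    intro x hx hx1 y hy hy1 z
    refine homogeneous_induction (P := fun z => br x (br y z) = -br y (br x z)) ?_ ?_ z
    · intro k z hz
      have := jacobi hx1 hy1 hz
      rw [hB.br_eq_zero_of_odd_zero hH hx hx1 hy hy1] at this
      simpa [ksign] using this
    · intro z z' h h'
      simp only [map_add, h, h']
      abel
  have sq : ∀ x ∈ rootSpace H 0, x ∈ gr (g := g) 1 → ∀ z, br x (br x z) = 0 := by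
    intro x hx hx1 z
    have h := anti x hx hx1 x hx hx1 z
    have h2 : (2 : ℂ) • br x (br x z) = 0 := by rw [two_smul]; nth_rw 2 [h]; exact add_neg_cancel _
    exact (smul_eq_zero.mp h2).resolve_left two_ne_zero
  have comm_root : ∀ α : Module.Dual ℂ H, α ≠ 0 → ∀ f ∈ rootSpace H (-α), f ∈ gr (g := g) 0 →
      br f y = 0 := by
    intro α hα f hf hf0
    by_cases hne : f = 0
    · rw [hne]; simp
    obtain ⟨e, he, he0, hef, t, ht, hαt⟩ := hB.exists_triple hH hs hα hf hf0 hne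
    -- The vector `f₁ = [x, [y, f]]` is even of weight `-α`. After subtracting `c f` it is
    -- orthogonal to `e`, so `e` annihilates it and `𝔰𝔩₂`-theory gives `f₁ = c f`. Applying `ad x`,
    -- whose square is zero, gives `c [x, f] = 0`. If `c = 0`, then `f₁ = 0`; if `[x, f] = 0`, the
    -- same follows because `ad x` and `ad y` anticommute.
    have double : ∀ x ∈ rootSpace H 0, x ∈ gr (g := g) 1 → br x (br y f) = 0 := by
      intro x hx hx1
      set f₁ := br x (br y f) with hf₁
      have hf₁m : f₁ ∈ rootSpace H (-α) := by
        simpa using br_mem_rootSpace hH hx (br_mem_rootSpace hH hy hf)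
      have hf₁0 : f₁ ∈ gr (g := g) 0 := by
        simpa [show (1 + 1 : ZMod 2) = 0 from rfl] using br_mem hx1 (br_mem hy1 hf0)
      set c := B e f₁ / B e f with hc
      have hu : f₁ - c • f ∈ rootSpace H (-α) := sub_mem hf₁m (Submodule.smul_mem _ _ hf)
      have hu0 : f₁ - c • f ∈ gr (g := g) 0 := sub_mem hf₁0 (Submodule.smul_mem _ _ hf0)
      have hBu : B e (f₁ - c • f) = 0 := by
        rw [map_sub, map_smul, hc, smul_eq_mul, div_mul_cancel₀ _ hef, sub_self]
      have heu0 : br e (f₁ - c • f) ∈ gr (g := g) 0 := by simpa using br_mem he0 hu0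
      have heu : br e (f₁ - c • f) = 0 := by
        refine hB.eq_zero_of_mem_cartan hH (mem_of_mem_rootSpace_zero hH heu0
          (by simpa using br_mem_rootSpace hH he hu)) fun h hh => ?_
        rw [hB.symm 0 0 h (hH.le_even hh) _ heu0, hB.apply_br hH hu ⟨h, hh⟩, hBu, mul_zero,
          smul_zero]
      have h1 := sub_eq_zero.mp (eq_zero_of_triple hH hf he0 ht hαt hu heu)
      have h2 : c • br x f = 0 := by
        rw [← map_smul, ← h1]
        exact sq x hx hx1 _
      rcases smul_eq_zero.mp h2 with h3 | h3
      · rw [h1, h3, zero_smul]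
      · rw [hf₁, anti x hx hx1 y hy hy1, h3, map_zero, neg_zero]
    have hyf : br y f ∈ rootSpace H (-α) := by simpa using br_mem_rootSpace hH hy hf
    have hyf1 : br y f ∈ gr (g := g) 1 := by simpa using br_mem hy1 hf0
    -- This vector is odd of weight zero. By invariance its pairing with such an `x` is `-B([x, [y,
    -- f]], e)`, which is zero by `double`. Then `[y, f]` has weight `-α` and is annihilated by `e`,
    -- so it vanishes too.
    have hz : br e (br y f) = 0 := by
      refine hB.eq_zero_of_orthogonal hH (β := 0) (i := 1)
        (by simpa using br_mem_rootSpace hH he hyf) (by simpa using br_mem he0 hyf1)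
        fun x hx hx1 => ?_
      rw [skew_even he0, map_neg, ← hB.inv, double x (by simpa using hx) hx1]
      simp
    rw [skew_even hf0, eq_zero_of_triple hH hf he0 ht hαt hyf hz, neg_zero]
  -- Even vectors of weight zero lie in `H` and act on `y` by the weight `0`; even root vectors
  -- commute with `y` by `comm_root`.
  have comm_even : ∀ x ∈ gr (g := g) 0, br x y = 0 := by
    intro x hx
    have hx' : x ∈ ⨆ α, rootSpace H α := iSup_rootSpace hH ▸ trivial
    rw [← even_of_even hx]
    clear hx
    induction hx' using Submodule.iSup_induction' with
    | mem α x hx =>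
      by_cases hα : α = 0
      · subst hα
        have := mem_of_mem_rootSpace_zero hH (even_mem x) (even_mem_rootSpace hH hx)
        simpa using hy ⟨_, this⟩
      · exact comm_root (-α) (neg_ne_zero.mpr hα) _
          (by simpa using even_mem_rootSpace hH hx) (even_mem x)
    | zero => simp
    | add x x' _ _ hx hx' => rw [map_add, map_add, LinearMap.add_apply, hx, hx', add_zero]
  refine hs.eq_zero_of_central hy1 fun u => ?_
  refine homogeneous_induction (P := fun u => br u y = 0) ?_ ?_ u
  · intro i u hu
    rcases zmod2_cases i with rfl | rfl
    · exact comm_even u hu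
    -- For odd `u`, the even vector `[u, y]` pairs with an even `x` as `B(u, [y, x])`, which is zero
    -- by `comm_even`. So `y` is central.
    · refine hB.nondeg.2 _ fun x => ?_
      refine homogeneous_induction (P := fun x => B x (br u y) = 0) ?_ ?_ x
      · intro j x hx
        have h0 : br u y ∈ gr (g := g) 0 := by
          simpa [show (1 + 1 : ZMod 2) = 0 from rfl] using br_mem hu hy1
        rcases zmod2_cases j with rfl | rfl
        · have h1 : br y x = 0 := by
            have := skew_even hx y
            rw [comm_even x hx, eq_comm, neg_eq_zero] at this
            exact this
          rw [hB.symm 0 0 x hx _ h0, hB.inv, h1, map_zero, smul_zero]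
        · exact hB.eq_zero_of_ne one_ne_zero hx h0
      · intro x x' h h'
        rw [map_add, LinearMap.add_apply, h, h', add_zero]
  · intro u u' h h'
    rw [map_add, LinearMap.add_apply, h, h', add_zero]

end IsInvariantForm

end LieSuperalgebra

/-! ### The subalgebra `𝔫⁻`, the triangular decomposition, and straightening of words -/

namespace LieSuperalgebra.Borel

variable {g : Type} [AddCommGroup g] [Module ℂ g] [LieSuperalgebra g] (b : Borel g)

/-- The weights in the real span of the roots that are negative for the order. -/
def IsNeg (α : Module.Dual ℂ b.H) : Prop :=
  ∃ h : α ∈ Submodule.span ℝ (roots b.H), b.lt ⟨α, h⟩ 0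

theorem isNeg_of_mem_neg {α : Module.Dual ℂ b.H} (h : α ∈ b.neg) : b.IsNeg α :=
  ⟨Submodule.subset_span h.1, h.2⟩

theorem IsNeg.add {α β : Module.Dual ℂ b.H} (hα : b.IsNeg α) (hβ : b.IsNeg β) :
    b.IsNeg (α + β) := by
  obtain ⟨h, hα⟩ := hα
  obtain ⟨h', hβ⟩ := hβ
  have := b.total
  refine ⟨add_mem h h', ?_⟩
  have h1 := b.add_lt _ _ ⟨β, h'⟩ hα
  rw [zero_add] at h1
  exact _root_.trans h1 hβ

theorem not_isNeg_zero : ¬ b.IsNeg 0 := fun ⟨_, h⟩ => by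
  have := b.total
  exact irrefl_of b.lt _ h

theorem IsNeg.sum_map {ι : Type} {β : ι → Module.Dual ℂ b.H} (hβ : ∀ i, b.IsNeg (β i))
    {l : List ι} (hl : l ≠ []) : b.IsNeg (l.map β).sum := by
  induction l with
  | nil => exact absurd rfl hl
  | cons i l ih =>
    by_cases h : l = []
    · simpa [h] using hβ i
    · simpa using IsNeg.add b (hβ i) (ih h)

/-- A negative weight is either a negative root or has no vectors. This allows sums of negative
roots that are not roots. -/
theorem IsNeg.rootSpace_le {α : Module.Dual ℂ b.H} (hα : b.IsNeg α) :
    rootSpace b.H α ≤ b.nNeg := by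
  by_cases h : rootSpace b.H α = ⊥
  · rw [h]; exact bot_le
  · obtain ⟨h1, h2⟩ := hα
    have h0 : α ≠ 0 := fun h0 => b.not_isNeg_zero ⟨h0 ▸ h1, by subst h0; exact h2⟩
    exact le_iSup₂ (f := fun α (_ : α ∈ b.neg) => rootSpace b.H α) α ⟨⟨h0, h⟩, h2⟩

theorem br_mem_nNeg {x y : g} (hx : x ∈ b.nNeg) (hy : y ∈ b.nNeg) : br x y ∈ b.nNeg := by
  have h : b.nNeg ≤ b.nNeg.comap (br.flip y) := by
    refine iSup₂_le fun α hα x hx => ?_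
    have h' : b.nNeg ≤ b.nNeg.comap (br x) := by
      refine iSup₂_le fun β hβ y hy => ?_
      exact IsNeg.rootSpace_le b (IsNeg.add b (b.isNeg_of_mem_neg hα) (b.isNeg_of_mem_neg hβ))
        (br_mem_rootSpace b.isCartan hx hy)
    exact h' hy
  exact h hx

theorem neg_mem_pos {α : Module.Dual ℂ b.H} (hα : α ∈ b.neg) (h : rootSpace b.H (-α) ≠ ⊥) :
    -α ∈ b.pos := by
  obtain ⟨h1, h2⟩ := hα
  refine ⟨⟨neg_ne_zero.mpr h1.1, h⟩, ?_⟩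
  have := b.add_lt _ _ (-⟨α, Submodule.subset_span h1⟩) h2
  rw [add_neg_cancel, zero_add] at this
  exact this

/-- Nonzero weights with vectors are positive or negative roots because the order is total. The part
of weight zero is `H` because it has no odd vectors. -/
theorem triangular [FiniteDimensional ℂ g] (hg : IsBasic g) : b.H ⊔ b.nPos ⊔ b.nNeg = ⊤ := by
  obtain ⟨B, h1, h2, h3, h4⟩ := hg.form
  have hB : IsInvariantForm B := ⟨h1, h2, h3, h4⟩
  rw [eq_top_iff, ← iSup_rootSpace b.isCartan]
  refine iSup_le fun α => ?_
  by_cases hα : α = 0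
  · intro x hx
    subst hα
    have h5 := hB.eq_zero_of_odd_zero b.isCartan hg.simple (odd_mem_rootSpace b.isCartan hx)
      (odd_mem x)
    have h6 := mem_of_mem_rootSpace_zero b.isCartan (even_mem x)
      (even_mem_rootSpace b.isCartan hx)
    rw [← even_add_odd x, h5, add_zero]
    exact Submodule.mem_sup_left (Submodule.mem_sup_left h6)
  by_cases h : rootSpace b.H α = ⊥
  · rw [h]; exact bot_le
  have hr : α ∈ roots b.H := ⟨hα, h⟩
  have := b.total
  rcases trichotomous_of b.lt (⟨α, Submodule.subset_span hr⟩ : RootSpan b.H) 0 with h | h | h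
  · exact (IsNeg.rootSpace_le b ⟨_, h⟩).trans le_sup_right
  · exact absurd (congrArg Subtype.val h) hα
  · exact (le_iSup₂ (f := fun α (_ : α ∈ b.pos) => rootSpace b.H α) α ⟨hr, h⟩).trans
      (le_sup_right.trans le_sup_left)

/-- A homogeneous spanning family of `𝔫⁻`. -/
structure NegFamily (ι : Type) where
  y : ι → g
  q : ι → ZMod 2
  mem : ∀ i, y i ∈ gr (g := g) (q i)
  span : Submodule.span ℂ (Set.range y) = b.nNeg

/-- There is a finite spanning family of `𝔫⁻` that consists of root vectors. -/
theorem exists_root_family [FiniteDimensional ℂ g] : ∃ (n : ℕ) (Y : b.NegFamily (Fin n))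
    (β : Fin n → Module.Dual ℂ b.H), (∀ i, β i ∈ b.neg) ∧ ∀ i, Y.y i ∈ rootSpace b.H (β i) := by
  -- Root vectors that are also homogeneous: both components of a root vector have the same weight,
  -- since `H` is even.
  let Z : Set g := {x | ∃ β ∈ b.neg, ∃ q : ZMod 2, x ∈ rootSpace b.H β ∧ x ∈ gr (g := g) q}
  have hZ : Submodule.span ℂ Z = b.nNeg := by
    refine le_antisymm (Submodule.span_le.mpr ?_) (iSup₂_le fun α hα x hx => ?_)
    · rintro x ⟨β, hβ, q, hx, -⟩
      exact IsNeg.rootSpace_le b (b.isNeg_of_mem_neg hβ) hx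
    · rw [← even_add_odd x]
      exact add_mem (Submodule.subset_span ⟨α, hα, 0, even_mem_rootSpace b.isCartan hx, even_mem x⟩)
        (Submodule.subset_span ⟨α, hα, 1, odd_mem_rootSpace b.isCartan hx, odd_mem x⟩)
  obtain ⟨f, hf, hs, -⟩ := Submodule.exists_fun_fin_finrank_span_eq ℂ Z
  choose β hβ q h1 h2 using hf
  exact ⟨_, ⟨f, q, h2, hs.trans hZ⟩, β, hβ, h1⟩

namespace NegFamily

variable {b} {ι : Type} (Y : b.NegFamily ι)

theorem y_mem (i : ι) : Y.y i ∈ b.nNeg := Y.span ▸ Submodule.subset_span ⟨i, rfl⟩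

/-- The product of the family along a list. -/
def word (l : List ι) : Env g := (l.map fun i => Env.ι g (Y.y i)).prod

@[simp] theorem word_nil : Y.word [] = 1 := rfl
@[simp] theorem word_cons (i : ι) (l : List ι) : Y.word (i :: l) = Env.ι g (Y.y i) * Y.word l := by
  simp [word]
theorem word_append (l l' : List ι) : Y.word (l ++ l') = Y.word l * Y.word l' := by simp [word]
theorem word_replicate (n : ℕ) (i : ι) : Y.word (List.replicate n i) = Env.ι g (Y.y i) ^ n := by
  simp [word]

/-- The span of the products of fewer than `n` factors. -/
def below (n : ℕ) : Submodule ℂ (Env g) := Submodule.span ℂ {u | ∃ l, l.length < n ∧ u = Y.word l}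

theorem word_mem_below {l : List ι} {n : ℕ} (h : l.length < n) : Y.word l ∈ Y.below n :=
  Submodule.subset_span ⟨l, h, rfl⟩

theorem ι_mul_word_mem {x : g} (hx : x ∈ b.nNeg) (l : List ι) {n : ℕ} (h : l.length + 1 < n) :
    Env.ι g x * Y.word l ∈ Y.below n := by
  rw [← Y.span] at hx
  induction hx using Submodule.span_induction with
  | mem x hx =>
    obtain ⟨i, rfl⟩ := hx
    rw [← word_cons]
    exact Y.word_mem_below h
  | zero => simp
  | add x y _ _ hx hy => rw [map_add, add_mul]; exact add_mem hx hy
  | smul c x _ hx => rw [map_smul, smul_mul_assoc]; exact Submodule.smul_mem _ _ hx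

theorem y_mul_mem_below (i : ι) {u : Env g} {n : ℕ} (hu : u ∈ Y.below n) :
    Env.ι g (Y.y i) * u ∈ Y.below (n + 1) := by
  induction hu using Submodule.span_induction with
  | mem u hu =>
    obtain ⟨l, hl, rfl⟩ := hu
    rw [← word_cons]
    exact Y.word_mem_below (by simpa using hl)
  | zero => simp
  | add x y _ _ hx hy => rw [mul_add]; exact add_mem hx hy
  | smul c x _ hx => rw [mul_smul_comm]; exact Submodule.smul_mem _ _ hx

/-- A permutation of the factors changes a product by a sign, up to shorter products. -/
theorem word_perm {l l' : List ι} (h : l.Perm l') :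
    ∃ c : ℂ, Y.word l - c • Y.word l' ∈ Y.below l.length := by
  induction h with
  | nil => exact ⟨1, by simp⟩
  | @cons i l l' _ ih =>
    obtain ⟨c, hc⟩ := ih
    refine ⟨c, ?_⟩
    rw [word_cons, word_cons, ← mul_smul_comm, ← mul_sub]
    exact Y.y_mul_mem_below i hc
  | swap i j l =>
    refine ⟨ksign (Y.q j) (Y.q i), ?_⟩
    rw [word_cons, word_cons, word_cons, word_cons, ← mul_assoc, ← mul_assoc,
      Env.ι_mul_ι (Y.mem j) (Y.mem i), add_mul, smul_mul_assoc, add_sub_cancel_left]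
    exact Y.ι_mul_word_mem (b.br_mem_nNeg (Y.y_mem _) (Y.y_mem _)) l (by simp)
  | trans h _ ih ih' =>
    obtain ⟨c, hc⟩ := ih
    obtain ⟨c', hc'⟩ := ih'
    refine ⟨c * c', ?_⟩
    rw [← h.length_eq] at hc'
    have := add_mem hc (Submodule.smul_mem _ c hc')
    rwa [smul_sub, smul_smul, sub_add_sub_cancel] at this

theorem word_mem_of_perm {l l' : List ι} (h : l.Perm l') {P : Submodule ℂ (Env g)}
    (hP : Y.below l.length ≤ P) (h' : Y.word l' ∈ P) : Y.word l ∈ P := by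
  obtain ⟨c, hc⟩ := Y.word_perm h
  have := add_mem (hP hc) (Submodule.smul_mem _ c h')
  rwa [sub_add_cancel] at this

/-- A product in which an odd factor occurs twice is a combination of shorter products. -/
theorem word_mem_of_odd [DecidableEq ι] {l : List ι} {i : ι} (hi : Y.q i = 1)
    (h : 2 ≤ l.count i) : Y.word l ∈ Y.below l.length := by
  obtain ⟨l', hl'⟩ : ∃ l', l.Perm (i :: i :: l') :=
    ((List.replicate_sublist_iff (n := 2)).mpr h).exists_perm_append
  refine Y.word_mem_of_perm hl' le_rfl ?_
  rw [word_cons, word_cons, ← mul_assoc]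
  -- For odd `y` the defining relation of `U(g)` reads `y y = -y y + [y, y]`.
  have hsq : Env.ι g (Y.y i) * Env.ι g (Y.y i) = Env.ι g ((1 / 2 : ℂ) • br (Y.y i) (Y.y i)) := by
    have := Env.ι_mul_ι (Y.mem i) (Y.mem i)
    rw [hi] at this
    simp only [ksign, and_self, if_true, neg_smul, one_smul] at this
    rw [map_smul, ← sub_eq_iff_eq_add'.mpr this, sub_neg_eq_add, ← two_smul ℂ, smul_smul]
    norm_num
  rw [hsq]
  exact Y.ι_mul_word_mem (Submodule.smul_mem _ _ (b.br_mem_nNeg (Y.y_mem _) (Y.y_mem _))) l'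
    (by rw [hl'.length_eq]; simp)

end NegFamily

end LieSuperalgebra.Borel

/-! ### Highest weight vectors -/

section highestWeight

open LieSuperalgebra.Borel

variable {g : Type} [AddCommGroup g] [Module ℂ g] [LieSuperalgebra g] (b : Borel g)
  (μ : Module.Dual ℂ b.H)
variable {V : Type} [AddCommGroup V] [Module ℂ V] [Module (Env g) V] [IsScalarTower ℂ (Env g) V]

/-- `v` is a highest weight vector of weight `μ` in a `U(g)`-module. -/
structure IsHighestWeight (v : V) : Prop where
  nPos : ∀ x ∈ b.nPos, Env.ι g x • v = 0
  weight : ∀ h : b.H, Env.ι g h.1 • v = μ h • v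

variable {b μ} {v : V}

theorem smul_comm_env (c : ℂ) (u : Env g) (w : V) : u • c • w = c • u • w := by
  rw [← smul_assoc c u w, ← algebraMap_smul (Env g) c w, smul_smul, ← Algebra.commutes,
    ← Algebra.smul_def]

/-- The span of the words in `𝔫⁻` applied to `v` is stable under `g`: in a word, `x` is moved to the
right until it meets `v`, where the triangular decomposition applies. This is the spanning half of
the Poincaré–Birkhoff–Witt theorem, the only half that is needed. -/
theorem IsHighestWeight.span_word [FiniteDimensional ℂ g] (hg : IsBasic g) {ι : Type}
    (hv : IsHighestWeight b μ v) (Y : b.NegFamily ι) (u : Env g) :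
    u • v ∈ Submodule.span ℂ {w | ∃ l, w = Y.word l • v} := by
  set W := Submodule.span ℂ {w | ∃ l, w = Y.word l • v} with hW
  have hy : ∀ i, ∀ w ∈ W, Env.ι g (Y.y i) • w ∈ W := by
    intro i w hw
    induction hw using Submodule.span_induction with
    | mem w hw =>
      obtain ⟨l, rfl⟩ := hw
      rw [smul_smul, ← NegFamily.word_cons]
      exact Submodule.subset_span ⟨_, rfl⟩
    | zero => rw [smul_zero]; exact zero_mem _
    | add x y _ _ hx hy => rw [smul_add]; exact add_mem hx hy
    | smul c x _ hx => rw [smul_comm_env]; exact Submodule.smul_mem _ _ hx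
  -- The claim is made for all `x` at once, because moving `x` past `y_i` produces the new element
  -- `[x, y_i]` in front of the shorter word.
  have hx : ∀ (l : List ι) (x : g), Env.ι g x • Y.word l • v ∈ W := by
    intro l
    induction l with
    | nil =>
      intro x
      rw [NegFamily.word_nil, one_smul]
      have hv0 : v ∈ W := Submodule.subset_span ⟨[], by simp⟩
      have hx : x ∈ b.H ⊔ b.nPos ⊔ b.nNeg := b.triangular hg ▸ trivial
      obtain ⟨x₁, hx₁, z, hz, rfl⟩ := Submodule.mem_sup.mp hx
      obtain ⟨h, hh, p, hp, rfl⟩ := Submodule.mem_sup.mp hx₁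
      rw [map_add, map_add, add_smul, add_smul, hv.nPos p hp, hv.weight ⟨h, hh⟩, add_zero]
      refine add_mem (Submodule.smul_mem _ _ hv0) ?_
      rw [← Y.span] at hz
      clear hx
      induction hz using Submodule.span_induction with
      | mem x hx => obtain ⟨i, rfl⟩ := hx; exact hy i v hv0
      | zero => rw [map_zero, zero_smul]; exact zero_mem _
      | add x y _ _ hx hy => rw [map_add, add_smul]; exact add_mem hx hy
      | smul c x _ hx => rw [map_smul, smul_assoc]; exact Submodule.smul_mem _ _ hx
    | cons i l ih =>
      intro x
      refine homogeneous_induction (P := fun x => Env.ι g x • Y.word (i :: l) • v ∈ W) ?_ ?_ x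
      · intro j x hx
        rw [NegFamily.word_cons, smul_smul, ← mul_assoc, Env.ι_mul_ι hx (Y.mem i), add_mul,
          add_smul, smul_mul_assoc, smul_assoc, mul_assoc, mul_smul, mul_smul, mul_smul]
        exact add_mem (Submodule.smul_mem _ _ (hy i _ (ih x))) (ih _)
      · intro x y h h'
        rw [map_add, add_smul]; exact add_mem h h'
  have hall : ∀ u : Env g, ∀ w ∈ W, u • w ∈ W := by
    intro u
    induction u using Env.induction with
    | hι i x hi =>
      intro w hw
      induction hw using Submodule.span_induction with
      | mem w hw => obtain ⟨l, rfl⟩ := hw; exact hx l x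
      | zero => rw [smul_zero]; exact zero_mem _
      | add x y _ _ hx hy => rw [smul_add]; exact add_mem hx hy
      | smul c x _ hx => rw [smul_comm_env]; exact Submodule.smul_mem _ _ hx
    | hc c =>
      intro w hw
      rw [algebraMap_smul]; exact Submodule.smul_mem _ _ hw
    | hadd u u' h h' => intro w hw; rw [add_smul]; exact add_mem (h w hw) (h' w hw)
    | hmul u u' h h' => intro w hw; rw [mul_smul]; exact h _ (h' w hw)
  exact hall u v (Submodule.subset_span ⟨[], by simp⟩)

theorem IsHighestWeight.weight_word {ι : Type} (hv : IsHighestWeight b μ v) (Y : b.NegFamily ι)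
    {β : ι → Module.Dual ℂ b.H} (hβ : ∀ i, Y.y i ∈ rootSpace b.H (β i)) (l : List ι) (h : b.H) :
    Env.ι g h.1 • Y.word l • v = (μ + (l.map β).sum) h • Y.word l • v := by
  induction l with
  | nil => simp [hv.weight]
  | cons i l ih =>
    have hc : Env.ι g h.1 * Env.ι g (Y.y i) =
        Env.ι g (Y.y i) * Env.ι g h.1 + β i h • Env.ι g (Y.y i) := by
      have := Env.ι_mul_ι (b.isCartan.le_even h.2) (Y.mem i)
      rw [hβ i h, map_smul] at this
      simpa [ksign] using this
    rw [NegFamily.word_cons, smul_smul, ← mul_assoc, hc, add_mul, add_smul, smul_mul_assoc,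
      smul_assoc, mul_assoc, mul_smul, mul_smul, ih, smul_comm_env, ← mul_smul, ← add_smul]
    congr 1
    simp only [List.map_cons, List.sum_cons, LinearMap.add_apply]
    ring

/-- In a finite-dimensional module, long products of negative root vectors annihilate a highest
weight vector. -/
theorem IsHighestWeight.word_root_eq_zero [FiniteDimensional ℂ V] {ι : Type}
    (hv : IsHighestWeight b μ v) (Y : b.NegFamily ι) {β : ι → Module.Dual ℂ b.H}
    (hβ : ∀ i, Y.y i ∈ rootSpace b.H (β i)) (hn : ∀ i, β i ∈ b.neg) {l : List ι}
    (hl : Module.finrank ℂ V ≤ l.length) : Y.word l • v = 0 := by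
  by_contra hne
  -- If the word does not annihilate `v`, neither does any of its `l.length + 1` suffixes. The
  -- weights of these vectors are distinct, because two of them differ by a nonempty sum of negative
  -- roots. This is more independent vectors than the dimension allows.
  have hli := linearIndependent_of_weights
    (fun h : b.H => (Algebra.lsmul ℂ ℂ V (Env.ι g h.1) : Module.End ℂ V))
    (fun (j : Fin (l.length + 1)) h => (μ + ((l.drop j).map β).sum) h) ?_
    (fun j => Y.word (l.drop j) • v) ?_ ?_
  · have := hli.fintype_card_le_finrank
    simp at this
    omega
  · have key : ∀ j k : Fin (l.length + 1), j < k →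
        (fun h => (μ + ((l.drop j).map β).sum) h) ≠ fun h => (μ + ((l.drop k).map β).sum) h := by
      intro j k hjk he
      have he' : μ + ((l.drop j).map β).sum = μ + ((l.drop k).map β).sum :=
        LinearMap.ext fun h => congrFun he h
      have hk := k.2
      have hs : l.drop j = (l.drop j).take (k - j) ++ l.drop k := by
        conv_lhs => rw [← List.take_append_drop (k - j) (l.drop j), List.drop_drop]
        congr 2
        omega
      rw [hs, List.map_append, List.sum_append, add_right_inj, add_eq_right] at he'
      refine b.not_isNeg_zero (he' ▸ IsNeg.sum_map b (fun i => b.isNeg_of_mem_neg (hn i)) ?_)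
      intro h0
      have := congrArg List.length h0
      simp only [List.length_take, List.length_drop, List.length_nil] at this
      omega
    intro j k hjk
    rcases lt_trichotomy j k with h | h | h
    · exact absurd hjk (key j k h)
    · exact h
    · exact absurd hjk.symm (key k j h)
  · intro j h0
    apply hne
    rw [← List.take_append_drop j l, NegFamily.word_append, mul_smul, h0, smul_zero]
  · intro j h
    exact hv.weight_word Y hβ _ h

/-- The family `Y` need not consist of weight vectors. A word in `Y` is a combination of words of
the same length in root vectors, to which `word_root_eq_zero` applies. -/
theorem IsHighestWeight.word_eq_zero [FiniteDimensional ℂ g] [FiniteDimensional ℂ V] {ι : Type}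
    (hv : IsHighestWeight b μ v) (Y : b.NegFamily ι) {l : List ι}
    (hl : Module.finrank ℂ V ≤ l.length) : Y.word l • v = 0 := by
  obtain ⟨n, Z, β, hn, hβ⟩ := b.exists_root_family
  have key : ∀ l : List ι,
      Y.word l ∈ Submodule.span ℂ {u | ∃ l', l'.length = l.length ∧ u = Z.word l'} := by
    intro l
    induction l with
    | nil => exact Submodule.subset_span ⟨[], rfl, rfl⟩
    | cons i l ih =>
      rw [NegFamily.word_cons]
      have hi := Y.y_mem i
      rw [← Z.span] at hi
      refine Submodule.span_induction (p := fun x _ => Env.ι g x * Y.word l ∈ _) ?_ ?_ ?_ ?_ hi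
      · rintro _ ⟨k, rfl⟩
        refine Submodule.span_induction (p := fun x _ => Env.ι g (Z.y k) * x ∈ _) ?_ ?_ ?_ ?_ ih
        · rintro _ ⟨l', hl', rfl⟩
          exact Submodule.subset_span ⟨k :: l', by simp [hl'], by simp⟩
        · rw [mul_zero]; exact zero_mem _
        · intro x y _ _ h h'
          rw [mul_add]; exact add_mem h h'
        · intro c x _ h
          rw [mul_smul_comm]; exact Submodule.smul_mem _ _ h
      · rw [map_zero, zero_mul]; exact zero_mem _
      · intro x y _ _ h h'
        rw [map_add, add_mul]; exact add_mem h h'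
      · intro c x _ h
        rw [map_smul, smul_mul_assoc]; exact Submodule.smul_mem _ _ h
  refine Submodule.span_induction (p := fun u _ => u • v = 0) ?_ ?_ ?_ ?_ (key l)
  · rintro _ ⟨l', hl', rfl⟩
    exact hv.word_root_eq_zero Z hβ hn (hl' ▸ hl)
  · rw [zero_smul]
  · intro x y _ _ h h'
    rw [add_smul, h, h', add_zero]
  · intro c x _ h
    rw [smul_assoc, h, smul_zero]

/-- The order of nilpotency of an even negative root vector on a highest weight vector of a
finite-dimensional module is bounded in terms of the weight. -/
theorem exists_pow_smul_eq_zero [FiniteDimensional ℂ g] (hg : IsBasic g) (b : Borel g)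
    (μ : Module.Dual ℂ b.H) {β : Module.Dual ℂ b.H} (hβ : β ∈ b.neg) {f : g}
    (hf : f ∈ rootSpace b.H β) (hf0 : f ∈ gr (g := g) 0) :
    ∃ n : ℕ, ∀ (V : Type) [AddCommGroup V] [Module ℂ V] [Module (Env g) V]
      [IsScalarTower ℂ (Env g) V] [FiniteDimensional ℂ V] (v : V), IsHighestWeight b μ v →
      Env.ι g f ^ n • v = 0 := by
  by_cases hne : f = 0
  · exact ⟨1, fun V _ _ _ _ _ v _ => by simp [hne]⟩
  obtain ⟨B, h1, h2, h3, h4⟩ := hg.form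
  have hB : IsInvariantForm B := ⟨h1, h2, h3, h4⟩
  obtain ⟨e, he, he0, hef, t, ht, hαt⟩ := hB.exists_triple b.isCartan hg.simple
    (neg_ne_zero.mpr hβ.1.1) (by simpa using hf) hf0 hne
  have hpos : e ∈ b.nPos := by
    refine le_iSup₂ (f := fun α (_ : α ∈ b.pos) => rootSpace b.H α) (-β)
      (b.neg_mem_pos hβ fun h => hef ?_) he
    rw [h, Submodule.mem_bot] at he
    simp [he]
  have key : ∀ (V : Type) [AddCommGroup V] [Module ℂ V] [Module (Env g) V]
      [IsScalarTower ℂ (Env g) V] [FiniteDimensional ℂ V] (v : V), IsHighestWeight b μ v →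
      v ≠ 0 → ∃ n : ℕ, 2 * μ t = (-β) t * n ∧ Env.ι g f ^ (n + 1) • v = 0 := by
    intro V _ _ _ _ _ v hv hv0
    let ρ : Env g →ₐ[ℂ] Module.End ℂ V := Algebra.lsmul ℂ ℂ V
    have h5 : ρ (Env.ι g e) * ρ (Env.ι g f) - ρ (Env.ι g f) * ρ (Env.ι g e) = ρ (Env.ι g t.1) := by
      have := Env.ι_mul_ι he0 hf0
      simp only [ksign, zero_ne_one, false_and, if_false, one_smul, ht] at this
      rw [← map_mul ρ, ← map_mul ρ, ← map_sub, this, add_sub_cancel_left]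
    have h6 : ρ (Env.ι g t.1) * ρ (Env.ι g f) - ρ (Env.ι g f) * ρ (Env.ι g t.1) =
        -((-β) t • ρ (Env.ι g f)) := by
      have := Env.ι_mul_ι (b.isCartan.le_even t.2) hf0
      simp only [ksign, zero_ne_one, false_and, if_false, one_smul, hf t] at this
      rw [← map_mul ρ, ← map_mul ρ, ← map_sub, this, add_sub_cancel_left]
      simp
    obtain ⟨n, hn, hn'⟩ := sl2_highest hαt h5 h6 hv0 (hv.nPos e hpos) (hv.weight t)
    refine ⟨n, hn, ?_⟩
    rw [← map_pow] at hn'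
    exact hn'
  -- The triple and this condition do not involve `V`. If the condition holds, it determines `n`,
  -- and the exponent `n + 1` works for all `V`. Otherwise no `V` has a nonzero highest weight
  -- vector of weight `μ`, and the exponent `0` works.
  by_cases hex : ∃ n : ℕ, 2 * μ t = (-β) t * n
  · obtain ⟨n, hn⟩ := hex
    refine ⟨n + 1, fun V _ _ _ _ _ v hv => ?_⟩
    by_cases hv0 : v = 0
    · rw [hv0, smul_zero]
    obtain ⟨m, hm, hm'⟩ := key V v hv hv0
    have : (m : ℂ) = n := mul_left_cancel₀ hαt (hm.symm.trans hn)
    rwa [show m = n by exact_mod_cast this] at hm'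
  · refine ⟨0, fun V _ _ _ _ _ v hv => ?_⟩
    by_contra hv0
    obtain ⟨m, hm, -⟩ := key V v hv (by simpa using hv0)
    exact hex ⟨m, hm⟩

/-- The submodule `N` is not assumed to be graded here, since `kIdeal` is an intersection over all
submodules of finite codimension. -/
theorem isHighestWeight_quot (N : Submodule (Env g) (Verma b μ)) :
    IsHighestWeight b μ
      (Submodule.Quotient.mk (Submodule.Quotient.mk 1) : Verma b μ ⧸ N) where
  nPos x hx := by
    have h : (Submodule.Quotient.mk (Env.ι g x * 1) : Verma b μ) = 0 := by
      rw [Submodule.Quotient.mk_eq_zero, mul_one]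
      exact Submodule.subset_span (Or.inl ⟨x, hx, rfl⟩)
    exact (congrArg (Submodule.Quotient.mk (p := N)) h).trans (Submodule.Quotient.mk_zero N)
  weight h := by
    have h : (Submodule.Quotient.mk (Env.ι g h.1 * 1) : Verma b μ) =
        Submodule.Quotient.mk (μ h • 1) := by
      rw [Submodule.Quotient.eq, mul_one, ← Algebra.algebraMap_eq_smul_one]
      exact Submodule.subset_span (Or.inr ⟨h, rfl⟩)
    exact congrArg (Submodule.Quotient.mk (p := N)) h

theorem isHighestWeight_v : IsHighestWeight b μ (KMod.v b μ) := isHighestWeight_quot _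

theorem exists_smul_v (x : KMod b μ) : ∃ u : Env g, x = u • KMod.v b μ := by
  obtain ⟨u, rfl⟩ := kOrbit_surjective x
  exact ⟨u, kOrbit_apply u⟩

/-- `K_𝔟(μ)` is finite-dimensional. -/
theorem finiteDimensional_kMod [FiniteDimensional ℂ g] (hg : IsBasic g) (b : Borel g)
    (μ : Module.Dual ℂ b.H) : FiniteDimensional ℂ (KMod b μ) := by
  classical
  obtain ⟨r, Y, β, hn, hβ⟩ := b.exists_root_family
  -- The exponent is the same for all finite-dimensional quotients, so the power of `y_i` sends the
  -- highest weight vector into every `N`, and hence into their intersection.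
  have hpow : ∀ i, ∃ n : ℕ, Y.q i = 0 → Env.ι g (Y.y i) ^ n • KMod.v b μ = 0 := by
    intro i
    by_cases hi : Y.q i = 0
    · obtain ⟨n, h⟩ := exists_pow_smul_eq_zero hg b μ (hn i) (hβ i) (hi ▸ Y.mem i)
      refine ⟨n, fun _ => ?_⟩
      refine (Submodule.Quotient.mk_eq_zero (kIdeal b μ)
        (x := Env.ι g (Y.y i) ^ n • (Submodule.Quotient.mk 1 : Verma b μ))).mpr ?_
      rw [kIdeal, Submodule.mem_sInf]
      intro N hN
      have : FiniteDimensional ℂ (Verma b μ ⧸ N) := hN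
      exact (Submodule.Quotient.mk_eq_zero N).mp (h _ _ (isHighestWeight_quot N))
    · exact ⟨0, fun h => absurd h hi⟩
  choose n hpow using hpow
  -- In a word longer than `D`, some letter `i` occurs at least `n i + 2` times. This is enough to
  -- annihilate `v` if the letter is even, and to shorten the word if it is odd. So words of length
  -- at most `D` span.
  set D := ∑ i, (n i + 2) with hD
  let W : Submodule ℂ (KMod b μ) :=
    Submodule.span ℂ ((fun l => Y.word l • KMod.v b μ) '' {l : List (Fin r) | l.length < D + 1})
  have hW : ∀ m : ℕ, ∀ u ∈ Y.below m, u • KMod.v b μ ∈ W := by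
    intro m
    induction m with
    | zero =>
      intro u hu
      have : Y.below 0 = ⊥ := by simp [NegFamily.below]
      rw [this, Submodule.mem_bot] at hu
      rw [hu, zero_smul]; exact zero_mem _
    | succ m ih =>
      let P : Submodule ℂ (Env g) := W.comap (LinearMap.flip (Algebra.lsmul ℂ ℂ
        (KMod b μ)).toLinearMap (KMod.v b μ))
      have hP : Y.below m ≤ P := ih
      suffices h : Y.below (m + 1) ≤ P from fun u hu => h hu
      refine Submodule.span_le.mpr ?_
      rintro _ ⟨l, hl, rfl⟩
      rcases Nat.lt_succ_iff_lt_or_eq.mp hl with hl | hl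
      · exact hP (Y.word_mem_below hl)
      by_cases hlD : l.length < D + 1
      · exact Submodule.subset_span ⟨l, hlD, rfl⟩
      obtain ⟨i, hi⟩ : ∃ i, n i + 2 ≤ l.count i := by
        by_contra! h
        have h1 : ∑ i, l.count i = l.length := by
          have := Multiset.sum_count_eq_card (s := Finset.univ) (m := (l : Multiset (Fin r)))
            (fun a _ => Finset.mem_univ a)
          simpa using this
        have h2 : ∑ i, l.count i ≤ D := Finset.sum_le_sum fun i _ => (h i).le
        omega
      rcases zmod2_cases (Y.q i) with hq | hq
      · obtain ⟨l', hl'⟩ : ∃ l', l.Perm (List.replicate (n i) i ++ l') :=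
          ((List.replicate_sublist_iff).mpr (by omega)).exists_perm_append
        refine Y.word_mem_of_perm (hl'.trans List.perm_append_comm) (hl ▸ hP) ?_
        change (Y.word _) • KMod.v b μ ∈ W
        rw [NegFamily.word_append, NegFamily.word_replicate, mul_smul, hpow i hq, smul_zero]
        exact zero_mem _
      · exact (hl ▸ hP) (Y.word_mem_of_odd hq (by omega))
  have htop : W = ⊤ := by
    rw [eq_top_iff]
    intro x _
    obtain ⟨u, rfl⟩ := exists_smul_v x
    refine Submodule.span_le.mpr ?_ (isHighestWeight_v.span_word hg Y u)
    rintro _ ⟨l, rfl⟩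
    exact hW _ _ (Y.word_mem_below (Nat.lt_succ_self _))
  exact ⟨htop ▸ Submodule.fg_span ((List.finite_length_lt (Fin r) (D + 1)).image _)⟩

end highestWeight

/-! ### Signs -/

section signs

variable {ι : Type} (p : ι → ZMod 2)

/-- The sign for moving a variable of index `i` past the monomial with exponent `d` in the variables
of the list `r`. -/
def passSign (r : List ι) (i : ι) (d : ι → ℕ) : ℂ := (r.map fun k => ksign (p i) (p k) ^ d k).prod

/-- The sign in the product of the ascending monomials with exponents `d'` and `d`, in this order,
in the variables of the list `r`, which is in descending order. -/
def mulSign : List ι → (ι → ℕ) → (ι → ℕ) → ℂ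
  | [], _, _ => 1
  | i :: r, d, d' => passSign p r i d ^ d' i * mulSign r d d'

theorem ksign_eq_or (i j : ZMod 2) : ksign i j = 1 ∨ ksign i j = -1 := by
  unfold ksign; split <;> simp

theorem ksign_comm (i j : ZMod 2) : ksign i j = ksign j i := by simp [ksign, and_comm]

theorem passSign_eq_or (r : List ι) (i : ι) (d : ι → ℕ) :
    passSign p r i d = 1 ∨ passSign p r i d = -1 := by
  induction r with
  | nil => simp [passSign]
  | cons k r ih =>
    have h : passSign p (k :: r) i d = ksign (p i) (p k) ^ d k * passSign p r i d := by
      simp [passSign]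
    rw [h]
    rcases ih with h | h <;> rcases ksign_eq_or (p i) (p k) with h' | h' <;>
      rcases neg_one_pow_eq_or ℂ (d k) with h'' | h'' <;> simp [h, h', h'']

theorem mulSign_eq_or (r : List ι) (d d' : ι → ℕ) :
    mulSign p r d d' = 1 ∨ mulSign p r d d' = -1 := by
  induction r with
  | nil => simp [mulSign]
  | cons i r ih =>
    rw [mulSign]
    rcases ih with h | h <;> rcases passSign_eq_or p r i d with h' | h' <;>
      rcases neg_one_pow_eq_or ℂ (d' i) with h'' | h'' <;> simp [h, h', h'']

theorem mulSign_ne_zero (r : List ι) (d d' : ι → ℕ) : mulSign p r d d' ≠ 0 := by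
  rcases mulSign_eq_or p r d d' with h | h <;> simp [h]

theorem passSign_congr {r : List ι} {i : ι} {d e : ι → ℕ} (h : ∀ k ∈ r, d k = e k) :
    passSign p r i d = passSign p r i e := by
  unfold passSign
  congr 1
  exact List.map_congr_left fun k hk => by rw [h k hk]

end signs

/-! ### The coproduct of ordered monomials -/

section coproduct

variable {g : Type} [AddCommGroup g] [Module ℂ g] [LieSuperalgebra g]

/-- For even `x` the two summands of the action commute, and this is the binomial theorem; the
hypothesis on `u` then says `c u = u`, so the powers of `c` do no harm. For odd `x` only `n ≤ 1`
occurs, and `c` is the sign for moving `x` past `u`. -/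
theorem tensAct_pow_tmul {i : ZMod 2} {x : g} (hx : x ∈ gr (g := g) i) {n : ℕ}
    (hn : i = 1 → n ≤ 1) {u : Env g} {c : ℂ} (hu : parPow (SuperRep.reg g).σ i u = c • u)
    (w : Env g) : ((SuperRep.tensAct (SuperRep.reg g) (SuperRep.reg g) x) ^ n) (u ⊗ₜ w) =
      ∑ a ∈ Finset.HasAntidiagonal.antidiagonal n, (c ^ a.2 * (n.choose a.1 : ℂ)) •
        ((Env.ι g x ^ a.1 * u) ⊗ₜ[ℂ] (Env.ι g x ^ a.2 * w)) := by
  rw [SuperRep.tensAct_apply _ _ hx]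
  rcases zmod2_cases i with rfl | rfl
  · have hc : c • u = u := by rw [← hu]; simp [parPow]
    have hcu : ∀ (m : ℕ) (y z : Env g), (c ^ m) • ((y * u) ⊗ₜ[ℂ] z) = (y * u) ⊗ₜ z := by
      intro m y z
      induction m with
      | zero => simp
      | succ m ih =>
        rw [pow_succ, mul_smul, TensorProduct.smul_tmul', ← mul_smul_comm, hc, ih]
    have hcomm : Commute (TensorProduct.map ((SuperRep.reg g).act x) (1 : Module.End ℂ (Env g)))
        (TensorProduct.map (1 : Module.End ℂ (Env g)) ((SuperRep.reg g).act x)) := by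
      rw [Commute, SemiconjBy, ← TensorProduct.map_mul, ← TensorProduct.map_mul]
      simp
    have hp : ∀ m (y : Env g), (((SuperRep.reg g).act x) ^ m) y = Env.ι g x ^ m * y := by
      intro m y
      rw [SuperRep.act_apply, ← map_pow]
      rfl
    simp only [parPow, if_true]
    rw [hcomm.add_pow', LinearMap.sum_apply]
    refine Finset.sum_congr rfl fun a _ => ?_
    rw [mul_comm, mul_smul, hcu, LinearMap.smul_apply, TensorProduct.map_pow,
      TensorProduct.map_pow, ← TensorProduct.map_mul, one_pow, one_pow, one_mul, mul_one,
      TensorProduct.map_tmul, hp, hp, Nat.cast_smul_eq_nsmul]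
  · have := hn rfl
    interval_cases n
    · simp
    · rw [Finset.Nat.antidiagonal_succ]
      have hu' : Env.par g u = c • u := by simpa [parPow, SuperRep.reg] using hu
      simp only [pow_one, LinearMap.add_apply, TensorProduct.map_tmul, parPow]
      simp only [Finset.Nat.antidiagonal_zero, Finset.map_singleton, Finset.sum_cons,
        Finset.sum_singleton]
      simp [SuperRep.act_apply, SuperRep.reg, TensorProduct.smul_tmul', hu', add_comm]

variable {ι : Type} (f : ι → g) (p : ι → ZMod 2)

/-- The product of the powers `f_i^{d_i}` along a list. -/
def monoList (r : List ι) (d : ι → ℕ) : Env g := (r.map fun i => Env.ι g (f i) ^ d i).prod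

theorem monoList_congr {r : List ι} {d e : ι → ℕ} (h : ∀ k ∈ r, d k = e k) :
    monoList f r d = monoList f r e := by
  unfold monoList
  congr 1
  exact List.map_congr_left fun k hk => by rw [h k hk]

theorem monoList_cons (i : ι) (r : List ι) (d : ι → ℕ) :
    monoList f (i :: r) d = Env.ι g (f i) ^ d i * monoList f r d := by simp [monoList]

variable {f p} (hf : ∀ i, f i ∈ gr (g := g) (p i))
include hf

/-- This supplies the scalar `c` of `tensAct_pow_tmul` when the monomial on the remaining list is
the left tensor factor. -/
theorem par_monoList (r : List ι) (d : ι → ℕ) (i : ι) :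
    parPow (SuperRep.reg g).σ (p i) (monoList f r d) = passSign p r i d • monoList f r d := by
  rcases zmod2_cases (p i) with hi | hi
  · simp [hi, parPow, passSign, ksign]
  · rw [hi, parPow, if_neg one_ne_zero]
    change Env.par g _ = _
    induction r with
    | nil => simp [monoList, passSign]
    | cons k r ih =>
      rw [monoList_cons, map_mul, map_pow, Env.par_ι (hf k), ih, smul_pow, smul_mul_smul_comm]
      simp [passSign, hi]

/-- The power of each `f_i` is distributed over the two tensor factors. The distribution `(e' i, e
i)` at every `i` gives the displayed term; any other one leaves a first exponent that differs from
`e'` somewhere. The induction peels off the leftmost factor, whose passage over the left tensor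
factor produces the sign. -/
theorem comul_monoList (r : List ι) (hr : r.Nodup) (e' e : ι → ℕ)
    (hadm : ∀ i, p i = 1 → (e' + e) i ≤ 1) :
    SuperRep.comul g (monoList f r (e' + e)) -
      (mulSign p r e' e * (r.map fun i => (((e' + e) i).choose (e' i) : ℂ)).prod) •
        (monoList f r e' ⊗ₜ[ℂ] monoList f r e) ∈
      Submodule.span ℂ {z | ∃ d₁ d₂ : ι → ℕ, d₁ + d₂ = e' + e ∧ (∃ j ∈ r, d₁ j ≠ e' j) ∧
        z = monoList f r d₁ ⊗ₜ[ℂ] monoList f r d₂} := by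
  classical
  induction r with
  | nil => simp [monoList, mulSign, SuperRep.comul, SuperRep.orbit_apply]
  | cons i r ih =>
    obtain ⟨hir, hr⟩ := List.nodup_cons.mp hr
    set T := SuperRep.tensAct (SuperRep.reg g) (SuperRep.reg g) (f i) with hT
    have hact : ∀ u, SuperRep.comul g (Env.ι g (f i) ^ (e' + e) i * u) =
        (T ^ (e' + e) i) (SuperRep.comul g u) := by
      intro u
      rw [SuperRep.comul, SuperRep.orbit_apply, map_mul, map_pow, Module.End.mul_apply,
        ← SuperRep.act_apply, SuperRep.tens_act]
      rfl
    have hterm : ∀ d₁ d₂ : ι → ℕ, d₁ + d₂ = e' + e →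
        (T ^ (e' + e) i) (monoList f r d₁ ⊗ₜ monoList f r d₂) =
        ∑ a ∈ Finset.HasAntidiagonal.antidiagonal ((e' + e) i),
          (passSign p r i d₁ ^ a.2 * (((e' + e) i).choose a.1 : ℂ)) •
          (monoList f (i :: r) (Function.update d₁ i a.1) ⊗ₜ[ℂ]
            monoList f (i :: r) (Function.update d₂ i a.2)) := by
      intro d₁ d₂ _
      rw [hT, tensAct_pow_tmul (hf i) (hadm i) (par_monoList hf r d₁ i)]
      refine Finset.sum_congr rfl fun a _ => ?_
      have h1 : ∀ (d : ι → ℕ) (n : ℕ), monoList f (i :: r) (Function.update d i n) =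
          Env.ι g (f i) ^ n * monoList f r d := by
        intro d n
        rw [monoList_cons, Function.update_self]
        congr 1
        refine monoList_congr f fun k hk => Function.update_of_ne ?_ _ _
        rintro rfl
        exact hir hk
      rw [h1, h1]
    have hupd : ∀ d₁ d₂ : ι → ℕ, d₁ + d₂ = e' + e → ∀ a ∈ Finset.HasAntidiagonal.antidiagonal ((e' + e) i),
        Function.update d₁ i a.1 + Function.update d₂ i a.2 = e' + e := by
      intro d₁ d₂ h a ha
      ext k
      by_cases hk : k = i
      · subst hk
        simpa using Finset.HasAntidiagonal.mem_antidiagonal.mp ha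
      · simpa [hk] using congrFun h k
    set W := Submodule.span ℂ {z | ∃ d₁ d₂ : ι → ℕ, d₁ + d₂ = e' + e ∧
      (∃ j ∈ i :: r, d₁ j ≠ e' j) ∧ z = monoList f (i :: r) d₁ ⊗ₜ[ℂ] monoList f (i :: r) d₂} with hW
    set c := mulSign p r e' e * (r.map fun i => (((e' + e) i).choose (e' i) : ℂ)).prod with hc
    -- A term that deviates from `e'` on `r` keeps deviating, since the factor `f_i` changes only
    -- the exponent at `i ∉ r`.
    have hrest : ∀ z ∈ Submodule.span ℂ {z | ∃ d₁ d₂ : ι → ℕ, d₁ + d₂ = e' + e ∧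
        (∃ j ∈ r, d₁ j ≠ e' j) ∧ z = monoList f r d₁ ⊗ₜ[ℂ] monoList f r d₂},
        (T ^ (e' + e) i) z ∈ W := by
      intro z hz
      induction hz using Submodule.span_induction with
      | mem z hz =>
        obtain ⟨d₁, d₂, h, ⟨j, hj, hne⟩, rfl⟩ := hz
        rw [hterm d₁ d₂ h]
        refine Submodule.sum_mem _ fun a ha => Submodule.smul_mem _ _ (Submodule.subset_span
          ⟨_, _, hupd d₁ d₂ h a ha, ⟨j, List.mem_cons_of_mem i hj, ?_⟩, rfl⟩)
        rwa [Function.update_of_ne (by rintro rfl; exact hir hj)]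
      | zero => rw [map_zero]; exact zero_mem _
      | add x y _ _ hx hy => rw [map_add]; exact add_mem hx hy
      | smul c x _ hx => rw [map_smul]; exact Submodule.smul_mem _ _ hx
    have h0 := hrest _ (ih hr)
    rw [map_sub, map_smul, ← hact, ← monoList_cons, hterm e' e rfl] at h0
    -- This is the summand that continues the main term; all others differ from `e'` at `i` itself.
    have hmem : (e' i, e i) ∈ Finset.HasAntidiagonal.antidiagonal ((e' + e) i) := by simp
    rw [← Finset.add_sum_erase _ _ hmem, smul_add, ← sub_sub] at h0
    have h1 : c • ∑ a ∈ (Finset.HasAntidiagonal.antidiagonal ((e' + e) i)).erase (e' i, e i),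
        (passSign p r i e' ^ a.2 * (((e' + e) i).choose a.1 : ℂ)) •
          (monoList f (i :: r) (Function.update e' i a.1) ⊗ₜ[ℂ]
            monoList f (i :: r) (Function.update e i a.2)) ∈ W := by
      refine Submodule.smul_mem _ _ (Submodule.sum_mem _ fun a ha => Submodule.smul_mem _ _
        (Submodule.subset_span ⟨_, _, hupd e' e rfl a (Finset.mem_of_mem_erase ha),
          ⟨i, List.mem_cons_self, ?_⟩, rfl⟩))
      rw [Function.update_self]
      intro h
      refine (Finset.mem_erase.mp ha).1 ?_
      have := Finset.HasAntidiagonal.mem_antidiagonal.mp (Finset.mem_of_mem_erase ha)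
      rw [h, Pi.add_apply, add_right_inj] at this
      exact Prod.ext h this
    have h2 := add_mem h0 h1
    rw [sub_add_cancel, Function.update_eq_self, Function.update_eq_self, smul_smul] at h2
    convert h2 using 3
    rw [mulSign, List.map_cons, List.prod_cons, hc]
    ring

/-- The product of functionals on ordered monomials, up to terms with other exponents. -/
theorem conv_monoList (φ ψ : Env g →ₗ[ℂ] ℂ) (r : List ι) (hr : r.Nodup) (e' e : ι → ℕ)
    (hadm : ∀ i, p i = 1 → (e' + e) i ≤ 1)
    (h : ∀ d₁ d₂ : ι → ℕ, d₁ + d₂ = e' + e → (∃ j ∈ r, d₁ j ≠ e' j) →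
      ψ (monoList f r d₁) * φ (monoList f r d₂) = 0) :
    conv φ ψ (monoList f r (e' + e)) =
      mulSign p r e' e * (r.map fun i => (((e' + e) i).choose (e' i) : ℂ)).prod *
        (φ (monoList f r e) * ψ (monoList f r e')) := by
  have h1 := comul_monoList hf r hr e' e hadm
  rw [← sub_eq_zero]
  have h2 : ∀ z ∈ Submodule.span ℂ {z | ∃ d₁ d₂ : ι → ℕ, d₁ + d₂ = e' + e ∧
      (∃ j ∈ r, d₁ j ≠ e' j) ∧ z = monoList f r d₁ ⊗ₜ[ℂ] monoList f r d₂},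
      LinearMap.mul' ℂ ℂ (TensorProduct.map ψ φ z) = 0 := by
    intro z hz
    induction hz using Submodule.span_induction with
    | mem z hz =>
      obtain ⟨d₁, d₂, h', hj, rfl⟩ := hz
      simpa using h d₁ d₂ h' hj
    | zero => simp
    | add x y _ _ hx hy => rw [map_add, map_add, hx, hy, add_zero]
    | smul c x _ hx => rw [map_smul, map_smul, hx, smul_zero]
  have h3 := h2 _ h1
  rw [map_sub, map_sub, map_smul, map_smul, TensorProduct.map_tmul, LinearMap.mul'_apply] at h3
  rw [← h3, smul_eq_mul, mul_comm (φ _)]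
  rfl

end coproduct

/-! ### Signs of sums of parities, and extremal elements of finite sets -/

theorem ksign_one_add (i j : ZMod 2) : ksign 1 (i + j) = ksign 1 i * ksign 1 j := by
  rcases zmod2_cases i with rfl | rfl <;> rcases zmod2_cases j with rfl | rfl <;>
    simp [ksign, show (1 + 1 : ZMod 2) = 0 from rfl]

theorem ksign_one_natCast_mul (n : ℕ) (i : ZMod 2) : ksign 1 ((n : ZMod 2) * i) = ksign 1 i ^ n := by
  induction n with
  | zero => simp [ksign]
  | succ n ih => rw [Nat.cast_succ, add_mul, one_mul, ksign_one_add, ih, pow_succ]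

theorem exists_extremal {α : Type} (r : α → α → Prop) [IsStrictTotalOrder α r] {s : Set α}
    (hs : s.Finite) (hne : s.Nonempty) : ∃ a ∈ s, ∀ c ∈ s, c ≠ a → r c a := by
  induction s, hs using Set.Finite.induction_on with
  | empty => exact absurd hne Set.not_nonempty_empty
  | @insert x s _ _ ih =>
    by_cases h : s.Nonempty
    · obtain ⟨a, ha, hm⟩ := ih h
      rcases trichotomous_of r x a with h' | rfl | h'
      · exact ⟨a, Set.mem_insert_of_mem _ ha, fun c hc hca => by
          rcases hc with rfl | hc
          · exact h'
          · exact hm c hc hca⟩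
      · exact ⟨x, Set.mem_insert _ _, fun c hc hca => hm c (hc.resolve_left hca) hca⟩
      · refine ⟨x, Set.mem_insert _ _, fun c hc hca => ?_⟩
        have hc := hc.resolve_left hca
        by_cases hcx : c = a
        · rw [hcx]; exact h'
        · exact _root_.trans (hm c hc hcx) h'
    · rw [Set.not_nonempty_iff_eq_empty] at h
      subst h
      exact ⟨x, by simp, fun c hc hca => absurd (by simpa using hc) hca⟩

namespace Setting

variable {g : Type} [AddCommGroup g] [Module ℂ g] [LieSuperalgebra g] (S : Setting g)

instance : IsStrictTotalOrder S.Exp S.lt := S.lt_total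

/-! ### The order -/

theorem lt_add_left {d e : S.Exp} (c : S.Exp) (h : S.lt d e) : S.lt (c + d) (c + e) := by
  rw [add_comm c, add_comm c]; exact S.lt_add d e c h

theorem lt_add_add {d e d' e' : S.Exp} (h : S.lt d e) (h' : S.lt d' e') :
    S.lt (d + d') (e + e') :=
  _root_.trans (S.lt_add d e d' h) (S.lt_add_left e h')

theorem not_lt_self (e : S.Exp) : ¬ S.lt e e := irrefl_of S.lt e

/-- If `d₁ + d₂ < e₁ + e₂`, then `d₁ < e₁` or `d₂ < e₂`. -/
theorem lt_or_lt_of_add_lt {d₁ d₂ e₁ e₂ : S.Exp} (h : S.lt (d₁ + d₂) (e₁ + e₂)) :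
    S.lt d₁ e₁ ∨ S.lt d₂ e₂ := by
  by_contra! hn
  rcases trichotomous_of S.lt d₁ e₁ with h1 | rfl | h1
  · exact hn.1 h1
  · rcases trichotomous_of S.lt d₂ e₂ with h2 | rfl | h2
    · exact hn.2 h2
    · exact S.not_lt_self _ h
    · exact S.not_lt_self _ (_root_.trans h (S.lt_add_left d₁ h2))
  · rcases trichotomous_of S.lt d₂ e₂ with h2 | rfl | h2
    · exact hn.2 h2
    · exact S.not_lt_self _ (_root_.trans h (S.lt_add _ _ d₂ h1))
    · exact S.not_lt_self _ (_root_.trans h (S.lt_add_add h1 h2))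

/-- If `d₁ + d₂ = e₁ + e₂` and `d₁ ≠ e₁`, then `d₁ < e₁` or `d₂ < e₂`. -/
theorem lt_or_lt_of_add_eq {d₁ d₂ e₁ e₂ : S.Exp} (h : d₁ + d₂ = e₁ + e₂) (hne : d₁ ≠ e₁) :
    S.lt d₁ e₁ ∨ S.lt d₂ e₂ := by
  rcases trichotomous_of S.lt d₁ e₁ with h1 | h1 | h1
  · exact Or.inl h1
  · exact absurd h1 hne
  · rcases trichotomous_of S.lt d₂ e₂ with h2 | rfl | h2
    · exact Or.inr h2
    · exact absurd (add_right_cancel h) hne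
    · have := S.lt_add_add h1 h2
      rw [h] at this
      exact absurd this (S.not_lt_self _)

/-! ### Monomials -/

/-- The basis of `𝔫⁻`, as a spanning family. -/
def family : S.b.NegFamily (Fin S.N) := ⟨S.f, S.p, S.f_mem, S.f_span⟩

/-- The indices in descending order. -/
def desc : List (Fin S.N) := (List.finRange S.N).reverse

theorem nodup_desc : S.desc.Nodup := List.nodup_reverse.mpr (List.nodup_finRange _)

theorem mem_desc (i : Fin S.N) : i ∈ S.desc := by simp [desc]

theorem sum_map_desc (c : Fin S.N → ℕ) : (S.desc.map c).sum = ∑ i, c i := by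
  rw [desc, List.map_reverse, List.sum_reverse, ← List.ofFn_eq_map, List.sum_ofFn]

theorem prod_map_desc (c : Fin S.N → ℂ) : (S.desc.map c).prod = ∏ i, c i := by
  rw [desc, ((List.reverse_perm _).map c).prod_eq, ← List.ofFn_eq_map, List.prod_ofFn]

theorem mono_eq (e : S.Exp) : S.mono e = monoList S.f S.desc e := by
  rw [mono, monoList, desc, List.map_reverse, List.ofFn_eq_map]

/-- The word of the ordered monomial with exponent `e`. -/
def monoWord (e : S.Exp) : List (Fin S.N) :=
  (S.desc.map fun i => List.replicate (e i) i).flatten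

theorem word_monoWord (e : S.Exp) : S.family.word (S.monoWord e) = S.mono e := by
  rw [mono_eq, monoWord, monoList]
  induction S.desc with
  | nil => rfl
  | cons i r ih =>
    rw [List.map_cons, List.flatten_cons, Borel.NegFamily.word_append, ih,
      Borel.NegFamily.word_replicate, List.map_cons, List.prod_cons]
    rfl

theorem length_monoWord (e : S.Exp) : (S.monoWord e).length = ∑ i, e i := by
  rw [monoWord, List.length_flatten, List.map_map, ← sum_map_desc]
  congr 1
  exact List.map_congr_left fun i _ => by simp

theorem count_monoWord (e : S.Exp) (j : Fin S.N) : (S.monoWord e).count j = e j := by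
  rw [monoWord, List.count_flatten, List.map_map]
  have : (List.count j ∘ fun i => List.replicate (e i) i) = fun i => if i = j then e i else 0 := by
    ext i
    simp [List.count_replicate]
  rw [this, sum_map_desc]
  simp

/-- Induction on the length. Up to shorter words, a word is a multiple of the sorted word with the
same letters, or a combination of shorter ones if an odd letter is repeated. -/
theorem word_mem_span (l : List (Fin S.N)) : S.family.word l ∈
    Submodule.span ℂ {u | ∃ e, S.Admissible e ∧ u = S.mono e} := by
  set P := Submodule.span ℂ {u | ∃ e, S.Admissible e ∧ u = S.mono e} with hP
  suffices h : ∀ n, S.family.below n ≤ P from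
    h _ (S.family.word_mem_below (Nat.lt_succ_self l.length))
  intro n
  induction n with
  | zero => simp [Borel.NegFamily.below]
  | succ n ih =>
    refine Submodule.span_le.mpr ?_
    rintro _ ⟨l, hl, rfl⟩
    rcases Nat.lt_succ_iff_lt_or_eq.mp hl with hl | hl
    · exact ih (S.family.word_mem_below hl)
    by_cases hadm : S.Admissible fun i => l.count i
    · have hperm : l.Perm (S.monoWord fun i => l.count i) :=
        List.perm_iff_count.mpr fun j =>
          (S.count_monoWord (fun i => l.count i) j).symm
      refine S.family.word_mem_of_perm hperm (hl ▸ ih) ?_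
      rw [word_monoWord]
      exact Submodule.subset_span ⟨_, hadm, rfl⟩
    · simp only [Admissible, not_forall, not_le] at hadm
      obtain ⟨i, hi, h2⟩ := hadm
      exact (hl ▸ ih) (S.family.word_mem_of_odd hi h2)

section basic

variable [FiniteDimensional ℂ g] (hg : IsBasic g)
include hg

theorem span_vec (k : ℕ) :
    Submodule.span ℂ {x | ∃ e, S.Admissible e ∧ x = S.vec k e} = ⊤ := by
  rw [eq_top_iff]
  intro x _
  obtain ⟨u, rfl⟩ := exists_smul_v x
  refine Submodule.span_le.mpr ?_ (isHighestWeight_v.span_word hg S.family u)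
  rintro _ ⟨l, rfl⟩
  refine Submodule.span_induction (p := fun u _ => u • KMod.v S.b (k • S.wt) ∈ _) ?_ ?_ ?_ ?_
    (S.word_mem_span l)
  · rintro _ ⟨e, he, rfl⟩
    exact Submodule.subset_span ⟨e, he, rfl⟩
  · rw [zero_smul]; exact zero_mem _
  · intro x y _ _ h h'
    rw [add_smul]; exact add_mem h h'
  · intro c x _ h
    rw [smul_assoc]; exact Submodule.smul_mem _ _ h

/-- A monomial of total exponent at least `dim K(kλ)` annihilates the highest weight vector, so the
exponents of the others are bounded. This finiteness stands in for well-foundedness of the order,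
which is not assumed. -/
theorem finite_vec_ne_zero (k : ℕ) : {e | S.vec k e ≠ 0}.Finite := by
  have := finiteDimensional_kMod hg S.b (k • S.wt)
  refine (Set.finite_Iic (fun _ : Fin S.N => Module.finrank ℂ (KMod S.b (k • S.wt)))).subset ?_
  intro e he i
  by_contra hi
  refine he ?_
  rw [vec, ← word_monoWord]
  refine isHighestWeight_v.word_eq_zero S.family ?_
  rw [length_monoWord]
  exact (not_le.mp hi).le.trans (Finset.single_le_sum (f := e) (fun _ _ => Nat.zero_le _)
    (Finset.mem_univ i))

theorem finite_es (k : ℕ) : (S.es k).Finite := by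
  refine (S.finite_vec_ne_zero hg k).subset fun e he h0 => he.2 ?_
  rw [h0]; exact zero_mem _

/-- A non-essential vector is a combination of vectors with smaller exponents, and so on downwards.
The descent ends because only finitely many vectors are nonzero. The condition `¬ S.lt d e` records
that the descent never leaves the exponents `≤ d`. -/
theorem vec_mem_span_es (k : ℕ) {d : S.Exp} (hd : S.Admissible d) :
    S.vec k d ∈ Submodule.span ℂ {x | ∃ e ∈ S.es k, ¬ S.lt d e ∧ x = S.vec k e} := by
  have hwf : {e | S.vec k e ≠ 0}.WellFoundedOn S.lt := (S.finite_vec_ne_zero hg k).wellFoundedOn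
  by_cases h0 : S.vec k d = 0
  · rw [h0]; exact zero_mem _
  refine hwf.induction (P := fun d => S.Admissible d → S.vec k d ∈ Submodule.span ℂ
    {x | ∃ e ∈ S.es k, ¬ S.lt d e ∧ x = S.vec k e}) h0 ?_ hd
  intro e _ ih hadm
  by_cases he : e ∈ S.es k
  · exact Submodule.subset_span ⟨e, he, S.not_lt_self e, rfl⟩
  have : S.vec k e ∈ Submodule.span ℂ {x | ∃ e', S.Admissible e' ∧ S.lt e' e ∧ x = S.vec k e'} := by
    by_contra h
    exact he ⟨hadm, h⟩
  refine Submodule.span_le.mpr ?_ this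
  rintro _ ⟨e', hadm', hlt, rfl⟩
  by_cases h0 : S.vec k e' = 0
  · rw [h0]; exact zero_mem _
  refine Submodule.span_mono ?_ (ih e' h0 hlt hadm')
  rintro _ ⟨d, hd, hn, rfl⟩
  exact ⟨d, hd, fun h => hn (_root_.trans hlt h), rfl⟩

theorem span_es (k : ℕ) : Submodule.span ℂ (Set.range fun e : S.es k => S.vec k e) = ⊤ := by
  rw [eq_top_iff, ← S.span_vec hg k]
  refine Submodule.span_le.mpr ?_
  rintro _ ⟨e, hadm, rfl⟩
  refine Submodule.span_mono ?_ (S.vec_mem_span_es hg k hadm)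
  rintro _ ⟨d, hd, -, rfl⟩
  exact ⟨⟨d, hd⟩, rfl⟩

end basic

/-- The vector with the largest exponent in a linear relation would lie in the span of vectors with
smaller exponents. -/
theorem linearIndependent_es (k : ℕ) : LinearIndependent ℂ fun e : S.es k => S.vec k e := by
  classical
  rw [linearIndependent_iff']
  intro s c hc
  by_contra! hne
  obtain ⟨i, hi, hci⟩ := hne
  obtain ⟨a, ⟨hac, ⟨has, ha⟩⟩, hmax⟩ := exists_extremal S.lt
    (s := {e | ∃ h : e ∈ S.es k, ⟨e, h⟩ ∈ s ∧ c ⟨e, h⟩ ≠ 0})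
    ((s.finite_toSet.image Subtype.val).subset (by
      rintro e ⟨h, hs, -⟩
      exact ⟨⟨e, h⟩, hs, rfl⟩)) ⟨i.1, i.2, hi, hci⟩
  refine hac.2 ?_
  rw [← Finset.add_sum_erase _ _ has] at hc
  have h1 : S.vec k a = (-(c ⟨a, hac⟩)⁻¹) • ∑ x ∈ s.erase ⟨a, hac⟩, c x • S.vec k x := by
    rw [eq_neg_of_add_eq_zero_right hc]
    simp [smul_smul, ha]
  rw [h1]
  refine Submodule.smul_mem _ _ (Submodule.sum_mem _ fun x hx => ?_)
  by_cases hx0 : c x = 0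
  · rw [hx0, zero_smul]; exact zero_mem _
  refine Submodule.smul_mem _ _ (Submodule.subset_span ⟨x.1, x.2.1, ?_, rfl⟩)
  exact hmax x.1 ⟨x.2, Finset.mem_of_mem_erase hx, hx0⟩ fun h =>
    (Finset.ne_of_mem_erase hx) (Subtype.ext h)

/-- The highest weight vector is even, so the parity is that of `f^e`. This makes `η_{e,1}`
homogeneous of the parity of `X_e`, as is needed for `ev`. -/
theorem parity_vec (k : ℕ) (e : S.Exp) :
    (kRep S.b (k • S.wt)).σ (S.vec k e) = ksign 1 (S.parity e) • S.vec k e := by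
  have h1 := congrArg (fun F : Module.End ℂ _ => F (KMod.v S.b (k • S.wt)))
    ((kRep S.b (k • S.wt)).σ_ρ (S.mono e))
  simp only [Module.End.mul_apply, isHighest_v.even] at h1
  refine (h1 : (kRep S.b (k • S.wt)).σ (S.vec k e) = Env.par g (S.mono e) • _).trans ?_
  have h2 : Env.par g (S.mono e) = ksign 1 (S.parity e) • S.mono e := by
    rw [mono_eq, monoList, map_list_prod, List.map_map]
    have h3 : ∀ r : List (Fin S.N), (r.map (Env.par g ∘ fun i => Env.ι g (S.f i) ^ e i)).prod =
        ksign 1 ((r.map fun i => (e i : ZMod 2) * S.p i).sum) •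
          (r.map fun i => Env.ι g (S.f i) ^ e i).prod := by
      intro r
      induction r with
      | nil => simp [ksign]
      | cons i r ih =>
        simp only [List.map_cons, List.prod_cons, List.sum_cons, ih, Function.comp_apply, map_pow,
          Env.par_ι (S.f_mem i), smul_pow, smul_mul_smul_comm]
        congr 1
        rw [ksign_one_add, ksign_one_natCast_mul]
    rw [h3]
    congr 2
    rw [parity, desc, List.map_reverse, List.sum_reverse, ← List.ofFn_eq_map, List.sum_ofFn]
  exact (congrArg (· • KMod.v S.b (k • S.wt)) h2).trans (smul_assoc _ _ _)

/-! ### Leading coefficients -/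

/-- The product `∏ e_i!`. -/
def fact (e : S.Exp) : ℂ := ((∏ i, (e i).factorial : ℕ) : ℂ)

theorem fact_ne_zero (e : S.Exp) : S.fact e ≠ 0 := by
  rw [fact, Nat.cast_ne_zero]
  exact Finset.prod_ne_zero_iff.mpr fun i _ => Nat.factorial_ne_zero _

/-- The normalized value of a functional at `f^e v_{kλ}`. -/
def coeff (k : ℕ) (e : S.Exp) : RPiece S.b S.wt k →ₗ[ℂ] ℂ :=
  (S.fact e)⁻¹ • LinearMap.flip RPiece.pull (S.mono e)

theorem coeff_apply (k : ℕ) (e : S.Exp) (φ : RPiece S.b S.wt k) :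
    S.coeff k e φ = (S.fact e)⁻¹ * φ.toDual (S.vec k e) := rfl

/-- The functionals that vanish at `f^d v_{kλ}` for all admissible `d < e`. -/
def ge (k : ℕ) (e : S.Exp) : Submodule ℂ (RPiece S.b S.wt k) where
  carrier := {φ | ∀ d, S.Admissible d → S.lt d e → S.coeff k d φ = 0}
  add_mem' h h' d hd hlt := by rw [map_add, h d hd hlt, h' d hd hlt, add_zero]
  zero_mem' d _ _ := map_zero _
  smul_mem' c φ h d hd hlt := by rw [map_smul, h d hd hlt, smul_zero]

theorem pull_mono (k : ℕ) (e : S.Exp) (φ : RPiece S.b S.wt k) :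
    RPiece.pull φ (S.mono e) = S.fact e * S.coeff k e φ := by
  rw [coeff_apply, mul_inv_cancel_left₀ (S.fact_ne_zero e)]
  rfl

/-- The sign in the product of monomials. -/
def sign (d d' : S.Exp) : ℂ := mulSign S.p S.desc d d'

theorem sign_eq_or (d d' : S.Exp) : S.sign d d' = 1 ∨ S.sign d d' = -1 := mulSign_eq_or _ _ _ _

/-- If `d₁ + d₂ < e' + e`, then `d₁ < e'` or `d₂ < e`; so every term of the coproduct of `f^d` is
killed by `ψ` or by `φ`. -/
theorem mul_mem_ge {m n : ℕ} {e e' : S.Exp} {φ : RPiece S.b S.wt m} {ψ : RPiece S.b S.wt n}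
    (hφ : φ ∈ S.ge m e) (hψ : ψ ∈ S.ge n e') : RPiece.mul φ ψ ∈ S.ge (m + n) (e + e') := by
  intro d hd hlt
  have hz : ∀ d₁ d₂ : S.Exp, d₁ + d₂ = d →
      RPiece.pull ψ (S.mono d₁) * RPiece.pull φ (S.mono d₂) = 0 := by
    intro d₁ d₂ h
    rw [← h, add_comm e] at hlt
    have had₁ : S.Admissible d₁ := fun i hi => le_trans (by simp [← h]) (hd i hi)
    have had₂ : S.Admissible d₂ := fun i hi => le_trans (by simp [← h]) (hd i hi)
    rcases S.lt_or_lt_of_add_lt hlt with h1 | h1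
    · rw [pull_mono, hψ d₁ had₁ h1, mul_zero, zero_mul]
    · rw [pull_mono S m, hφ d₂ had₂ h1, mul_zero, mul_zero]
  -- The splitting `0 + d` is taken as the main term only to apply the formula; it vanishes like all
  -- others.
  have h1 := conv_monoList S.f_mem (RPiece.pull φ) (RPiece.pull ψ) S.desc S.nodup_desc 0 d
    (by rw [zero_add]; exact hd) (fun d₁ d₂ h _ => by
      rw [← mono_eq, ← mono_eq]
      exact hz d₁ d₂ (by simpa using h))
  rw [← RPiece.pull_mul, zero_add, ← mono_eq, ← mono_eq, mul_comm (RPiece.pull φ _),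
    hz 0 d (zero_add d), mul_zero, pull_mono] at h1
  exact (mul_eq_zero.mp h1).resolve_left (S.fact_ne_zero d)

/-- Among the splittings of `e' + e` only `(e', e)` avoids the vanishing ranges of `ψ` and `φ`. The
factor `∏ e_i!` in the normalization cancels the binomial coefficients, and only a sign remains. In
`conv` the second functional acts on the left tensor factor, which explains the order of the
arguments of `sign`. -/
theorem coeff_mul {m n : ℕ} {e e' : S.Exp} {φ : RPiece S.b S.wt m} {ψ : RPiece S.b S.wt n}
    (hφ : φ ∈ S.ge m e) (hψ : ψ ∈ S.ge n e') (hadm : S.Admissible (e + e')) :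
    S.coeff (m + n) (e + e') (RPiece.mul φ ψ) =
      S.sign e' e * (S.coeff m e φ * S.coeff n e' ψ) := by
  rw [add_comm e e'] at hadm
  have h1 := conv_monoList S.f_mem (RPiece.pull φ) (RPiece.pull ψ) S.desc S.nodup_desc e' e
    hadm (fun d₁ d₂ h ⟨j, _, hj⟩ => by
      rw [← mono_eq, ← mono_eq]
      have had₁ : S.Admissible d₁ := fun i hi => le_trans (by rw [← h]; simp) (hadm i hi)
      have had₂ : S.Admissible d₂ := fun i hi => le_trans (by rw [← h]; simp) (hadm i hi)
      rcases S.lt_or_lt_of_add_eq h (fun h => hj (congrFun h j)) with h1 | h1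
      · rw [pull_mono, hψ d₁ had₁ h1, mul_zero, zero_mul]
      · rw [pull_mono S m, hφ d₂ had₂ h1, mul_zero, mul_zero])
  rw [← RPiece.pull_mul, ← mono_eq, ← mono_eq, ← mono_eq, prod_map_desc, pull_mono, pull_mono,
    pull_mono] at h1
  -- The identity `(a + b)! = C(a + b, a) a! b!`, applied at each index.
  have h2 : S.fact (e' + e) = (∏ i, (((e' + e) i).choose (e' i) : ℂ)) * (S.fact e' * S.fact e) := by
    simp only [fact]
    push_cast
    rw [← Finset.prod_mul_distrib, ← Finset.prod_mul_distrib]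
    refine Finset.prod_congr rfl fun i _ => ?_
    have := Nat.add_choose_mul_factorial_mul_factorial (e i) (e' i)
    rw [add_comm (e i), mul_right_comm] at this
    rw [← mul_assoc]
    exact_mod_cast this.symm
  rw [add_comm e e']
  refine mul_left_cancel₀ (S.fact_ne_zero (e' + e)) (h1.trans ?_)
  rw [h2, sign]
  ring

end Setting

/-! ### Monomials in free supercommutative superalgebras -/

namespace FreeSuperRing

variable {ι : Type} (p : ι → ZMod 2)

/-- The ascending monomial with exponent `d`; the list `r` is in descending order. -/
def asc : List ι → (ι → ℕ) → FreeSuperRing p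
  | [], _ => 1
  | i :: r, d => asc r d * X p i ^ d i

theorem X_mul_X_pow (i k : ι) (n : ℕ) :
    X p i * X p k ^ n = ksign (p i) (p k) ^ n • (X p k ^ n * X p i) := by
  induction n with
  | zero => simp
  | succ n ih =>
    rw [pow_succ, ← mul_assoc, ih, smul_mul_assoc, mul_assoc, X_mul_X, mul_smul_comm, smul_smul,
      ← mul_assoc, pow_succ]

theorem X_mul_asc (r : List ι) (i : ι) (d : ι → ℕ) :
    X p i * asc p r d = passSign p r i d • (asc p r d * X p i) := by
  induction r with
  | nil => simp [asc, passSign]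
  | cons k r ih =>
    rw [asc, ← mul_assoc, ih, smul_mul_assoc, mul_assoc, X_mul_X_pow, mul_smul_comm, smul_smul,
      ← mul_assoc]
    congr 1
    simp [passSign, mul_comm]

theorem X_pow_mul_asc (r : List ι) (i : ι) (d : ι → ℕ) (n : ℕ) :
    X p i ^ n * asc p r d = passSign p r i d ^ n • (asc p r d * X p i ^ n) := by
  induction n with
  | zero => simp
  | succ n ih =>
    rw [pow_succ, mul_assoc, X_mul_asc, mul_smul_comm, ← mul_assoc, ih, smul_mul_assoc, smul_smul,
      mul_assoc, pow_succ, mul_comm (passSign p r i d)]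

/-- Multiplying ascending monomials moves variables in the same way as the coproduct moves root
vectors in descending monomials; so both are governed by one function `mulSign`. This is why
ascending monomials are used. -/
theorem asc_mul_asc (r : List ι) (d' d : ι → ℕ) :
    asc p r d' * asc p r d = mulSign p r d d' • asc p r (d' + d) := by
  induction r with
  | nil => simp [asc, mulSign]
  | cons i r ih =>
    rw [asc, asc, asc, mul_assoc, ← mul_assoc (X p i ^ d' i), X_pow_mul_asc, smul_mul_assoc,
      mul_smul_comm, ← mul_assoc, ← mul_assoc, ih, mulSign, mul_smul, smul_mul_assoc,
      smul_mul_assoc, mul_assoc, ← pow_add]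
    rfl

/-- Reordering costs a nonzero scalar, so ascending and descending monomials generate the same
subalgebras. The monomial superalgebra is stated with the latter. -/
theorem exists_descending (r : List ι) (d : ι → ℕ) :
    ∃ c : ℂ, c ≠ 0 ∧ (r.map fun i => X p i ^ d i).prod = c • asc p r d := by
  induction r with
  | nil => exact ⟨1, one_ne_zero, by simp [asc]⟩
  | cons i r ih =>
    obtain ⟨c, hc, h⟩ := ih
    refine ⟨c * passSign p r i d ^ d i, mul_ne_zero hc (pow_ne_zero _ ?_), ?_⟩
    · rcases passSign_eq_or p r i d with h | h <;> simp [h]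
    · rw [List.map_cons, List.prod_cons, h, mul_smul_comm, X_pow_mul_asc, asc, smul_smul]

theorem X_sq {i : ι} (hi : p i = 1) : X p i * X p i = 0 := by
  have h := X_mul_X p i i
  rw [hi] at h
  simp only [ksign, and_self, if_true, neg_smul, one_smul] at h
  have h2 : (2 : ℂ) • (X p i * X p i) = 0 := by
    rw [two_smul]; nth_rw 2 [h]; exact add_neg_cancel _
  exact (smul_eq_zero.mp h2).resolve_left two_ne_zero

/-- The exponents of odd variables are at most `1`. -/
def Adm (d : ι → ℕ) : Prop := ∀ i, p i = 1 → d i ≤ 1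

theorem Adm.mono {c d : ι → ℕ} (h : Adm p d) (hcd : c ≤ d) : Adm p c :=
  fun i hi => (hcd i).trans (h i hi)

theorem asc_eq_zero {r : List ι} {d : ι → ℕ} {i : ι} (hr : i ∈ r) (hi : p i = 1) (h : 2 ≤ d i) :
    asc p r d = 0 := by
  induction r with
  | nil => simp at hr
  | cons k r ih =>
    rw [asc]
    rcases List.mem_cons.mp hr with rfl | hr
    · obtain ⟨n, hn⟩ := Nat.exists_eq_add_of_le h
      rw [hn, pow_add, pow_two, X_sq p hi, zero_mul, mul_zero]
    · rw [ih hr, zero_mul]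

theorem par_asc (r : List ι) (d : ι → ℕ) :
    par p (asc p r d) = ksign 1 ((r.map fun i => (d i : ZMod 2) * p i).sum) • asc p r d := by
  induction r with
  | nil => simp [asc, ksign]
  | cons i r ih =>
    rw [asc, map_mul, map_pow, par_X, ih, smul_pow, smul_mul_smul_comm, List.map_cons,
      List.sum_cons, ksign_one_add, ksign_one_natCast_mul, mul_comm]

section independence

theorem passSign_add (r : List ι) (i : ι) (c d : ι → ℕ) :
    passSign p r i (c + d) = passSign p r i c * passSign p r i d := by
  induction r with
  | nil => simp [passSign]
  | cons k r ih =>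
    simp only [passSign, List.map_cons, List.prod_cons, Pi.add_apply, pow_add] at *
    rw [ih]; ring

theorem mulSign_add_left (r : List ι) (c d e : ι → ℕ) :
    mulSign p r (c + d) e = mulSign p r c e * mulSign p r d e := by
  induction r with
  | nil => simp [mulSign]
  | cons k r ih =>
    rw [mulSign, mulSign, mulSign, ih, passSign_add, mul_pow]; ring

theorem mulSign_zero_left {r : List ι} {d e : ι → ℕ} (h : ∀ k ∈ r, d k = 0) :
    mulSign p r d e = 1 := by
  induction r with
  | nil => rfl
  | cons k r ih =>
    have h1 : passSign p r k d = 1 := by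
      rw [passSign_congr p (e := 0) fun j hj => h j (List.mem_cons_of_mem k hj)]
      simp [passSign]
    rw [mulSign, h1, one_pow, one_mul, ih fun j hj => h j (List.mem_cons_of_mem k hj)]

theorem mulSign_zero_right {r : List ι} {d e : ι → ℕ} (h : ∀ k ∈ r, e k = 0) :
    mulSign p r d e = 1 := by
  induction r with
  | nil => rfl
  | cons k r ih =>
    rw [mulSign, h k List.mem_cons_self, pow_zero, one_mul,
      ih fun j hj => h j (List.mem_cons_of_mem k hj)]

variable [DecidableEq ι]

theorem passSign_single {r : List ι} (hr : r.Nodup) {i j : ι} (hj : j ∈ r) :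
    passSign p r i (Pi.single j 1) = ksign (p i) (p j) := by
  induction r with
  | nil => simp at hj
  | cons k r ih =>
    obtain ⟨hk, hr⟩ := List.nodup_cons.mp hr
    have hc : passSign p (k :: r) i (Pi.single j 1) =
        ksign (p i) (p k) ^ (Pi.single j 1 : ι → ℕ) k * passSign p r i (Pi.single j 1) := by
      simp [passSign]
    rw [hc]
    by_cases hkj : k = j
    · subst hkj
      rw [passSign_congr p (e := 0) fun l hl =>
        Pi.single_eq_of_ne (by rintro rfl; exact hk hl) _]
      simp [passSign]
    · rw [Pi.single_eq_of_ne hkj, pow_zero, one_mul,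
        ih hr ((List.mem_cons.mp hj).resolve_left (Ne.symm hkj))]

/-- One of the two values of `mulSign` is `1` and the other is the commutation sign, according to
which of `i` and `j` comes first in `r`. -/
theorem mulSign_single {r : List ι} (hr : r.Nodup) {i j : ι} (hij : i ≠ j) (hi : i ∈ r)
    (hj : j ∈ r) : mulSign p r (Pi.single j 1) (Pi.single i 1) =
      ksign (p i) (p j) * mulSign p r (Pi.single i 1) (Pi.single j 1) := by
  have key : ∀ (i j : ι) (r : List ι), (i :: r).Nodup → i ≠ j → j ∈ r →
      mulSign p (i :: r) (Pi.single j 1) (Pi.single i 1) = ksign (p i) (p j) ∧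
      mulSign p (i :: r) (Pi.single i 1) (Pi.single j 1) = 1 := by
    intro i j r hr hij hj
    obtain ⟨hi, hr⟩ := List.nodup_cons.mp hr
    have h0 : ∀ k ∈ r, (Pi.single i 1 : ι → ℕ) k = 0 := fun k hk =>
      Pi.single_eq_of_ne (by rintro rfl; exact hi hk) _
    rw [mulSign, mulSign, mulSign_zero_right p h0, mulSign_zero_left p h0, passSign_single p hr hj]
    simp [Pi.single_eq_of_ne hij]
  induction r with
  | nil => simp at hi
  | cons k r ih =>
    rcases List.mem_cons.mp hi with rfl | hi'
    · have := key i j r hr hij ((List.mem_cons.mp hj).resolve_left hij.symm)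
      rw [this.1, this.2, mul_one]
    rcases List.mem_cons.mp hj with rfl | hj'
    · have := key j i r hr hij.symm hi'
      rw [this.1, this.2, ksign_comm]
      rcases ksign_eq_or (p j) (p i) with h | h <;> simp [h]
    · obtain ⟨hk, hr'⟩ := List.nodup_cons.mp hr
      rw [mulSign, mulSign, ih hr' hi' hj', Pi.single_eq_of_ne (by rintro rfl; exact hk hi'),
        Pi.single_eq_of_ne (by rintro rfl; exact hk hj'), pow_zero, pow_zero, one_mul, one_mul]

open Classical in
/-- The action of a variable on the space with a basis indexed by exponents. -/
def varAct (r : List ι) (i : ι) : Module.End ℂ ((ι → ℕ) →₀ ℂ) :=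
  Finsupp.linearCombination ℂ fun d => if Adm p (d + Pi.single i 1) then
    Finsupp.single (d + Pi.single i 1) (mulSign p r d (Pi.single i 1)) else 0

open Classical in
theorem varAct_single (r : List ι) (i : ι) (d : ι → ℕ) (c : ℂ) :
    varAct p r i (Finsupp.single d c) = if Adm p (d + Pi.single i 1) then
      Finsupp.single (d + Pi.single i 1) (c * mulSign p r d (Pi.single i 1)) else 0 := by
  rw [varAct, Finsupp.linearCombination_single]
  split <;> simp

variable {r : List ι} (hr : r.Nodup) (hall : ∀ i, i ∈ r)

include hr hall in
theorem varAct_mul (i j : ι) :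
    varAct p r i * varAct p r j = ksign (p i) (p j) • (varAct p r j * varAct p r i) := by
  classical
  refine Finsupp.lhom_ext fun d c => ?_
  have hd : d + Pi.single i 1 + Pi.single j 1 = d + Pi.single j 1 + Pi.single i 1 := by abel
  simp only [Module.End.mul_apply, LinearMap.smul_apply, varAct_single]
  by_cases h : Adm p (d + Pi.single j 1 + Pi.single i 1)
  · have hj : Adm p (d + Pi.single j 1) := h.mono p (by intro k; simp)
    have hi : Adm p (d + Pi.single i 1) := h.mono p (by rw [← hd]; intro k; simp)
    rw [if_pos hi, if_pos hj, varAct_single, varAct_single, if_pos h, if_pos (hd ▸ h), hd,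
      Finsupp.smul_single]
    congr 1
    -- Multiplicativity in the exponent `d` cancels the contribution of `d` and leaves the signs of
    -- two single variables.
    rw [mulSign_add_left, mulSign_add_left]
    by_cases hij : i = j
    · subst hij
      -- If `d + 2 e_i` is admissible, then `i` is even and there is no sign to compare.
      have hpi : p i ≠ 1 := fun hpi => by
        have := h i hpi
        simp at this
      rw [(zmod2_cases (p i)).resolve_right hpi]
      simp [ksign]
    · rw [mulSign_single p hr hij (hall i) (hall j), smul_eq_mul]
      ring
  · have h1 : ∀ x : ℂ, varAct p r i (if Adm p (d + Pi.single j 1) then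
        Finsupp.single (d + Pi.single j 1) x else 0) = 0 := by
      intro x
      split
      · rw [varAct_single, if_neg h]
      · simp
    have h2 : ∀ x : ℂ, varAct p r j (if Adm p (d + Pi.single i 1) then
        Finsupp.single (d + Pi.single i 1) x else 0) = 0 := by
      intro x
      split
      · rw [varAct_single, if_neg (hd ▸ h)]
      · simp
    rw [h1, h2, smul_zero]

/-- The action on the space with a basis indexed by exponents. -/
def monoRep (hr : r.Nodup) (hall : ∀ i, i ∈ r) :
    FreeSuperRing p →ₐ[ℂ] Module.End ℂ ((ι → ℕ) →₀ ℂ) :=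
  lift p (varAct p r) (varAct_mul p hr hall)

theorem monoRep_X_pow (i : ι) (n : ℕ) (d : ι → ℕ) (c : ℂ) (hc : c ≠ 0)
    (h : Adm p (d + Pi.single i n)) : ∃ c' : ℂ, c' ≠ 0 ∧
      monoRep p hr hall (X p i ^ n) (Finsupp.single d c) =
        Finsupp.single (d + Pi.single i n) c' := by
  classical
  induction n with
  | zero => exact ⟨c, hc, by simp⟩
  | succ n ih =>
    have hs : d + Pi.single i (n + 1) = d + Pi.single i n + Pi.single i 1 := by
      rw [Pi.single_add, add_assoc]
    obtain ⟨c', hc', h'⟩ := ih (h.mono p (by rw [hs]; intro k; simp))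
    refine ⟨c' * mulSign p r (d + Pi.single i n) (Pi.single i 1),
      mul_ne_zero hc' (mulSign_ne_zero _ _ _ _), ?_⟩
    rw [pow_succ', map_mul, Module.End.mul_apply, h', monoRep, lift_X, varAct_single,
      if_pos (hs ▸ h), hs]

/-- The induction runs over a sublist `r'` of the variables with an arbitrary starting exponent `e`,
while the representation stays that of the full list `r`. The rightmost factor of the ascending
monomial acts first. -/
theorem monoRep_asc (r' : List ι) (hr' : r'.Nodup) (d : ι → ℕ) (e : ι → ℕ) (c : ℂ) (hc : c ≠ 0)
    (h : Adm p (e + fun i => if i ∈ r' then d i else 0)) : ∃ c' : ℂ, c' ≠ 0 ∧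
      monoRep p hr hall (asc p r' d) (Finsupp.single e c) =
        Finsupp.single (e + fun i => if i ∈ r' then d i else 0) c' := by
  induction r' generalizing e c with
  | nil => exact ⟨c, hc, by simp [asc, show (fun _ : ι => (0 : ℕ)) = 0 from rfl]⟩
  | cons i r' ih =>
    obtain ⟨hi, hr''⟩ := List.nodup_cons.mp hr'
    have hs : (e + fun k => if k ∈ i :: r' then d k else 0) =
        (e + Pi.single i (d i)) + fun k => if k ∈ r' then d k else 0 := by
      ext k
      by_cases hk : k = i
      · subst hk; simp [hi]
      · simp [hk, List.mem_cons]
    rw [hs] at h ⊢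
    obtain ⟨c₁, hc₁, h₁⟩ := monoRep_X_pow p hr hall i (d i) e c hc
      (h.mono p (by intro k; simp))
    obtain ⟨c₂, hc₂, h₂⟩ := ih hr'' _ c₁ hc₁ h
    exact ⟨c₂, hc₂, by rw [asc, map_mul, Module.End.mul_apply, h₁, h₂]⟩

include hr hall in
/-- The monomials with admissible exponents are linearly independent. -/
theorem linearIndependent_asc :
    LinearIndependent ℂ fun d : {d : ι → ℕ // Adm p d} => asc p r d.1 := by
  have hex : ∀ d : {d : ι → ℕ // Adm p d}, ∃ c : ℂ, c ≠ 0 ∧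
      monoRep p hr hall (asc p r d.1) (Finsupp.single 0 1) = Finsupp.single d.1 c := by
    intro d
    have := monoRep_asc p hr hall r hr d.1 0 1 one_ne_zero
    simp only [hall, if_true, zero_add] at this
    exact this d.2
  choose c hc h using hex
  -- Acting on the vacuum vector sends each admissible monomial to a nonzero multiple of its own
  -- basis vector.
  let ev : FreeSuperRing p →ₗ[ℂ] ((ι → ℕ) →₀ ℂ) :=
    (monoRep p hr hall).toLinearMap.flip (Finsupp.single 0 1)
  refine LinearIndependent.of_comp ev ?_
  have he : ev ∘ (fun d : {d : ι → ℕ // Adm p d} => asc p r d.1) =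
      fun d => Units.mk0 (c d) (hc d) • (Finsupp.single d.1 1 : (ι → ℕ) →₀ ℂ) := by
    ext1 d
    refine (h d).trans ?_
    rw [Units.smul_def, Finsupp.smul_single]
    simp
  rw [he]
  refine LinearIndependent.units_smul (v := fun d : {d : ι → ℕ // Adm p d} =>
    (Finsupp.single d.1 1 : (ι → ℕ) →₀ ℂ)) ?_ (fun d => Units.mk0 (c d) (hc d))
  exact (Finsupp.linearIndependent_single_one ℂ (ι → ℕ)).comp Subtype.val Subtype.val_injective

end independence

end FreeSuperRing

/-! ### The monomial superalgebra -/

namespace Setting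

variable {g : Type} [AddCommGroup g] [Module ℂ g] [LieSuperalgebra g] (S : Setting g)

/-- The parities of the variables `v`, `x_i` and `ξ_i`. -/
def polyPar (i : Option (Fin S.N)) : ZMod 2 := i.elim 0 S.p

/-- The indices of the variables `v`, `x_i` and `ξ_i`, in descending order. -/
def polyDesc : List (Option (Fin S.N)) := none :: S.desc.map some

/-- The exponent of the monomial `ξ^I x^𝐦 v^k`. -/
def polyExp (e : S.Exp) (k : ℕ) (i : Option (Fin S.N)) : ℕ := i.elim k e

/-- The monomial `ξ^I x^𝐦 v^k`, with the factors in ascending order of the indices. -/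
def polyAsc (e : S.Exp) (k : ℕ) : S.polyAlg :=
  (FreeSuperRing.asc S.polyPar S.polyDesc (S.polyExp e k) : FreeSuperRing S.polyPar)

theorem nodup_polyDesc : S.polyDesc.Nodup := by
  rw [polyDesc, List.nodup_cons]
  exact ⟨by simp, S.nodup_desc.map (Option.some_injective _)⟩

theorem mem_polyDesc (i : Option (Fin S.N)) : i ∈ S.polyDesc := by
  cases i <;> simp [polyDesc, S.mem_desc]

theorem polyExp_add (e e' : S.Exp) (k k' : ℕ) :
    S.polyExp e k + S.polyExp e' k' = S.polyExp (e + e') (k + k') := by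
  ext i
  cases i <;> rfl

theorem passSign_map_some (r : List (Fin S.N)) (i : Fin S.N) (e : S.Exp) (k : ℕ) :
    passSign S.polyPar (r.map some) (some i) (S.polyExp e k) = passSign S.p r i e := by
  simp only [passSign, List.map_map]
  rfl

theorem mulSign_map_some (r : List (Fin S.N)) (e e' : S.Exp) (k k' : ℕ) :
    mulSign S.polyPar (r.map some) (S.polyExp e k) (S.polyExp e' k') = mulSign S.p r e e' := by
  induction r with
  | nil => rfl
  | cons i r ih =>
    rw [List.map_cons, mulSign, mulSign, ih, passSign_map_some]
    rfl

/-- The variable `v` is even and contributes no sign. -/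
theorem mulSign_polyDesc (e e' : S.Exp) (k k' : ℕ) :
    mulSign S.polyPar S.polyDesc (S.polyExp e k) (S.polyExp e' k') = S.sign e e' := by
  have h : passSign S.polyPar (S.desc.map some) none (S.polyExp e k) = 1 := by
    have : S.polyPar none = 0 := rfl
    refine List.prod_eq_one fun x hx => ?_
    obtain ⟨i, -, rfl⟩ := List.mem_map.mp hx
    simp [this, ksign]
  rw [polyDesc, mulSign, h, one_pow, one_mul, mulSign_map_some, sign]

/-- This is the sign of `coeff_mul`; their agreement is what identifies leading terms in `R(λ)` with
monomials. -/
theorem polyAsc_mul (e e' : S.Exp) (k k' : ℕ) :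
    S.polyAsc e k * S.polyAsc e' k' = S.sign e' e • S.polyAsc (e + e') (k + k') := by
  refine (FreeSuperRing.asc_mul_asc S.polyPar S.polyDesc (S.polyExp e k)
    (S.polyExp e' k')).trans ?_
  rw [mulSign_polyDesc, polyExp_add]
  rfl

theorem polyAsc_zero : S.polyAsc 0 0 = 1 := by
  have h : ∀ r : List (Option (Fin S.N)),
      FreeSuperRing.asc S.polyPar r (S.polyExp 0 0) = 1 := by
    intro r
    induction r with
    | nil => rfl
    | cons i r ih =>
      have : S.polyExp 0 0 i = 0 := by cases i <;> rfl
      rw [FreeSuperRing.asc, ih, this, pow_zero, mul_one]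
  exact h _

theorem polyAsc_eq_zero {e : S.Exp} (h : ¬ S.Admissible e) (k : ℕ) : S.polyAsc e k = 0 := by
  simp only [Admissible, not_forall, not_le] at h
  obtain ⟨i, hi, h2⟩ := h
  exact FreeSuperRing.asc_eq_zero S.polyPar (i := some i) (S.mem_polyDesc _) hi h2

theorem par_polyAsc (e : S.Exp) (k : ℕ) :
    S.polyAlg.par (S.polyAsc e k) = ksign 1 (S.parity e) • S.polyAsc e k := by
  refine (FreeSuperRing.par_asc S.polyPar S.polyDesc (S.polyExp e k)).trans ?_
  have h : (S.polyDesc.map fun i => (S.polyExp e k i : ZMod 2) * S.polyPar i).sum = S.parity e := by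
    rw [polyDesc, List.map_cons, List.sum_cons, List.map_map]
    have h0 : S.polyPar none = 0 := rfl
    rw [h0, mul_zero, zero_add, parity, ← List.sum_ofFn, List.ofFn_eq_map, desc, List.map_reverse,
      List.sum_reverse]
    rfl
  rw [h]
  rfl

theorem exists_polyMono (e : S.Exp) : ∃ c : ℂ, c ≠ 0 ∧ S.polyMono e = c • S.polyAsc e 1 := by
  obtain ⟨c, hc, h⟩ := FreeSuperRing.exists_descending S.polyPar (S.desc.map some) (S.polyExp e 1)
  refine ⟨c, hc, ?_⟩
  have h1 : (List.ofFn fun i => S.polyX (some i) ^ e i).reverse.prod =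
      (((S.desc.map some).map fun i => FreeSuperRing.X S.polyPar i ^ S.polyExp e 1 i).prod :
        FreeSuperRing S.polyPar) := by
    rw [List.map_map, desc, List.map_reverse, List.ofFn_eq_map]
    rfl
  have h2 : ((S.desc.map some).map fun i =>
      FreeSuperRing.X S.polyPar i ^ S.polyExp e 1 i).prod * FreeSuperRing.X S.polyPar none =
      c • FreeSuperRing.asc S.polyPar S.polyDesc (S.polyExp e 1) := by
    rw [h, smul_mul_assoc, polyDesc, FreeSuperRing.asc]
    congr 2
    exact (pow_one _).symm
  rw [polyMono, h1]
  exact h2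

theorem linearIndependent_polyAsc :
    LinearIndependent ℂ fun x : {e : S.Exp // S.Admissible e} × ℕ => S.polyAsc x.1 x.2 := by
  have h := FreeSuperRing.linearIndependent_asc S.polyPar S.nodup_polyDesc S.mem_polyDesc
  let F : {e : S.Exp // S.Admissible e} × ℕ → {d // FreeSuperRing.Adm S.polyPar d} :=
    fun x => ⟨S.polyExp x.1 x.2, fun i hi => by
      cases i with
      | none => exact absurd hi (by decide : ¬ (0 : ZMod 2) = 1)
      | some i => exact x.1.2 i hi⟩
  refine h.comp F ?_
  rintro ⟨⟨e, he⟩, k⟩ ⟨⟨e', he'⟩, k'⟩ hF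
  have h1 : S.polyExp e k = S.polyExp e' k' := congrArg Subtype.val hF
  have h2 : k = k' := congrFun h1 none
  have h3 : e = e' := funext fun i => congrFun h1 (some i)
  subst h2 h3
  rfl

end Setting

/-! ### Morphisms from free superalgebras, and the components of `R(λ)` -/

/-- The morphism from a free supercommutative superalgebra that is given by the images of the
variables. -/
def FreeSuper.lift {ι : Type} {p : ι → ZMod 2} {A : SuperAlg} (f : ι → A)
    (hf : ∀ i, A.par (f i) = ksign 1 (p i) • f i) : FreeSuper p ⟶ A where
  hom := FreeSuperRing.lift p f fun i j => A.comm _ _ _ _ (hf i) (hf j)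
  map_par := by
    have h : (FreeSuperRing.lift p f fun i j => A.comm _ _ _ _ (hf i) (hf j)).comp
        (FreeSuperRing.par p) = A.par.comp (FreeSuperRing.lift p f fun i j =>
          A.comm _ _ _ _ (hf i) (hf j)) :=
      FreeSuperRing.hom_ext p fun i => by
        rw [AlgHom.comp_apply, AlgHom.comp_apply, FreeSuperRing.par_X, map_smul,
          FreeSuperRing.lift_X, hf]
    exact fun a => congrArg (fun F : FreeSuperRing p →ₐ[ℂ] A => F a) h

theorem FreeSuper.lift_X {ι : Type} {p : ι → ZMod 2} {A : SuperAlg} (f : ι → A)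
    (hf : ∀ i, A.par (f i) = ksign 1 (p i) • f i) (i : ι) :
    (FreeSuper.lift f hf).hom (FreeSuperRing.X p i) = f i :=
  FreeSuperRing.lift_X p f (fun i j => A.comm _ _ _ _ (hf i) (hf j)) i

/-- The inclusion of a component of `R(λ)`. -/
def RAlg.lof {g : Type} [AddCommGroup g] [Module ℂ g] [LieSuperalgebra g] (b : Borel g)
    (l : Module.Dual ℂ b.H) (k : ℕ) : RPiece b l k →ₗ[ℂ] RAlg b l :=
  (DirectSum.lof ℂ ℕ (RPiece b l) k : RPiece b l k →ₗ[ℂ] RRing b l)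

/-- The projection to a component of `R(λ)`. -/
def RAlg.proj {g : Type} [AddCommGroup g] [Module ℂ g] [LieSuperalgebra g] (b : Borel g)
    (l : Module.Dual ℂ b.H) (k : ℕ) : RAlg b l →ₗ[ℂ] RPiece b l k :=
  (DirectSum.component ℂ ℕ (RPiece b l) k : RRing b l →ₗ[ℂ] RPiece b l k)

namespace RAlg

variable {g : Type} [AddCommGroup g] [Module ℂ g] [LieSuperalgebra g] {b : Borel g}
  {l : Module.Dual ℂ b.H}

theorem of_eq (k : ℕ) (φ : Module.Dual ℂ (KMod b (k • l))) :
    RAlg.of b l k φ = RAlg.lof b l k (RPiece.ofDual φ) := rfl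

theorem proj_lof (k : ℕ) (φ : RPiece b l k) : RAlg.proj b l k (RAlg.lof b l k φ) = φ :=
  DirectSum.component.lof_self (R := ℂ) (M := RPiece b l) k φ

theorem proj_lof_of_ne {k k' : ℕ} (h : k ≠ k') (φ : RPiece b l k) :
    RAlg.proj b l k' (RAlg.lof b l k φ) = 0 :=
  DirectSum.of_eq_of_ne (β := RPiece b l) k k' φ h.symm

theorem lof_mul {m n : ℕ} (φ : RPiece b l m) (ψ : RPiece b l n) :
    RAlg.lof b l m φ * RAlg.lof b l n ψ = RAlg.lof b l (m + n) (RPiece.mul φ ψ) :=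
  RRing.of_mul_of b l φ ψ

theorem lof_one : RAlg.lof b l 0 RPiece.one = 1 := rfl

end RAlg

namespace Setting

variable {g : Type} [AddCommGroup g] [Module ℂ g] [LieSuperalgebra g] (S : Setting g)

/-! ### The filtration of the components of `R(λ)` -/

/-- The functionals that vanish at `f^d v_{kλ}` for all admissible `d ≤ e`. -/
def gt (k : ℕ) (e : S.Exp) : Submodule ℂ (RPiece S.b S.wt k) where
  carrier := {φ | ∀ d, S.Admissible d → ¬ S.lt e d → S.coeff k d φ = 0}
  add_mem' h h' d hd hlt := by rw [map_add, h d hd hlt, h' d hd hlt, add_zero]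
  zero_mem' d _ _ := map_zero _
  smul_mem' c φ h d hd hlt := by rw [map_smul, h d hd hlt, smul_zero]

theorem mem_gt_of_mem_ge {k : ℕ} {e : S.Exp} {φ : RPiece S.b S.wt k} (h : φ ∈ S.ge k e)
    (h' : S.Admissible e → S.coeff k e φ = 0) : φ ∈ S.gt k e := by
  intro d hd hlt
  rcases trichotomous_of S.lt d e with h1 | rfl | h1
  · exact h d hd h1
  · exact h' hd
  · exact absurd h1 hlt

theorem ge_le_gt {k : ℕ} {e e' : S.Exp} (h : S.lt e e') : S.ge k e' ≤ S.gt k e := by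
  intro φ hφ d hd hlt
  rcases trichotomous_of S.lt d e with h1 | rfl | h1
  · exact hφ d hd (_root_.trans h1 h)
  · exact hφ d hd h
  · exact absurd h1 hlt

theorem coeff_vec_eq_zero {k : ℕ} {φ : RPiece S.b S.wt k} {e : S.Exp} :
    S.coeff k e φ = 0 ↔ φ.toDual (S.vec k e) = 0 := by
  rw [coeff_apply, mul_eq_zero_iff_left (inv_ne_zero (S.fact_ne_zero e))]

theorem counit_mono_of_ne {d : S.Exp} (h : d ≠ 0) : SuperRep.counit g (S.mono d) = 0 := by
  obtain ⟨i, hi⟩ := Function.ne_iff.mp h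
  obtain ⟨n, hn⟩ := Nat.exists_eq_succ_of_ne_zero hi
  have hz : ∀ x : g, (SuperRep.triv g).ρ (Env.ι g x) = 0 := fun x => SuperRep.triv_act x
  change (SuperRep.triv g).ρ (S.mono d) 1 = 0
  have : (SuperRep.triv g).ρ (S.mono d) = 0 := by
    rw [mono_eq, monoList, map_list_prod]
    refine List.prod_eq_zero ?_
    rw [List.map_map]
    refine List.mem_map.mpr ⟨i, S.mem_desc i, ?_⟩
    rw [Function.comp_apply, hn, map_pow, hz, zero_pow (Nat.succ_ne_zero n)]
  rw [this]; rfl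

theorem mono_zero : S.mono 0 = 1 := by
  rw [mono]
  refine List.prod_eq_one fun x hx => ?_
  rw [List.mem_reverse, List.mem_ofFn] at hx
  obtain ⟨i, rfl⟩ := hx
  exact pow_zero _

theorem counit_one : SuperRep.counit g 1 = 1 := by
  change (SuperRep.triv g).ρ 1 1 = 1
  rw [map_one (SuperRep.triv g).ρ]; rfl

/-- As a functional on `U(g)` the unit is the counit, which vanishes on all monomials except `1`. -/
theorem one_mem_ge : (RPiece.one : RPiece S.b S.wt 0) ∈ S.ge 0 0 := by
  intro d _ hlt
  have hd : d ≠ 0 := by rintro rfl; exact S.not_lt_self _ hlt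
  have h := S.pull_mono 0 d (RPiece.one : RPiece S.b S.wt 0)
  rw [RPiece.pull_one, S.counit_mono_of_ne hd] at h
  exact (mul_eq_zero.mp h.symm).resolve_left (S.fact_ne_zero d)

theorem coeff_one : S.coeff 0 0 (RPiece.one : RPiece S.b S.wt 0) = 1 := by
  have h := S.pull_mono 0 0 (RPiece.one : RPiece S.b S.wt 0)
  rw [RPiece.pull_one, mono_zero, counit_one] at h
  have hf : S.fact 0 = 1 := by simp [fact]
  rw [hf, one_mul] at h
  exact h.symm

/-! ### The leading monomials -/

/-- The map `𝒮 → ℂ[v, x_1, …, ξ_q]` that sends the variable of `e` to the monomial of exponent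
`(e, 1)`. -/
def lead : S.freeAlg ⟶ S.polyAlg :=
  FreeSuper.lift (fun e : S.es 1 => S.polyAsc e 1) fun e => S.par_polyAsc e 1

theorem lead_X (e : S.es 1) : S.lead.hom (S.freeX e) = S.polyAsc e 1 :=
  FreeSuper.lift_X (A := S.polyAlg) (fun e : S.es 1 => S.polyAsc e 1)
    (fun e => S.par_polyAsc e 1) e

theorem freeMono_nil : S.freeMono [] = 1 := rfl

theorem freeMono_cons (e : S.es 1) (L : List (S.es 1)) :
    S.freeMono (e :: L) = S.freeX e * S.freeMono L := List.prod_cons ..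

theorem freeMono_append (L L' : List (S.es 1)) :
    S.freeMono (L ++ L') = S.freeMono L * S.freeMono L' := by
  rw [freeMono, freeMono, freeMono, List.map_append, List.prod_append]

variable {S} in
theorem HasDegree.append {L L' : List (S.es 1)} {e e' : S.Exp} {h h' : ℕ} (H : S.HasDegree L e h)
    (K : S.HasDegree L' e' h') : S.HasDegree (L ++ L') (e + e') (h + h') :=
  ⟨by rw [List.length_append, H.1, K.1], by rw [List.map_append, List.sum_append, H.2, K.2]⟩

/-- A dual basis and the corresponding evaluation map. -/
structure DualBasis where
  η : ∀ (k : ℕ), S.es k → Module.Dual ℂ (KMod S.b (k • S.wt))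
  η_vec : ∀ k (e e' : S.es k), η k e (S.vec k e') =
    if e = e' then ((∏ i, (e.1 i).factorial : ℕ) : ℂ) else 0
  ev : S.freeAlg ⟶ RAlg S.b S.wt
  ev_X : ∀ e : S.es 1, ev.hom (S.freeX e) = RAlg.of S.b S.wt 1 (η 1 e)

namespace DualBasis

variable {S} (E : S.DualBasis)

theorem coeff_η (k : ℕ) (e e' : S.es k) :
    S.coeff k e' (RPiece.ofDual (E.η k e)) = if e = e' then 1 else 0 := by
  rw [coeff_apply, RPiece.toDual_ofDual, E.η_vec]
  split
  · next h => subst h; exact inv_mul_cancel₀ (S.fact_ne_zero e)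
  · exact mul_zero _

variable [FiniteDimensional ℂ g] (hg : IsBasic g)

-- For admissible `d < e` the vector `f^d v` is a combination of essential vectors with exponents at
-- most `d`, and `η_e` vanishes on these.
include hg in
theorem η_mem_ge (k : ℕ) (e : S.es k) : RPiece.ofDual (E.η k e) ∈ S.ge k e := by
  intro d hd hlt
  rw [coeff_vec_eq_zero]
  have : Submodule.span ℂ {x | ∃ e ∈ S.es k, ¬ S.lt d e ∧ x = S.vec k e} ≤
      LinearMap.ker (E.η k e) := by
    refine Submodule.span_le.mpr ?_
    rintro _ ⟨d', hd', hn, rfl⟩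
    refine (E.η_vec k e ⟨d', hd'⟩).trans (if_neg ?_)
    rintro rfl
    exact hn hlt
  exact this (S.vec_mem_span_es hg k hd)

include hg in
/-- A functional is determined by its values at the essential vectors. -/
theorem eq_sum [Fintype (S.es k)] (φ : RPiece S.b S.wt k) :
    φ = ∑ e : S.es k, S.coeff k e φ • (RPiece.ofDual (E.η k e) : RPiece S.b S.wt k) := by
  classical
  have h : ∀ ψ : RPiece S.b S.wt k, (∀ e ∈ S.es k, S.coeff k e ψ = 0) → ψ = 0 := by
    intro ψ hψ
    have : (⊤ : Submodule ℂ (KMod S.b (k • S.wt))) ≤ LinearMap.ker ψ.toDual := by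
      rw [← S.span_es hg k]
      refine Submodule.span_le.mpr ?_
      rintro _ ⟨e, rfl⟩
      exact (coeff_vec_eq_zero S).mp (hψ e e.2)
    exact LinearMap.ext fun x => this (Submodule.mem_top (x := x))
  rw [← sub_eq_zero]
  refine h _ fun e he => ?_
  rw [map_sub, map_sum, Finset.sum_eq_single (⟨e, he⟩ : S.es k)]
  · rw [map_smul, E.coeff_η k ⟨e, he⟩ ⟨e, he⟩, if_pos rfl, smul_eq_mul, mul_one, sub_self]
  · intro d _ hd
    rw [map_smul, E.coeff_η k d ⟨e, he⟩, if_neg hd, smul_zero]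
  · intro h; exact absurd (Finset.mem_univ _) h

-- Expanding a functional in the dual basis turns membership in a span of the `η_{e'}` into
-- vanishing conditions, which are easier to multiply.
include hg in
theorem lof_mem_above {k : ℕ} {e : S.Exp} {φ : RPiece S.b S.wt k} :
    RAlg.lof S.b S.wt k φ ∈ S.above E.η e k ↔ φ ∈ S.gt k e := by
  constructor
  · intro h
    have hle : S.above E.η e k ≤ (S.gt k e).comap (RAlg.proj S.b S.wt k) := by
      refine Submodule.span_le.mpr ?_
      rintro _ ⟨e', hlt, rfl⟩
      refine Submodule.mem_comap.mpr ?_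
      rw [RAlg.of_eq, RAlg.proj_lof]
      exact S.ge_le_gt hlt (E.η_mem_ge hg k e')
    have := hle h
    rwa [Submodule.mem_comap, RAlg.proj_lof] at this
  · intro h
    have := (S.finite_es hg k).fintype
    rw [E.eq_sum hg φ, map_sum]
    refine Submodule.sum_mem _ fun e' _ => ?_
    rw [map_smul]
    by_cases hlt : S.lt e e'
    · exact Submodule.smul_mem _ _ (Submodule.subset_span ⟨e', hlt, rfl⟩)
    · rw [h e' e'.2.1 hlt, zero_smul]; exact zero_mem _

include hg in
/-- The leading term of a monomial. -/
theorem exists_ev_freeMono (L : List (S.es 1)) (e : S.Exp) (h : ℕ) (H : S.HasDegree L e h) :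
    ∃ φ ∈ S.ge h e, E.ev.hom (S.freeMono L) = RAlg.lof S.b S.wt h φ ∧ ∃ c : ℂ, (c = 1 ∨ c = -1) ∧
      S.lead.hom (S.freeMono L) = c • S.polyAsc e h ∧
      (S.Admissible e → S.coeff h e φ = c) := by
  induction L generalizing e h with
  | nil =>
    obtain ⟨rfl, rfl⟩ := H
    refine ⟨RPiece.one, S.one_mem_ge, ?_, 1, Or.inl rfl, ?_, fun _ => S.coeff_one⟩
    · rw [freeMono_nil, map_one]; exact RAlg.lof_one.symm
    · rw [freeMono_nil, map_one, one_smul]; exact S.polyAsc_zero.symm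
  | cons d L ih =>
    obtain ⟨hh, he⟩ := H
    rw [List.map_cons, List.sum_cons] at he
    rw [List.length_cons, add_comm] at hh
    subst hh he
    obtain ⟨φ, hφ, h1, c, hc, h2, h3⟩ := ih _ _ ⟨rfl, rfl⟩
    have hd := E.η_mem_ge hg 1 d
    -- One more variable multiplies the leading coefficient in `R(λ)` and the scalar in the
    -- polynomial superalgebra by the same sign, so the two stay equal along the list.
    refine ⟨RPiece.mul (RPiece.ofDual (E.η 1 d)) φ, S.mul_mem_ge hd hφ, ?_,
      S.sign (L.map Subtype.val).sum d * c, ?_, ?_, fun hadm => ?_⟩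
    · rw [freeMono_cons, map_mul, h1, E.ev_X, RAlg.of_eq, RAlg.lof_mul]
    · rcases S.sign_eq_or (L.map Subtype.val).sum d with h | h <;> rcases hc with hc | hc <;>
        rw [h, hc] <;> norm_num
    · rw [freeMono_cons, map_mul, h2, lead_X, mul_smul_comm, polyAsc_mul, smul_smul, mul_comm c]
    · rw [S.coeff_mul hd hφ hadm, E.coeff_η, if_pos rfl, one_mul,
        h3 fun i hi => le_trans (by simp) (hadm i hi)]

include hg in
/-- The leading term of a homogeneous element. -/
theorem exists_ev {e : S.Exp} {h : ℕ} {s : S.freeAlg} (hs : s ∈ S.component e h) :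
    ∃ φ ∈ S.ge h e, E.ev.hom s = RAlg.lof S.b S.wt h φ ∧ ∃ c : ℂ,
      S.lead.hom s = c • S.polyAsc e h ∧ (S.Admissible e → S.coeff h e φ = c) := by
  induction hs using Submodule.span_induction with
  | mem s hs =>
    obtain ⟨L, H, rfl⟩ := hs
    obtain ⟨φ, hφ, h1, c, -, h2, h3⟩ := E.exists_ev_freeMono hg L e h H
    exact ⟨φ, hφ, h1, c, h2, h3⟩
  | zero => exact ⟨0, zero_mem _, by simp, 0, by simp, fun _ => map_zero _⟩
  | add x y _ _ hx hy =>
    obtain ⟨φ, hφ, h1, c, h2, h3⟩ := hx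
    obtain ⟨ψ, hψ, k1, d, k2, k3⟩ := hy
    exact ⟨φ + ψ, add_mem hφ hψ, by rw [map_add, map_add, h1, k1], c + d,
      by rw [map_add, h2, k2, add_smul], fun hadm => by rw [map_add, h3 hadm, k3 hadm]⟩
  | smul a x _ hx =>
    obtain ⟨φ, hφ, h1, c, h2, h3⟩ := hx
    exact ⟨a • φ, Submodule.smul_mem _ _ hφ, by rw [map_smul, map_smul, h1], a * c,
      by rw [map_smul, h2, smul_smul], fun hadm => by rw [map_smul, h3 hadm, smul_eq_mul]⟩

include hg in
/-- A homogeneous element is in the kernel of `𝒮 → gr R(λ)` if and only if it is in the kernel of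
the map to the monomial superalgebra. -/
theorem ev_mem_above_iff {e : S.Exp} {h : ℕ} {s : S.freeAlg} (hs : s ∈ S.component e h) :
    E.ev.hom s ∈ S.above E.η e h ↔ S.lead.hom s = 0 := by
  obtain ⟨φ, hφ, h1, c, h2, h3⟩ := E.exists_ev hg hs
  rw [h1, E.lof_mem_above hg, h2]
  constructor
  · intro hgt
    -- For inadmissible `e` the monomial `polyAsc e h` is zero because it contains the square of an
    -- odd variable; so every homogeneous element of this degree is in the kernel.
    by_cases hadm : S.Admissible e
    · rw [← h3 hadm, hgt e hadm (S.not_lt_self e), zero_smul]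
    · rw [S.polyAsc_eq_zero hadm, smul_zero]
  · intro h0
    refine S.mem_gt_of_mem_ge hφ fun hadm => ?_
    rw [h3 hadm]
    exact (smul_eq_zero.mp h0).resolve_right
      (S.linearIndependent_polyAsc.ne_zero (⟨e, hadm⟩, h))

end DualBasis
end Setting

/-- The dual basis and the evaluation map of a degeneration. -/
def Degeneration.dualBasis {g : Type} [AddCommGroup g] [Module ℂ g] [LieSuperalgebra g]
    {S : Setting g} (D : Degeneration S) : S.DualBasis := ⟨D.η, D.η_vec, D.ev, D.ev_X⟩

namespace Setting

variable {g : Type} [AddCommGroup g] [Module ℂ g] [LieSuperalgebra g] (S : Setting g)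

/-! ### The grading of `𝒮` -/

theorem freeX_mul_freeX (e d : S.es 1) : S.freeX e * S.freeX d =
    ksign (S.parity e) (S.parity d) • (S.freeX d * S.freeX e) :=
  FreeSuperRing.X_mul_X (fun e : S.es 1 => S.parity e) e d

/-- The coaction `s ↦ s ⊗ (e, h)`, for `s` homogeneous of degree `(e, h)`. -/
def gradHom : S.freeAlg →ₐ[ℂ] AddMonoidAlgebra S.freeAlg (S.Exp × ℕ) :=
  FreeSuperRing.lift (fun e : S.es 1 => S.parity e)
    (fun e => AddMonoidAlgebra.single ((e : S.Exp), 1) (S.freeX e)) fun e e' => by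
      rw [AddMonoidAlgebra.single_mul_single, AddMonoidAlgebra.single_mul_single,
        AddMonoidAlgebra.smul_single, ← freeX_mul_freeX, add_comm]

theorem gradHom_X (e : S.es 1) :
    S.gradHom (S.freeX e) = AddMonoidAlgebra.single ((e : S.Exp), 1) (S.freeX e) :=
  FreeSuperRing.lift_X ..

theorem gradHom_freeMono {L : List (S.es 1)} {e : S.Exp} {h : ℕ} (H : S.HasDegree L e h) :
    S.gradHom (S.freeMono L) = AddMonoidAlgebra.single (e, h) (S.freeMono L) := by
  induction L generalizing e h with
  | nil =>
    obtain ⟨rfl, rfl⟩ := H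
    rw [freeMono_nil, map_one]; rfl
  | cons d L ih =>
    obtain ⟨rfl, rfl⟩ := H
    rw [freeMono_cons, map_mul, gradHom_X, ih ⟨rfl, rfl⟩, AddMonoidAlgebra.single_mul_single,
      List.map_cons, List.sum_cons, List.length_cons, Prod.mk_add_mk, add_comm 1]

/-- The projection to a component of `𝒮`. -/
def compProj (γ : S.Exp × ℕ) : S.freeAlg →ₗ[ℂ] S.freeAlg where
  toFun s := (S.gradHom s).coeff γ
  map_add' s s' := by rw [map_add]; rfl
  map_smul' c s := by rw [map_smul]; rfl

theorem compProj_freeMono {L : List (S.es 1)} {e : S.Exp} {h : ℕ} (H : S.HasDegree L e h) :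
    S.compProj (e, h) (S.freeMono L) = S.freeMono L := by
  change (S.gradHom _).coeff _ = _
  rw [S.gradHom_freeMono H]
  simp

theorem compProj_freeMono_of_ne {L : List (S.es 1)} {e : S.Exp} {h : ℕ} (H : S.HasDegree L e h)
    {γ : S.Exp × ℕ} (hγ : (e, h) ≠ γ) : S.compProj γ (S.freeMono L) = 0 := by
  change (S.gradHom _).coeff _ = _
  rw [S.gradHom_freeMono H]
  simp [Finsupp.single_eq_of_ne hγ.symm]

theorem compProj_of_mem {e : S.Exp} {h : ℕ} {s : S.freeAlg} (hs : s ∈ S.component e h) :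
    S.compProj (e, h) s = s := by
  induction hs using Submodule.span_induction with
  | mem s hs => obtain ⟨L, H, rfl⟩ := hs; exact S.compProj_freeMono H
  | zero => exact map_zero _
  | add x y _ _ hx hy => rw [map_add, hx, hy]
  | smul a x _ hx => rw [map_smul, hx]

theorem compProj_of_mem_of_ne {e : S.Exp} {h : ℕ} {s : S.freeAlg} (hs : s ∈ S.component e h)
    {γ : S.Exp × ℕ} (hγ : (e, h) ≠ γ) : S.compProj γ s = 0 := by
  induction hs using Submodule.span_induction with
  | mem s hs => obtain ⟨L, H, rfl⟩ := hs; exact S.compProj_freeMono_of_ne H hγ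
  | zero => exact map_zero _
  | add x y _ _ hx hy => rw [map_add, hx, hy, add_zero]
  | smul a x _ hx => rw [map_smul, hx, smul_zero]

theorem freeMono_mem_component {L : List (S.es 1)} {e : S.Exp} {h : ℕ} (H : S.HasDegree L e h) :
    S.freeMono L ∈ S.component e h := Submodule.subset_span ⟨L, H, rfl⟩

theorem component_mul {e e' : S.Exp} {h h' : ℕ} {s s' : S.freeAlg} (hs : s ∈ S.component e h)
    (hs' : s' ∈ S.component e' h') : s * s' ∈ S.component (e + e') (h + h') := by
  induction hs using Submodule.span_induction with
  | mem s hs =>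
    obtain ⟨L, H, rfl⟩ := hs
    induction hs' using Submodule.span_induction with
    | mem s hs =>
      obtain ⟨L', H', rfl⟩ := hs
      rw [← freeMono_append]
      exact S.freeMono_mem_component (H.append H')
    | zero => rw [mul_zero]; exact zero_mem _
    | add x y _ _ hx hy => rw [mul_add]; exact add_mem hx hy
    | smul a x _ hx => rw [mul_smul_comm]; exact Submodule.smul_mem _ _ hx
  | zero => rw [zero_mul]; exact zero_mem _
  | add x y _ _ hx hy => rw [add_mul]; exact add_mem hx hy
  | smul a x _ hx => rw [smul_mul_assoc]; exact Submodule.smul_mem _ _ hx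

theorem span_freeMono : Submodule.span ℂ (Set.range S.freeMono) = ⊤ := by
  have hX : Algebra.adjoin ℂ (Set.range S.freeX) = ⊤ := FreeSuperRing.adjoin_X _
  rw [eq_top_iff]
  intro s _
  have h : s ∈ Subalgebra.toSubmodule (Algebra.adjoin ℂ (Set.range S.freeX)) := by
    rw [hX, Algebra.top_toSubmodule]; exact Submodule.mem_top
  rw [Algebra.adjoin_eq_span] at h
  refine Submodule.span_mono ?_ h
  intro x hx
  induction hx using Submonoid.closure_induction with
  | mem x hx => obtain ⟨e, rfl⟩ := hx; exact ⟨[e], by rw [freeMono_cons, freeMono_nil, mul_one]⟩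
  | one => exact ⟨[], rfl⟩
  | mul x y _ _ hx hy =>
    obtain ⟨L, rfl⟩ := hx
    obtain ⟨L', rfl⟩ := hy
    exact ⟨L ++ L', S.freeMono_append L L'⟩

theorem parity_add (e e' : S.Exp) : S.parity (e + e') = S.parity e + S.parity e' := by
  simp only [parity, Pi.add_apply, Nat.cast_add, add_mul, Finset.sum_add_distrib]

theorem par_freeX (e : S.es 1) : S.freeAlg.par (S.freeX e) = ksign 1 (S.parity e) • S.freeX e :=
  FreeSuperRing.par_X ..

theorem par_freeMono (L : List (S.es 1)) : S.freeAlg.par (S.freeMono L) =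
    ksign 1 (S.parity (L.map Subtype.val).sum) • S.freeMono L := by
  induction L with
  | nil => rw [freeMono_nil, map_one]; simp [parity, ksign]
  | cons d L ih =>
    rw [freeMono_cons, map_mul, ih, par_freeX, smul_mul_smul_comm, List.map_cons, List.sum_cons,
      parity_add, ksign_one_add]

theorem par_of_mem_component {e : S.Exp} {h : ℕ} {s : S.freeAlg} (hs : s ∈ S.component e h) :
    S.freeAlg.par s = ksign 1 (S.parity e) • s := by
  induction hs using Submodule.span_induction with
  | mem s hs => obtain ⟨L, H, rfl⟩ := hs; rw [par_freeMono, H.2]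
  | zero => rw [map_zero, smul_zero]
  | add x y _ _ hx hy => rw [map_add, hx, hy, smul_add]
  | smul a x _ hx => rw [map_smul, hx, smul_comm]

/-- A homogeneous element of an ideal with homogeneous generators is a homogeneous combination of
these. -/
theorem mem_span_of_mem_ideal {κ : Type} {f : κ → S.freeAlg} {J : κ → S.Exp} {h : κ → ℕ}
    (hf : ∀ k, f k ∈ S.component (J k) (h k)) {e : S.Exp} {n : ℕ} {s : S.freeAlg}
    (hs : s ∈ S.component e n) (hi : s ∈ S.freeAlg.ideal (Set.range f)) :
    s ∈ Submodule.span ℂ {x | ∃ (k : κ) (d d' : S.Exp) (i j : ℕ) (L L' : List (S.es 1)),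
      S.HasDegree L d i ∧ S.HasDegree L' d' j ∧ d + J k + d' = e ∧ i + h k + j = n ∧
      x = S.freeMono L * f k * S.freeMono L'} := by
  set W := Submodule.span ℂ {x | ∃ (k : κ) (L L' : List (S.es 1)),
    x = S.freeMono L * f k * S.freeMono L'} with hW
  have hl : ∀ a x, x ∈ W → a * x ∈ W := by
    intro a x hx
    have ha : a ∈ Submodule.span ℂ (Set.range S.freeMono) := by
      rw [span_freeMono]; exact Submodule.mem_top
    induction ha using Submodule.span_induction with
    | mem a ha =>
      obtain ⟨L₀, rfl⟩ := ha
      induction hx using Submodule.span_induction with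
      | mem x hx =>
        obtain ⟨k, L, L', rfl⟩ := hx
        exact Submodule.subset_span ⟨k, L₀ ++ L, L', by simp only [freeMono_append, mul_assoc]⟩
      | zero => rw [mul_zero]; exact zero_mem _
      | add x y _ _ hx hy => rw [mul_add]; exact add_mem hx hy
      | smul c x _ hx => rw [mul_smul_comm]; exact Submodule.smul_mem _ _ hx
    | zero => rw [zero_mul]; exact zero_mem _
    | add a b _ _ ha hb => rw [add_mul]; exact add_mem ha hb
    | smul c a _ ha => rw [smul_mul_assoc]; exact Submodule.smul_mem _ _ ha
  have hr : ∀ x a, x ∈ W → x * a ∈ W := by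
    intro x a hx
    have ha : a ∈ Submodule.span ℂ (Set.range S.freeMono) := by
      rw [span_freeMono]; exact Submodule.mem_top
    induction ha using Submodule.span_induction with
    | mem a ha =>
      obtain ⟨L₀, rfl⟩ := ha
      induction hx using Submodule.span_induction with
      | mem x hx =>
        obtain ⟨k, L, L', rfl⟩ := hx
        exact Submodule.subset_span ⟨k, L, L' ++ L₀, by simp only [freeMono_append, mul_assoc]⟩
      | zero => rw [zero_mul]; exact zero_mem _
      | add x y _ _ hx hy => rw [add_mul]; exact add_mem hx hy
      | smul c x _ hx => rw [smul_mul_assoc]; exact Submodule.smul_mem _ _ hx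
    | zero => rw [mul_zero]; exact zero_mem _
    | add a b _ _ ha hb => rw [mul_add]; exact add_mem ha hb
    | smul c a _ ha => rw [mul_smul_comm]; exact Submodule.smul_mem _ _ ha
  have hfW : ∀ k, f k ∈ W := fun k => Submodule.subset_span ⟨k, [], [], by
    rw [freeMono_nil, one_mul, mul_one]⟩
  -- `W` is a two-sided ideal that contains the generators and their parity images, hence all of the
  -- ideal.
  have hsW : s ∈ W := by
    let I : TwoSidedIdeal S.freeAlg := .mk' W (zero_mem W) (fun h h' => add_mem h h')
      (fun h => neg_mem h) (fun {a x} hx => hl a x hx) (fun {x a} hx => hr x a hx)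
    have hI : S.freeAlg.ideal (Set.range f) ≤ I := by
      refine TwoSidedIdeal.span_le.mpr ?_
      rintro _ (⟨k, rfl⟩ | ⟨_, ⟨k, rfl⟩, rfl⟩)
      · exact (TwoSidedIdeal.mem_mk' ..).mpr (hfW k)
      · refine (TwoSidedIdeal.mem_mk' ..).mpr ?_
        change S.freeAlg.par (f k) ∈ W
        rw [S.par_of_mem_component (hf k)]
        exact Submodule.smul_mem _ _ (hfW k)
    exact (TwoSidedIdeal.mem_mk' ..).mp (hI hi)
  -- Projecting to degree `(e, n)` keeps the products of this degree and discards the others.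
  rw [← S.compProj_of_mem hs]
  clear hi hs
  induction hsW using Submodule.span_induction with
  | mem x hx =>
    obtain ⟨k, L, L', rfl⟩ := hx
    have hm := S.component_mul (S.component_mul (S.freeMono_mem_component (L := L) ⟨rfl, rfl⟩)
      (hf k)) (S.freeMono_mem_component (L := L') ⟨rfl, rfl⟩)
    by_cases hγ : ((L.map Subtype.val).sum + J k + (L'.map Subtype.val).sum,
        L.length + h k + L'.length) = (e, n)
    rotate_left
    · rw [S.compProj_of_mem_of_ne hm hγ]; exact zero_mem _
    · rw [← hγ, S.compProj_of_mem hm]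
      obtain ⟨h1, h2⟩ := Prod.mk.inj hγ
      exact Submodule.subset_span ⟨k, _, _, _, _, L, L', ⟨rfl, rfl⟩, ⟨rfl, rfl⟩, h1, h2, rfl⟩
  | zero => rw [map_zero]; exact zero_mem _
  | add x y _ _ hx hy => rw [map_add]; exact add_mem hx hy
  | smul a x _ hx => rw [map_smul]; exact Submodule.smul_mem _ _ hx

end Setting

/-! ### Morphisms from quotients -/

namespace SuperAlg

variable {A B : SuperAlg}

/-- The morphism from a quotient that is induced by a morphism. -/
def quotLift {s : Set A} (f : A ⟶ B) (hf : ∀ x ∈ s, f.hom x = 0) : A.quot s ⟶ B where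
  hom := RingCon.liftₐ (A.ideal s).ringCon f.hom (by
    have h : A.ideal s ≤ TwoSidedIdeal.ker f.hom := by
      refine TwoSidedIdeal.span_le.mpr ?_
      rintro _ (hx | ⟨x, hx, rfl⟩)
      · exact (TwoSidedIdeal.mem_ker _).mpr (hf _ hx)
      · refine (TwoSidedIdeal.mem_ker _).mpr ((f.map_par x).trans ?_)
        rw [hf x hx, map_zero]
    intro x y hxy
    have := (TwoSidedIdeal.mem_ker _).mp (h ((TwoSidedIdeal.rel_iff _ _ _).mp hxy))
    rw [map_sub, sub_eq_zero] at this
    exact this)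
  map_par a := by
    obtain ⟨a, rfl⟩ := RingCon.mkₐ_surjective (α := ℂ) (A.ideal s).ringCon a
    exact f.map_par a

theorem toQuot_surjective (s : Set A) : Function.Surjective (A.toQuot s).hom :=
  RingCon.mkₐ_surjective (α := ℂ) (A.ideal s).ringCon

theorem toQuot_eq_zero {s : Set A} {x : A} : (A.toQuot s).hom x = 0 ↔ x ∈ A.ideal s := by
  have h : (A.toQuot s).hom x = (A.toQuot s).hom 0 ↔ (A.ideal s).ringCon x 0 :=
    RingCon.eq (A.ideal s).ringCon
  rw [map_zero] at h
  rw [h, TwoSidedIdeal.rel_iff, sub_zero]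

theorem subset_ideal (s : Set A) : s ⊆ A.ideal s := fun _ hx =>
  TwoSidedIdeal.subset_span (Or.inl hx)

theorem even_comm {a : A} (ha : A.par a = a) (x : A) : a * x = x * a := Even.val_comm (Even.mk a ha) x

end SuperAlg

namespace Degeneration

variable {g : Type} [AddCommGroup g] [Module ℂ g] [LieSuperalgebra g] {S : Setting g}
  (D : Degeneration S)

theorem gbar_mem (k : Fin D.m) : D.gbar k ∈ S.component (D.J k) (D.h k) := by
  rcases D.gbar_form k with ⟨L, L', n, H, H', h⟩ | ⟨L, H, h⟩
  · rw [h]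
    exact add_mem (S.freeMono_mem_component H)
      (Submodule.smul_mem _ _ (S.freeMono_mem_component H'))
  · rw [h]; exact S.freeMono_mem_component H

/-- The map `𝒮[t] → 𝓡`. -/
def familyMk : S.freeAlgT ⟶ D.family := S.freeAlgT.toQuot _

/-- The map `𝒮 → 𝓡`. -/
def toFamily : S.freeAlg →ₐ[ℂ] D.family := D.familyMk.hom.comp S.inclT

theorem familyT_comm (x : D.family) : D.familyT * x = x * D.familyT :=
  SuperAlg.even_comm D.par_familyT x

/-- This is the rewriting rule of the family: a generator of the kernel becomes a combination of
terms of larger multidegree and the same total degree, with powers of `t` as coefficients. -/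
theorem toFamily_gbar (k : Fin D.m) : D.toFamily (D.gbar k) =
    -∑ j, D.familyT ^ (S.weight D.w (D.U k j) - S.weight D.w (D.J k)).toNat *
      D.toFamily (D.corr k j) := by
  have h : D.familyMk.hom (D.relation k) = 0 :=
    SuperAlg.toQuot_eq_zero.mpr (SuperAlg.subset_ideal _ (Or.inl ⟨k, rfl⟩))
  rw [relation, map_add, map_sum] at h
  rw [eq_neg_iff_add_eq_zero]
  refine Eq.trans ?_ h
  congr 1

/-! ### A normal form -/

variable (S) in
/-- The indices of the monomial basis: the admissible degrees of monomials. -/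
abbrev Ind : Type := {x : S.Exp × ℕ // S.Admissible x.1 ∧ ∃ L, S.HasDegree L x.1 x.2}

/-- A monomial of a given degree. -/
def basisMono (x : Ind S) : S.freeAlg := S.freeMono x.2.2.choose

theorem basisMono_mem (x : Ind S) : basisMono x ∈ S.component x.1.1 x.1.2 :=
  S.freeMono_mem_component x.2.2.choose_spec

/-- The linear combinations of the basis monomials with coefficients in `ℂ[t]`. -/
def combination : (Ind S →₀ Polynomial ℂ) →ₗ[ℂ] D.family :=
  Finsupp.lsum ℂ fun x => (LinearMap.mulRight ℂ (D.toFamily (basisMono x))) ∘ₗ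
    (Polynomial.aeval D.familyT : Polynomial ℂ →ₐ[ℂ] D.family).toLinearMap

theorem combination_single (x : Ind S) (p : Polynomial ℂ) : D.combination (Finsupp.single x p) =
    Polynomial.aeval D.familyT p * D.toFamily (basisMono x) := by
  rw [combination, Finsupp.lsum_single]
  rfl

theorem combination_smul (p : Polynomial ℂ) (P : Ind S →₀ Polynomial ℂ) :
    D.combination (p • P) = Polynomial.aeval D.familyT p * D.combination P := by
  induction P using Finsupp.induction_linear with
  | zero => rw [smul_zero, map_zero, mul_zero]
  | add P Q hP hQ => rw [smul_add, map_add, map_add, hP, hQ, mul_add]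
  | single x q => rw [Finsupp.smul_single, combination_single, combination_single, smul_eq_mul,
      map_mul, mul_assoc]

theorem aeval_mul_mem_range (p : Polynomial ℂ) {x : D.family}
    (hx : x ∈ LinearMap.range D.combination) :
    Polynomial.aeval D.familyT p * x ∈ LinearMap.range D.combination := by
  obtain ⟨P, rfl⟩ := hx
  exact ⟨p • P, D.combination_smul p P⟩

theorem component_eq_bot {e : S.Exp} {n : ℕ} (h : ¬ ∃ L, S.HasDegree L e n) :
    S.component e n = ⊥ := by
  refine (Submodule.eq_bot_iff _).mpr fun s hs => ?_
  induction hs using Submodule.span_induction with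
  | mem s hs => exact absurd ⟨hs.choose, hs.choose_spec.1⟩ h
  | zero => rfl
  | add x y _ _ hx hy => rw [hx, hy, add_zero]
  | smul a x _ hx => rw [hx, smul_zero]

variable [FiniteDimensional ℂ g] (hg : IsBasic g)

-- There are finitely many lists of length `n` in the finite set `es(λ)`. Hence induction on larger
-- and larger multidegrees, with `n` fixed, is well-founded.
variable (S) in
include hg in
theorem finite_degrees (n : ℕ) : {e : S.Exp | ∃ L, S.HasDegree L e n}.Finite := by
  have := (S.finite_es hg 1).to_subtype
  refine ((List.finite_length_eq (S.es 1) n).image fun L => (L.map Subtype.val).sum).subset ?_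
  rintro e ⟨L, h, rfl⟩
  exact ⟨L, h, rfl⟩

-- In each degree `lead` has rank at most one, so subtracting a multiple of the basis monomial
-- leaves an element of the kernel. This is a homogeneous combination of the `ḡ_k`, which the
-- relations push into larger multidegrees, where the induction hypothesis applies.
include hg in
theorem toFamily_mem_range {e : S.Exp} {n : ℕ} {s : S.freeAlg} (hs : s ∈ S.component e n) :
    D.toFamily s ∈ LinearMap.range D.combination := by
  by_cases hL : ∃ L, S.HasDegree L e n
  rotate_left
  · rw [component_eq_bot hL, Submodule.mem_bot] at hs
    rw [hs, map_zero]; exact zero_mem _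
  have hwf : {e : S.Exp | ∃ L, S.HasDegree L e n}.WellFoundedOn (Function.swap S.lt) :=
    (finite_degrees S hg n).wellFoundedOn
  refine hwf.induction (P := fun e => ∀ s ∈ S.component e n,
    D.toFamily s ∈ LinearMap.range D.combination) hL ?_ s hs
  clear hs hL s e
  intro e hL ih s hs
  have ih' : ∀ d, S.lt e d → ∀ s ∈ S.component d n,
      D.toFamily s ∈ LinearMap.range D.combination := by
    intro d hd s hs
    by_cases hL : ∃ L, S.HasDegree L d n
    · exact ih d hL hd s hs
    · rw [component_eq_bot hL, Submodule.mem_bot] at hs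
      rw [hs, map_zero]; exact zero_mem _
  -- This is where the `ḡ_k` are used as generators of the whole kernel. Surrounding `ḡ_k` by
  -- monomials does not affect the inequality `J_k < U_{k,l}`.
  have key : ∀ s ∈ S.component e n, S.lead.hom s = 0 →
      D.toFamily s ∈ LinearMap.range D.combination := by
    intro s hs h0
    have hi := D.gbar_gen e n s hs ((D.dualBasis.ev_mem_above_iff hg hs).mpr h0)
    refine Submodule.span_induction (p := fun s _ => D.toFamily s ∈ LinearMap.range D.combination)
      ?_ ?_ ?_ ?_ (S.mem_span_of_mem_ideal D.gbar_mem hs hi)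
    · rintro _ ⟨k, d, d', i, j, L, L', H, H', hd, hn, rfl⟩
      rw [map_mul, map_mul, toFamily_gbar, mul_neg, neg_mul, Finset.mul_sum, Finset.sum_mul]
      refine neg_mem (Submodule.sum_mem _ fun l _ => ?_)
      have hc : D.toFamily (S.freeMono L) * (D.familyT ^
          (S.weight D.w (D.U k l) - S.weight D.w (D.J k)).toNat * D.toFamily (D.corr k l)) *
          D.toFamily (S.freeMono L') = Polynomial.aeval D.familyT ((Polynomial.X : Polynomial ℂ) ^
            (S.weight D.w (D.U k l) - S.weight D.w (D.J k)).toNat) *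
              D.toFamily (S.freeMono L * D.corr k l * S.freeMono L') := by
        rw [map_pow, Polynomial.aeval_X, map_mul, map_mul, ← mul_assoc, ← mul_assoc, ← mul_assoc,
          ((show Commute D.familyT _ from D.familyT_comm _).pow_left _).eq]
      rw [hc]
      refine D.aeval_mul_mem_range _ (ih' (d + D.U k l + d') ?_ _ ?_)
      · rw [← hd]
        exact S.lt_add _ _ _ (S.lt_add_left _ (D.U_lt k l))
      · rw [← hn]
        exact S.component_mul (S.component_mul (S.freeMono_mem_component H) (D.corr_mem k l))
          (S.freeMono_mem_component H')
    · rw [map_zero]; exact zero_mem _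
    · intro x y _ _ hx hy; rw [map_add]; exact add_mem hx hy
    · intro a x _ hx; rw [map_smul]; exact Submodule.smul_mem _ _ hx
  by_cases hadm : S.Admissible e
  · let b : Ind S := ⟨(e, n), hadm, hL⟩
    obtain ⟨-, -, -, c, hc, -⟩ := D.dualBasis.exists_ev hg hs
    obtain ⟨-, -, -, c', hc', hb, -⟩ := D.dualBasis.exists_ev_freeMono hg _ e n b.2.2.choose_spec
    have hc0 : c' ≠ 0 := by rcases hc' with rfl | rfl <;> simp
    -- The coefficient `c / c'` compares `lead s` with `lead` of the basis monomial; both are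
    -- multiples of the same monomial.
    have hs' : s = (s - (c * c'⁻¹) • basisMono b) + (c * c'⁻¹) • basisMono b := by abel
    rw [hs', map_add, map_smul]
    refine add_mem (key _ (sub_mem hs (Submodule.smul_mem _ _ (basisMono_mem b))) ?_)
      (Submodule.smul_mem _ _ ⟨Finsupp.single b 1, ?_⟩)
    · rw [map_sub, map_smul, hc, show S.lead.hom (basisMono b) = c' • S.polyAsc e n from hb,
        smul_smul, mul_assoc, inv_mul_cancel₀ hc0, mul_one, sub_self]
    · rw [combination_single, map_one, one_mul]
  · refine key s hs ?_
    obtain ⟨-, -, -, c, hc, -⟩ := D.dualBasis.exists_ev hg hs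
    rw [hc, S.polyAsc_eq_zero hadm, smul_zero]

include hg in
/-- The basis monomials generate the family over `ℂ[t]`. -/
theorem combination_surjective : Function.Surjective D.combination := by
  -- The range contains `1`, so it suffices that it is stable under left multiplication by `t` and
  -- by the variables `X_e`.
  have key : ∀ y : S.freeAlgT, ∀ u ∈ LinearMap.range D.combination,
      D.familyMk.hom y * u ∈ LinearMap.range D.combination := by
    intro y
    have hy : y ∈ Algebra.adjoin ℂ (Set.range S.freeXT) := by
      have hX : Algebra.adjoin ℂ (Set.range S.freeXT) = ⊤ := FreeSuperRing.adjoin_X _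
      rw [hX]; exact Algebra.mem_top
    induction hy using Algebra.adjoin_induction with
    | mem x hx =>
      obtain ⟨_ | e, rfl⟩ := hx
      · intro u hu
        have := D.aeval_mul_mem_range Polynomial.X hu
        rw [Polynomial.aeval_X] at this
        exact this
      · have hXe : D.familyMk.hom (S.freeXT (some e)) = D.toFamily (S.freeX e) := by
          refine congrArg D.familyMk.hom (Eq.symm ?_)
          exact FreeSuperRing.lift_X ..
        rintro _ ⟨P, rfl⟩
        rw [hXe]
        induction P using Finsupp.induction_linear with
        | zero => rw [map_zero, mul_zero]; exact zero_mem _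
        | add P Q hP hQ => rw [map_add, mul_add]; exact add_mem hP hQ
        | single b p =>
          have hcomm : Commute (D.toFamily (S.freeX e)) (Polynomial.aeval D.familyT p) := by
            induction p using Polynomial.induction_on' with
            | add p q hp hq => rw [map_add]; exact hp.add_right hq
            | monomial i c =>
              rw [Polynomial.aeval_monomial]
              exact (Algebra.commute_algebraMap_right c _).mul_right
                ((show Commute _ _ from (D.familyT_comm _).symm).pow_right i)
          rw [combination_single, ← mul_assoc, hcomm.eq, mul_assoc, ← map_mul]
          refine D.aeval_mul_mem_range _ (D.toFamily_mem_range hg (e := (e : S.Exp) + b.1.1)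
            (n := 1 + b.1.2) (S.component_mul ?_ (basisMono_mem b)))
          refine Submodule.subset_span ⟨[e], ⟨rfl, by simp⟩, ?_⟩
          rw [Setting.freeMono_cons, Setting.freeMono_nil, mul_one]
    | algebraMap c =>
      intro u hu
      rw [AlgHom.commutes, ← Algebra.smul_def]
      exact Submodule.smul_mem _ _ hu
    | add x y _ _ hx hy => intro u hu; rw [map_add, add_mul]; exact add_mem (hx u hu) (hy u hu)
    | mul x y _ _ hx hy => intro u hu; rw [map_mul, mul_assoc]; exact hx _ (hy u hu)
  intro x
  obtain ⟨y, rfl⟩ := SuperAlg.toQuot_surjective _ x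
  have h1 : (1 : D.family) ∈ LinearMap.range D.combination := by
    have := D.toFamily_mem_range hg (S.freeMono_mem_component (L := []) ⟨rfl, rfl⟩)
    rwa [Setting.freeMono_nil, map_one] at this
  have := key y 1 h1
  rwa [mul_one] at this

end Degeneration

/-! ### Specializations of `𝒮[t]` -/

namespace Setting

variable {g : Type} [AddCommGroup g] [Module ℂ g] [LieSuperalgebra g] (S : Setting g)

theorem weight_add (w : Fin S.N → ℤ) (e e' : S.Exp) :
    S.weight w (e + e') = S.weight w e + S.weight w e' := by
  simp only [weight, Pi.add_apply, Nat.cast_add, mul_add, Finset.sum_add_distrib]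

/-- The images of the variables under `specialize`. -/
def specVar (w : Fin S.N → ℤ) (u t : ℂ) {C : SuperAlg} (G : S.freeAlg ⟶ C) :
    Option (S.es 1) → C
  | none => algebraMap ℂ C t
  | some e => u ^ (-S.weight w e) • G.hom (S.freeX e)

/-- The map from `𝒮[t]` that sends `t` to a scalar and twists a given map from `𝒮` by a one
parameter group. -/
def specialize (w : Fin S.N → ℤ) (u t : ℂ) {C : SuperAlg} (G : S.freeAlg ⟶ C) :
    S.freeAlgT ⟶ C :=
  FreeSuper.lift (S.specVar w u t G) fun i => by
    cases i with
    | none =>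
      change C.par (algebraMap ℂ C t) = ksign 1 0 • algebraMap ℂ C t
      rw [AlgHom.commutes]; simp [ksign]
    | some e =>
      change C.par (_ • G.hom (S.freeX e)) = ksign 1 (S.parity e) • _ • G.hom (S.freeX e)
      rw [map_smul, ← G.map_par, par_freeX, map_smul, smul_comm]

variable (w : Fin S.N → ℤ) {u : ℂ} (t : ℂ) {C : SuperAlg} (G : S.freeAlg ⟶ C)

theorem specialize_T (u : ℂ) :
    (S.specialize w u t G).hom (S.freeXT none) = algebraMap ℂ C t :=
  FreeSuper.lift_X ..

theorem specialize_inclT (hu : u ≠ 0) {e : S.Exp} {h : ℕ} {s : S.freeAlg}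
    (hs : s ∈ S.component e h) :
    (S.specialize w u t G).hom (S.inclT s) = u ^ (-S.weight w e) • G.hom s := by
  induction hs using Submodule.span_induction with
  | mem s hs =>
    obtain ⟨L, ⟨rfl, rfl⟩, rfl⟩ := hs
    induction L with
    | nil => rw [freeMono_nil, map_one, map_one, map_one]; simp [weight]
    | cons d L ih =>
      have hX : (S.specialize w u t G).hom (S.inclT (S.freeX d)) =
          u ^ (-S.weight w d) • G.hom (S.freeX d) := by
        have h1 : S.inclT (S.freeX d) = S.freeXT (some d) := FreeSuperRing.lift_X ..
        rw [h1]
        exact FreeSuper.lift_X ..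
      rw [freeMono_cons, map_mul, map_mul, map_mul, ih, hX, smul_mul_smul_comm, ← zpow_add₀ hu,
        List.map_cons, List.sum_cons, weight_add, neg_add]
  | zero => rw [map_zero, map_zero, map_zero, smul_zero]
  | add x y _ _ hx hy => rw [map_add, map_add, map_add, hx, hy, smul_add]
  | smul a x _ hx => rw [map_smul, map_smul, map_smul, hx, smul_comm]

end Setting

/-! ### The maps to the fibres, independence of the basis monomials, and absence of torsion -/

namespace Degeneration

variable {g : Type} [AddCommGroup g] [Module ℂ g] [LieSuperalgebra g] {S : Setting g}
  (D : Degeneration S)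

/-- In the largest essential multidegree, being in the kernel of `𝒮 → gr R(λ)` means vanishing in
`R(λ)` itself. So the additional binomial relations hold in every fibre without corrections. -/
theorem above_eq_bot {e : S.Exp} {n : ℕ} (h : ∀ e' ∈ S.es n, e' ≠ e → S.lt e' e) :
    S.above D.η e n = ⊥ := by
  refine (Submodule.eq_bot_iff _).mpr fun r hr => ?_
  induction hr using Submodule.span_induction with
  | mem r hr =>
    obtain ⟨e', hlt, -⟩ := hr
    by_cases he : (e' : S.Exp) = e
    · rw [he] at hlt; exact absurd hlt (S.not_lt_self e)
    · exact absurd (_root_.trans hlt (h e' e'.2 he)) (S.not_lt_self e)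
  | zero => rfl
  | add x y _ _ hx hy => rw [hx, hy, add_zero]
  | smul a x _ hx => rw [hx, smul_zero]

theorem isBinomial_mem {e : S.Exp} {n : ℕ} {s : S.freeAlg} (h : S.IsBinomial e n s) :
    s ∈ S.component e n := by
  obtain ⟨L, L', σ, H, K, rfl⟩ := h
  exact add_mem (S.freeMono_mem_component H)
    (Submodule.smul_mem _ _ (S.freeMono_mem_component K))

/-- The map from the family to its fibre over `a ≠ 0`. -/
def fibreMap {a : ℂ} (ha : a ≠ 0) : D.family ⟶ RAlg S.b S.wt :=
  SuperAlg.quotLift (S.specialize D.w a a D.ev) (by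
    rintro _ (⟨k, rfl⟩ | hx)
    · rw [relation, map_add, map_sum, S.specialize_inclT D.w a D.ev ha (D.gbar_mem k)]
      -- Since `a^{w(U) - w(J)} a^{-w(U)} = a^{-w(J)}`, all terms of the relation acquire the same
      -- factor, and the relation becomes a multiple of `ev(ḡ_k + ∑ g_{k,j}) = 0`. The inequality
      -- `w(J) < w(U)` makes the truncation `toNat` harmless.
      have hj : ∀ j ∈ Finset.univ, (S.specialize D.w a a D.ev).hom (S.freeXT none ^
          (S.weight D.w (D.U k j) - S.weight D.w (D.J k)).toNat * S.inclT (D.corr k j)) =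
          a ^ (-S.weight D.w (D.J k)) • D.ev.hom (D.corr k j) := by
        intro j _
        rw [map_mul, map_pow, S.specialize_T, S.specialize_inclT D.w a D.ev ha (D.corr_mem k j),
          ← map_pow, ← Algebra.smul_def, smul_smul, ← zpow_natCast,
          Int.toNat_of_nonneg (sub_nonneg.mpr (D.w_lt k j).le), ← zpow_add₀ ha]
        congr 2
        ring
      rw [Finset.sum_congr rfl hj, ← Finset.smul_sum, ← smul_add, ← map_sum, ← map_add,
        D.ev_lift k, smul_zero]
    · obtain ⟨n, s, ⟨e, -, hmax, hb, hs⟩, rfl⟩ := Set.mem_iUnion.mp hx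
      rw [D.above_eq_bot hmax, Submodule.mem_bot] at hs
      rw [S.specialize_inclT D.w a D.ev ha (isBinomial_mem hb), hs, smul_zero])

theorem fibreMap_T {a : ℂ} (ha : a ≠ 0) :
    (D.fibreMap ha).hom D.familyT = algebraMap ℂ (RAlg S.b S.wt) a :=
  S.specialize_T D.w a D.ev a

theorem fibreMap_toFamily {a : ℂ} (ha : a ≠ 0) {e : S.Exp} {n : ℕ} {s : S.freeAlg}
    (hs : s ∈ S.component e n) :
    (D.fibreMap ha).hom (D.toFamily s) = a ^ (-S.weight D.w e) • D.ev.hom s :=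
  S.specialize_inclT D.w a D.ev ha hs

variable [FiniteDimensional ℂ g] (hg : IsBasic g)

/-- The map from the family to its fibre over `0`. -/
def fibreMapZero : D.family ⟶ S.polyAlg :=
  SuperAlg.quotLift (S.specialize D.w 1 0 S.lead) (by
    rintro _ (⟨k, rfl⟩ | hx)
    · rw [relation, map_add, map_sum, S.specialize_inclT D.w 0 S.lead one_ne_zero (D.gbar_mem k),
        (D.dualBasis.ev_mem_above_iff hg (D.gbar_mem k)).mp (D.gbar_ker k), smul_zero, zero_add]
      -- At `t = 0` the corrections disappear, because their exponents are positive by `w_lt`.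
      refine Finset.sum_eq_zero fun j _ => ?_
      rw [map_mul, map_pow, S.specialize_T, map_zero, zero_pow, zero_mul]
      have := D.w_lt k j
      omega
    · obtain ⟨n, s, ⟨e, -, hmax, hb, hs⟩, rfl⟩ := Set.mem_iUnion.mp hx
      rw [S.specialize_inclT D.w 0 S.lead one_ne_zero (isBinomial_mem hb),
        (D.dualBasis.ev_mem_above_iff hg (isBinomial_mem hb)).mp hs, smul_zero])

theorem fibreMapZero_T : (D.fibreMapZero hg).hom D.familyT = algebraMap ℂ S.polyAlg 0 :=
  S.specialize_T D.w 0 S.lead 1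

theorem fibreMapZero_toFamily {e : S.Exp} {n : ℕ} {s : S.freeAlg} (hs : s ∈ S.component e n) :
    (D.fibreMapZero hg).hom (D.toFamily s) = S.lead.hom s :=
  (S.specialize_inclT D.w 0 S.lead one_ne_zero hs).trans (by rw [one_zpow, one_smul])

-- The leading exponents within one total degree are distinct. Evaluating a relation at the smallest
-- exponent that occurs in that degree isolates one coefficient.
include hg in
theorem linearIndependent_ev : LinearIndependent ℂ fun x : Ind S => D.ev.hom (basisMono x) := by
  classical
  have hex := fun x : Ind S => D.dualBasis.exists_ev_freeMono hg _ x.1.1 x.1.2 x.2.2.choose_spec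
  choose φ hφ hev c hc _ hcoeff using hex
  rw [linearIndependent_iff']
  intro s a ha
  by_contra! hne
  obtain ⟨i, hi, hai⟩ := hne
  -- The swapped order turns the extremal element into the smallest exponent, among the terms with
  -- the total degree of `i`.
  obtain ⟨_, ⟨x, ⟨hx, hn, hax⟩, rfl⟩, hmin⟩ := exists_extremal (Function.swap S.lt)
    (s := (fun x : Ind S => x.1.1) '' {x | x ∈ s ∧ x.1.2 = i.1.2 ∧ a x ≠ 0})
    ((s.finite_toSet.subset fun x hx => hx.1).image _) ⟨_, i, ⟨hi, rfl, hai⟩, rfl⟩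
  refine hax ?_
  have h1 := congrArg (fun r => S.coeff x.1.2 x.1.1 (RAlg.proj S.b S.wt x.1.2 r)) ha
  simp only [map_sum, map_smul, map_zero] at h1
  rw [Finset.sum_eq_single x] at h1
  · have h2 : D.ev.hom (basisMono x) = RAlg.lof S.b S.wt x.1.2 (φ x) := hev x
    rw [h2, RAlg.proj_lof, hcoeff x x.2.1] at h1
    refine (smul_eq_zero.mp h1).resolve_right ?_
    rcases hc x with h | h <;> rw [h] <;> norm_num
  · intro y hy hyx
    by_cases hay : a y = 0
    · rw [hay, zero_smul]
    have h2 : D.ev.hom (basisMono y) = RAlg.lof S.b S.wt y.1.2 (φ y) := hev y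
    rw [h2]
    by_cases hyn : y.1.2 = x.1.2
    · have hlt : S.lt x.1.1 y.1.1 := hmin _ ⟨y, ⟨hy, hyn.trans hn, hay⟩, rfl⟩ fun h =>
        hyx (Subtype.ext (Prod.ext h hyn))
      have h3 := hφ y
      obtain ⟨⟨d, m⟩, hy'⟩ := y
      dsimp only at hyn
      subst hyn
      rw [RAlg.proj_lof, h3 _ x.2.1 hlt, smul_zero]
    · rw [RAlg.proj_lof_of_ne hyn, map_zero, smul_zero]
  · intro h; exact absurd hx h

include hg in
theorem linearIndependent_fibreMap {a : ℂ} (ha : a ≠ 0) :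
    LinearIndependent ℂ fun x : Ind S => (D.fibreMap ha).hom (D.toFamily (basisMono x)) := by
  have h := (D.linearIndependent_ev hg).units_smul fun x : Ind S =>
    Units.mk0 (a ^ (-S.weight D.w x.1.1)) (zpow_ne_zero _ ha)
  convert h using 1
  ext1 x
  exact D.fibreMap_toFamily ha (basisMono_mem x)

/-- Up to sign, the images are distinct admissible monomials of the polynomial superalgebra. -/
theorem linearIndependent_fibreMapZero :
    LinearIndependent ℂ fun x : Ind S =>
      (D.fibreMapZero hg).hom (D.toFamily (basisMono x)) := by
  have hex := fun x : Ind S => D.dualBasis.exists_ev_freeMono hg _ x.1.1 x.1.2 x.2.2.choose_spec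
  choose φ hφ hev c hc hlead hcoeff using hex
  have hc0 : ∀ x, c x ≠ 0 := fun x => by rcases hc x with h | h <;> rw [h] <;> norm_num
  have h1 : LinearIndependent ℂ fun x : Ind S => S.polyAsc x.1.1 x.1.2 :=
    S.linearIndependent_polyAsc.comp
      (fun x : Ind S => ((⟨x.1.1, x.2.1⟩, x.1.2) : {e : S.Exp // S.Admissible e} × ℕ)) (by
        intro x y h
        obtain ⟨h1, h2⟩ := Prod.mk.inj h
        exact Subtype.ext (Prod.ext (congrArg Subtype.val h1) h2))
  have h := h1.units_smul fun x : Ind S => Units.mk0 (c x) (hc0 x)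
  convert h using 1
  ext1 x
  exact (D.fibreMapZero_toFamily hg (basisMono_mem x)).trans (hlead x)

-- On combinations of the basis monomials, a map with `t ↦ a` evaluates the coefficient polynomials
-- at `a`. So independence in the fibre controls the values of the coefficients.
omit [FiniteDimensional ℂ g] in
theorem map_combination {C : SuperAlg} (F : D.family ⟶ C) {a : ℂ}
    (hF : F.hom D.familyT = algebraMap ℂ C a) (P : Ind S →₀ Polynomial ℂ) :
    F.hom (D.combination P) = Finsupp.linearCombination ℂ
      (fun x : Ind S => F.hom (D.toFamily (basisMono x)))
        (P.mapRange (Polynomial.eval a) (Polynomial.eval_zero)) := by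
  induction P using Finsupp.induction_linear with
  | zero => simp
  | add P Q hP hQ =>
    rw [map_add, map_add, hP, hQ, Finsupp.mapRange_add (fun _ _ => Polynomial.eval_add), map_add]
  | single x p =>
    rw [combination_single, map_mul, Finsupp.mapRange_single, Finsupp.linearCombination_single,
      Algebra.smul_def]
    congr 1
    rw [← Polynomial.aeval_algHom_apply, hF, Polynomial.aeval_algebraMap_apply,
      Polynomial.coe_aeval_eq_eval]

omit [FiniteDimensional ℂ g] in
theorem eval_eq_zero_of_map_combination {C : SuperAlg} (F : D.family ⟶ C) {a : ℂ}
    (hF : F.hom D.familyT = algebraMap ℂ C a)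
    (hind : LinearIndependent ℂ fun x : Ind S => F.hom (D.toFamily (basisMono x)))
    {P : Ind S →₀ Polynomial ℂ} (h : F.hom (D.combination P) = 0) (x : Ind S) :
    (P x).eval a = 0 := by
  rw [D.map_combination F hF] at h
  have := DFunLike.congr_fun (linearIndependent_iff.mp hind _ h) x
  simpa using this

include hg in
/-- The kernel of a map to a fibre. -/
theorem map_eq_zero_iff {C : SuperAlg} (F : D.family ⟶ C) {a : ℂ}
    (hF : F.hom D.familyT = algebraMap ℂ C a)
    (hind : LinearIndependent ℂ fun x : Ind S => F.hom (D.toFamily (basisMono x)))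
    (y : D.family) :
    F.hom y = 0 ↔ y ∈ D.family.ideal {D.familyT - algebraMap ℂ D.family a} := by
  constructor
  · intro h
    obtain ⟨P, rfl⟩ := D.combination_surjective hg y
    have h0 := D.eval_eq_zero_of_map_combination F hF hind h
    -- All coefficients vanish at `a`, so `t - a` can be divided out of each of them.
    have hP : P = (Polynomial.X - Polynomial.C a) •
        P.mapRange (fun p => p /ₘ (Polynomial.X - Polynomial.C a)) (Polynomial.zero_divByMonic _) := by
      ext1 x
      rw [Finsupp.smul_apply, Finsupp.mapRange_apply, smul_eq_mul,
        Polynomial.mul_divByMonic_eq_iff_isRoot.mpr (h0 x)]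
    rw [hP, combination_smul, map_sub, Polynomial.aeval_X, Polynomial.aeval_C]
    exact TwoSidedIdeal.mul_mem_right _ _ _ (SuperAlg.subset_ideal _ rfl)
  · intro h
    have hle : D.family.ideal {D.familyT - algebraMap ℂ D.family a} ≤ TwoSidedIdeal.ker F.hom := by
      have h1 : F.hom (D.familyT - algebraMap ℂ D.family a) = 0 := by
        rw [map_sub, hF, AlgHom.commutes, sub_self]
      refine TwoSidedIdeal.span_le.mpr ?_
      rintro _ (rfl | ⟨_, rfl, rfl⟩)
      · exact (TwoSidedIdeal.mem_ker _).mpr h1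
      · refine (TwoSidedIdeal.mem_ker _).mpr ((F.map_par _).trans ?_)
        rw [h1, map_zero]
    exact (TwoSidedIdeal.mem_ker _).mp (hle h)

include hg in
/-- The family has no torsion over `ℂ[t]`. -/
theorem eq_zero_of_aeval_mul {p : Polynomial ℂ} (hp : p ≠ 0) {y : D.family}
    (h : Polynomial.aeval D.familyT p * y = 0) : y = 0 := by
  obtain ⟨P, rfl⟩ := D.combination_surjective hg y
  rw [← combination_smul] at h
  have hP : P = 0 := by
    ext1 x
    -- The fibres over all `a ≠ 0` show that this polynomial has infinitely many roots.
    have h0 : p * P x = 0 := by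
      refine Polynomial.eq_zero_of_infinite_isRoot _ ((Set.infinite_univ.sdiff
        (Set.finite_singleton (0 : ℂ))).mono fun a ha => ?_)
      have ha : a ≠ 0 := fun h => ha.2 h
      exact D.eval_eq_zero_of_map_combination (D.fibreMap ha) (D.fibreMap_T ha)
        (D.linearIndependent_fibreMap hg ha) (by rw [h, map_zero]) x
    exact (mul_eq_zero.mp h0).resolve_left hp
  rw [hP, map_zero]

end Degeneration

namespace SuperAlg

/-! ### Functoriality of the spectrum -/

theorem Hom.stalkMap_id {A : SuperAlg} (x : PrimeSpectrum A.Even) (a : A.Stalk x) :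
    Hom.stalkMap (𝟙 A) x a = a := by
  induction a using LocalizedModule.induction_on with
  | _ a s => exact Hom.stalkMap_mk (𝟙 A) x a s

theorem Hom.stalkMap_comp {A B C : SuperAlg} (φ : A ⟶ B) (ψ : B ⟶ C) (x : PrimeSpectrum C.Even)
    (a : A.Stalk (PrimeSpectrum.comap (Hom.even (φ ≫ ψ)) x)) :
    Hom.stalkMap (φ ≫ ψ) x a =
      Hom.stalkMap ψ x (Hom.stalkMap φ (PrimeSpectrum.comap (Hom.even ψ) x) a) := by
  induction a using LocalizedModule.induction_on with
  | _ a s =>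
    refine (Hom.stalkMap_mk (φ ≫ ψ) x a s).trans ?_
    exact ((congrArg (Hom.stalkMap ψ x) (Hom.stalkMap_mk φ (PrimeSpectrum.comap (Hom.even ψ) x) a s)).trans
      (Hom.stalkMap_mk ψ x _ _)).symm

theorem Spec.map_id (A : SuperAlg) : Spec.map (𝟙 A) = 𝟙 A.Spec := by
  refine AlgebraicGeometry.PresheafedSpace.hext _ _ rfl (heq_of_eq ?_)
  refine NatTrans.ext (funext fun U => Hom.ext (AlgHom.ext fun f => ?_))
  exact Subtype.ext (funext fun x => Hom.stalkMap_id x.1 _)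

theorem Spec.map_comp {A B C : SuperAlg} (φ : A ⟶ B) (ψ : B ⟶ C) :
    Spec.map (φ ≫ ψ) = Spec.map ψ ≫ Spec.map φ := by
  refine AlgebraicGeometry.PresheafedSpace.hext _ _ rfl (heq_of_eq ?_)
  refine NatTrans.ext (funext fun U => Hom.ext (AlgHom.ext fun f => ?_))
  exact Subtype.ext (funext fun x => Hom.stalkMap_comp φ ψ x.1 _)

/-- Isomorphic superalgebras have isomorphic spectra. -/
def Spec.mapIso {A B : SuperAlg} (i : A ≅ B) : A.Spec ≅ B.Spec where
  hom := Spec.map i.inv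
  inv := Spec.map i.hom
  hom_inv_id := by rw [← Spec.map_comp, i.hom_inv_id, Spec.map_id]
  inv_hom_id := by rw [← Spec.map_comp, i.inv_hom_id, Spec.map_id]

/-! ### Isomorphisms with quotients -/

theorem nonempty_iso_of_bijective {A B : SuperAlg} (f : A ⟶ B) (hf : Function.Bijective f.hom) :
    Nonempty (A ≅ B) := by
  let e := AlgEquiv.ofBijective f.hom hf
  let k : B ⟶ A := ⟨e.symm.toAlgHom, fun b => by
    obtain ⟨a, rfl⟩ := hf.2 b
    refine e.injective ?_
    have h1 : e.symm.toAlgHom (f.hom a) = a := e.symm_apply_apply a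
    rw [h1, ← f.map_par]
    exact e.apply_symm_apply _⟩
  exact ⟨⟨f, k, Hom.ext (AlgHom.ext fun a => e.symm_apply_apply a),
    Hom.ext (AlgHom.ext fun b => e.apply_symm_apply b)⟩⟩

theorem nonempty_iso_quot {A B : SuperAlg} (f : A ⟶ B) (hf : Function.Surjective f.hom) {s : Set A}
    (hs : ∀ x, f.hom x = 0 ↔ x ∈ A.ideal s) : Nonempty (B ≅ A.quot s) := by
  obtain ⟨i⟩ := nonempty_iso_of_bijective
    (quotLift f fun x hx => (hs x).mpr (subset_ideal s hx)) (by
      constructor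
      · rw [injective_iff_map_eq_zero]
        intro y hy
        obtain ⟨x, rfl⟩ := toQuot_surjective s y
        exact toQuot_eq_zero.mpr ((hs x).mp hy)
      · intro y
        obtain ⟨x, rfl⟩ := hf y
        exact ⟨(A.toQuot s).hom x, rfl⟩)
  exact ⟨i.symm⟩

/-- Restriction of the codomain of a morphism to a sub-superalgebra. -/
def corestrict {A B : SuperAlg} (f : A ⟶ B) (s : Set B)
    (h : f.hom.range = Algebra.adjoin ℂ (s ∪ B.par '' s)) : A ⟶ B.adjoin s where
  hom := f.hom.codRestrict (Algebra.adjoin ℂ (s ∪ B.par '' s)) fun x => h ▸ ⟨x, rfl⟩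
  map_par x := Subtype.ext (f.map_par x)

theorem corestrict_surjective {A B : SuperAlg} (f : A ⟶ B) (s : Set B)
    (h : f.hom.range = Algebra.adjoin ℂ (s ∪ B.par '' s)) :
    Function.Surjective (corestrict f s h).hom := by
  rintro ⟨y, hy⟩
  rw [← h] at hy
  obtain ⟨x, rfl⟩ := hy
  exact ⟨x, rfl⟩

theorem corestrict_eq_zero {A B : SuperAlg} (f : A ⟶ B) (s : Set B)
    (h : f.hom.range = Algebra.adjoin ℂ (s ∪ B.par '' s)) (x : A) :
    (corestrict f s h).hom x = 0 ↔ f.hom x = 0 := by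
  constructor
  · intro h0; exact congrArg Subtype.val h0
  · intro h0; exact Subtype.ext h0

/-! ### Flatness over the affine line -/

/-- The even part of `ℂ[t]`. -/
def lineEvenEquiv : Polynomial ℂ ≃+* lineAlg.Even where
  toFun p := Even.mk (A := lineAlg) p rfl
  invFun p := (Even.val lineAlg p : lineAlg)
  left_inv _ := rfl
  right_inv _ := rfl
  map_mul' _ _ := rfl
  map_add' _ _ := rfl

instance : IsDomain lineAlg.Even := MulEquiv.isDomain (Polynomial ℂ) lineEvenEquiv.symm.toMulEquiv

instance : IsPrincipalIdealRing lineAlg.Even :=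
  IsPrincipalIdealRing.of_surjective lineEvenEquiv.toRingHom lineEvenEquiv.surjective

/-- The local rings of the line are Dedekind domains, over which flat means torsion-free; and
torsion in a stalk comes from torsion in `A` after clearing denominators. -/
theorem flat_stalk {A : SuperAlg} (φ : lineAlg ⟶ A)
    (h : ∀ (p : lineAlg.Even) (y : A), p ≠ 0 → Hom.even φ p • y = 0 → y = 0)
    (x : PrimeSpectrum A.Even) :
    @Module.Flat (Localization.AtPrime (x.asIdeal.comap (Hom.even φ))) (A.Stalk x) _ _
      (stalkModule φ x) := by
  let := stalkModule φ x
  have : IsDedekindDomain (Localization.AtPrime (x.asIdeal.comap (Hom.even φ))) :=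
    IsLocalization.AtPrime.isDedekindDomain lineAlg.Even (x.asIdeal.comap (Hom.even φ)) _
  have hdom : IsDomain (Localization.AtPrime (x.asIdeal.comap (Hom.even φ))) := inferInstance
  suffices Module.IsTorsionFree (Localization.AtPrime (x.asIdeal.comap (Hom.even φ)))
      (A.Stalk x) by infer_instance
  refine Module.isTorsionFree_iff_smul_eq_zero.mpr ?_
  intro r m hr
  by_cases h0 : r = 0
  · exact Or.inl h0
  refine Or.inr ?_
  obtain ⟨p, s, rfl⟩ := IsLocalization.exists_mk'_eq (x.asIdeal.comap (Hom.even φ)).primeCompl r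
  have hp : p ≠ 0 := by
    rintro rfl
    exact h0 (IsLocalization.mk'_zero _)
  -- The denominator of `r` is a unit of the local ring, so only its numerator `p` matters.
  have h1 : Hom.even φ p • m = 0 := by
    have h2 : algebraMap lineAlg.Even (Localization.AtPrime (x.asIdeal.comap (Hom.even φ))) p • m =
        0 := by
      rw [← IsLocalization.mk'_spec' _ p s, mul_smul, hr, smul_zero]
    have h3 : Localization.localRingHom (x.asIdeal.comap (Hom.even φ)) x.asIdeal (Hom.even φ) rfl
        (algebraMap lineAlg.Even _ p) • m = 0 := h2
    rwa [Localization.localRingHom_to_map, algebraMap_smul] at h3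
  induction m using LocalizedModule.induction_on with
  | _ a t =>
    rw [LocalizedModule.smul'_mk] at h1
    rw [← LocalizedModule.zero_mk 1, LocalizedModule.mk_eq] at h1 ⊢
    obtain ⟨v, hv⟩ := h1
    rw [one_smul, smul_zero, smul_zero] at hv
    refine ⟨v, ?_⟩
    rw [one_smul, smul_zero, smul_zero]
    refine h p _ hp ?_
    rw [smul_comm]
    exact hv

end SuperAlg

/-! ### Favourability: the components of `R(λ)` as values of products of variables -/

namespace Setting

variable {g : Type} [AddCommGroup g] [Module ℂ g] [LieSuperalgebra g] {S : Setting g}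

theorem FavourableAt.exists_hasDegree {k : ℕ} (hfav : S.FavourableAt k) {e : S.Exp}
    (he : e ∈ S.es k) : ∃ L, S.HasDegree L e k := by
  obtain ⟨c, hc, hs⟩ := hfav e he
  refine ⟨List.ofFn fun i => ⟨c i, hc i⟩, List.length_ofFn, ?_⟩
  rw [List.map_ofFn, List.sum_ofFn, ← hs]
  rfl

namespace DualBasis

variable (E : S.DualBasis) [FiniteDimensional ℂ g] (hg : IsBasic g)

include hg in
/-- The elements of the dual basis are in the image of `𝒮`, up to higher terms. -/
theorem η_mem_iSup {k : ℕ} (hfav : S.FavourableAt k) (e : S.es k) :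
    RAlg.lof S.b S.wt k (RPiece.ofDual (E.η k e)) ∈
      ⨆ d : {d // d ∈ S.es k ∧ ¬ S.lt d e}, (S.component d.1 k).map E.ev.hom.toLinearMap := by
  classical
  have hwf : (S.es k).WellFoundedOn (Function.swap S.lt) := (S.finite_es hg k).wellFoundedOn
  obtain ⟨e, he⟩ := e
  refine hwf.induction (P := fun e => ∀ he : e ∈ S.es k,
    RAlg.lof S.b S.wt k (RPiece.ofDual (E.η k ⟨e, he⟩)) ∈
      ⨆ d : {d // d ∈ S.es k ∧ ¬ S.lt d e}, (S.component d.1 k).map E.ev.hom.toLinearMap)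
    he ?_ he
  clear he e
  intro e _ ih he
  -- Favourability gives a product of `k` variables of multidegree `e`. Its value is `±η_e` plus
  -- terms `η_d` with `d > e`, and these are covered by the induction, which runs from large
  -- exponents to small ones.
  obtain ⟨L, hL⟩ := hfav.exists_hasDegree he
  obtain ⟨φ, hφ, h1, c, hc, -, h3⟩ := E.exists_ev_freeMono hg L e k hL
  have hc0 : c ≠ 0 := by rcases hc with rfl | rfl <;> norm_num
  have := (S.finite_es hg k).fintype
  have h4 := E.eq_sum hg φ
  rw [← Finset.add_sum_erase _ _ (Finset.mem_univ (⟨e, he⟩ : S.es k)), h3 he.1] at h4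
  have h5 : RAlg.lof S.b S.wt k (RPiece.ofDual (E.η k ⟨e, he⟩)) = c⁻¹ • (E.ev.hom (S.freeMono L) -
      ∑ d ∈ Finset.univ.erase (⟨e, he⟩ : S.es k), S.coeff k d φ •
        RAlg.lof S.b S.wt k (RPiece.ofDual (E.η k d))) := by
    have h6 := congrArg (RAlg.lof S.b S.wt k) h4
    rw [map_add, map_sum, map_smul] at h6
    simp only [map_smul] at h6
    rw [h1, h6, add_sub_cancel_right, smul_smul, inv_mul_cancel₀ hc0, one_smul]
  rw [h5]
  refine Submodule.smul_mem _ _ (sub_mem ?_ (Submodule.sum_mem _ fun d hd => ?_))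
  · exact Submodule.mem_iSup_of_mem (⟨e, he, S.not_lt_self e⟩ : {d // d ∈ S.es k ∧ ¬ S.lt d e})
      ⟨S.freeMono L, S.freeMono_mem_component hL, rfl⟩
  · have hne : (d : S.Exp) ≠ e := fun h => (Finset.ne_of_mem_erase hd) (Subtype.ext h)
    rcases trichotomous_of S.lt (d : S.Exp) e with h | h | h
    · rw [hφ d d.2.1 h, zero_smul]; exact zero_mem _
    · exact absurd h hne
    · refine Submodule.smul_mem _ _ (SetLike.le_def.mp (iSup_le fun d' => ?_) (ih d d.2 h d.2))
      exact le_iSup (fun x : {d // d ∈ S.es k ∧ ¬ S.lt d e} =>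
        (S.component x.1 k).map E.ev.hom.toLinearMap)
          ⟨d'.1, d'.2.1, fun h' => d'.2.2 (_root_.trans h' h)⟩

end DualBasis

end Setting

/-! ### The images of the specializations, and the proof of flatness and of the description of the
fibres -/

namespace Degeneration

variable {g : Type} [AddCommGroup g] [Module ℂ g] [LieSuperalgebra g] {S : Setting g}
  (D : Degeneration S)

/-- The family is generated by `t` and the variables, and `t` goes to a scalar. -/
theorem range_le {C : SuperAlg} (F : D.family ⟶ C) {a : ℂ}
    (hF : F.hom D.familyT = algebraMap ℂ C a) {A : Subalgebra ℂ C}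
    (h : ∀ e, F.hom (D.toFamily (S.freeX e)) ∈ A) : F.hom.range ≤ A := by
  rintro _ ⟨y, rfl⟩
  obtain ⟨y, rfl⟩ := SuperAlg.toQuot_surjective _ y
  have hy : y ∈ Algebra.adjoin ℂ (Set.range S.freeXT) := by
    have hX : Algebra.adjoin ℂ (Set.range S.freeXT) = ⊤ := FreeSuperRing.adjoin_X _
    rw [hX]; exact Algebra.mem_top
  change (F.hom.comp D.familyMk.hom) y ∈ A
  refine (Algebra.adjoin_le (S := A.comap (F.hom.comp D.familyMk.hom)) ?_ : _ ≤ _) hy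
  rintro _ ⟨_ | e, rfl⟩
  · change F.hom D.familyT ∈ A
    rw [hF]; exact A.algebraMap_mem a
  · have hX : S.inclT (S.freeX e) = S.freeXT (some e) := FreeSuperRing.lift_X ..
    have := h e
    rw [toFamily, AlgHom.comp_apply, hX] at this
    exact this

theorem adjoin_le_range {A C : SuperAlg} (F : A ⟶ C) {s : Set C} (h : s ⊆ F.hom.range) :
    Algebra.adjoin ℂ (s ∪ C.par '' s) ≤ F.hom.range := by
  refine Algebra.adjoin_le ?_
  rintro _ (hx | ⟨x, hx, rfl⟩)
  · exact h hx
  · obtain ⟨y, rfl⟩ := h hx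
    exact ⟨A.par y, F.map_par y⟩

theorem freeX_mem (e : S.es 1) : S.freeX e ∈ S.component e 1 :=
  Submodule.subset_span ⟨[e], ⟨rfl, by simp⟩, by
    rw [Setting.freeMono_cons, Setting.freeMono_nil, mul_one]⟩

theorem isFibreOver {C : SuperAlg} (F : D.family ⟶ C) {a : ℂ} (hs : Function.Surjective F.hom)
    (hk : ∀ y, F.hom y = 0 ↔ y ∈ D.family.ideal {D.familyT - algebraMap ℂ D.family a}) :
    SuperAlg.IsFibreOver D.κ a C.Spec := by
  refine ⟨D.familyHom, rfl, ?_⟩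
  have hT : D.familyHom.hom lineT = D.familyT := Polynomial.aeval_X D.familyT
  rw [hT]
  obtain ⟨i⟩ := SuperAlg.nonempty_iso_quot F hs hk
  exact ⟨SuperAlg.Spec.mapIso i⟩

variable [FiniteDimensional ℂ g] (hg : IsBasic g)

theorem range_fibreMapZero : (D.fibreMapZero hg).hom.range =
    Algebra.adjoin ℂ ({y | ∃ e ∈ S.es 1, y = S.polyMono e} ∪
      S.polyAlg.par '' {y | ∃ e ∈ S.es 1, y = S.polyMono e}) := by
  have hX : ∀ e : S.es 1, (D.fibreMapZero hg).hom (D.toFamily (S.freeX e)) = S.polyAsc e 1 :=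
    fun e => (D.fibreMapZero_toFamily hg (freeX_mem e)).trans (S.lead_X e)
  refine le_antisymm (D.range_le _ (D.fibreMapZero_T hg) fun e => ?_) (adjoin_le_range _ ?_)
  · obtain ⟨c, hc, h⟩ := S.exists_polyMono e
    have h1 : S.polyAsc e 1 = c⁻¹ • S.polyMono e := by
      rw [h, smul_smul, inv_mul_cancel₀ hc, one_smul]
    rw [hX, h1]
    refine Subalgebra.smul_mem _ (Algebra.subset_adjoin ?_) _
    exact Or.inl ⟨e, e.2, rfl⟩
  · rintro _ ⟨e, he, rfl⟩
    obtain ⟨c, hc, h⟩ := S.exists_polyMono e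
    rw [h, ← hX ⟨e, he⟩]
    exact Subalgebra.smul_mem _ (AlgHom.mem_range_self _ _) _

-- By favourability in degree `k` every functional is the value of an element of `𝒮`. The
-- specialization has the same range as `ev`, because on each homogeneous component it differs from
-- `ev` by an invertible scalar.
include hg in
theorem lof_mem_range {a : ℂ} (ha : a ≠ 0) {k : ℕ} (hfav : S.FavourableAt k)
    (φ : RPiece S.b S.wt k) : RAlg.lof S.b S.wt k φ ∈ (D.fibreMap ha).hom.range := by
  have := (S.finite_es hg k).fintype
  rw [D.dualBasis.eq_sum hg φ, map_sum]
  refine Subalgebra.sum_mem _ fun e _ => ?_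
  rw [map_smul]
  refine Subalgebra.smul_mem _ ?_ _
  refine (iSup_le fun d => ?_ : _ ≤ Subalgebra.toSubmodule (D.fibreMap ha).hom.range)
    (D.dualBasis.η_mem_iSup hg hfav e)
  rintro _ ⟨s, hs, rfl⟩
  -- The twist `a^{-w(d)}` is undone on the component of multidegree `d`.
  have h1 : D.ev.hom s = a ^ S.weight D.w d.1 • (D.fibreMap ha).hom (D.toFamily s) := by
    rw [D.fibreMap_toFamily ha hs, smul_smul, ← zpow_add₀ ha, add_neg_cancel, zpow_zero, one_smul]
  refine (?_ : D.ev.hom s ∈ (D.fibreMap ha).hom.range)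
  rw [h1]
  exact Subalgebra.smul_mem _ (AlgHom.mem_range_self _ _) _

include hg in
theorem range_fibreMap {a : ℂ} (ha : a ≠ 0) (hfav : ∀ k : ℕ, 1 ≤ k → S.FavourableAt k) :
    (D.fibreMap ha).hom.range = Algebra.adjoin ℂ
      ({r | ∃ (k : ℕ) (φ : Module.Dual ℂ (KMod S.b (k • S.wt))), 1 ≤ k ∧
          r = RAlg.of S.b S.wt k φ} ∪ (RAlg S.b S.wt).par ''
        {r | ∃ (k : ℕ) (φ : Module.Dual ℂ (KMod S.b (k • S.wt))), 1 ≤ k ∧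
          r = RAlg.of S.b S.wt k φ}) := by
  refine le_antisymm (D.range_le _ (D.fibreMap_T ha) fun e => ?_) (adjoin_le_range _ ?_)
  · rw [D.fibreMap_toFamily ha (freeX_mem e), D.ev_X]
    refine Subalgebra.smul_mem _ (Algebra.subset_adjoin ?_) _
    exact Or.inl ⟨1, _, le_rfl, rfl⟩
  · rintro _ ⟨k, φ, hk, rfl⟩
    exact D.lof_mem_range hg ha (hfav k hk) _

include hg in
theorem fibreMap_surjective {a : ℂ} (ha : a ≠ 0) (hfav : ∀ k : ℕ, S.FavourableAt k) :
    Function.Surjective (D.fibreMap ha).hom := by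
  intro r
  have h : ∀ r : RRing S.b S.wt, (r : RAlg S.b S.wt) ∈ (D.fibreMap ha).hom.range := by
    intro r
    induction r using DirectSum.induction_on with
    | zero => exact zero_mem _
    | add x y hx hy => exact add_mem hx hy
    | of k φ => exact D.lof_mem_range hg ha (hfav k) φ
  exact h r

include hg in
theorem isFlat : SuperAlg.IsFlatOverLine D.κ := by
  refine ⟨D.familyHom, rfl, SuperAlg.flat_stalk _ fun p y hp h => ?_⟩
  refine D.eq_zero_of_aeval_mul hg (p := SuperAlg.lineEvenEquiv.symm p) ?_ h
  exact fun h0 => hp (SuperAlg.lineEvenEquiv.symm.map_eq_zero_iff.mp h0)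

include hg in
theorem isFibreOver_zero : SuperAlg.IsFibreOver D.κ 0 S.monomialAlg.Spec :=
  D.isFibreOver (SuperAlg.corestrict (D.fibreMapZero hg) _ (D.range_fibreMapZero hg))
    (SuperAlg.corestrict_surjective _ _ _) fun y =>
      (SuperAlg.corestrict_eq_zero _ _ _ y).trans (D.map_eq_zero_iff hg _ (D.fibreMapZero_T hg)
        (D.linearIndependent_fibreMapZero hg) y)

include hg in
theorem isFibreOver_RPosAlg {a : ℂ} (ha : a ≠ 0) (hfav : ∀ k : ℕ, 1 ≤ k → S.FavourableAt k) :
    SuperAlg.IsFibreOver D.κ a (RPosAlg S.b S.wt).Spec :=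
  D.isFibreOver (SuperAlg.corestrict (D.fibreMap ha) _ (D.range_fibreMap hg ha hfav))
    (SuperAlg.corestrict_surjective _ _ _) fun y =>
      (SuperAlg.corestrict_eq_zero _ _ _ y).trans (D.map_eq_zero_iff hg _ (D.fibreMap_T ha)
        (D.linearIndependent_fibreMap hg ha) y)

include hg in
theorem isFibreOver_RAlg {a : ℂ} (ha : a ≠ 0) (hfav : ∀ k : ℕ, S.FavourableAt k) :
    SuperAlg.IsFibreOver D.κ a (RAlg S.b S.wt).Spec :=
  D.isFibreOver (D.fibreMap ha) (D.fibreMap_surjective hg ha hfav)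
    (D.map_eq_zero_iff hg _ (D.fibreMap_T ha) (D.linearIndependent_fibreMap hg ha))

end Degeneration

/-! ### Weight vectors -/

/-- Finitely many elements of a semigroup of integral vectors that does not contain `0` are in an
open half space. -/
theorem exists_rat_dotProduct_pos {n : ℕ} (C : AddSubsemigroup (Fin n → ℤ)) (h0 : 0 ∉ C)
    {D : Set (Fin n → ℤ)} (hD : D.Finite) (hDC : D ⊆ C) :
    ∃ w : Fin n → ℚ, ∀ v ∈ D, 0 < ∑ i, w i * v i := by
  induction n with
  | zero =>
    refine ⟨0, fun v hv => absurd (hDC hv) ?_⟩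
    rwa [Subsingleton.elim v 0]
  | succ n ih =>
    -- Induction by elimination of the first coordinate: `C'` is the slice of `C` where it is zero.
    let C' : AddSubsemigroup (Fin n → ℤ) :=
      { carrier := {c | (Fin.cons 0 c : Fin (n + 1) → ℤ) ∈ C}
        add_mem' := fun {a b} ha hb => by
          have : (Fin.cons 0 (a + b) : Fin (n + 1) → ℤ) = Fin.cons 0 a + Fin.cons 0 b := by
            ext i
            refine Fin.cases ?_ (fun i => ?_) i <;> simp
          change (Fin.cons 0 (a + b) : Fin (n + 1) → ℤ) ∈ C
          rw [this]
          exact C.add_mem ha hb }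
    have hC' : (0 : Fin n → ℤ) ∉ C' := by
      intro h
      refine h0 ?_
      have : (Fin.cons 0 0 : Fin (n + 1) → ℤ) = 0 := by
        ext i
        refine Fin.cases ?_ (fun i => ?_) i <;> simp
      rw [← this]
      exact h
    have hsmul : ∀ (m : ℕ) (v : Fin (n + 1) → ℤ), 0 < m → v ∈ C → m • v ∈ C := by
      intro m v hm hv
      induction m with
      | zero => exact absurd hm (lt_irrefl _)
      | succ m ihm =>
        rcases Nat.eq_zero_or_pos m with rfl | hm
        · rwa [zero_add, one_smul]
        · rw [add_smul, one_smul]; exact C.add_mem (ihm hm) hv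
    have htail : ∀ v : Fin (n + 1) → ℤ, v ∈ C → v 0 = 0 → Fin.tail v ∈ C' := by
      intro v hv hv0
      change (Fin.cons 0 (Fin.tail v) : Fin (n + 1) → ℤ) ∈ C
      rw [← hv0, Fin.cons_self_tail]
      exact hv
    -- For `v 0 > 0 > u 0` this is a positive combination of `v` and `u` with first coordinate zero,
    -- so its tail lies in `C'`. The induction is applied to these tails and to those of the vectors
    -- with `v 0 = 0`.
    let comb : (Fin (n + 1) → ℤ) → (Fin (n + 1) → ℤ) → Fin (n + 1) → ℤ :=
      fun v u => (-u 0).toNat • v + (v 0).toNat • u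
    have hcomb : ∀ v u i, comb v u i = ((-u 0).toNat : ℤ) * v i + ((v 0).toNat : ℤ) * u i := by
      intro v u i
      change (-u 0).toNat • v i + (v 0).toNat • u i = _
      rw [nsmul_eq_mul, nsmul_eq_mul]
    obtain ⟨w, hw⟩ := ih C' hC' (D := Fin.tail '' {v ∈ D | v 0 = 0} ∪
        Set.image2 (fun v u => Fin.tail (comb v u)) {v ∈ D | 0 < v 0} {u ∈ D | u 0 < 0})
      (((hD.subset fun v hv => hv.1).image _).union ((hD.subset fun v hv => hv.1).image2 _
        (hD.subset fun v hv => hv.1))) (by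
        rintro _ (⟨v, ⟨hv, hv0⟩, rfl⟩ | ⟨v, ⟨hv, hv0⟩, u, ⟨hu, hu0⟩, rfl⟩)
        · exact htail v (hDC hv) hv0
        · refine htail _ (C.add_mem (hsmul _ _ ?_ (hDC hv)) (hsmul _ _ ?_ (hDC hu)) :
            comb v u ∈ C) ?_
          · omega
          · omega
          · rw [hcomb v u 0, Int.toNat_of_nonneg (by omega), Int.toNat_of_nonneg (by omega)]
            ring)
    let val : (Fin (n + 1) → ℤ) → ℚ := fun v => ∑ i, w i * (Fin.tail v i : ℤ)
    -- The first weight `x` must exceed `-val v / v 0` when `v 0 > 0` and stay below `-val u / u 0`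
    -- when `u 0 < 0`. Positivity on the vectors `comb v u` says that the lower bounds are below the
    -- upper ones.
    obtain ⟨x, hlo, hhi⟩ := Order.exists_between_finsets
      ((hD.subset fun v hv => hv.1 : {v ∈ D | 0 < v 0}.Finite).toFinset.image
        fun v => -val v / (v 0 : ℚ))
      ((hD.subset fun v hv => hv.1 : {u ∈ D | u 0 < 0}.Finite).toFinset.image
        fun u => -val u / (u 0 : ℚ)) (by
        intro a ha c hc
        simp only [Finset.mem_image, Set.Finite.mem_toFinset] at ha hc
        obtain ⟨v, ⟨hv, hv0⟩, rfl⟩ := ha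
        obtain ⟨u, ⟨hu, hu0⟩, rfl⟩ := hc
        have hv' : (0 : ℚ) < v 0 := by exact_mod_cast hv0
        have hu' : (u 0 : ℚ) < 0 := by exact_mod_cast hu0
        have h1 := hw _ (Or.inr ⟨v, ⟨hv, hv0⟩, u, ⟨hu, hu0⟩, rfl⟩)
        have h2 : ∑ i, w i * (Fin.tail (comb v u) i : ℤ) = -(u 0 : ℚ) * val v + v 0 * val u := by
          simp only [val, Finset.mul_sum, ← Finset.sum_add_distrib]
          refine Finset.sum_congr rfl fun i _ => ?_
          have h3 : ((-u 0).toNat : ℤ) = -u 0 := Int.toNat_of_nonneg (by omega)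
          have h4 : ((v 0).toNat : ℤ) = v 0 := Int.toNat_of_nonneg (by omega)
          simp only [Fin.tail, hcomb, h3, h4]
          push_cast
          ring
        rw [h2] at h1
        rw [div_lt_iff₀ hv', div_mul_eq_mul_div, lt_div_iff_of_neg hu']
        linarith)
    refine ⟨Fin.cons x w, fun v hv => ?_⟩
    rw [Fin.sum_univ_succ]
    simp only [Fin.cons_zero, Fin.cons_succ]
    change 0 < x * v 0 + val v
    rcases lt_trichotomy (v 0) 0 with h | h | h
    · have h' : (v 0 : ℚ) < 0 := by exact_mod_cast h
      have := hhi (-val v / v 0) (by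
        simp only [Finset.mem_image, Set.Finite.mem_toFinset]
        exact ⟨v, ⟨hv, h⟩, rfl⟩)
      rw [lt_div_iff_of_neg h'] at this
      linarith
    · rw [h, Int.cast_zero, mul_zero, zero_add]
      exact hw _ (Or.inl ⟨v, ⟨hv, h⟩, rfl⟩)
    · have h' : (0 : ℚ) < v 0 := by exact_mod_cast h
      have := hlo (-val v / v 0) (by
        simp only [Finset.mem_image, Set.Finite.mem_toFinset]
        exact ⟨v, ⟨hv, h⟩, rfl⟩)
      rw [div_lt_iff₀ h'] at this
      linarith

/-- Multiplication by the product of all denominators makes a rational solution integral and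
preserves the inequalities. -/
theorem exists_int_dotProduct_pos {n : ℕ} (C : AddSubsemigroup (Fin n → ℤ)) (h0 : 0 ∉ C)
    {D : Set (Fin n → ℤ)} (hD : D.Finite) (hDC : D ⊆ C) :
    ∃ w : Fin n → ℤ, ∀ v ∈ D, 0 < ∑ i, w i * v i := by
  obtain ⟨w, hw⟩ := exists_rat_dotProduct_pos C h0 hD hDC
  have hm : ∀ i, ∃ z : ℤ, (z : ℚ) = (∏ j, ((w j).den : ℚ)) * w i := by
    intro i
    refine ⟨(∏ j ∈ Finset.univ.erase i, ((w j).den : ℤ)) * (w i).num, ?_⟩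
    rw [← Finset.mul_prod_erase _ _ (Finset.mem_univ i)]
    push_cast
    rw [mul_comm ((w i).den : ℚ), mul_assoc, Rat.den_mul_eq_num]
  choose z hz using hm
  refine ⟨z, fun v hv => ?_⟩
  have hpos : (0 : ℚ) < ∏ j, ((w j).den : ℚ) :=
    Finset.prod_pos fun j _ => by exact_mod_cast (w j).den_pos
  have h := mul_pos hpos (hw v hv)
  rw [Finset.mul_sum] at h
  have h2 : ((∑ i, z i * v i : ℤ) : ℚ) = ∑ i, (∏ j, ((w j).den : ℚ)) * (w i * v i) := by
    push_cast
    exact Finset.sum_congr rfl fun i _ => by rw [hz, mul_assoc]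
  rw [← h2] at h
  exact_mod_cast h

/-- Compatibility of the order with addition makes the differences `e - d` with `d < e` a semigroup,
and irreflexivity excludes `0`. -/
theorem Setting.exists_weight {g : Type} [AddCommGroup g] [Module ℂ g] [LieSuperalgebra g]
    (S : Setting g) {κ : Type} [Finite κ] (d e : κ → S.Exp) (h : ∀ i, S.lt (d i) (e i)) :
    ∃ w : Fin S.N → ℤ, ∀ i, S.weight w (d i) < S.weight w (e i) := by
  let C : AddSubsemigroup (Fin S.N → ℤ) :=
    { carrier := {v | ∃ d e : S.Exp, S.lt d e ∧ v = fun i => (e i : ℤ) - d i}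
      add_mem' := by
        rintro _ _ ⟨d, e, h, rfl⟩ ⟨d', e', h', rfl⟩
        refine ⟨d + d', e + e', S.lt_add_add h h', ?_⟩
        ext i
        simp only [Pi.add_apply, Nat.cast_add]
        ring }
  have h0 : (0 : Fin S.N → ℤ) ∉ C := by
    rintro ⟨d, e, h, h0⟩
    have : d = e := by
      ext i
      have := congrFun h0 i
      simp only [Pi.zero_apply] at this
      omega
    rw [this] at h
    exact S.not_lt_self e h
  obtain ⟨w, hw⟩ := exists_int_dotProduct_pos C h0
    (Set.finite_range fun (k : κ) (i : Fin S.N) => (e k i : ℤ) - d k i) (by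
      rintro _ ⟨k, rfl⟩
      exact ⟨d k, e k, h k, rfl⟩)
  refine ⟨w, fun k => ?_⟩
  have h1 := hw _ ⟨k, rfl⟩
  simp only [mul_sub, Finset.sum_sub_distrib] at h1
  exact sub_pos.mp h1

/-! ### Noetherianity -/

namespace FreeSuperRing

variable {ι : Type} (p : ι → ZMod 2) {r : List ι} (hr : r.Nodup) (hall : ∀ i, i ∈ r)

theorem asc_zero (r : List ι) : asc p r 0 = 1 := by
  induction r with
  | nil => rfl
  | cons i r ih => rw [asc, ih, Pi.zero_apply, pow_zero, mul_one]

theorem asc_congr {r : List ι} {d e : ι → ℕ} (h : ∀ i ∈ r, d i = e i) : asc p r d = asc p r e := by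
  induction r with
  | nil => rfl
  | cons i r ih =>
    rw [asc, asc, ih fun j hj => h j (List.mem_cons_of_mem i hj), h i List.mem_cons_self]

include hr in
theorem asc_single [DecidableEq ι] {i : ι} (hi : i ∈ r) : asc p r (Pi.single i 1) = X p i := by
  induction r with
  | nil => simp at hi
  | cons k r ih =>
    obtain ⟨hk, hr⟩ := List.nodup_cons.mp hr
    rw [asc]
    by_cases hki : k = i
    · subst hki
      rw [asc_congr p (e := 0) fun j hj => Pi.single_eq_of_ne (by rintro rfl; exact hk hj) _,
        asc_zero, Pi.single_eq_same, pow_one, one_mul]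
    · rw [Pi.single_eq_of_ne hki, pow_zero, mul_one,
        ih hr ((List.mem_cons.mp hi).resolve_left (Ne.symm hki))]

include hr hall in
/-- The monomials span the free supercommutative superalgebra. -/
theorem span_asc : Submodule.span ℂ (Set.range (asc p r)) = ⊤ := by
  classical
  rw [eq_top_iff]
  intro s _
  have h : s ∈ Subalgebra.toSubmodule (Algebra.adjoin ℂ (Set.range (X p))) := by
    rw [adjoin_X, Algebra.top_toSubmodule]; exact Submodule.mem_top
  rw [Algebra.adjoin_eq_span] at h
  refine Submodule.span_le.mpr ?_ h
  intro x hx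
  have key : ∃ (c : ℂ) (d : ι → ℕ), x = c • asc p r d := by
    induction hx using Submonoid.closure_induction with
    | mem x hx =>
      obtain ⟨i, rfl⟩ := hx
      exact ⟨1, Pi.single i 1, by rw [one_smul, asc_single p hr (hall i)]⟩
    | one => exact ⟨1, 0, by rw [one_smul, asc_zero]⟩
    | mul x y _ _ hx hy =>
      obtain ⟨c, d, rfl⟩ := hx
      obtain ⟨c', d', rfl⟩ := hy
      exact ⟨_, _, by rw [smul_mul_smul_comm, asc_mul_asc, smul_smul]⟩
  obtain ⟨c, d, rfl⟩ := key
  exact Submodule.smul_mem _ _ (Submodule.subset_span ⟨d, rfl⟩)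

/-- The map from the polynomial ring that sends the variables of even index to the even
variables. -/
def evenPoly : MvPolynomial ι ℂ →ₐ[ℂ] FreeSuperRing p :=
  (SuperAlg.Even.val (FreeSuper p)).comp (MvPolynomial.aeval fun i =>
    if h : p i = 0 then SuperAlg.Even.mk (A := FreeSuper p) (X p i) (by
      refine (par_X p i).trans ?_
      rw [h]
      simp [ksign]) else 0)

theorem evenPoly_X {i : ι} (h : p i = 0) : evenPoly p (MvPolynomial.X i) = X p i := by
  have : evenPoly p (MvPolynomial.X i) = SuperAlg.Even.val (FreeSuper p) (MvPolynomial.aeval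
    (fun i => if h : p i = 0 then SuperAlg.Even.mk (A := FreeSuper p) (X p i) (by
      refine (par_X p i).trans ?_
      rw [h]
      simp [ksign]) else 0) (MvPolynomial.X i : MvPolynomial ι ℂ)) := rfl
  rw [this, MvPolynomial.aeval_X, dif_pos h]
  rfl

theorem asc_mem_range (r : List ι) {d : ι → ℕ} (h : ∀ i, p i = 1 → d i = 0) :
    asc p r d ∈ (evenPoly p).range := by
  induction r with
  | nil => exact one_mem _
  | cons i r ih =>
    rw [asc]
    refine mul_mem ih ?_
    rcases zmod2_cases (p i) with hi | hi
    · rw [← evenPoly_X p hi]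
      exact pow_mem (AlgHom.mem_range_self _ _) _
    · rw [h i hi, pow_zero]; exact one_mem _

/-- The ring is a finite module over the polynomial ring in its even variables: the products of
distinct odd variables generate it. Left ideals are submodules of this Noetherian module. -/
theorem isNoetherianRing [Finite ι] : IsNoetherianRing (FreeSuperRing p) := by
  classical
  have := Fintype.ofFinite ι
  let r := (Finset.univ : Finset ι).toList
  have hr : r.Nodup := Finset.nodup_toList _
  have hall : ∀ i, i ∈ r := fun i => Finset.mem_toList.mpr (Finset.mem_univ i)
  let P := MvPolynomial ι ℂ
  let : Module P (FreeSuperRing p) := Module.compHom _ (evenPoly p : P →+* FreeSuperRing p)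
  have hsmul : ∀ (q : P) (a : FreeSuperRing p), q • a = evenPoly p q * a := fun _ _ => rfl
  have : IsScalarTower P (FreeSuperRing p) (FreeSuperRing p) :=
    ⟨fun q a c => by rw [hsmul, hsmul, smul_eq_mul, smul_eq_mul, mul_assoc]⟩
  let ind : Finset ι → ι → ℕ := fun T i => if i ∈ T then 1 else 0
  have hfg : (⊤ : Submodule P (FreeSuperRing p)) =
      Submodule.span P (Set.range fun T : Finset ι => asc p r (ind T)) := by
    refine (eq_top_iff.mpr fun a _ => ?_).symm
    have ha : a ∈ Submodule.span ℂ (Set.range (asc p r)) := by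
      rw [span_asc p hr hall]; exact Submodule.mem_top
    induction ha using Submodule.span_induction with
    | mem a ha =>
      obtain ⟨d, rfl⟩ := ha
      by_cases hadm : Adm p d
      -- An admissible exponent is split into its even part `d₀` and the set `T` of its odd
      -- variables; separating the monomials costs only a sign.
      · let d₀ : ι → ℕ := fun i => if p i = 1 then 0 else d i
        let T : Finset ι := {i | p i = 1 ∧ d i = 1}
        have hd : d₀ + ind T = d := by
          ext i
          simp only [Pi.add_apply, d₀, ind, T, Finset.mem_filter, Finset.mem_univ, true_and]
          by_cases hi : p i = 1
          · have := hadm i hi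
            simp only [hi, if_true, true_and, zero_add]
            split <;> omega
          · simp [hi]
        obtain ⟨q, hq⟩ := asc_mem_range p r (d := d₀) fun i hi => by simp [d₀, hi]
        have hmul := asc_mul_asc p r d₀ (ind T)
        rw [hd] at hmul
        have h1 : asc p r d = (MvPolynomial.C (mulSign p r (ind T) d₀)⁻¹ * q : P) •
            asc p r (ind T) := by
          rw [hsmul, map_mul, mul_assoc]
          change _ = _ * (evenPoly p q * _)
          rw [show evenPoly p q = asc p r d₀ from hq, hmul,
            ← MvPolynomial.algebraMap_eq, AlgHom.commutes, ← Algebra.smul_def, smul_smul,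
            inv_mul_cancel₀ (mulSign_ne_zero _ _ _ _), one_smul]
        rw [h1]
        exact Submodule.smul_mem _ _ (Submodule.subset_span ⟨T, rfl⟩)
      · simp only [Adm, not_forall, not_le] at hadm
        obtain ⟨i, hi, h2⟩ := hadm
        rw [asc_eq_zero p (hall i) hi h2]
        exact zero_mem _
    | zero => exact zero_mem _
    | add x y _ _ hx hy => exact add_mem (hx trivial) (hy trivial)
    | smul c x _ hx =>
      have h1 : c • x = (MvPolynomial.C c : P) • x := by
        rw [hsmul, ← MvPolynomial.algebraMap_eq, AlgHom.commutes, ← Algebra.smul_def]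
      rw [h1]
      exact Submodule.smul_mem _ _ (hx trivial)
  have : Module.Finite P (FreeSuperRing p) := ⟨by
    rw [hfg]
    exact Submodule.fg_span (Set.finite_range _)⟩
  exact isNoetherianRing_iff.mpr (isNoetherian_of_tower P inferInstance)

end FreeSuperRing

namespace Setting

variable {g : Type} [AddCommGroup g] [Module ℂ g] [LieSuperalgebra g] (S : Setting g)

section existence

variable [FiniteDimensional ℂ g] (hg : IsBasic g)

/-! ### The dual basis -/

include hg in
theorem nonempty_dualBasis : Nonempty S.DualBasis := by
  classical
  let bas := fun k => Module.Basis.mk (S.linearIndependent_es k) (S.span_es hg k).ge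
  have hbas : ∀ k (e : S.es k), bas k e = S.vec k e := fun k e => Module.Basis.mk_apply _ _ e
  let η : ∀ k : ℕ, S.es k → Module.Dual ℂ (KMod S.b (k • S.wt)) := fun k e =>
    S.fact e • (bas k).coord e
  have hη : ∀ k (e e' : S.es k), η k e (S.vec k e') = if e = e' then S.fact e else 0 := by
    intro k e e'
    rw [← hbas, LinearMap.smul_apply, Module.Basis.coord_apply, Module.Basis.repr_self,
      Finsupp.single_apply, smul_eq_mul, mul_ite, mul_one, mul_zero]
    simp only [eq_comm]
  clear_value η
  -- Both sides are compared on the basis of essential vectors, whose parities are known. The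
  -- universal property of `𝒮` requires this.
  have hpar : ∀ e : S.es 1, RPiece.par (RPiece.ofDual (η 1 e) : RPiece S.b S.wt 1) =
      ksign 1 (S.parity e) • (RPiece.ofDual (η 1 e) : RPiece S.b S.wt 1) := by
    intro e
    refine (bas 1).ext (f₁ := η 1 e ∘ₗ (kRep S.b (1 • S.wt)).σ)
      (f₂ := ksign 1 (S.parity e) • η 1 e) fun e' => ?_
    rw [hbas, LinearMap.comp_apply, S.parity_vec, map_smul, LinearMap.smul_apply, hη 1 e e']
    split
    · next h => rw [h]
    · rw [smul_zero, smul_zero]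
  exact ⟨⟨η, hη, FreeSuper.lift (p := fun e : S.es 1 => S.parity e)
    (fun e : S.es 1 => RAlg.of S.b S.wt 1 (η 1 e)) fun e =>
      (RRing.par_of S.b S.wt (RPiece.ofDual (η 1 e))).trans
        ((congrArg (RAlg.lof S.b S.wt 1) (hpar e)).trans (map_smul _ _ _)),
    fun e => FreeSuper.lift_X ..⟩⟩

/-! ### Binomial generators -/

variable {S}

/-- In an admissible degree all products of variables have the same image under `lead` up to sign.
So, modulo binomials in the kernel, each is a multiple of one fixed product `L₀`, which itself is
not in the kernel. In an inadmissible degree all monomials are in the kernel. -/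
theorem DualBasis.mem_span_binomials (E : S.DualBasis) (hg : IsBasic g) {e : S.Exp} {n : ℕ}
    {s : S.freeAlg} (hs : s ∈ S.component e n) (h0 : S.lead.hom s = 0) :
    s ∈ Submodule.span ℂ {x | (S.IsBinomial e n x ∨ S.IsMonomial e n x) ∧ S.lead.hom x = 0} := by
  set G := {x | (S.IsBinomial e n x ∨ S.IsMonomial e n x) ∧ S.lead.hom x = 0} with hG
  by_cases hadm : S.Admissible e
  rotate_left
  · refine Submodule.span_mono ?_ hs
    rintro _ ⟨L, H, rfl⟩
    obtain ⟨-, -, -, c, -, h, -⟩ := E.exists_ev_freeMono hg L e n H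
    exact ⟨Or.inr ⟨L, H, rfl⟩, by rw [h, S.polyAsc_eq_zero hadm, smul_zero]⟩
  by_cases hL : ∃ L, S.HasDegree L e n
  rotate_left
  · rw [Degeneration.component_eq_bot hL, Submodule.mem_bot] at hs
    rw [hs]; exact zero_mem _
  obtain ⟨L₀, H₀⟩ := hL
  obtain ⟨-, -, -, c₀, hc₀, h₀, -⟩ := E.exists_ev_freeMono hg L₀ e n H₀
  have key : ∃ c : ℂ, s - c • S.freeMono L₀ ∈ Submodule.span ℂ G := by
    clear h0
    induction hs using Submodule.span_induction with
    | mem s hs =>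
      obtain ⟨L, H, rfl⟩ := hs
      obtain ⟨-, -, -, c, hc, h, -⟩ := E.exists_ev_freeMono hg L e n H
      -- The sign that makes the binomial vanish under `lead`.
      obtain ⟨σ, hσ⟩ : ∃ σ : ℕ, c + (-1) ^ σ * c₀ = 0 := by
        rcases hc with rfl | rfl <;> rcases hc₀ with rfl | rfl
        · exact ⟨1, by norm_num⟩
        · exact ⟨0, by norm_num⟩
        · exact ⟨0, by norm_num⟩
        · exact ⟨1, by norm_num⟩
      refine ⟨-(-1) ^ σ, Submodule.subset_span ⟨Or.inl ⟨L, L₀, σ, H, H₀, ?_⟩, ?_⟩⟩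
      · rw [neg_smul, sub_neg_eq_add]
      · rw [neg_smul, sub_neg_eq_add, map_add, map_smul, h, h₀, smul_smul, ← add_smul, hσ,
          zero_smul]
    | zero => exact ⟨0, by rw [zero_smul, sub_zero]; exact zero_mem _⟩
    | add x y _ _ hx hy =>
      obtain ⟨c, hc⟩ := hx
      obtain ⟨d, hd⟩ := hy
      exact ⟨c + d, by rw [add_smul, add_sub_add_comm]; exact add_mem hc hd⟩
    | smul a x _ hx =>
      obtain ⟨c, hc⟩ := hx
      exact ⟨a * c, by rw [mul_smul, ← smul_sub]; exact Submodule.smul_mem _ _ hc⟩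
  obtain ⟨c, hc⟩ := key
  have hlead : ∀ x ∈ Submodule.span ℂ G, S.lead.hom x = 0 := by
    intro x hx
    exact (Submodule.span_le (p := LinearMap.ker S.lead.hom.toLinearMap)).mpr
      (fun y hy => hy.2) hx
  have h1 := hlead _ hc
  rw [map_sub, h0, map_smul, h₀, smul_smul, zero_sub, neg_eq_zero] at h1
  have h2 := (smul_eq_zero.mp h1).resolve_right
    (S.linearIndependent_polyAsc.ne_zero (⟨e, hadm⟩, n))
  have hc00 : c₀ ≠ 0 := by rcases hc₀ with rfl | rfl <;> norm_num
  rw [(mul_eq_zero.mp h2).resolve_right hc00, zero_smul, sub_zero] at hc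
  exact hc

/-- The binomials and monomials in the kernel generate a left ideal of a Noetherian ring; finitely
many of these same elements suffice, so the generators keep the required form. -/
theorem DualBasis.exists_generators (E : S.DualBasis) (hg : IsBasic g) :
    ∃ (m : ℕ) (f : Fin m → S.freeAlg) (J : Fin m → S.Exp) (h : Fin m → ℕ),
      (∀ k, S.IsBinomial (J k) (h k) (f k) ∨ S.IsMonomial (J k) (h k) (f k)) ∧
      (∀ k, S.lead.hom (f k) = 0) ∧
      ∀ (e : S.Exp) (n : ℕ), ∀ s ∈ S.component e n, S.lead.hom s = 0 →
        s ∈ S.freeAlg.ideal (Set.range f) := by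
  have := (S.finite_es hg 1).to_subtype
  have hN : IsNoetherianRing S.freeAlg :=
    FreeSuperRing.isNoetherianRing fun e : S.es 1 => S.parity e
  let G : Set S.freeAlg := {x | ∃ e n, (S.IsBinomial e n x ∨ S.IsMonomial e n x) ∧
    S.lead.hom x = 0}
  obtain ⟨T, hT, hspan⟩ := (Submodule.fg_span_iff_fg_span_finset_subset (R := S.freeAlg) G).mp
    (IsNoetherian.noetherian _)
  let f : Fin T.card → S.freeAlg := fun k => (T.equivFin.symm k : S.freeAlg)
  have hf : ∀ k, f k ∈ G := fun k => hT (T.equivFin.symm k).2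
  choose J h hform hlead using hf
  refine ⟨T.card, f, J, h, hform, hlead, fun e n s hs h0 => ?_⟩
  have hTf : (T : Set S.freeAlg) ⊆ Set.range f := fun x hx =>
    ⟨T.equivFin ⟨x, hx⟩, by simp [f]⟩
  have hle : Submodule.span S.freeAlg G ≤ (S.freeAlg.ideal (Set.range f)).asIdeal := by
    rw [hspan]
    exact Submodule.span_le.mpr fun x hx => SuperAlg.subset_ideal _ (hTf hx)
  refine TwoSidedIdeal.mem_asIdeal.mp (hle ?_)
  refine Submodule.span_induction (p := fun s _ => s ∈ Submodule.span S.freeAlg G) ?_ ?_ ?_ ?_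
    (E.mem_span_binomials hg hs h0)
  · rintro x ⟨hx, hx0⟩
    exact Submodule.subset_span ⟨e, n, hx, hx0⟩
  · exact zero_mem _
  · intro x y _ _ hx hy; exact add_mem hx hy
  · intro a x _ hx
    rw [Algebra.smul_def]
    exact Submodule.smul_mem _ (algebraMap ℂ S.freeAlg a) hx

/-! ### The correction terms -/

/-- The value `ev s` lies in the span of the `η_{d,n}` with `d > e`. By favourability these are
values of homogeneous elements of essential multidegrees larger than `e`, which are then subtracted.
-/
theorem DualBasis.exists_correction (E : S.DualBasis) (hg : IsBasic g)
    (hfav : ∀ k : ℕ, 1 ≤ k → S.FavourableAt k) {e : S.Exp} {n : ℕ} {s : S.freeAlg}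
    (hs : s ∈ S.component e n) (h0 : S.lead.hom s = 0) :
    ∃ (r : ℕ) (c : Fin r → S.freeAlg) (U : Fin r → S.Exp), (∀ j, c j ∈ S.component (U j) n) ∧
      (∀ j, U j ∈ S.es n) ∧ (∀ j, S.lt e (U j)) ∧ E.ev.hom (s + ∑ j, c j) = 0 := by
  rcases Nat.eq_zero_or_pos n with rfl | hn
  -- Favourability is not available for `n = 0`, but there the component consists of scalars, and a
  -- scalar in the kernel of `lead` is zero. No correction is needed.
  · have hs' : ∃ c : ℂ, s = c • 1 := by
      clear h0
      induction hs using Submodule.span_induction with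
      | mem s hs =>
        obtain ⟨L, H, rfl⟩ := hs
        obtain rfl := List.eq_nil_of_length_eq_zero H.1
        exact ⟨1, by rw [one_smul, freeMono_nil]⟩
      | zero => exact ⟨0, (zero_smul _ _).symm⟩
      | add x y _ _ hx hy =>
        obtain ⟨c, rfl⟩ := hx
        obtain ⟨d, rfl⟩ := hy
        exact ⟨c + d, (add_smul _ _ _).symm⟩
      | smul a x _ hx =>
        obtain ⟨c, rfl⟩ := hx
        exact ⟨a * c, (mul_smul _ _ _).symm⟩
    obtain ⟨c, rfl⟩ := hs'
    have h1 : S.polyAsc 0 0 ≠ 0 :=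
      S.linearIndependent_polyAsc.ne_zero (⟨0, fun _ _ => Nat.zero_le _⟩, 0)
    rw [map_smul, map_one, ← S.polyAsc_zero] at h0
    refine ⟨0, Fin.elim0, Fin.elim0, fun j => j.elim0, fun j => j.elim0, fun j => j.elim0, ?_⟩
    rw [(smul_eq_zero.mp h0).resolve_right h1, zero_smul, zero_add, Fin.sum_univ_zero, map_zero]
  · have hle : S.above E.η e n ≤ ⨆ d : {d // d ∈ S.es n ∧ S.lt e d},
        (S.component d.1 n).map E.ev.hom.toLinearMap := by
      refine Submodule.span_le.mpr ?_
      rintro _ ⟨e', hlt, rfl⟩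
      refine SetLike.le_def.mp (iSup_le fun d => ?_) (E.η_mem_iSup hg (hfav n hn) e')
      refine le_iSup (fun x : {d // d ∈ S.es n ∧ S.lt e d} =>
        (S.component x.1 n).map E.ev.hom.toLinearMap) ⟨d.1, d.2.1, ?_⟩
      rcases trichotomous_of S.lt d.1 (e' : S.Exp) with h | h | h
      · exact absurd h d.2.2
      · rw [h]; exact hlt
      · exact _root_.trans hlt h
    have hmem := hle ((E.ev_mem_above_iff hg hs).mpr h0)
    obtain ⟨f, hf, hsum⟩ := (Submodule.mem_iSup_iff_exists_finsupp _ _).mp hmem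
    choose c hc hcf using hf
    let i := f.support.equivFin.symm
    -- The corrections are indexed by the finite support of a decomposition of `ev s` into values of
    -- components.
    refine ⟨f.support.card, fun j => -c (i j), fun j => (i j).1.1, fun j => neg_mem (hc _),
      fun j => (i j).1.2.1, fun j => (i j).1.2.2, ?_⟩
    rw [map_add, map_sum, ← hsum]
    have h1 : ∀ j, E.ev.hom (-c (i j)) = -f (i j) := fun j => by
      rw [map_neg]; exact congrArg _ (hcf (i j))
    simp only [h1, Finset.sum_neg_distrib]
    rw [i.sum_comp fun x => f x, Finset.sum_coe_sort f.support fun x => f x, Finsupp.sum,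
      add_neg_cancel]

end existence

end Setting

/-! ### Existence of the choices, and the theorem -/

theorem nonempty_degeneration {g : Type} [AddCommGroup g] [Module ℂ g] [LieSuperalgebra g]
    [FiniteDimensional ℂ g] (hg : IsBasic g) (S : Setting g)
    (hfav : ∀ k : ℕ, 1 ≤ k → S.FavourableAt k) : Nonempty (Degeneration S) := by
  obtain ⟨E⟩ := S.nonempty_dualBasis hg
  obtain ⟨m, f, J, h, hform, hlead, hgen⟩ := E.exists_generators hg
  have hmem : ∀ k, f k ∈ S.component (J k) (h k) := fun k => by
    rcases hform k with hb | ⟨L, H, hL⟩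
    · exact Degeneration.isBinomial_mem hb
    · rw [hL]; exact S.freeMono_mem_component H
  choose r c U hc hU hlt hev using fun k => E.exists_correction hg hfav (hmem k) (hlead k)
  -- One weight vector must serve all pairs `(k, j)`, of which there are finitely many.
  obtain ⟨w, hw⟩ := S.exists_weight (κ := Σ k, Fin (r k)) (fun x => J x.1) (fun x => U x.1 x.2)
    fun x => hlt x.1 x.2
  exact ⟨{
    η := E.η
    η_vec := E.η_vec
    ev := E.ev
    ev_X := E.ev_X
    m := m
    gbar := f
    J := J
    h := h
    gbar_form := hform
    gbar_ker := fun k => (E.ev_mem_above_iff hg (hmem k)).mpr (hlead k)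
    gbar_gen := fun e n s hs hs' => hgen e n s hs ((E.ev_mem_above_iff hg hs).mp hs')
    r := r
    corr := c
    U := U
    corr_mem := hc
    U_mem := hU
    U_lt := hlt
    ev_lift := hev
    w := w
    w_lt := fun k j => hw ⟨k, j⟩ }⟩
end

theorem corollary6 (g : Type) [AddCommGroup g] [Module ℂ g] [LieSuperalgebra g]
    [FiniteDimensional ℂ g] (hg : LieSuperalgebra.IsBasic g) (S : Setting g)
    (hdom : ∀ k : ℕ, IsDominantIntegral S.b (k • S.wt))
    (hfav : ∀ k : ℕ, 1 ≤ k → S.FavourableAt k) :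
    Nonempty (Degeneration S) ∧ ∀ D : Degeneration S,
      SuperAlg.IsFlatOverLine D.κ ∧
      (∀ a : ℂ, a ≠ 0 →
        SuperAlg.IsFibreOver D.κ a (RPosAlg S.b S.wt).Spec ∧
        (S.FavourableAt 0 → SuperAlg.IsFibreOver D.κ a (RAlg S.b S.wt).Spec)) ∧
      SuperAlg.IsFibreOver D.κ 0 S.monomialAlg.Spec := by
  refine ⟨nonempty_degeneration hg S hfav, fun D => ⟨D.isFlat hg, fun a ha =>
    ⟨D.isFibreOver_RPosAlg hg ha hfav, fun h0 => D.isFibreOver_RAlg hg ha fun k => ?_⟩,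
      D.isFibreOver_zero hg⟩⟩
  rcases Nat.eq_zero_or_pos k with rfl | hk
  · exact h0
  · exact hfav k hk
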